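/- Fix $\alpha\in(-1,1)$ and let $B=(A,B')$ be a two-dimensional Brownian motion on $[0,1]$ started from the origin with $\operatorname{Var}A_t=\operatorname{Var}B'_t=t$ and $\operatorname{Cov}(A_t,B'_t)=\alpha t$. Let $\mathbf R_+^2=[0,\infty)^2$, and let $C([0,1],\mathbf R^2)$ carry the topology of uniform convergence. Consider laws of continuous processes $Z=(X,Y)$ on $[0,1]$ with $Z_0=0$ such that (i) for each $t\in(0,1)$, almost surely $X_t>0$ and $Y_t>0$; and (ii) for all $0<s<t<1$, the conditional law of $Z|_{[s,t]}$ given $Z|_{[0,s]}$ and $Z|_{[t,1]}$ is that of a Brownian motion on $[s,t]$ with the above covariance, conditioned to take the values $Z_s$ at time $s$ and $Z_t$ at time $t$ and to stay in $\mathbf R_+^2$ on $[s,t]$; that is, the law of the Brownian bridge from $Z_s$ to $Z_t$ on $[s,t]$, conditioned on the event (of positive probability) that it stays in $\mathbf R_+^2$. For every $w\in\partial\mathbf R_+^2$ there is exactly one such law with $Z_1=w$ almost surely. The one with $w=0$ is called the law of the correlated Brownian loop. For $\epsilon>0$, a law of a correlated Brownian $\pi/2$-cone excursion of length $1$ and terminal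 displacement $\epsilon$ is a law with $Z_0=0$, (i) and (ii) for which, almost surely, $Z_r\ge Z_0$ coordinatewise for all $r\in[0,1]$, $X_1=X_0$ or $Y_1=Y_0$, and $\max(X_1-X_0,\,Y_1-Y_0)=\epsilon$ (so $Z_1\in\{(\epsilon,0),(0,\epsilon)\}$; which of the two occurs may be deterministic or random). Such laws exist for every $\epsilon>0$. If, for each $\epsilon>0$, $\mu_\epsilon$ is a law of a correlated Brownian $\pi/2$-cone excursion of length $1$ and terminal displacement $\epsilon$, then $\mu_\epsilon$ converges weakly, with respect to the topology of uniform convergence, to the law of the correlated Brownian loop as $\epsilon\to0$. -/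

import Mathlib

open MeasureTheory ProbabilityTheory Topology

/-- Spaces of continuous functions carry the Borel σ-algebra of the compact-open topology, which
on a compact domain is the topology of uniform convergence. -/
instance instMeasurableSpaceCM {S E : Type*} [TopologicalSpace S] [TopologicalSpace E] :
    MeasurableSpace C(S, E) := borel _

instance instBorelSpaceCM {S E : Type*} [TopologicalSpace S] [TopologicalSpace E] :
    BorelSpace C(S, E) := ⟨rfl⟩

/-- Continuous planar paths `Z = (X, Y)` on the time interval `[0, 1]`. The order on `ℝ × ℝ` is the
coordinatewise one, so that `0 ≤ z` says that `z` lies in the closed quadrant. -/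
abbrev PlanarPath : Type := C(unitInterval, ℝ × ℝ)

/-- `W` is the law on path space of the two-dimensional Brownian motion `(X, Y)` on `[0, 1]` started
from the origin with `Var X_t = Var Y_t = t` and `Cov (X_t, Y_t) = α t`: the (unique) law of a
continuous centred Gaussian process with this covariance structure. -/
structure IsCorrelatedBrownianLaw (α : ℝ) (W : Measure PlanarPath) : Prop where
  gaussian : IsGaussianProcess (fun (t : unitInterval) (η : PlanarPath) ↦ η t) W
  mean_fst : ∀ t : unitInterval, ∫ η : PlanarPath, (η t).1 ∂W = 0
  mean_snd : ∀ t : unitInterval, ∫ η : PlanarPath, (η t).2 ∂W = 0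
  cov_fst : ∀ s t : unitInterval,
    cov[fun η : PlanarPath ↦ (η s).1, fun η : PlanarPath ↦ (η t).1; W] = min (s : ℝ) t
  cov_snd : ∀ s t : unitInterval,
    cov[fun η : PlanarPath ↦ (η s).2, fun η : PlanarPath ↦ (η t).2; W] = min (s : ℝ) t
  cov_fst_snd : ∀ s t : unitInterval,
    cov[fun η : PlanarPath ↦ (η s).1, fun η : PlanarPath ↦ (η t).2; W] = α * min (s : ℝ) t

/-- The bridge on `[s, t]` from `z` (at time `s`) to `w` (at time `t`) that is built from the path
`η`: `r ↦ z + (η_r - η_s) - (r - s) / (t - s) * ((η_t - η_s) - (w - z))`. If `η` is a Brownian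
motion, this is the Brownian motion on `[s, t]` conditioned to be at `z` at time `s` and at `w` at
time `t`. -/
noncomputable def bridge (s t : unitInterval) (z w : ℝ × ℝ) (η : PlanarPath) :
    C(Set.Icc s t, ℝ × ℝ) where
  toFun r := z + (η r - η s) -
    (((r : unitInterval) - s : ℝ) / (t - s : ℝ)) • ((η t - η s) - (w - z))
  continuous_toFun := by fun_prop

/-- The paths on `[s, t]` that stay in the closed quadrant. -/
def stayInQuadrant (s t : unitInterval) : Set C(Set.Icc s t, ℝ × ℝ) :=
  {f | ∀ r, 0 ≤ f r}

/-- The law of the bridge on `[s, t]` from `z` to `w`, conditioned to stay in the closed quadrant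
(an elementary conditioning: the event has positive probability if `s < t` and `z`, `w` lie in the
open quadrant). -/
noncomputable def quadrantBridge (W : Measure PlanarPath) (s t : unitInterval) (z w : ℝ × ℝ) :
    Measure C(Set.Icc s t, ℝ × ℝ) :=
  ProbabilityTheory.cond (W.map (bridge s t z w)) (stayInQuadrant s t)

/-- A path on `[0, 1]` outside `(s, t)`: its restrictions to `[0, s]` and to `[t, 1]`. -/
def outside (s t : unitInterval) (ω : PlanarPath) :
    C(Set.Icc (0 : unitInterval) s, ℝ × ℝ) × C(Set.Icc t (1 : unitInterval), ℝ × ℝ) :=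
  (ω.restrict _, ω.restrict _)

/-- A path on `[0, 1]` inside `[s, t]`. -/
def inside (s t : unitInterval) (ω : PlanarPath) : C(Set.Icc s t, ℝ × ℝ) :=
  ω.restrict _

theorem measurable_bridge (s t : unitInterval) :
    Measurable fun p : ((ℝ × ℝ) × (ℝ × ℝ)) × PlanarPath ↦ bridge s t p.1.1 p.1.2 p.2 := by
  apply Continuous.measurable
  apply ContinuousMap.continuous_of_continuous_uncurry
  have h : Continuous fun q : (((ℝ × ℝ) × (ℝ × ℝ)) × PlanarPath) × Set.Icc s t ↦
      q.1.1.1 + (q.1.2 (q.2 : unitInterval) - q.1.2 s) -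
        (((q.2 : unitInterval) - s : ℝ) / (t - s : ℝ)) •
          ((q.1.2 t - q.1.2 s) - (q.1.1.2 - q.1.1.1)) := by
    fun_prop
  exact h

theorem measurableSet_stayInQuadrant (s t : unitInterval) :
    MeasurableSet (stayInQuadrant s t) := by
  apply IsClosed.measurableSet
  have : stayInQuadrant s t = ⋂ r, {f : C(Set.Icc s t, ℝ × ℝ) | 0 ≤ f r} := by
    ext f; simp [stayInQuadrant]
  rw [this]
  exact isClosed_iInter fun r ↦ isClosed_le continuous_const (by fun_prop)

theorem measurable_quadrantBridge (W : Measure PlanarPath) [IsProbabilityMeasure W]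
    (s t : unitInterval) :
    Measurable fun p : (ℝ × ℝ) × (ℝ × ℝ) ↦ quadrantBridge W s t p.1 p.2 := by
  have key : ∀ A : Set C(Set.Icc s t, ℝ × ℝ), MeasurableSet A →
      Measurable fun p : (ℝ × ℝ) × (ℝ × ℝ) ↦ W.map (bridge s t p.1 p.2) A := by
    intro A hA
    have h := measurable_measure_prodMk_left (ν := W) (measurable_bridge s t hA)
    have e : (fun p : (ℝ × ℝ) × (ℝ × ℝ) ↦ W.map (bridge s t p.1 p.2) A) =
        fun p ↦ W (Prod.mk p ⁻¹'
          ((fun p : ((ℝ × ℝ) × (ℝ × ℝ)) × PlanarPath ↦ bridge s t p.1.1 p.1.2 p.2) ⁻¹' A)) := by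
      funext p
      have hb : Measurable (bridge s t p.1 p.2) :=
        (measurable_bridge s t).comp measurable_prodMk_left
      rw [Measure.map_apply hb hA]
      rfl
    rw [e]
    exact h
  refine Measure.measurable_of_measurable_coe _ fun A hA ↦ ?_
  simp only [quadrantBridge, cond_apply (measurableSet_stayInQuadrant s t)]
  exact (key _ (measurableSet_stayInQuadrant s t)).inv.mul
    (key _ ((measurableSet_stayInQuadrant s t).inter hA))

/-- The values at times `s` and `t` of a path outside `(s, t)`. -/
def gapEnds (s t : unitInterval)
    (q : C(Set.Icc (0 : unitInterval) s, ℝ × ℝ) × C(Set.Icc t (1 : unitInterval), ℝ × ℝ)) :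
    (ℝ × ℝ) × (ℝ × ℝ) :=
  (q.1 ⟨s, unitInterval.nonneg', le_rfl⟩, q.2 ⟨t, le_rfl, unitInterval.le_one'⟩)

theorem measurable_gapEnds (s t : unitInterval) : Measurable (gapEnds s t) := by
  have h1 : Measurable fun f : C(Set.Icc (0 : unitInterval) s, ℝ × ℝ) ↦
      f ⟨s, unitInterval.nonneg', le_rfl⟩ := (continuous_eval_const _).measurable
  have h2 : Measurable fun f : C(Set.Icc t (1 : unitInterval), ℝ × ℝ) ↦
      f ⟨t, le_rfl, unitInterval.le_one'⟩ := (continuous_eval_const _).measurable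
  exact (h1.comp measurable_fst).prodMk (h2.comp measurable_snd)

/-- `quadrantBridge`, as a kernel from the pair of end values to paths on `[s, t]`. -/
noncomputable def quadrantBridgeKernel (W : Measure PlanarPath) [IsProbabilityMeasure W]
    (s t : unitInterval) : Kernel ((ℝ × ℝ) × (ℝ × ℝ)) C(Set.Icc s t, ℝ × ℝ) where
  toFun p := quadrantBridge W s t p.1 p.2
  measurable' := measurable_quadrantBridge W s t

instance instIsFiniteKernelQuadrantBridge (W : Measure PlanarPath) [IsProbabilityMeasure W]
    (s t : unitInterval) : IsFiniteKernel (quadrantBridgeKernel W s t) := by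
  refine ⟨1, ENNReal.one_lt_top, fun p ↦ ?_⟩
  change ProbabilityTheory.cond _ _ _ ≤ _
  rw [cond_apply (measurableSet_stayInQuadrant s t), Set.inter_univ]
  exact ENNReal.inv_mul_le_one _

/-- The conditional law prescribed on `[s, t]` by the path outside `(s, t)`: it depends on the
latter only through its values `z` at time `s` and `w` at time `t`, and it is the law of the
Brownian bridge from `z` to `w` conditioned to stay in the closed quadrant. -/
noncomputable def resamplingKernel (W : Measure PlanarPath) [IsProbabilityMeasure W]
    (s t : unitInterval) :
    Kernel (C(Set.Icc (0 : unitInterval) s, ℝ × ℝ) × C(Set.Icc t (1 : unitInterval), ℝ × ℝ))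
      C(Set.Icc s t, ℝ × ℝ) :=
  (quadrantBridgeKernel W s t).comap (gapEnds s t) (measurable_gapEnds s t)

instance instIsFiniteKernelResampling (W : Measure PlanarPath) [IsProbabilityMeasure W]
    (s t : unitInterval) : IsFiniteKernel (resamplingKernel W s t) := by
  unfold resamplingKernel
  infer_instance

/-- The properties, common to all the conditioned Brownian paths below, of a law `μ` on paths
`Z = (X, Y)` on `[0, 1]`: `Z_0 = 0`; for each `t ∈ (0, 1)`, almost surely `X_t, Y_t > 0`; and for
all `0 < s < t < 1` the conditional law of `Z` on `[s, t]` given `Z` on `[0, s]` and on `[t, 1]` is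
that of the Brownian motion on `[s, t]` conditioned to stay in the closed quadrant and to take the
values `Z_s` and `Z_t` at times `s` and `t`. -/
structure IsConditionedInQuadrant (W : Measure PlanarPath) [IsProbabilityMeasure W]
    (μ : Measure PlanarPath) : Prop where
  start : ∀ᵐ ω ∂μ, ω 0 = 0
  pos : ∀ t : unitInterval, 0 < t → t < 1 → ∀ᵐ ω ∂μ, 0 < (ω t).1 ∧ 0 < (ω t).2
  resampling : ∀ s t : unitInterval, 0 < s → s < t → t < 1 →
    HasCondDistrib (inside s t) (outside s t) (resamplingKernel W s t) μ

/-- `μ` is a law of the Brownian path from the origin at time `0` to `w` at time `1` conditioned to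
stay in the quadrant. For `w = 0` it is a law of the correlated Brownian loop. -/
structure IsQuadrantBridgeLaw (W : Measure PlanarPath) [IsProbabilityMeasure W] (w : ℝ × ℝ)
    (μ : Measure PlanarPath) : Prop extends IsConditionedInQuadrant W μ where
  terminal : ∀ᵐ ω ∂μ, ω 1 = w

/-- The path is a `π/2`-cone excursion (over the whole time interval `[0, 1]`, so of length `1`). -/
def IsConeExcursion (ω : PlanarPath) : Prop :=
  (∀ r, ω 0 ≤ ω r) ∧ ((ω 0).1 = (ω 1).1 ∨ (ω 0).2 = (ω 1).2)

/-- The terminal displacement of a `π/2`-cone excursion. -/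
noncomputable def terminalDisplacement (ω : PlanarPath) : ℝ :=
  max ((ω 1).1 - (ω 0).1) ((ω 1).2 - (ω 0).2)

/-- `μ` is a law of a correlated Brownian `π/2`-cone excursion (started from the origin) of length
`1` and terminal displacement `ε`. Its side of exit, i.e. whether it ends at `(ε, 0)` or at
`(0, ε)`, may be deterministic or random. -/
structure IsConeExcursionLaw (W : Measure PlanarPath) [IsProbabilityMeasure W] (ε : ℝ)
    (μ : Measure PlanarPath) : Prop extends IsConditionedInQuadrant W μ where
  excursion : ∀ᵐ ω ∂μ, IsConeExcursion ω
  displacement : ∀ᵐ ω ∂μ, terminalDisplacement ω = ε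

/-! ### Linear functionals of a path with finitely supported weights -/

/-- The finite linear combination of values of the path `η` with weights `φ`. -/
noncomputable def pathLin (φ : unitInterval →₀ ℝ) (η : PlanarPath) : ℝ × ℝ :=
  Finsupp.linearCombination ℝ (fun t ↦ η t) φ

/-- The bilinear form on weights whose kernel is the covariance `min s t` of Brownian motion. -/
noncomputable def minForm : (unitInterval →₀ ℝ) →ₗ[ℝ] (unitInterval →₀ ℝ) →ₗ[ℝ] ℝ :=
  Finsupp.linearCombination ℝ fun s : unitInterval ↦
    (Finsupp.linearCombination ℝ (fun t : unitInterval ↦ min (s : ℝ) t) :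
      (unitInterval →₀ ℝ) →ₗ[ℝ] ℝ)

theorem minForm_single (s t : unitInterval) (a b : ℝ) :
    minForm (Finsupp.single s a) (Finsupp.single t b) = a * (b * min (s : ℝ) t) := by
  simp [minForm]

theorem pathLin_single (t : unitInterval) (a : ℝ) (η : PlanarPath) :
    pathLin (Finsupp.single t a) η = a • η t := by
  simp [pathLin]

theorem pathLin_add (φ ψ : unitInterval →₀ ℝ) (η : PlanarPath) :
    pathLin (φ + ψ) η = pathLin φ η + pathLin ψ η := by
  simp [pathLin]

theorem pathLin_sub (φ ψ : unitInterval →₀ ℝ) (η : PlanarPath) :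
    pathLin (φ - ψ) η = pathLin φ η - pathLin ψ η := by
  simp [pathLin]

theorem pathLin_smul (c : ℝ) (φ : unitInterval →₀ ℝ) (η : PlanarPath) :
    pathLin (c • φ) η = c • pathLin φ η := by
  simp [pathLin]

theorem continuous_pathLin (φ : unitInterval →₀ ℝ) : Continuous (pathLin φ) := by
  unfold pathLin
  simp only [Finsupp.linearCombination_apply, Finsupp.sum]
  exact continuous_finsetSum _ fun t _ ↦ Continuous.const_smul (continuous_eval_const t) (φ t)

theorem isGaussianProcess_pathLin {W : Measure PlanarPath}
    (hpath : IsGaussianProcess (fun (t : unitInterval) (η : PlanarPath) ↦ η t) W)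
    {J : Type*} (φ : J → unitInterval →₀ ℝ) :
    IsGaussianProcess (fun j η ↦ pathLin (φ j) η) W := by
  refine hpath.of_isGaussianProcess fun j ↦ ⟨(φ j).support, ?_⟩
  let L : ((φ j).support → ℝ × ℝ) →L[ℝ] ℝ × ℝ :=
    ∑ t : (φ j).support, (φ j t) • ContinuousLinearMap.proj t
  refine ⟨L, fun η ↦ ?_⟩
  simp only [pathLin, Finsupp.linearCombination_apply, Finsupp.sum, L]
  rw [sum_apply, ← Finset.sum_coe_sort]
  simp [Finset.restrict]

theorem covariance_fun_add_left' {Ω : Type*} {mΩ : MeasurableSpace Ω} {μ : Measure Ω}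
    [IsFiniteMeasure μ] {X Y Z : Ω → ℝ} (hX : MemLp X 2 μ) (hY : MemLp Y 2 μ) (hZ : MemLp Z 2 μ) :
    cov[fun ω ↦ X ω + Y ω, Z; μ] = cov[X, Z; μ] + cov[Y, Z; μ] :=
  covariance_add_left hX hY hZ

theorem covariance_fun_add_right' {Ω : Type*} {mΩ : MeasurableSpace Ω} {μ : Measure Ω}
    [IsFiniteMeasure μ] {X Y Z : Ω → ℝ} (hX : MemLp X 2 μ) (hY : MemLp Y 2 μ) (hZ : MemLp Z 2 μ) :
    cov[Z, fun ω ↦ X ω + Y ω; μ] = cov[Z, X; μ] + cov[Z, Y; μ] :=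
  covariance_add_right hZ hX hY

namespace IsCorrelatedBrownianLaw

variable {α : ℝ} {W : Measure PlanarPath}

theorem memLp_dual (hW : IsCorrelatedBrownianLaw α W) (φ : unitInterval →₀ ℝ)
    (L : StrongDual ℝ (ℝ × ℝ)) : MemLp (fun η ↦ L (pathLin φ η)) 2 W :=
  (((isGaussianProcess_pathLin hW.gaussian fun _ : Unit ↦ φ).hasGaussianLaw_eval ()).map_fun
    L).memLp_two

theorem integrable_dual (hW : IsCorrelatedBrownianLaw α W) (φ : unitInterval →₀ ℝ)
    (L : StrongDual ℝ (ℝ × ℝ)) : Integrable (fun η ↦ L (pathLin φ η)) W :=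
  (((isGaussianProcess_pathLin hW.gaussian fun _ : Unit ↦ φ).hasGaussianLaw_eval ()).map_fun
    L).integrable

theorem isProbabilityMeasure (hW : IsCorrelatedBrownianLaw α W) : IsProbabilityMeasure W :=
  hW.gaussian.isProbabilityMeasure

theorem dual_apply_eq (L : StrongDual ℝ (ℝ × ℝ)) (x : ℝ × ℝ) :
    L x = L (1, 0) * x.1 + L (0, 1) * x.2 := by
  have : x = x.1 • ((1 : ℝ), (0 : ℝ)) + x.2 • ((0 : ℝ), (1 : ℝ)) := by
    ext <;> simp
  conv_lhs => rw [this]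
  rw [map_add, map_smul, map_smul, smul_eq_mul, smul_eq_mul, mul_comm, mul_comm x.2]

theorem integral_dual (hW : IsCorrelatedBrownianLaw α W) (φ : unitInterval →₀ ℝ)
    (L : StrongDual ℝ (ℝ × ℝ)) : ∫ η, L (pathLin φ η) ∂W = 0 := by
  induction φ using Finsupp.induction_linear with
  | zero => simp [pathLin]
  | add f g hf hg =>
    simp only [pathLin_add, map_add]
    rw [integral_add (hW.integrable_dual f L) (hW.integrable_dual g L), hf, hg, add_zero]
  | single t a =>
    have h1 := hW.integrable_dual (Finsupp.single t 1) (ContinuousLinearMap.fst ℝ ℝ ℝ)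
    have h2 := hW.integrable_dual (Finsupp.single t 1) (ContinuousLinearMap.snd ℝ ℝ ℝ)
    simp only [pathLin_single, one_smul, ContinuousLinearMap.coe_fst',
      ContinuousLinearMap.coe_snd'] at h1 h2
    simp only [pathLin_single, map_smul, smul_eq_mul]
    have eL (η : PlanarPath) : L (η t) = L (1, 0) * (η t).1 + L (0, 1) * (η t).2 :=
      dual_apply_eq L _
    simp only [eL]
    rw [integral_const_mul, integral_add (h1.const_mul _) (h2.const_mul _), integral_const_mul,
      integral_const_mul, hW.mean_fst, hW.mean_snd]
    simp

theorem covariance_dual (hW : IsCorrelatedBrownianLaw α W) (φ ψ : unitInterval →₀ ℝ)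
    (L M : StrongDual ℝ (ℝ × ℝ)) :
    cov[fun η ↦ L (pathLin φ η), fun η ↦ M (pathLin ψ η); W] =
      (L (1, 0) * M (1, 0) + L (0, 1) * M (0, 1) +
        α * (L (1, 0) * M (0, 1) + L (0, 1) * M (1, 0))) * minForm φ ψ := by
  have := hW.isProbabilityMeasure
  induction φ using Finsupp.induction_linear with
  | zero => simp [pathLin, covariance_const_left]
  | add f g hf hg =>
    simp only [pathLin_add, map_add, LinearMap.add_apply]
    rw [covariance_fun_add_left' (hW.memLp_dual f L) (hW.memLp_dual g L) (hW.memLp_dual ψ M), hf, hg]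
    ring
  | single s a =>
    induction ψ using Finsupp.induction_linear with
    | zero => simp [pathLin, covariance_const_right]
    | add f g hf hg =>
      simp only [pathLin_add, map_add]
      rw [covariance_fun_add_right' (hW.memLp_dual f M) (hW.memLp_dual g M)
        (hW.memLp_dual _ L), hf, hg]
      ring
    | single t b =>
      have h1 (t) := hW.memLp_dual (Finsupp.single t 1) (ContinuousLinearMap.fst ℝ ℝ ℝ)
      have h2 (t) := hW.memLp_dual (Finsupp.single t 1) (ContinuousLinearMap.snd ℝ ℝ ℝ)
      simp only [pathLin_single, one_smul, ContinuousLinearMap.coe_fst',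
        ContinuousLinearMap.coe_snd'] at h1 h2
      simp only [pathLin_single, map_smul, smul_eq_mul]
      have eL (η : PlanarPath) : L (η s) = L (1, 0) * (η s).1 + L (0, 1) * (η s).2 :=
        dual_apply_eq L _
      have eM (η : PlanarPath) : M (η t) = M (1, 0) * (η t).1 + M (0, 1) * (η t).2 :=
        dual_apply_eq M _
      simp only [eL, eM]
      rw [covariance_const_mul_left, covariance_const_mul_right,
        covariance_fun_add_left' ((h1 s).const_mul _) ((h2 s).const_mul _)
          (show MemLp (fun η : PlanarPath ↦ M (1, 0) * (η t).1 + M (0, 1) * (η t).2) 2 W from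
            ((h1 t).const_mul _).add ((h2 t).const_mul _)),
        covariance_fun_add_right' ((h1 t).const_mul _) ((h2 t).const_mul _) ((h1 s).const_mul _),
        covariance_fun_add_right' ((h1 t).const_mul _) ((h2 t).const_mul _) ((h2 s).const_mul _)]
      simp only [covariance_const_mul_left, covariance_const_mul_right, hW.cov_fst, hW.cov_snd,
        hW.cov_fst_snd, covariance_comm (fun η : PlanarPath ↦ (η s).2) fun η ↦ (η t).1,
        minForm_single]
      rw [min_comm (t : ℝ) s]
      ring

/-- Linear images of Brownian motion with the same covariances have the same law. -/
theorem map_pathLin_eq (hW : IsCorrelatedBrownianLaw α W) {J : Type*}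
    (φ ψ : J → unitInterval →₀ ℝ)
    (h : ∀ i j, minForm (φ i) (φ j) = minForm (ψ i) (ψ j)) :
    W.map (fun η j ↦ pathLin (φ j) η) = W.map (fun η j ↦ pathLin (ψ j) η) := by
  have := hW.isProbabilityMeasure
  have hm (χ : J → unitInterval →₀ ℝ) : Measurable fun η j ↦ pathLin (χ j) η :=
    measurable_pi_lambda _ fun j ↦ (continuous_pathLin _).measurable
  rw [map_eq_iff_forall_finset_map_restrict_eq (hm φ).aemeasurable (hm ψ).aemeasurable]
  intro K
  classical
  have hφ := (isGaussianProcess_pathLin hW.gaussian φ).hasGaussianLaw K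
  have hψ := (isGaussianProcess_pathLin hW.gaussian ψ).hasGaussianLaw K
  have := hφ.isGaussian_map
  have := hψ.isGaussian_map
  refine Measure.ext_of_charFunDual (funext fun L ↦ ?_)
  rw [hφ.charFunDual_map_eq_fun, hψ.charFunDual_map_eq_fun]
  have expand (χ : J → unitInterval →₀ ℝ) (η : PlanarPath) :
      L (K.restrict fun j ↦ pathLin (χ j) η) =
        ∑ k : K, (L ∘L ContinuousLinearMap.single ℝ _ k) (pathLin (χ k) η) := by
    rw [← L.sum_comp_single]; rfl
  have mean (χ : J → unitInterval →₀ ℝ) :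
      ∫ η, L (K.restrict fun j ↦ pathLin (χ j) η) ∂W = 0 := by
    simp_rw [expand]
    rw [integral_finsetSum _ fun k _ ↦ hW.integrable_dual _ _]
    exact Finset.sum_eq_zero fun k _ ↦ hW.integral_dual _ _
  have var (χ : J → unitInterval →₀ ℝ) :
      Var[fun η ↦ L (K.restrict fun j ↦ pathLin (χ j) η); W] =
        ∑ k : K, ∑ l : K, cov[fun η ↦ (L ∘L ContinuousLinearMap.single ℝ _ k) (pathLin (χ k) η),
          fun η ↦ (L ∘L ContinuousLinearMap.single ℝ _ l) (pathLin (χ l) η); W] := by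
    simp_rw [expand]
    rw [← covariance_self, covariance_fun_sum_fun_sum]
    · exact fun k ↦ hW.memLp_dual _ _
    · exact fun k ↦ hW.memLp_dual _ _
    · exact Measurable.aemeasurable (Finset.measurable_sum _ fun k _ ↦
        (ContinuousLinearMap.continuous _).measurable.comp (continuous_pathLin _).measurable)
  rw [mean, mean, var, var]
  simp only [hW.covariance_dual, h]

/-- Uncorrelated linear images of Brownian motion are independent. -/
theorem indepFun_pathLin (hW : IsCorrelatedBrownianLaw α W) {J K : Type*}
    (φ : J → unitInterval →₀ ℝ) (ψ : K → unitInterval →₀ ℝ)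
    (h : ∀ j k, minForm (φ j) (ψ k) = 0) :
    IndepFun (fun η j ↦ pathLin (φ j) η) (fun η k ↦ pathLin (ψ k) η) W := by
  have hG := isGaussianProcess_pathLin hW.gaussian (Sum.elim φ ψ)
  have : (fun j η ↦ pathLin (Sum.elim φ ψ j) η) =
      Sum.elim (fun j η ↦ pathLin (φ j) η) (fun k η ↦ pathLin (ψ k) η) := by
    ext j <;> cases j <;> rfl
  rw [this] at hG
  refine hG.indepFun_of_covariance_strongDual
    (fun s ↦ (continuous_pathLin _).measurable.aemeasurable)
    (fun s ↦ (continuous_pathLin _).measurable.aemeasurable) fun s t L M ↦ ?_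
  exact (hW.covariance_dual _ _ _ _).trans (by rw [h, mul_zero])

end IsCorrelatedBrownianLaw

/-! ### The σ-algebra of a space of continuous functions -/

theorem comap_eval_eq {K : Type*} [TopologicalSpace K] [CompactSpace K]
    [TopologicalSpace.MetrizableSpace K] :
    MeasurableSpace.comap (fun (f : C(K, ℝ × ℝ)) k ↦ f k) MeasurableSpace.pi =
      instMeasurableSpaceCM := by
  apply le_antisymm
  · exact (measurable_pi_lambda _ fun k ↦ (continuous_eval_const k).measurable).comap_le
  · obtain ⟨D, hDc, hDd⟩ := TopologicalSpace.exists_countable_dense K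
    have := hDc.to_subtype
    have hc : Continuous fun (f : C(K, ℝ × ℝ)) (k : D) ↦ f k :=
      continuous_pi fun k ↦ continuous_eval_const _
    have hi : Function.Injective fun (f : C(K, ℝ × ℝ)) (k : D) ↦ f k := by
      intro f g h
      refine DFunLike.coe_injective (Continuous.ext_on hDd f.continuous g.continuous fun k hk ↦ ?_)
      exact congrFun h ⟨k, hk⟩
    have he := (hc.measurableEmbedding hi).comap_eq
    calc (instMeasurableSpaceCM : MeasurableSpace C(K, ℝ × ℝ)) = _ := he.symm
      _ = MeasurableSpace.comap (fun (f : C(K, ℝ × ℝ)) k ↦ f k)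
          (MeasurableSpace.comap (fun (x : K → ℝ × ℝ) (k : D) ↦ x k) MeasurableSpace.pi) := by
        rw [MeasurableSpace.comap_comp]; rfl
      _ ≤ _ := MeasurableSpace.comap_mono
        (measurable_pi_lambda _ fun k ↦ measurable_pi_apply _).comap_le

theorem measurable_continuousMap_iff {Ω K : Type*} [MeasurableSpace Ω] [TopologicalSpace K]
    [CompactSpace K] [TopologicalSpace.MetrizableSpace K] {Φ : Ω → C(K, ℝ × ℝ)} :
    Measurable Φ ↔ ∀ k, Measurable fun ω ↦ Φ ω k := by
  rw [← measurable_pi_iff, ← comap_eval_eq, measurable_comap_iff]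
  rfl

theorem measure_continuousMap_ext {K : Type*} [TopologicalSpace K]
    [CompactSpace K] [TopologicalSpace.MetrizableSpace K] {μ ν : Measure C(K, ℝ × ℝ)}
    (h : μ.map (fun f k ↦ f k) = ν.map (fun f k ↦ f k)) : μ = ν := by
  ext A hA
  rw [← comap_eval_eq] at hA
  obtain ⟨B, hB, rfl⟩ := hA
  have hm : Measurable fun (f : C(K, ℝ × ℝ)) k ↦ f k :=
    measurable_pi_lambda _ fun k ↦ (continuous_eval_const k).measurable
  rw [← Measure.map_apply hm hB, h, Measure.map_apply hm hB]

theorem measurable_of_pathLin {K : Type*} [TopologicalSpace K]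
    [CompactSpace K] [TopologicalSpace.MetrizableSpace K] {Φ : PlanarPath → C(K, ℝ × ℝ)}
    {φ : K → unitInterval →₀ ℝ} (hΦ : ∀ η k, Φ η k = pathLin (φ k) η) : Measurable Φ :=
  measurable_continuousMap_iff.2 fun k ↦ by
    simp_rw [hΦ]; exact (continuous_pathLin _).measurable

namespace IsCorrelatedBrownianLaw

variable {α : ℝ} {W : Measure PlanarPath}

theorem map_path_eq (hW : IsCorrelatedBrownianLaw α W) {K : Type*} [TopologicalSpace K]
    [CompactSpace K] [TopologicalSpace.MetrizableSpace K] {Φ Ψ : PlanarPath → C(K, ℝ × ℝ)}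
    (φ ψ : K → unitInterval →₀ ℝ) (hΦ : ∀ η k, Φ η k = pathLin (φ k) η)
    (hΨ : ∀ η k, Ψ η k = pathLin (ψ k) η)
    (h : ∀ i j, minForm (φ i) (φ j) = minForm (ψ i) (ψ j)) :
    W.map Φ = W.map Ψ := by
  have hm : Measurable fun (f : C(K, ℝ × ℝ)) k ↦ f k :=
    measurable_pi_lambda _ fun k ↦ (continuous_eval_const k).measurable
  apply measure_continuousMap_ext
  rw [Measure.map_map hm (measurable_of_pathLin hΦ),
    Measure.map_map hm (measurable_of_pathLin hΨ)]
  have := hW.map_pathLin_eq φ ψ h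
  simpa only [Function.comp_def, hΦ, hΨ] using this

theorem map_point_eq (hW : IsCorrelatedBrownianLaw α W) (φ ψ : unitInterval →₀ ℝ)
    (h : minForm φ φ = minForm ψ ψ) : W.map (pathLin φ) = W.map (pathLin ψ) := by
  have := congrArg (Measure.map fun x : Unit → ℝ × ℝ ↦ x ())
    (hW.map_pathLin_eq (fun _ : Unit ↦ φ) (fun _ ↦ ψ) fun _ _ ↦ h)
  rw [Measure.map_map (measurable_pi_apply _)
      (measurable_pi_lambda _ fun _ ↦ (continuous_pathLin _).measurable),
    Measure.map_map (measurable_pi_apply _)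
      (measurable_pi_lambda _ fun _ ↦ (continuous_pathLin _).measurable)] at this
  exact this

theorem indepFun_of_comap_le (hW : IsCorrelatedBrownianLaw α W) {J K S T : Type*}
    [mS : MeasurableSpace S] [mT : MeasurableSpace T]
    (φ : J → unitInterval →₀ ℝ) (ψ : K → unitInterval →₀ ℝ)
    (h : ∀ j k, minForm (φ j) (ψ k) = 0) {X : PlanarPath → S} {Y : PlanarPath → T}
    (hX : mS.comap X ≤ MeasurableSpace.comap (fun η j ↦ pathLin (φ j) η) MeasurableSpace.pi)
    (hY : mT.comap Y ≤ MeasurableSpace.comap (fun η k ↦ pathLin (ψ k) η) MeasurableSpace.pi) :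
    IndepFun X Y W := by
  have := hW.indepFun_pathLin φ ψ h
  rw [IndepFun_iff_Indep] at this ⊢
  exact indep_of_indep_of_le_left (indep_of_indep_of_le_right this hY) hX

end IsCorrelatedBrownianLaw

theorem comap_path_le {K J : Type*} [TopologicalSpace K] [CompactSpace K] [TopologicalSpace.MetrizableSpace K]
    {Φ : PlanarPath → C(K, ℝ × ℝ)} (φ : J → unitInterval →₀ ℝ) (i : K → J)
    (hΦ : ∀ η k, Φ η k = pathLin (φ (i k)) η) :
    MeasurableSpace.comap Φ instMeasurableSpaceCM ≤
      MeasurableSpace.comap (fun η j ↦ pathLin (φ j) η) MeasurableSpace.pi := by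
  rw [← comap_eval_eq, MeasurableSpace.comap_comp]
  have : (fun (f : C(K, ℝ × ℝ)) k ↦ f k) ∘ Φ =
      (fun (x : J → ℝ × ℝ) k ↦ x (i k)) ∘ fun η j ↦ pathLin (φ j) η := by
    ext1 η; ext1 k; exact hΦ η k
  rw [this, ← MeasurableSpace.comap_comp]
  exact MeasurableSpace.comap_mono (measurable_pi_lambda _ fun k ↦ measurable_pi_apply _).comap_le

theorem comap_point_le {J : Type*} (φ : J → unitInterval →₀ ℝ) (j : J)
    {X : PlanarPath → ℝ × ℝ} (hX : ∀ η, X η = pathLin (φ j) η) :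
    MeasurableSpace.comap X inferInstance ≤
      MeasurableSpace.comap (fun η j ↦ pathLin (φ j) η) MeasurableSpace.pi := by
  rw [funext hX]
  have : pathLin (φ j) = (fun x : J → ℝ × ℝ ↦ x j) ∘ fun η j ↦ pathLin (φ j) η := rfl
  rw [this, ← MeasurableSpace.comap_comp]
  exact MeasurableSpace.comap_mono (measurable_pi_apply _).comap_le

theorem comap_prodMk_le {Ω S T : Type*} {m : MeasurableSpace Ω} [mS : MeasurableSpace S]
    [mT : MeasurableSpace T] {X : Ω → S} {Y : Ω → T} (hX : mS.comap X ≤ m) (hY : mT.comap Y ≤ m) :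
    MeasurableSpace.comap (fun ω ↦ (X ω, Y ω)) inferInstance ≤ m :=
  ((measurable_iff_comap_le.2 hX).prodMk (measurable_iff_comap_le.2 hY)).comap_le

/-! ### Segments and bridges of a path -/

/-- The time that divides the interval from `s` to `t` in the proportion `u : 1 - u`. -/
def affTime (s t u : unitInterval) : unitInterval :=
  ⟨(1 - u) * s + u * t, by
    have := unitInterval.nonneg u
    have := unitInterval.le_one u
    have := unitInterval.nonneg s
    have := unitInterval.le_one s
    have := unitInterval.nonneg t
    have := unitInterval.le_one t
    constructor <;> nlinarith⟩

theorem coe_affTime (s t u : unitInterval) : (affTime s t u : ℝ) = (1 - u) * s + u * t := rfl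

@[simp] theorem affTime_zero (s t : unitInterval) : affTime s t 0 = s := by
  ext; simp [coe_affTime]

@[simp] theorem affTime_one (s t : unitInterval) : affTime s t 1 = t := by
  ext; simp [coe_affTime]

theorem continuous_affTime (s t : unitInterval) : Continuous (affTime s t) := by
  unfold affTime
  fun_prop

/-- The increments of a path from time `s` to time `t` (possibly backwards), in Brownian scaling. -/
noncomputable def seg (s t : unitInterval) (η : PlanarPath) : PlanarPath where
  toFun u := (√|(t - s : ℝ)|)⁻¹ • (η (affTime s t u) - η s)
  continuous_toFun := by
    have := continuous_affTime s t
    fun_prop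

/-- The path minus the linear interpolation of its end values. -/
noncomputable def bridgePart (η : PlanarPath) : PlanarPath where
  toFun u := η u - η 0 - (u : ℝ) • (η 1 - η 0)
  continuous_toFun := by fun_prop

theorem seg_apply (s t u : unitInterval) (η : PlanarPath) :
    seg s t η u = (√|(t - s : ℝ)|)⁻¹ • (η (affTime s t u) - η s) := rfl

theorem bridgePart_apply (u : unitInterval) (η : PlanarPath) :
    bridgePart η u = η u - η 0 - (u : ℝ) • (η 1 - η 0) := rfl

theorem sqrt_smul_seg {s t : unitInterval} (h : s ≠ t) (u : unitInterval) (η : PlanarPath) :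
    √|(t - s : ℝ)| • seg s t η u = η (affTime s t u) - η s := by
  have : √|(t - s : ℝ)| ≠ 0 := by
    rw [Real.sqrt_ne_zero (abs_nonneg _)]
    exact abs_ne_zero.2 (sub_ne_zero.2 fun h' ↦ h (Subtype.ext h'.symm))
  rw [seg_apply, smul_inv_smul₀ this]

theorem sqrt_smul_bridgePart_seg {s t : unitInterval} (h : s ≠ t) (u : unitInterval)
    (η : PlanarPath) :
    √|(t - s : ℝ)| • bridgePart (seg s t η) u =
      η (affTime s t u) - (1 - u : ℝ) • η s - (u : ℝ) • η t := by
  rw [bridgePart_apply, smul_sub, smul_sub, smul_comm, smul_sub, sqrt_smul_seg h, sqrt_smul_seg h,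
    sqrt_smul_seg h]
  simp only [affTime_zero, affTime_one]
  module

theorem bridgePart_affTime_zero {θ : unitInterval} (h : 0 < θ) (u : unitInterval)
    (η : PlanarPath) :
    bridgePart η (affTime 0 θ u) =
      (u : ℝ) • bridgePart η θ + √(θ : ℝ) • bridgePart (seg 0 θ η) u := by
  have := sqrt_smul_bridgePart_seg h.ne u η
  have e : |((θ : ℝ) - (0 : unitInterval))| = θ := by simp [abs_of_nonneg (unitInterval.nonneg θ)]
  rw [e] at this
  rw [this, bridgePart_apply, bridgePart_apply]
  have : ((affTime 0 θ u : unitInterval) : ℝ) = u * θ := by simp [coe_affTime]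
  rw [this]
  module

theorem bridgePart_affTime_one {θ : unitInterval} (h : θ < 1) (u : unitInterval)
    (η : PlanarPath) :
    bridgePart η (affTime 1 θ u) =
      (u : ℝ) • bridgePart η θ + √(1 - θ : ℝ) • bridgePart (seg 1 θ η) u := by
  have := sqrt_smul_bridgePart_seg h.ne' u η
  have e : |((θ : ℝ) - (1 : unitInterval))| = 1 - θ := by
    rw [abs_sub_comm]
    simp [abs_of_nonneg (sub_nonneg.2 (unitInterval.le_one θ))]
  rw [e] at this
  rw [this, bridgePart_apply, bridgePart_apply]
  have : ((affTime 1 θ u : unitInterval) : ℝ) = (1 - u) + u * θ := by simp [coe_affTime]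
  rw [this]
  module

/-- The weights of `seg`. -/
noncomputable def segWeight (s t u : unitInterval) : unitInterval →₀ ℝ :=
  (√|(t - s : ℝ)|)⁻¹ • (Finsupp.single (affTime s t u) 1 - Finsupp.single s 1)

/-- The weights of the unscaled bridge from time `s` to time `t`. -/
noncomputable def resWeight (s t u : unitInterval) : unitInterval →₀ ℝ :=
  Finsupp.single (affTime s t u) 1 - (1 - u : ℝ) • Finsupp.single s 1 -
    (u : ℝ) • Finsupp.single t 1

theorem seg_eq_pathLin (s t u : unitInterval) (η : PlanarPath) :
    seg s t η u = pathLin (segWeight s t u) η := by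
  simp only [segWeight, pathLin_smul, pathLin_sub, pathLin_single, one_smul, seg_apply]

theorem pathLin_resWeight (s t u : unitInterval) (η : PlanarPath) :
    pathLin (resWeight s t u) η = η (affTime s t u) - (1 - u : ℝ) • η s - (u : ℝ) • η t := by
  simp only [resWeight, pathLin_smul, pathLin_sub, pathLin_single, one_smul]

theorem bridgePart_seg_eq_pathLin {s t : unitInterval} (h : s ≠ t) (u : unitInterval)
    (η : PlanarPath) :
    bridgePart (seg s t η) u = pathLin ((√|(t - s : ℝ)|)⁻¹ • resWeight s t u) η := by
  rw [pathLin_smul, pathLin_resWeight, ← sqrt_smul_bridgePart_seg h, inv_smul_smul₀]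
  rw [Real.sqrt_ne_zero (abs_nonneg _)]
  exact abs_ne_zero.2 (sub_ne_zero.2 fun h' ↦ h (Subtype.ext h'.symm))

theorem bridgePart_eq_pathLin (u : unitInterval) (η : PlanarPath) :
    bridgePart η u = pathLin (resWeight 0 1 u) η := by
  rw [pathLin_resWeight, bridgePart_apply]
  have : affTime 0 1 u = u := by ext; simp [coe_affTime]
  rw [this]
  module

theorem pathLin_point (u : unitInterval) (η : PlanarPath) :
    η u = pathLin (Finsupp.single u 1) η := by
  rw [pathLin_single, one_smul]

theorem minForm_resWeight_single {s t : unitInterval} (u r : unitInterval)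
    (h : (r ≤ s ∧ r ≤ t) ∨ (s ≤ r ∧ t ≤ r)) :
    minForm (resWeight s t u) (Finsupp.single r 1) = 0 := by
  have hu0 := unitInterval.nonneg u
  have hu1 := unitInterval.le_one u
  simp only [resWeight, map_sub, map_smul, LinearMap.sub_apply, LinearMap.smul_apply,
    minForm_single, smul_eq_mul, one_mul, coe_affTime]
  rcases h with ⟨h1, h2⟩ | ⟨h1, h2⟩
  · have h1' : (r : ℝ) ≤ s := h1
    have h2' : (r : ℝ) ≤ t := h2
    rw [min_eq_right h1', min_eq_right h2', min_eq_right (by nlinarith)]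
    ring
  · have h1' : (s : ℝ) ≤ r := h1
    have h2' : (t : ℝ) ≤ r := h2
    rw [min_eq_left h1', min_eq_left h2', min_eq_left (by nlinarith)]
    ring

theorem minForm_resWeight_resWeight {s t s' t' : unitInterval} (u v : unitInterval)
    (h : (s' ≤ s ∧ t' ≤ s ∧ s' ≤ t ∧ t' ≤ t) ∨ (s ≤ s' ∧ s ≤ t' ∧ t ≤ s' ∧ t ≤ t')) :
    minForm (resWeight s t u) (resWeight s' t' v) = 0 := by
  have hv0 := unitInterval.nonneg v
  have hv1 := unitInterval.le_one v
  rw [show resWeight s' t' v = Finsupp.single (affTime s' t' v) 1 - (1 - v : ℝ) • Finsupp.single s' 1 -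
    (v : ℝ) • Finsupp.single t' 1 from rfl, map_sub, map_sub, map_smul, map_smul,
    minForm_resWeight_single, minForm_resWeight_single, minForm_resWeight_single]
  · simp
  · tauto
  · tauto
  · have e : ((affTime s' t' v : unitInterval) : ℝ) = (1 - v) * s' + v * t' := rfl
    rcases h with ⟨h1, h2, h3, h4⟩ | ⟨h1, h2, h3, h4⟩
    · left
      constructor <;> rw [← Subtype.coe_le_coe, e] <;> rw [← Subtype.coe_le_coe] at * <;> nlinarith
    · right
      constructor <;> rw [← Subtype.coe_le_coe, e] <;> rw [← Subtype.coe_le_coe] at * <;> nlinarith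

theorem minForm_segWeight {s t : unitInterval} (h : s ≠ t) (u v : unitInterval) :
    minForm (segWeight s t u) (segWeight s t v) = min (u : ℝ) v := by
  have hu0 := unitInterval.nonneg u
  have hu1 := unitInterval.le_one u
  have hv0 := unitInterval.nonneg v
  have hv1 := unitInterval.le_one v
  have hne : (t - s : ℝ) ≠ 0 := sub_ne_zero.2 fun h' ↦ h (Subtype.ext h'.symm)
  have hs : (√|(t - s : ℝ)|)⁻¹ * (√|(t - s : ℝ)|)⁻¹ = |(t - s : ℝ)|⁻¹ := by
    rw [← mul_inv, Real.mul_self_sqrt (abs_nonneg _)]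
  simp only [segWeight, map_sub, map_smul, LinearMap.sub_apply, LinearMap.smul_apply,
    minForm_single, smul_eq_mul, one_mul, coe_affTime, min_self]
  rw [← mul_sub, ← mul_assoc, hs, inv_mul_eq_div, div_eq_iff (abs_ne_zero.2 hne)]
  rcases lt_or_gt_of_ne h with hst | hst
  · have hst' : (s : ℝ) < t := hst
    rw [abs_of_pos (sub_pos.2 hst'), min_eq_right (by nlinarith : (s : ℝ) ≤ (1 - u) * s + u * t),
      min_eq_left (by nlinarith : (s : ℝ) ≤ (1 - v) * s + v * t)]
    rcases le_total (u : ℝ) v with huv | huv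
    · rw [min_eq_left huv, min_eq_left (by nlinarith)]; ring
    · rw [min_eq_right huv, min_eq_right (by nlinarith)]; ring
  · have hst' : (t : ℝ) < s := hst
    rw [abs_of_neg (sub_neg.2 hst'), min_eq_left (by nlinarith : (1 - u) * s + u * t ≤ (s : ℝ)),
      min_eq_right (by nlinarith : (1 - v) * s + v * t ≤ (s : ℝ))]
    rcases le_total (u : ℝ) v with huv | huv
    · rw [min_eq_left huv, min_eq_right (by nlinarith)]; ring
    · rw [min_eq_right huv, min_eq_left (by nlinarith)]; ring

theorem minForm_segWeight_segWeight (r u v : unitInterval) :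
    minForm (segWeight 0 r u) (segWeight r 1 v) = 0 := by
  have hu0 := unitInterval.nonneg u
  have hu1 := unitInterval.le_one u
  have hv0 := unitInterval.nonneg v
  have hv1 := unitInterval.le_one v
  have hr0 := unitInterval.nonneg r
  have hr1 := unitInterval.le_one r
  simp only [segWeight, map_sub, map_smul, LinearMap.sub_apply, LinearMap.smul_apply,
    minForm_single, smul_eq_mul, one_mul, coe_affTime, Set.Icc.coe_zero, Set.Icc.coe_one]
  rw [min_eq_left (by nlinarith : (1 - u) * 0 + u * (r : ℝ) ≤ (1 - v) * r + v * 1),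
    min_eq_left (by nlinarith : (1 - u) * 0 + u * (r : ℝ) ≤ r), min_eq_left hr0,
    min_eq_left (by nlinarith : (0 : ℝ) ≤ (1 - v) * r + v * 1)]
  ring

theorem measurable_seg (s t : unitInterval) : Measurable (seg s t) :=
  measurable_of_pathLin fun η u ↦ seg_eq_pathLin s t u η

theorem continuous_bridgePart : Continuous bridgePart := by
  apply ContinuousMap.continuous_of_continuous_uncurry
  have : Continuous fun p : PlanarPath × unitInterval ↦
    p.1 p.2 - p.1 0 - (p.2 : ℝ) • (p.1 1 - p.1 0) := by fun_prop
  exact this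

/-- The law of the value at time `1`. -/
noncomputable def endLaw (W : Measure PlanarPath) : Measure (ℝ × ℝ) :=
  W.map fun η ↦ η 1

/-- The law of the bridge of duration `1` from `0` to `0`. -/
noncomputable def bridgeLaw (W : Measure PlanarPath) : Measure PlanarPath :=
  W.map bridgePart

instance {W : Measure PlanarPath} [IsProbabilityMeasure W] : IsProbabilityMeasure (endLaw W) :=
  Measure.isProbabilityMeasure_map (continuous_eval_const _).measurable.aemeasurable

instance {W : Measure PlanarPath} [IsProbabilityMeasure W] : IsProbabilityMeasure (bridgeLaw W) :=
  Measure.isProbabilityMeasure_map continuous_bridgePart.measurable.aemeasurable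

theorem minForm_resWeight_self (s t u : unitInterval) (r : unitInterval →₀ ℝ)
    (h1 : minForm r (Finsupp.single s 1) = 0) (h2 : minForm r (Finsupp.single t 1) = 0) :
    minForm r (resWeight s t u) = minForm r (Finsupp.single (affTime s t u) 1) := by
  simp only [resWeight, map_sub, map_smul, h1, h2]
  simp

namespace IsCorrelatedBrownianLaw

variable {α : ℝ} {W : Measure PlanarPath}

theorem map_seg (hW : IsCorrelatedBrownianLaw α W) {s t : unitInterval} (h : s ≠ t) :
    W.map (seg s t) = W := by
  have := hW.map_path_eq (Φ := seg s t) (Ψ := id) (segWeight s t) (fun u ↦ Finsupp.single u 1)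
    (fun η u ↦ seg_eq_pathLin s t u η) (fun η u ↦ pathLin_point u η)
    fun u v ↦ by rw [minForm_segWeight h, minForm_single]; ring
  rwa [Measure.map_id] at this

theorem ae_zero (hW : IsCorrelatedBrownianLaw α W) : ∀ᵐ η ∂W, η 0 = 0 := by
  have h := hW.map_point_eq (Finsupp.single 0 1) 0 (by rw [minForm_single]; simp)
  have h0 : W.map (pathLin 0) {0}ᶜ = 0 := by
    rw [Measure.map_apply (continuous_pathLin _).measurable (measurableSet_singleton _).compl]
    have : pathLin 0 ⁻¹' {0}ᶜ = ∅ := by ext; simp [pathLin]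
    rw [this, measure_empty]
  rw [← h, Measure.map_apply (continuous_pathLin _).measurable (measurableSet_singleton _).compl]
    at h0
  filter_upwards [measure_eq_zero_iff_ae_notMem.1 h0] with η hη
  simpa [pathLin_single] using hη

/-- The end value of Brownian motion is independent of its bridge part. -/
theorem map_end_bridgePart (hW : IsCorrelatedBrownianLaw α W) :
    W.map (fun η ↦ (η 1, bridgePart η)) = (endLaw W).prod (bridgeLaw W) := by
  have := hW.isProbabilityMeasure
  have h := hW.indepFun_of_comap_le (X := fun η ↦ η 1) (Y := bridgePart)
    (fun _ : Unit ↦ Finsupp.single 1 1) (resWeight 0 1)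
    (fun _ u ↦ by
      have := minForm_resWeight_single (s := 0) (t := 1) u 1
        (Or.inr ⟨unitInterval.le_one', le_rfl⟩)
      rw [← this]
      simp only [resWeight, map_sub, map_smul, LinearMap.sub_apply, LinearMap.smul_apply,
        minForm_single, min_comm])
    (comap_point_le _ () fun η ↦ pathLin_point 1 η)
    (comap_path_le _ id fun η u ↦ bridgePart_eq_pathLin u η)
  rw [indepFun_iff_map_prod_eq_prod_map_map (continuous_eval_const _).measurable.aemeasurable
    continuous_bridgePart.measurable.aemeasurable] at h
  exact h

/-- The Markov property of Brownian motion. -/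
theorem map_seg_seg (hW : IsCorrelatedBrownianLaw α W) {r : unitInterval} (h0 : 0 < r)
    (h1 : r < 1) : W.map (fun η ↦ (seg 0 r η, seg r 1 η)) = W.prod W := by
  have := hW.isProbabilityMeasure
  have h := hW.indepFun_of_comap_le (X := seg 0 r) (Y := seg r 1) (segWeight 0 r) (segWeight r 1)
    (fun u v ↦ minForm_segWeight_segWeight r u v)
    (comap_path_le _ id fun η u ↦ seg_eq_pathLin 0 r u η)
    (comap_path_le _ id fun η u ↦ seg_eq_pathLin r 1 u η)
  rw [indepFun_iff_map_prod_eq_prod_map_map (measurable_seg _ _).aemeasurable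
    (measurable_seg _ _).aemeasurable, hW.map_seg h0.ne, hW.map_seg h1.ne] at h
  exact h

theorem map_bridgePart_apply (hW : IsCorrelatedBrownianLaw α W) (θ : unitInterval) :
    W.map (fun η ↦ bridgePart η θ) = (endLaw W).map (√(θ * (1 - θ) : ℝ) • ·) := by
  have h := hW.map_point_eq (resWeight 0 1 θ) (√(θ * (1 - θ) : ℝ) • Finsupp.single 1 1) (by
    have hθ0 := unitInterval.nonneg θ
    have hθ1 := unitInterval.le_one θ
    rw [minForm_resWeight_self _ _ _ _
      (minForm_resWeight_single _ _ (Or.inl ⟨le_rfl, unitInterval.nonneg'⟩))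
      (minForm_resWeight_single _ _ (Or.inr ⟨unitInterval.le_one', le_rfl⟩))]
    simp only [resWeight, map_smul, map_sub, LinearMap.smul_apply, LinearMap.sub_apply,
      minForm_single, coe_affTime, smul_eq_mul]
    rw [← mul_assoc (√_), Real.mul_self_sqrt (by nlinarith)]
    simp [hθ1, hθ0]
    ring)
  rw [endLaw, Measure.map_map (measurable_const_smul _) (continuous_eval_const _).measurable]
  calc _ = W.map (pathLin (resWeight 0 1 θ)) := by
        congr 1; ext1 η; exact bridgePart_eq_pathLin θ η
    _ = _ := h
    _ = _ := by congr 1; ext1 η; simp [pathLin_single]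

theorem map_bridgePart_seg (hW : IsCorrelatedBrownianLaw α W) {s t : unitInterval} (h : s ≠ t) :
    W.map (fun η ↦ bridgePart (seg s t η)) = bridgeLaw W := by
  rw [bridgeLaw]
  conv_rhs => rw [← hW.map_seg h]
  rw [Measure.map_map continuous_bridgePart.measurable (measurable_seg _ _)]
  rfl

/-- A Brownian bridge is cut at time `θ` into two independent bridges. -/
theorem map_bridgePart_split (hW : IsCorrelatedBrownianLaw α W) {θ : unitInterval} (h0 : 0 < θ)
    (h1 : θ < 1) :
    W.map (fun η ↦ (bridgePart η θ, bridgePart (seg 0 θ η), bridgePart (seg 1 θ η))) =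
      ((endLaw W).map (√(θ * (1 - θ) : ℝ) • ·)).prod ((bridgeLaw W).prod (bridgeLaw W)) := by
  have := hW.isProbabilityMeasure
  have m1 : Measurable fun η ↦ bridgePart (seg 0 θ η) :=
    continuous_bridgePart.measurable.comp (measurable_seg _ _)
  have m2 : Measurable fun η ↦ bridgePart (seg 1 θ η) :=
    continuous_bridgePart.measurable.comp (measurable_seg _ _)
  have m0 : Measurable fun η : PlanarPath ↦ bridgePart η θ :=
    (continuous_eval_const θ).measurable.comp continuous_bridgePart.measurable
  have hA := hW.indepFun_of_comap_le (X := fun η ↦ bridgePart (seg 0 θ η))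
    (Y := fun η ↦ bridgePart (seg 1 θ η))
    (fun u ↦ (√|(θ - (0 : unitInterval) : ℝ)|)⁻¹ • resWeight 0 θ u)
    (fun u ↦ (√|(θ - (1 : unitInterval) : ℝ)|)⁻¹ • resWeight 1 θ u)
    (fun u v ↦ by
      rw [map_smul, map_smul, LinearMap.smul_apply, minForm_resWeight_resWeight _ _
        (Or.inr ⟨unitInterval.nonneg', unitInterval.nonneg', h1.le, le_rfl⟩)]
      simp)
    (comap_path_le _ id fun η u ↦ bridgePart_seg_eq_pathLin h0.ne u η)
    (comap_path_le _ id fun η u ↦ bridgePart_seg_eq_pathLin h1.ne' u η)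
  have hB := hW.indepFun_of_comap_le (X := fun η ↦ bridgePart η θ)
    (Y := fun η ↦ (bridgePart (seg 0 θ η), bridgePart (seg 1 θ η)))
    (fun _ : Unit ↦ resWeight 0 1 θ)
    (Sum.elim (fun u ↦ (√|(θ - (0 : unitInterval) : ℝ)|)⁻¹ • resWeight 0 θ u)
      (fun u ↦ (√|(θ - (1 : unitInterval) : ℝ)|)⁻¹ • resWeight 1 θ u))
    (by
      have symm (φ ψ : unitInterval →₀ ℝ) : minForm φ ψ = minForm ψ φ := by
        induction φ using Finsupp.induction_linear with
        | zero => simp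
        | add f g hf hg => simp [hf, hg]
        | single s a =>
          induction ψ using Finsupp.induction_linear with
          | zero => simp
          | add f g hf hg => simp [hf, hg]
          | single t b => rw [minForm_single, minForm_single, min_comm]; ring
      have key (s t u : unitInterval) (h : (s ≤ 0 ∧ t ≤ 1 ∧ s ≤ θ ∧ t ≤ θ) ∨ (s = 1 ∧ t = θ)) :
          minForm (resWeight 0 1 θ) (resWeight s t u) = 0 := by
        rw [symm]
        rw [show resWeight 0 1 θ = Finsupp.single (affTime 0 1 θ) 1 -
          (1 - θ : ℝ) • Finsupp.single 0 1 - (θ : ℝ) • Finsupp.single 1 1 from rfl,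
          map_sub, map_sub, map_smul, map_smul]
        have e : affTime 0 1 θ = θ := by ext; simp [coe_affTime]
        rw [e]
        rcases h with ⟨ha, hb, hc, hd⟩ | ⟨rfl, rfl⟩
        · have : s = 0 := le_antisymm ha unitInterval.nonneg'
          subst this
          rw [minForm_resWeight_single u θ (Or.inr ⟨hc, hd⟩),
            minForm_resWeight_single u 0 (Or.inl ⟨le_rfl, unitInterval.nonneg'⟩),
            minForm_resWeight_single u 1 (Or.inr ⟨unitInterval.le_one', unitInterval.le_one'⟩)]
          simp
        · rw [minForm_resWeight_single u t (Or.inl ⟨unitInterval.le_one', le_rfl⟩),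
            minForm_resWeight_single u 0 (Or.inl ⟨unitInterval.nonneg', unitInterval.nonneg'⟩),
            minForm_resWeight_single u 1 (Or.inr ⟨unitInterval.le_one', unitInterval.le_one'⟩)]
          simp
      rintro _ (u | u)
      · simp only [Sum.elim_inl, map_smul]
        rw [key 0 θ u (Or.inl ⟨le_rfl, unitInterval.le_one', h0.le, le_rfl⟩), smul_zero]
      · simp only [Sum.elim_inr, map_smul]
        rw [key 1 θ u (Or.inr ⟨rfl, rfl⟩), smul_zero])
    (comap_point_le _ () fun η ↦ bridgePart_eq_pathLin θ η)
    (comap_prodMk_le (comap_path_le _ Sum.inl fun η u ↦ bridgePart_seg_eq_pathLin h0.ne u η)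
      (comap_path_le _ Sum.inr fun η u ↦ bridgePart_seg_eq_pathLin h1.ne' u η))
  rw [indepFun_iff_map_prod_eq_prod_map_map m1.aemeasurable m2.aemeasurable,
    hW.map_bridgePart_seg h0.ne, hW.map_bridgePart_seg h1.ne'] at hA
  rw [indepFun_iff_map_prod_eq_prod_map_map m0.aemeasurable (m1.prodMk m2).aemeasurable,
    hW.map_bridgePart_apply, hA] at hB
  exact hB

/-- Time reversal of the Brownian bridge. -/
theorem map_reverse_bridgeLaw (hW : IsCorrelatedBrownianLaw α W) :
    (bridgeLaw W).map (fun f ↦ f.comp ⟨affTime 1 0, continuous_affTime 1 0⟩) = bridgeLaw W := by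
  have hc : Continuous fun f : PlanarPath ↦ f.comp ⟨affTime 1 0, continuous_affTime 1 0⟩ :=
    ContinuousMap.continuous_precomp _
  rw [bridgeLaw, Measure.map_map hc.measurable continuous_bridgePart.measurable]
  conv_rhs => rw [← bridgeLaw, ← hW.map_bridgePart_seg (zero_ne_one.symm : (1 : unitInterval) ≠ 0)]
  congr 1
  ext1 η
  ext1 u
  have h := sqrt_smul_bridgePart_seg (zero_ne_one.symm : (1 : unitInterval) ≠ 0) u η
  simp only [Set.Icc.coe_zero, Set.Icc.coe_one, zero_sub, abs_neg, abs_one, Real.sqrt_one,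
    one_smul] at h
  rw [h]
  simp only [Function.comp_apply, ContinuousMap.comp_apply, ContinuousMap.coe_mk, bridgePart_apply]
  have : ((affTime 1 0 u : unitInterval) : ℝ) = 1 - u := by simp [coe_affTime]
  rw [this]
  module

theorem indepFun_outside (hW : IsCorrelatedBrownianLaw α W) {s t : unitInterval} (h : s < t) :
    IndepFun (outside s t) (fun η ↦ bridgePart (seg s t η)) W := by
  have hm := hW.indepFun_of_comap_le (Y := outside s t) (X := fun η ↦ bridgePart (seg s t η))
    (fun u ↦ (√|(t - s : ℝ)|)⁻¹ • resWeight s t u)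
    (fun r : {r : unitInterval // r ≤ s ∨ t ≤ r} ↦ Finsupp.single r.1 1)
    (fun u r ↦ by
      rw [map_smul, LinearMap.smul_apply, minForm_resWeight_single, smul_zero]
      rcases r.2 with hr | hr
      · exact Or.inl ⟨hr, hr.trans h.le⟩
      · exact Or.inr ⟨h.le.trans hr, hr⟩)
    (comap_path_le _ id fun η u ↦ bridgePart_seg_eq_pathLin h.ne u η)
    (comap_prodMk_le
      (comap_path_le _ (fun r : Set.Icc (0 : unitInterval) s ↦ ⟨r, Or.inl r.2.2⟩)
        fun η u ↦ pathLin_point u.1 η)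
      (comap_path_le _ (fun r : Set.Icc t (1 : unitInterval) ↦ ⟨r, Or.inr r.2.1⟩)
        fun η u ↦ pathLin_point u.1 η))
  exact hm.symm

theorem map_rotation (hW : IsCorrelatedBrownianLaw α W) (θ : ℝ) :
    (W.prod W).map (ContinuousLinearMap.rotation θ) = W.prod W := by
  have := hW.isProbabilityMeasure
  let r : unitInterval := ⟨1 / 2, by norm_num, by norm_num⟩
  have h0 : 0 < r := by rw [← Subtype.coe_lt_coe]; norm_num [r]
  have h1 : r < 1 := by rw [← Subtype.coe_lt_coe]; norm_num [r]
  let a u := Real.cos θ • segWeight 0 r u + Real.sin θ • segWeight r 1 u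
  let b u := -Real.sin θ • segWeight 0 r u + Real.cos θ • segWeight r 1 u
  let A : PlanarPath → PlanarPath := fun η ↦ Real.cos θ • seg 0 r η + Real.sin θ • seg r 1 η
  let B : PlanarPath → PlanarPath := fun η ↦ -Real.sin θ • seg 0 r η + Real.cos θ • seg r 1 η
  have symm (u v) : minForm (segWeight r 1 u) (segWeight 0 r v) = 0 := by
    have hu0 := unitInterval.nonneg u
    have hu1 := unitInterval.le_one u
    have hv0 := unitInterval.nonneg v
    have hv1 := unitInterval.le_one v
    have hr0 := unitInterval.nonneg r
    have hr1 := unitInterval.le_one r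
    rw [← minForm_segWeight_segWeight r v u]
    simp only [segWeight, map_sub, map_smul, LinearMap.sub_apply, LinearMap.smul_apply,
      minForm_single, smul_eq_mul, one_mul, min_comm]
    ring
  have hA η u : A η u = pathLin (a u) η := by
    simp only [A, a, pathLin_add, pathLin_smul, ← seg_eq_pathLin, ContinuousMap.add_apply,
      ContinuousMap.smul_apply]
  have hB η u : B η u = pathLin (b u) η := by
    simp only [B, b, pathLin_add, pathLin_smul, ← seg_eq_pathLin, ContinuousMap.add_apply,
      ContinuousMap.smul_apply]
  have cs := Real.cos_sq_add_sin_sq θ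
  have hAW : W.map A = W := by
    have := hW.map_path_eq (Φ := A) (Ψ := id) a (fun u ↦ Finsupp.single u 1) hA
      (fun η u ↦ pathLin_point u η) fun u v ↦ by
        simp only [a, map_add, map_smul, LinearMap.add_apply, LinearMap.smul_apply,
          minForm_segWeight h0.ne, minForm_segWeight h1.ne, minForm_segWeight_segWeight, symm,
          minForm_single, smul_eq_mul]
        linear_combination (min (u : ℝ) v) * cs
    rwa [Measure.map_id] at this
  have hBW : W.map B = W := by
    have := hW.map_path_eq (Φ := B) (Ψ := id) b (fun u ↦ Finsupp.single u 1) hB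
      (fun η u ↦ pathLin_point u η) fun u v ↦ by
        simp only [b, map_add, map_smul, LinearMap.add_apply, LinearMap.smul_apply,
          minForm_segWeight h0.ne, minForm_segWeight h1.ne, minForm_segWeight_segWeight, symm,
          minForm_single, smul_eq_mul]
        linear_combination (min (u : ℝ) v) * cs
    rwa [Measure.map_id] at this
  have hI := hW.indepFun_of_comap_le (X := A) (Y := B) a b
    (fun u v ↦ by
      simp only [a, b, map_add, map_smul, LinearMap.add_apply, LinearMap.smul_apply,
        minForm_segWeight h0.ne, minForm_segWeight h1.ne, minForm_segWeight_segWeight, symm,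
        smul_eq_mul]
      ring)
    (comap_path_le _ id hA) (comap_path_le _ id hB)
  rw [indepFun_iff_map_prod_eq_prod_map_map (measurable_of_pathLin hA).aemeasurable
    (measurable_of_pathLin hB).aemeasurable, hAW, hBW] at hI
  conv_lhs => rw [← hW.map_seg_seg h0 h1]
  rw [Measure.map_map (ContinuousLinearMap.continuous _).measurable
    ((measurable_seg _ _).prodMk (measurable_seg _ _))]
  exact hI

theorem exists_integrable_exp_sq (hW : IsCorrelatedBrownianLaw α W) :
    ∃ C, 0 < C ∧ Integrable (fun η : PlanarPath ↦ Real.exp (C * ‖η‖ ^ 2)) W := by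
  have := hW.isProbabilityMeasure
  exact exists_integrable_exp_sq_of_map_rotation_eq_self (hW.map_rotation _)

theorem integrable_exp_norm (hW : IsCorrelatedBrownianLaw α W) (l : ℝ) :
    Integrable (fun η : PlanarPath ↦ Real.exp (l * ‖η‖)) W := by
  have := hW.isProbabilityMeasure
  obtain ⟨C, hC, h⟩ := hW.exists_integrable_exp_sq
  refine (h.const_mul (Real.exp (l ^ 2 / (4 * C)))).mono'
    (by fun_prop) (Filter.Eventually.of_forall fun η ↦ ?_)
  rw [Real.norm_eq_abs, abs_of_pos (Real.exp_pos _), ← Real.exp_add]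
  apply Real.exp_le_exp.2
  have : l ^ 2 / (4 * C) + C * ‖η‖ ^ 2 - l * ‖η‖ = C * (‖η‖ - l / (2 * C)) ^ 2 := by
    field_simp
    ring
  have h2 : 0 ≤ C * (‖η‖ - l / (2 * C)) ^ 2 := by positivity
  linarith

end IsCorrelatedBrownianLaw

/-! ### The density of the end value -/

/-- The quadratic form of the density of the end value. -/
noncomputable def gaussForm (α : ℝ) (x : ℝ × ℝ) : ℝ :=
  x.1 ^ 2 + (x.2 - α * x.1) ^ 2 / (1 - α ^ 2)

/-- The density of the end value. -/
noncomputable def gaussDensity (α : ℝ) (x : ℝ × ℝ) : ℝ :=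
  ((√(2 * Real.pi))⁻¹ * (√(2 * Real.pi * (1 - α ^ 2)))⁻¹) * Real.exp (-gaussForm α x / 2)

theorem one_sub_sq_pos {α : ℝ} (hα : α ∈ Set.Ioo (-1 : ℝ) 1) : 0 < 1 - α ^ 2 := by
  have := hα.1
  have := hα.2
  nlinarith

theorem gaussDensity_pos {α : ℝ} (hα : α ∈ Set.Ioo (-1 : ℝ) 1) (x : ℝ × ℝ) :
    0 < gaussDensity α x := by
  have := one_sub_sq_pos hα
  unfold gaussDensity
  positivity

theorem continuous_gaussDensity (α : ℝ) : Continuous (gaussDensity α) := by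
  unfold gaussDensity gaussForm
  fun_prop

theorem gaussDensity_midpoint (α : ℝ) (x z w : ℝ × ℝ) :
    gaussDensity α (x - z) * gaussDensity α (x - w) =
      ((√(2 * Real.pi))⁻¹ * (√(2 * Real.pi * (1 - α ^ 2)))⁻¹) *
        Real.exp (-gaussForm α (w - z) / 4) *
        gaussDensity α (√2 • (x - (1 / 2 : ℝ) • (z + w))) := by
  have h2 : √2 ^ 2 = (2 : ℝ) := Real.sq_sqrt (by norm_num)
  have key : gaussForm α (x - z) + gaussForm α (x - w) =
      gaussForm α (w - z) / 2 + gaussForm α (√2 • (x - (1 / 2 : ℝ) • (z + w))) := by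
    unfold gaussForm
    simp only [Prod.fst_sub, Prod.snd_sub, Prod.smul_fst, Prod.smul_snd, Prod.fst_add,
      Prod.snd_add, smul_eq_mul]
    have e1 (a : ℝ) : (√2 * a) ^ 2 = 2 * a ^ 2 := by rw [mul_pow, h2]
    have e2 (a b : ℝ) : (√2 * a - α * (√2 * b)) ^ 2 = 2 * (a - α * b) ^ 2 := by
      linear_combination (a - α * b) ^ 2 * h2
    rw [e1, e2]
    ring
  unfold gaussDensity
  have : Real.exp (-gaussForm α (x - z) / 2) * Real.exp (-gaussForm α (x - w) / 2) =
      Real.exp (-gaussForm α (w - z) / 4) *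
        Real.exp (-gaussForm α (√2 • (x - (1 / 2 : ℝ) • (z + w))) / 2) := by
    rw [← Real.exp_add, ← Real.exp_add]
    congr 1
    linarith
  linear_combination ((√(2 * Real.pi))⁻¹ * (√(2 * Real.pi * (1 - α ^ 2)))⁻¹) ^ 2 * this

theorem exists_gaussDensity_shift {α : ℝ} (hα : α ∈ Set.Ioo (-1 : ℝ) 1) :
    ∃ K, 0 < K ∧ ∀ x v, Real.exp (-(K * ‖v‖ * (‖x‖ + ‖v‖))) * gaussDensity α x ≤
      gaussDensity α (x + v) := by
  have h1 := one_sub_sq_pos hα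
  have hα1 := hα.1
  have hα2 := hα.2
  refine ⟨1 + 4 / (1 - α ^ 2), by positivity, fun x v ↦ ?_⟩
  unfold gaussDensity
  rw [mul_left_comm, ← Real.exp_add]
  refine mul_le_mul_of_nonneg_left (Real.exp_le_exp.2 ?_) (by positivity)
  have ax1 : |x.1| ≤ ‖x‖ := norm_fst_le x
  have ax2 : |x.2| ≤ ‖x‖ := norm_snd_le x
  have av1 : |v.1| ≤ ‖v‖ := norm_fst_le v
  have av2 : |v.2| ≤ ‖v‖ := norm_snd_le v
  have aα : |α| ≤ 1 := abs_le.2 ⟨hα1.le, hα2.le⟩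
  have bx : |x.2 - α * x.1| ≤ 2 * ‖x‖ := by
    refine (abs_sub _ _).trans ?_
    rw [abs_mul]
    nlinarith [abs_nonneg x.1, abs_nonneg α]
  have bv : |v.2 - α * v.1| ≤ 2 * ‖v‖ := by
    refine (abs_sub _ _).trans ?_
    rw [abs_mul]
    nlinarith [abs_nonneg v.1, abs_nonneg α]
  have c1 : x.1 * v.1 ≤ ‖x‖ * ‖v‖ := (le_abs_self _).trans (by rw [abs_mul]; gcongr)
  have c2 : v.1 ^ 2 ≤ ‖v‖ ^ 2 := by rw [← sq_abs v.1]; gcongr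
  have c3 : (x.2 - α * x.1) * (v.2 - α * v.1) ≤ 4 * (‖x‖ * ‖v‖) :=
    (le_abs_self _).trans (by
      rw [abs_mul]
      calc _ ≤ (2 * ‖x‖) * (2 * ‖v‖) := by gcongr
        _ = _ := by ring)
  have c4 : (v.2 - α * v.1) ^ 2 ≤ 4 * ‖v‖ ^ 2 := by
    rw [← sq_abs]
    calc _ ≤ (2 * ‖v‖) ^ 2 := by gcongr
      _ = _ := by ring
  have d3 : (x.2 - α * x.1) * (v.2 - α * v.1) / (1 - α ^ 2) ≤ 4 * (‖x‖ * ‖v‖) / (1 - α ^ 2) := by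
    gcongr
  have d4 : (v.2 - α * v.1) ^ 2 / (1 - α ^ 2) ≤ 4 * ‖v‖ ^ 2 / (1 - α ^ 2) := by gcongr
  have e : gaussForm α (x + v) = gaussForm α x + 2 * (x.1 * v.1) + v.1 ^ 2 +
      2 * ((x.2 - α * x.1) * (v.2 - α * v.1) / (1 - α ^ 2)) +
      (v.2 - α * v.1) ^ 2 / (1 - α ^ 2) := by
    unfold gaussForm
    simp only [Prod.fst_add, Prod.snd_add]
    ring
  have n1 := sq_nonneg ‖v‖
  have n2 : 0 ≤ 4 * ‖v‖ ^ 2 / (1 - α ^ 2) := by positivity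
  have e2 : (1 + 4 / (1 - α ^ 2)) * ‖v‖ * (‖x‖ + ‖v‖) = ‖x‖ * ‖v‖ + ‖v‖ ^ 2 +
      4 * (‖x‖ * ‖v‖) / (1 - α ^ 2) + 4 * ‖v‖ ^ 2 / (1 - α ^ 2) := by ring
  rw [e, e2]
  linarith

namespace IsCorrelatedBrownianLaw

variable {α : ℝ} {W : Measure PlanarPath}

theorem endLaw_eq_withDensity (hW : IsCorrelatedBrownianLaw α W) (hα : α ∈ Set.Ioo (-1 : ℝ) 1) :
    endLaw W = volume.withDensity fun x ↦ ENNReal.ofReal (gaussDensity α x) := by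
  have := hW.isProbabilityMeasure
  have h1 := one_sub_sq_pos hα
  let v : NNReal := ⟨1 - α ^ 2, h1.le⟩
  have hv : v ≠ 0 := fun h ↦ h1.ne' (congrArg NNReal.toReal h)
  let A : PlanarPath → ℝ := fun η ↦ (η 1).1
  let D : PlanarPath → ℝ := fun η ↦ (η 1).2 - α * (η 1).1
  let LA : StrongDual ℝ (ℝ × ℝ) := ContinuousLinearMap.fst ℝ ℝ ℝ
  let LD : StrongDual ℝ (ℝ × ℝ) :=
    ContinuousLinearMap.snd ℝ ℝ ℝ - α • ContinuousLinearMap.fst ℝ ℝ ℝ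
  have eA η : A η = LA (pathLin (Finsupp.single 1 1) η) := by simp [A, LA, pathLin_single]
  have eD η : D η = LD (pathLin (Finsupp.single 1 1) η) := by simp [D, LD, pathLin_single]
  have hG : HasGaussianLaw (fun η : PlanarPath ↦ η 1) W := hW.gaussian.hasGaussianLaw_eval 1
  have gAD : HasGaussianLaw (fun η ↦ (A η, D η)) W := by
    have := hG.map_fun (LA.prod LD)
    exact this
  have gA : HasGaussianLaw A W := gAD.fst
  have gD : HasGaussianLaw D W := gAD.snd
  have cAD : cov[A, D; W] = 0 := by
    rw [funext eA, funext eD, hW.covariance_dual, minForm_single]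
    simp [LA, LD]
  have vA : Var[A; W] = 1 := by
    rw [← covariance_self gA.aemeasurable, funext eA, hW.covariance_dual, minForm_single]
    simp [LA]
  have vD : Var[D; W] = 1 - α ^ 2 := by
    rw [← covariance_self gD.aemeasurable, funext eD, hW.covariance_dual, minForm_single]
    simp [LD]
    ring
  have mA : ∫ η, A η ∂W = 0 := by simp_rw [eA]; exact hW.integral_dual _ _
  have mD : ∫ η, D η ∂W = 0 := by simp_rw [eD]; exact hW.integral_dual _ _
  have lA : W.map A = gaussianReal 0 1 := by
    rw [gA.map_eq_gaussianReal, mA, vA, Real.toNNReal_one]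
  have lD : W.map D = gaussianReal 0 v := by
    rw [gD.map_eq_gaussianReal, mD, vD]
    congr 1
    exact Real.toNNReal_of_nonneg h1.le
  have hind := gAD.indepFun_of_covariance_eq_zero cAD
  rw [indepFun_iff_map_prod_eq_prod_map_map gA.aemeasurable gD.aemeasurable, lA, lD] at hind
  have hshear : endLaw W = ((gaussianReal 0 1).prod (gaussianReal 0 v)).map
      fun p : ℝ × ℝ ↦ (p.1, α * p.1 + p.2) := by
    rw [← hind, AEMeasurable.map_map_of_aemeasurable (by fun_prop) gAD.aemeasurable, endLaw]
    congr 1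
    ext1 η
    ext <;> simp [A, D]
  have dens (p : ℝ × ℝ) : gaussianPDF 0 1 p.1 * gaussianPDF 0 v (p.2 - α * p.1) =
      ENNReal.ofReal (gaussDensity α p) := by
    unfold gaussianPDF
    rw [← ENNReal.ofReal_mul (gaussianPDFReal_nonneg _ _ _)]
    congr 1
    unfold gaussianPDFReal gaussDensity gaussForm
    have : (v : ℝ) = 1 - α ^ 2 := rfl
    rw [this, mul_mul_mul_comm, ← Real.exp_add]
    simp only [NNReal.coe_one, mul_one, sub_zero]
    congr 2
    field_simp
    ring
  ext B hB
  set F : ℝ × ℝ → ENNReal := B.indicator 1 with hF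
  have mF : Measurable F := measurable_one.indicator hB
  have mp : Measurable fun p : ℝ × ℝ ↦ (p.1, α * p.1 + p.2) := by fun_prop
  have m1 : Measurable (gaussianPDF 0 1) := measurable_gaussianPDF _ _
  have m2 : Measurable (gaussianPDF 0 v) := measurable_gaussianPDF _ _
  calc endLaw W B = ∫⁻ p, F p ∂(endLaw W) := (lintegral_indicator_one hB).symm
    _ = ∫⁻ a, ∫⁻ d, F (a, α * a + d) ∂(gaussianReal 0 v) ∂(gaussianReal 0 1) := by
      rw [hshear, lintegral_map mF mp]
      exact lintegral_prod _ (mF.comp mp).aemeasurable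
    _ = ∫⁻ a, gaussianPDF 0 1 a * ∫⁻ d, gaussianPDF 0 v d * F (a, α * a + d) := by
      rw [gaussianReal_of_var_ne_zero 0 one_ne_zero, gaussianReal_of_var_ne_zero 0 hv]
      rw [lintegral_withDensity_eq_lintegral_mul _ m1]
      · refine lintegral_congr fun a ↦ ?_
        rw [Pi.mul_apply, lintegral_withDensity_eq_lintegral_mul _ m2]
        · rfl
        · exact mF.comp (mp.comp measurable_prodMk_left)
      · exact (mF.comp mp).lintegral_prod_right'
    _ = ∫⁻ a, ∫⁻ x, gaussianPDF 0 1 a * (gaussianPDF 0 v (x - α * a) * F (a, x)) := by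
      refine lintegral_congr fun a ↦ ?_
      rw [lintegral_const_mul _ (by fun_prop)]
      congr 1
      rw [← lintegral_sub_right_eq_self _ (α * a)]
      refine lintegral_congr fun x ↦ ?_
      rw [add_sub_cancel]
    _ = ∫⁻ p : ℝ × ℝ, ENNReal.ofReal (gaussDensity α p) * F p := by
      rw [Measure.volume_eq_prod, lintegral_prod]
      · refine lintegral_congr fun a ↦ lintegral_congr fun x ↦ ?_
        rw [← dens (a, x), mul_assoc]
      · exact ((continuous_gaussDensity α).measurable.ennreal_ofReal.mul mF).aemeasurable
    _ = _ := by
      rw [withDensity_apply _ hB, ← lintegral_indicator hB]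
      refine lintegral_congr fun p ↦ ?_
      by_cases hp : p ∈ B <;> simp [hF, hp]

theorem lintegral_endLaw (hW : IsCorrelatedBrownianLaw α W) (hα : α ∈ Set.Ioo (-1 : ℝ) 1)
    {F : ℝ × ℝ → ENNReal} (hF : Measurable F) :
    ∫⁻ x, F x ∂(endLaw W) = ∫⁻ x, ENNReal.ofReal (gaussDensity α x) * F x := by
  rw [hW.endLaw_eq_withDensity hα,
    lintegral_withDensity_eq_lintegral_mul _ (continuous_gaussDensity α).measurable.ennreal_ofReal hF]
  rfl

/-- The law of `c • x + m` for `x` with the law of the end value. -/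
theorem lintegral_endLaw_affine (hW : IsCorrelatedBrownianLaw α W)
    (hα : α ∈ Set.Ioo (-1 : ℝ) 1) {F : ℝ × ℝ → ENNReal} (hF : Measurable F) {c : ℝ} (hc : 0 < c)
    (m : ℝ × ℝ) :
    ∫⁻ x, F (m + c • x) ∂(endLaw W) =
      ∫⁻ y, ENNReal.ofReal (gaussDensity α (c⁻¹ • (y - m))) * F y * ENNReal.ofReal (c⁻¹ ^ 2) := by
  have hm : Measurable fun x : ℝ × ℝ ↦ m + c • x := by fun_prop
  have hG : Measurable fun y : ℝ × ℝ ↦ ENNReal.ofReal (gaussDensity α (c⁻¹ • (y - m))) * F y :=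
    ((continuous_gaussDensity α).measurable.comp (by fun_prop)).ennreal_ofReal.mul hF
  have hF' : Measurable fun x ↦ F (m + c • x) := hF.comp hm
  let H : ℝ × ℝ → ENNReal := fun y ↦ ENNReal.ofReal (gaussDensity α (c⁻¹ • y)) * F (m + y)
  have hH : Measurable H :=
    ((continuous_gaussDensity α).measurable.comp (by fun_prop)).ennreal_ofReal.mul
      (hF.comp (by fun_prop))
  have h := Measure.map_addHaar_smul (volume : Measure (ℝ × ℝ)) hc.ne'
  have h2 : Module.finrank ℝ (ℝ × ℝ) = 2 := by simp
  rw [hW.lintegral_endLaw hα hF', lintegral_mul_const _ hG]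
  calc _ = ∫⁻ x, H (c • x) := by simp only [H, inv_smul_smul₀ hc.ne']
    _ = ∫⁻ y, H y ∂(Measure.map (c • ·) volume) :=
      (lintegral_map hH (measurable_const_smul c)).symm
    _ = ENNReal.ofReal (c⁻¹ ^ 2) * ∫⁻ y, H y := by
      rw [h, lintegral_smul_measure, h2, abs_of_pos (by positivity), inv_pow]
      rfl
    _ = ENNReal.ofReal (c⁻¹ ^ 2) * ∫⁻ y, H (y - m) := by
      rw [lintegral_sub_right_eq_self H m]
    _ = _ := by
      rw [mul_comm]
      simp only [H, add_sub_cancel]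

end IsCorrelatedBrownianLaw

/-! ### Straight lines, decomposition of Brownian motion, and shifts -/

/-- The straight line from `z` to `w`. -/
def linePath (z w : ℝ × ℝ) : PlanarPath where
  toFun u := z + (u : ℝ) • (w - z)
  continuous_toFun := by fun_prop

theorem linePath_apply (z w : ℝ × ℝ) (u : unitInterval) :
    linePath z w u = z + (u : ℝ) • (w - z) := rfl

theorem continuous_linePath : Continuous fun p : (ℝ × ℝ) × (ℝ × ℝ) ↦ linePath p.1 p.2 := by
  apply ContinuousMap.continuous_of_continuous_uncurry
  have : Continuous fun p : ((ℝ × ℝ) × (ℝ × ℝ)) × unitInterval ↦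
    p.1.1 + (p.2 : ℝ) • (p.1.2 - p.1.1) := by fun_prop
  exact this

theorem linePath_add (z w z' w' : ℝ × ℝ) :
    linePath (z + z') (w + w') = linePath z w + linePath z' w' := by
  ext1 u
  rw [ContinuousMap.add_apply, linePath_apply, linePath_apply, linePath_apply]
  module

namespace IsCorrelatedBrownianLaw

variable {α : ℝ} {W : Measure PlanarPath}

theorem lintegral_eq_endLaw_bridgeLaw (hW : IsCorrelatedBrownianLaw α W)
    {G : PlanarPath → ENNReal} (hG : Measurable G) :
    ∫⁻ η, G η ∂W = ∫⁻ x, ∫⁻ f, G (linePath 0 x + f) ∂(bridgeLaw W) ∂(endLaw W) := by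
  have := hW.isProbabilityMeasure
  have hc : Measurable fun p : (ℝ × ℝ) × PlanarPath ↦ linePath 0 p.1 + p.2 :=
    ((continuous_linePath.comp (continuous_const.prodMk continuous_fst)).add
      continuous_snd).measurable
  have e := lintegral_prod (μ := endLaw W) (ν := bridgeLaw W) _ (hG.comp hc).aemeasurable
  refine Eq.trans ?_ e
  rw [← hW.map_end_bridgePart, lintegral_map (hG.comp hc)
      ((continuous_eval_const _).measurable.prodMk continuous_bridgePart.measurable)]
  refine lintegral_congr_ae ?_
  filter_upwards [hW.ae_zero] with η h0
  refine congrArg G ?_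
  ext1 u
  simp only [ContinuousMap.add_apply, linePath_apply, bridgePart_apply, h0]
  module

theorem lintegral_shift_le (hW : IsCorrelatedBrownianLaw α W) (hα : α ∈ Set.Ioo (-1 : ℝ) 1)
    {K : ℝ} (hK : ∀ x v, Real.exp (-(K * ‖v‖ * (‖x‖ + ‖v‖))) * gaussDensity α x ≤
      gaussDensity α (x + v)) (hK0 : 0 ≤ K) (v : ℝ × ℝ)
    {G : PlanarPath → ENNReal} (hG : Measurable G) :
    ∫⁻ η, ENNReal.ofReal (Real.exp (-(K * ‖v‖ * (‖η‖ + ‖v‖)))) * G (linePath 0 v + η) ∂W ≤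
      ∫⁻ η, G η ∂W := by
  have := hW.isProbabilityMeasure
  have hc : Measurable fun p : (ℝ × ℝ) × PlanarPath ↦ linePath 0 p.1 + p.2 :=
    ((continuous_linePath.comp (continuous_const.prodMk continuous_fst)).add
      continuous_snd).measurable
  have hH : Measurable fun x ↦ ∫⁻ f, G (linePath 0 x + f) ∂(bridgeLaw W) :=
    (hG.comp hc).lintegral_prod_right'
  calc ∫⁻ η, ENNReal.ofReal (Real.exp (-(K * ‖v‖ * (‖η‖ + ‖v‖)))) * G (linePath 0 v + η) ∂W
      ≤ ∫⁻ η, ENNReal.ofReal (Real.exp (-(K * ‖v‖ * (‖η 1‖ + ‖v‖)))) * G (linePath 0 v + η) ∂W := by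
        refine lintegral_mono fun η ↦ ?_
        gcongr
        exact η.norm_coe_le_norm 1
    _ = ∫⁻ x, ∫⁻ f, ENNReal.ofReal (Real.exp (-(K * ‖v‖ * (‖(linePath 0 x + f) 1‖ + ‖v‖)))) *
          G (linePath 0 v + (linePath 0 x + f)) ∂(bridgeLaw W) ∂(endLaw W) := by
        rw [hW.lintegral_eq_endLaw_bridgeLaw]
        have h1 : Continuous fun η : PlanarPath ↦ Real.exp (-(K * ‖v‖ * (‖η 1‖ + ‖v‖))) := by
          fun_prop
        exact h1.measurable.ennreal_ofReal.mul (hG.comp (measurable_const_add _))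
    _ = ∫⁻ x, ENNReal.ofReal (Real.exp (-(K * ‖v‖ * (‖x‖ + ‖v‖)))) *
          ∫⁻ f, G (linePath 0 (x + v) + f) ∂(bridgeLaw W) ∂(endLaw W) := by
        refine lintegral_congr fun x ↦ ?_
        rw [← lintegral_const_mul _ (by fun_prop)]
        refine lintegral_congr_ae ?_
        have : ∀ᵐ f ∂(bridgeLaw W), f 1 = 0 := by
          have hm : MeasurableSet {f : PlanarPath | f 1 = 0} :=
            (continuous_eval_const (1 : unitInterval)).measurable (measurableSet_singleton 0)
          rw [bridgeLaw, ae_map_iff continuous_bridgePart.measurable.aemeasurable hm]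
          exact Filter.Eventually.of_forall fun η ↦ by simp [bridgePart_apply]
        filter_upwards [this] with f hf
        have e1 : (linePath 0 x + f) 1 = x := by simp [linePath_apply, hf]
        have e2 : linePath 0 v + (linePath 0 x + f) = linePath 0 (x + v) + f := by
          rw [← add_assoc, ← linePath_add, add_zero, add_comm v]
        rw [e1, e2]
    _ = ∫⁻ x, ENNReal.ofReal (Real.exp (-(K * ‖v‖ * (‖x‖ + ‖v‖))) * gaussDensity α x) *
          ∫⁻ f, G (linePath 0 (x + v) + f) ∂(bridgeLaw W) := by
        rw [hW.lintegral_endLaw hα]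
        · refine lintegral_congr fun x ↦ ?_
          rw [ENNReal.ofReal_mul (Real.exp_pos _).le]
          ring
        · exact Measurable.mul (by fun_prop) (hH.comp (measurable_id.add_const v))
    _ ≤ ∫⁻ x, ENNReal.ofReal (gaussDensity α (x + v)) *
          ∫⁻ f, G (linePath 0 (x + v) + f) ∂(bridgeLaw W) := by
        refine lintegral_mono fun x ↦ ?_
        gcongr
        exact hK x v
    _ = ∫⁻ x, ENNReal.ofReal (gaussDensity α x) *
          ∫⁻ f, G (linePath 0 x + f) ∂(bridgeLaw W) :=
        lintegral_add_right_eq_self (fun x ↦ ENNReal.ofReal (gaussDensity α x) *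
          ∫⁻ f, G (linePath 0 x + f) ∂(bridgeLaw W)) v
    _ = _ := by rw [hW.lintegral_eq_endLaw_bridgeLaw hG, hW.lintegral_endLaw hα hH]

end IsCorrelatedBrownianLaw

/-! ### Brownian motion killed outside the quadrant -/

/-- The paths that stay in the closed quadrant when started from `z`. -/
def stays (z : ℝ × ℝ) : Set PlanarPath := {η | ∀ u, 0 ≤ z + η u}

/-- The probability that Brownian motion started from `z` stays in the quadrant up to time `1`. -/
noncomputable def surv (W : Measure PlanarPath) (z : ℝ × ℝ) : ENNReal := W (stays z)

theorem measurableSet_stays (z : ℝ × ℝ) : MeasurableSet (stays z) := by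
  apply IsClosed.measurableSet
  have : stays z = ⋂ u, {η : PlanarPath | 0 ≤ z + η u} := by ext; simp [stays]
  rw [this]
  exact isClosed_iInter fun u ↦ isClosed_le continuous_const (by fun_prop)

theorem stays_mono {z w : ℝ × ℝ} (h : z ≤ w) : stays z ⊆ stays w :=
  fun _ hη u ↦ (hη u).trans (by gcongr)

theorem surv_mono (W : Measure PlanarPath) : Monotone (surv W) :=
  fun _ _ h ↦ measure_mono (stays_mono h)

theorem measurable_surv (W : Measure PlanarPath) [IsProbabilityMeasure W] :
    Measurable (surv W) := by
  have hc : IsClosed {p : (ℝ × ℝ) × PlanarPath | ∀ u, 0 ≤ p.1 + p.2 u} := by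
    have : {p : (ℝ × ℝ) × PlanarPath | ∀ u, 0 ≤ p.1 + p.2 u} =
        ⋂ u, {p : (ℝ × ℝ) × PlanarPath | 0 ≤ p.1 + p.2 u} := by ext; simp
    rw [this]
    exact isClosed_iInter fun u ↦ isClosed_le continuous_const (by fun_prop)
  exact measurable_measure_prodMk_left hc.measurableSet

theorem neg_norm_le (x : ℝ × ℝ) : -(‖x‖ • ((1 : ℝ), (1 : ℝ))) ≤ x := by
  have h1 := (abs_le.1 (norm_fst_le x)).1
  have h2 := (abs_le.1 (norm_snd_le x)).1
  constructor <;> simp <;> assumption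

theorem le_norm_smul (x : ℝ × ℝ) : x ≤ ‖x‖ • ((1 : ℝ), (1 : ℝ)) := by
  have h1 := (abs_le.1 (norm_fst_le x)).2
  have h2 := (abs_le.1 (norm_snd_le x)).2
  constructor <;> simp <;> assumption

theorem le_smul_of_one_le {c : ℝ} (hc : 1 ≤ c) {x : ℝ × ℝ} (hx : 0 ≤ x) : x ≤ c • x := by
  have h1 : 0 ≤ x.1 := hx.1
  have h2 : 0 ≤ x.2 := hx.2
  constructor <;> simp <;> nlinarith

theorem quadrant_smul_iff {c : ℝ} (hc : 0 < c) (x : ℝ × ℝ) : 0 ≤ c • x ↔ 0 ≤ x := by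
  simp only [Prod.le_def, Prod.smul_fst, Prod.smul_snd, Prod.fst_zero, Prod.snd_zero, smul_eq_mul,
    mul_nonneg_iff_of_pos_left hc]

theorem exists_affTime_eq {s t r : unitInterval} (hs : s ≤ r) (ht : r ≤ t) :
    ∃ u, affTime s t u = r := by
  rcases eq_or_lt_of_le (hs.trans ht) with h | h
  · subst h
    exact ⟨0, by rw [affTime_zero]; exact le_antisymm hs ht⟩
  · have h' : (0 : ℝ) < t - s := sub_pos.2 h
    have hs' : (s : ℝ) ≤ r := hs
    have ht' : (r : ℝ) ≤ t := ht
    refine ⟨⟨(r - s) / (t - s), div_nonneg (by linarith) h'.le,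
      (div_le_one h').2 (by linarith)⟩, ?_⟩
    ext
    rw [coe_affTime]
    field_simp
    ring

/-- Splitting of a path at time `r`. -/
theorem seg_split {r : unitInterval} (h0 : 0 < r) (h1 : r < 1) {η : PlanarPath} (hη : η 0 = 0)
    (u : unitInterval) : η (affTime 0 r u) = √(r : ℝ) • seg 0 r η u ∧
      η (affTime r 1 u) = √(r : ℝ) • seg 0 r η 1 + √(1 - r : ℝ) • seg r 1 η u := by
  have e0 : |((r : ℝ) - (0 : unitInterval))| = r := by simp [abs_of_nonneg (unitInterval.nonneg r)]
  have e1 : |(((1 : unitInterval) : ℝ) - r)| = 1 - r := by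
    simp [abs_of_nonneg (sub_nonneg.2 (unitInterval.le_one r))]
  have a := sqrt_smul_seg h0.ne u η
  have b := sqrt_smul_seg h0.ne 1 η
  have c := sqrt_smul_seg h1.ne u η
  rw [e0, hη, sub_zero] at a b
  rw [e1] at c
  rw [a, b, c, affTime_one]
  exact ⟨rfl, by abel⟩

theorem mem_stays_iff_seg {r : unitInterval} (h0 : 0 < r) (h1 : r < 1) {η : PlanarPath}
    (hη : η 0 = 0) (z : ℝ × ℝ) :
    η ∈ stays z ↔ seg 0 r η ∈ stays ((√(r : ℝ))⁻¹ • z) ∧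
      seg r 1 η ∈ stays ((√(1 - r : ℝ))⁻¹ • (z + √(r : ℝ) • seg 0 r η 1)) := by
  have hr0 : 0 < √(r : ℝ) := Real.sqrt_pos.2 h0
  have hr1 : 0 < √(1 - r : ℝ) := Real.sqrt_pos.2 (sub_pos.2 h1)
  have k1 u : 0 ≤ (√(r : ℝ))⁻¹ • z + seg 0 r η u ↔ 0 ≤ z + η (affTime 0 r u) := by
    rw [(seg_split h0 h1 hη u).1, ← quadrant_smul_iff hr0 (_⁻¹ • z + _), smul_add,
      smul_inv_smul₀ hr0.ne']
  have k2 u : 0 ≤ (√(1 - r : ℝ))⁻¹ • (z + √(r : ℝ) • seg 0 r η 1) + seg r 1 η u ↔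
      0 ≤ z + η (affTime r 1 u) := by
    rw [(seg_split h0 h1 hη u).2, ← quadrant_smul_iff hr1 (_⁻¹ • _ + _), smul_add,
      smul_inv_smul₀ hr1.ne', add_assoc]
  constructor
  · exact fun h ↦ ⟨fun u ↦ (k1 u).2 (h _), fun u ↦ (k2 u).2 (h _)⟩
  · rintro ⟨a, b⟩ u
    rcases le_total u r with hu | hu
    · obtain ⟨v, rfl⟩ := exists_affTime_eq unitInterval.nonneg' hu
      exact (k1 v).1 (a v)
    · obtain ⟨v, rfl⟩ := exists_affTime_eq hu unitInterval.le_one'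
      exact (k2 v).1 (b v)

theorem surv_lower {W : Measure PlanarPath} {R : ℝ} (hR : 2⁻¹ ≤ W {η | ‖η‖ ≤ R}) :
    2⁻¹ ≤ surv W (R • ((1 : ℝ), (1 : ℝ))) := by
  refine hR.trans (measure_mono fun η hη u ↦ ?_)
  have h := (η.norm_coe_le_norm u).trans hη
  have h1 := neg_norm_le (η u)
  have : ‖η u‖ • ((1 : ℝ), (1 : ℝ)) ≤ R • ((1 : ℝ), (1 : ℝ)) := by
    exact ⟨by simpa using h, by simpa using h⟩
  calc (0 : ℝ × ℝ) = ‖η u‖ • ((1 : ℝ), (1 : ℝ)) + -(‖η u‖ • ((1 : ℝ), (1 : ℝ))) := by abel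
    _ ≤ _ := by gcongr

namespace IsCorrelatedBrownianLaw

variable {α : ℝ} {W : Measure PlanarPath}

theorem lintegral_seg_seg (hW : IsCorrelatedBrownianLaw α W) {r : unitInterval} (h0 : 0 < r)
    (h1 : r < 1) {H : PlanarPath → PlanarPath → ENNReal} (hH : Measurable (Function.uncurry H)) :
    ∫⁻ η, H (seg 0 r η) (seg r 1 η) ∂W = ∫⁻ η, ∫⁻ ζ, H η ζ ∂W ∂W := by
  have := hW.isProbabilityMeasure
  have e := lintegral_prod (μ := W) (ν := W) _ hH.aemeasurable
  refine Eq.trans ?_ e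
  rw [← hW.map_seg_seg h0 h1, lintegral_map hH ((measurable_seg _ _).prodMk (measurable_seg _ _))]
  rfl

/-- The Markov property at time `r` of the killed Brownian motion. -/
theorem setLIntegral_stays (hW : IsCorrelatedBrownianLaw α W) {r : unitInterval} (h0 : 0 < r)
    (h1 : r < 1) (z : ℝ × ℝ) {H : PlanarPath → ENNReal} (hH : Measurable H) :
    ∫⁻ η in stays z, H (seg 0 r η) ∂W = ∫⁻ η in stays ((√(r : ℝ))⁻¹ • z),
      H η * surv W ((√(1 - r : ℝ))⁻¹ • (z + √(r : ℝ) • η 1)) ∂W := by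
  have := hW.isProbabilityMeasure
  let A : Set (PlanarPath × PlanarPath) := {p | p.1 ∈ stays ((√(r : ℝ))⁻¹ • z) ∧
    p.2 ∈ stays ((√(1 - r : ℝ))⁻¹ • (z + √(r : ℝ) • p.1 1))}
  have hA : MeasurableSet A := by
    have hc : IsClosed {p : PlanarPath × PlanarPath | ∀ u,
        0 ≤ (√(1 - r : ℝ))⁻¹ • (z + √(r : ℝ) • p.1 1) + p.2 u} := by
      have : {p : PlanarPath × PlanarPath | ∀ u,
          0 ≤ (√(1 - r : ℝ))⁻¹ • (z + √(r : ℝ) • p.1 1) + p.2 u} = ⋂ u,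
          {p : PlanarPath × PlanarPath |
            0 ≤ (√(1 - r : ℝ))⁻¹ • (z + √(r : ℝ) • p.1 1) + p.2 u} := by
        ext; simp
      rw [this]
      exact isClosed_iInter fun u ↦ isClosed_le continuous_const (by fun_prop)
    exact (measurable_fst (measurableSet_stays _)).inter hc.measurableSet
  have key := hW.lintegral_seg_seg h0 h1 (H := fun η ζ ↦ A.indicator (fun p ↦ H p.1) (η, ζ))
    ((hH.comp measurable_fst).indicator hA)
  rw [← lintegral_indicator (measurableSet_stays _), ← lintegral_indicator (measurableSet_stays _)]
  refine (lintegral_congr_ae ?_).trans (key.trans (lintegral_congr fun η ↦ ?_))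
  · filter_upwards [hW.ae_zero] with η hη
    by_cases h : η ∈ stays z
    · rw [Set.indicator_of_mem h, Set.indicator_of_mem]
      exact (mem_stays_iff_seg h0 h1 hη z).1 h
    · rw [Set.indicator_of_notMem h, Set.indicator_of_notMem]
      exact fun h' ↦ h ((mem_stays_iff_seg h0 h1 hη z).2 h')
  · by_cases h : η ∈ stays ((√(r : ℝ))⁻¹ • z)
    · rw [Set.indicator_of_mem h]
      have : (fun ζ ↦ A.indicator (fun p ↦ H p.1) (η, ζ)) =
          (stays ((√(1 - r : ℝ))⁻¹ • (z + √(r : ℝ) • η 1))).indicator fun _ ↦ H η := by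
        ext1 ζ
        by_cases h' : ζ ∈ stays ((√(1 - r : ℝ))⁻¹ • (z + √(r : ℝ) • η 1))
        · rw [Set.indicator_of_mem h', Set.indicator_of_mem]
          exact ⟨h, h'⟩
        · rw [Set.indicator_of_notMem h', Set.indicator_of_notMem]
          exact fun h'' ↦ h' h''.2
      rw [this, lintegral_indicator_const (measurableSet_stays _)]
      rfl
    · rw [Set.indicator_of_notMem h]
      have : (fun ζ ↦ A.indicator (fun p ↦ H p.1) (η, ζ)) = 0 := by
        ext1 ζ
        exact Set.indicator_of_notMem (fun h' ↦ h h'.1) _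
      rw [this]
      exact lintegral_zero

theorem exists_norm_le (hW : IsCorrelatedBrownianLaw α W) :
    ∃ R : ℝ, 1 ≤ R ∧ 2⁻¹ ≤ W {η | ‖η‖ ≤ R} := by
  have := hW.isProbabilityMeasure
  have h : Filter.Tendsto (fun n : ℕ ↦ W {η | ‖η‖ ≤ (n : ℝ)}) Filter.atTop
      (𝓝 (W (⋃ n : ℕ, {η | ‖η‖ ≤ (n : ℝ)}))) :=
    tendsto_measure_iUnion_atTop fun m n hmn η (hη : ‖η‖ ≤ m) ↦
      hη.trans (by exact_mod_cast hmn)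
  have hU : (⋃ n : ℕ, {η : PlanarPath | ‖η‖ ≤ (n : ℝ)}) = Set.univ :=
    Set.eq_univ_of_forall fun η ↦ Set.mem_iUnion.2 (exists_nat_ge ‖η‖)
  rw [hU, measure_univ] at h
  have h2 := (h.eventually (lt_mem_nhds (show (2⁻¹ : ENNReal) < 1 by norm_num))).and
    (Filter.eventually_ge_atTop 1)
  obtain ⟨n, hn, hn1⟩ := h2.exists
  exact ⟨n, by exact_mod_cast hn1, hn.le⟩

end IsCorrelatedBrownianLaw

/-- The exponential moment of the norm on the event of survival. -/
noncomputable def survExp (W : Measure PlanarPath) (l : ℝ) (z : ℝ × ℝ) : ENNReal :=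
  ∫⁻ η in stays z, ENNReal.ofReal (Real.exp (l * ‖η‖)) ∂W

theorem measurable_expNorm (l : ℝ) :
    Measurable fun η : PlanarPath ↦ ENNReal.ofReal (Real.exp (l * ‖η‖)) := by
  have : Continuous fun η : PlanarPath ↦ Real.exp (l * ‖η‖) := by fun_prop
  exact this.measurable.ennreal_ofReal

theorem survExp_half {W : Measure PlanarPath} {l κ : ℝ} (hκ : 0 < κ) {z : ℝ × ℝ}
    (h : survExp W (2 * l) z ≤ ENNReal.ofReal (κ ^ 2) * surv W z) :
    survExp W l z ≤ ENNReal.ofReal κ * surv W z := by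
  have pt (x : ℝ) : Real.exp x ≤ (2 * κ)⁻¹ * Real.exp (2 * x) + κ / 2 := by
    have e : Real.exp (2 * x) = Real.exp x ^ 2 := by rw [← Real.exp_nat_mul]; norm_num
    rw [e]
    have : (2 * κ)⁻¹ * Real.exp x ^ 2 + κ / 2 - Real.exp x =
      (2 * κ)⁻¹ * (Real.exp x - κ) ^ 2 := by field_simp; ring
    have h2 : 0 ≤ (2 * κ)⁻¹ * (Real.exp x - κ) ^ 2 := by positivity
    linarith
  calc survExp W l z ≤ ∫⁻ η in stays z, (ENNReal.ofReal (2 * κ)⁻¹ *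
        ENNReal.ofReal (Real.exp (2 * l * ‖η‖)) + ENNReal.ofReal (κ / 2)) ∂W := by
        refine lintegral_mono fun η ↦ ?_
        rw [← ENNReal.ofReal_mul (by positivity), ← ENNReal.ofReal_add (by positivity)
          (by positivity), mul_assoc]
        exact ENNReal.ofReal_le_ofReal (pt _)
    _ = ENNReal.ofReal (2 * κ)⁻¹ * survExp W (2 * l) z + ENNReal.ofReal (κ / 2) * surv W z := by
        rw [lintegral_add_right _ measurable_const, lintegral_const_mul _ (measurable_expNorm _),
          setLIntegral_const]
        rfl
    _ ≤ ENNReal.ofReal (2 * κ)⁻¹ * (ENNReal.ofReal (κ ^ 2) * surv W z) +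
          ENNReal.ofReal (κ / 2) * surv W z := by gcongr
    _ = ENNReal.ofReal κ * surv W z := by
        rw [← mul_assoc, ← add_mul, ← ENNReal.ofReal_mul (by positivity),
          ← ENNReal.ofReal_add (by positivity) (by positivity)]
        congr 2
        field_simp
        norm_num

theorem survExp_neg {W : Measure PlanarPath} [IsProbabilityMeasure W] {l κ : ℝ} (hκ : 0 < κ)
    {z : ℝ × ℝ} (h : survExp W l z ≤ ENNReal.ofReal κ * surv W z) :
    ENNReal.ofReal κ⁻¹ * surv W z ≤ survExp W (-l) z := by
  have pt (x : ℝ) : 2 * κ⁻¹ ≤ Real.exp (-x) + (κ⁻¹) ^ 2 * Real.exp x := by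
    have e : Real.exp (-x) + (κ⁻¹) ^ 2 * Real.exp x - 2 * κ⁻¹ =
        Real.exp x * (Real.exp (-x) - κ⁻¹) ^ 2 := by
      rw [Real.exp_neg]; field_simp; ring
    have h2 : 0 ≤ Real.exp x * (Real.exp (-x) - κ⁻¹) ^ 2 := by positivity
    linarith
  have h1 : ENNReal.ofReal (2 * κ⁻¹) * surv W z ≤
      survExp W (-l) z + ENNReal.ofReal ((κ⁻¹) ^ 2) * survExp W l z := by
    calc _ = ∫⁻ η in stays z, ENNReal.ofReal (2 * κ⁻¹) ∂W := (setLIntegral_const _ _).symm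
      _ ≤ ∫⁻ η in stays z, (ENNReal.ofReal (Real.exp (-l * ‖η‖)) + ENNReal.ofReal ((κ⁻¹) ^ 2) *
            ENNReal.ofReal (Real.exp (l * ‖η‖))) ∂W := by
          refine lintegral_mono fun η ↦ ?_
          rw [← ENNReal.ofReal_mul (by positivity), ← ENNReal.ofReal_add (by positivity)
            (by positivity), neg_mul]
          exact ENNReal.ofReal_le_ofReal (pt _)
      _ = _ := by
          rw [lintegral_add_left (measurable_expNorm _),
            lintegral_const_mul _ (measurable_expNorm _)]
          rfl
  have h2 : ENNReal.ofReal ((κ⁻¹) ^ 2) * survExp W l z ≤ ENNReal.ofReal κ⁻¹ * surv W z := by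
    calc _ ≤ ENNReal.ofReal ((κ⁻¹) ^ 2) * (ENNReal.ofReal κ * surv W z) := by gcongr
      _ = _ := by
        rw [← mul_assoc, ← ENNReal.ofReal_mul (by positivity)]
        congr 2
        field_simp
  have h3 : ENNReal.ofReal (2 * κ⁻¹) * surv W z =
      ENNReal.ofReal κ⁻¹ * surv W z + ENNReal.ofReal κ⁻¹ * surv W z := by
    rw [two_mul, ENNReal.ofReal_add (by positivity) (by positivity), add_mul]
  have h4 := (h3 ▸ h1).trans (add_le_add_right h2 _)
  refine (ENNReal.add_le_add_iff_right ?_).1 h4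
  exact ENNReal.mul_ne_top ENNReal.ofReal_ne_top (measure_ne_top _ _)

namespace IsCorrelatedBrownianLaw

variable {α : ℝ} {W : Measure PlanarPath}

theorem norm_le_seg {r : unitInterval} (h0 : 0 < r) (h1 : r < 1) {η : PlanarPath} (hη : η 0 = 0) :
    ‖η‖ ≤ √(r : ℝ) * ‖seg 0 r η‖ + ‖seg r 1 η‖ := by
  have hr : √(1 - r : ℝ) ≤ 1 :=
    Real.sqrt_le_one.2 (by linarith [unitInterval.nonneg r])
  rw [ContinuousMap.norm_le _ (by positivity)]
  intro u
  rcases le_total u r with hu | hu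
  · obtain ⟨v, rfl⟩ := exists_affTime_eq unitInterval.nonneg' hu
    rw [(seg_split h0 h1 hη v).1, norm_smul, Real.norm_of_nonneg (Real.sqrt_nonneg _)]
    have := (seg 0 r η).norm_coe_le_norm v
    have := norm_nonneg (seg r 1 η)
    nlinarith [Real.sqrt_nonneg (r : ℝ)]
  · obtain ⟨v, rfl⟩ := exists_affTime_eq hu unitInterval.le_one'
    rw [(seg_split h0 h1 hη v).2]
    refine (norm_add_le _ _).trans ?_
    rw [norm_smul, norm_smul, Real.norm_of_nonneg (Real.sqrt_nonneg _),
      Real.norm_of_nonneg (Real.sqrt_nonneg _)]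
    have h2 := (seg 0 r η).norm_coe_le_norm 1
    have h3 := (seg r 1 η).norm_coe_le_norm v
    have := norm_nonneg ((seg r 1 η) v)
    gcongr
    nlinarith

/-- Survival probabilities and exponential moments at two scales that differ by a factor two. -/
theorem survExp_le_survExp_two_smul (hW : IsCorrelatedBrownianLaw α W) {l : ℝ} (hl : 0 ≤ l)
    (z : ℝ × ℝ) :
    survExp W (2 * l) z ≤
      (∫⁻ η, ENNReal.ofReal (Real.exp (2 * l * ‖η‖)) ∂W) * survExp W l ((2 : ℝ) • z) := by
  let r : unitInterval := ⟨1 / 4, by norm_num, by norm_num⟩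
  have h0 : 0 < r := by rw [← Subtype.coe_lt_coe]; norm_num [r]
  have h1 : r < 1 := by rw [← Subtype.coe_lt_coe]; norm_num [r]
  have hs : √(r : ℝ) = 1 / 2 := by
    rw [show (r : ℝ) = (1 / 2) ^ 2 by norm_num [r]]
    exact Real.sqrt_sq (by norm_num)
  have hz : (√(r : ℝ))⁻¹ • z = (2 : ℝ) • z := by rw [hs]; norm_num
  have hm := measurable_expNorm (2 * l)
  have hm1 := measurable_expNorm l
  calc survExp W (2 * l) z
      = ∫⁻ η, (stays z).indicator
          (fun η ↦ ENNReal.ofReal (Real.exp (2 * l * ‖η‖))) η ∂W :=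
        (lintegral_indicator (measurableSet_stays _) _).symm
    _ ≤ ∫⁻ η, (stays ((2 : ℝ) • z)).indicator
          (fun η ↦ ENNReal.ofReal (Real.exp (l * ‖η‖))) (seg 0 r η) *
          ENNReal.ofReal (Real.exp (2 * l * ‖seg r 1 η‖)) ∂W := by
        refine lintegral_mono_ae ?_
        filter_upwards [hW.ae_zero] with η hη
        by_cases h : η ∈ stays z
        · have h' := ((mem_stays_iff_seg h0 h1 hη z).1 h).1
          rw [hz] at h'
          rw [Set.indicator_of_mem h, Set.indicator_of_mem h',
            ← ENNReal.ofReal_mul (Real.exp_pos _).le, ← Real.exp_add]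
          refine ENNReal.ofReal_le_ofReal (Real.exp_le_exp.2 ?_)
          have := norm_le_seg h0 h1 hη
          rw [hs] at this
          nlinarith
        · rw [Set.indicator_of_notMem h]
          exact zero_le
    _ = ∫⁻ η, ∫⁻ ζ, (stays ((2 : ℝ) • z)).indicator
          (fun η ↦ ENNReal.ofReal (Real.exp (l * ‖η‖))) η *
          ENNReal.ofReal (Real.exp (2 * l * ‖ζ‖)) ∂W ∂W :=
        hW.lintegral_seg_seg h0 h1 (H := fun η ζ ↦ (stays ((2 : ℝ) • z)).indicator
          (fun η ↦ ENNReal.ofReal (Real.exp (l * ‖η‖))) η *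
          ENNReal.ofReal (Real.exp (2 * l * ‖ζ‖)))
          (((hm1.indicator (measurableSet_stays _)).comp measurable_fst).mul
            (hm.comp measurable_snd))
    _ = _ := by
        simp_rw [lintegral_const_mul _ hm]
        rw [lintegral_mul_const _ (hm1.indicator (measurableSet_stays _)), mul_comm,
          lintegral_indicator (measurableSet_stays _)]
        rfl

/-- Shifting a killed path into the quadrant. -/
theorem setLIntegral_stays_shift (hW : IsCorrelatedBrownianLaw α W)
    (hα : α ∈ Set.Ioo (-1 : ℝ) 1) {K : ℝ}
    (hK : ∀ x v, Real.exp (-(K * ‖v‖ * (‖x‖ + ‖v‖))) * gaussDensity α x ≤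
      gaussDensity α (x + v)) (hK0 : 0 ≤ K) (z : ℝ × ℝ) {v : ℝ × ℝ} (hv : 0 ≤ v)
    {h : ℝ × ℝ → ENNReal} (hh : Measurable h) :
    ∫⁻ η in stays z, ENNReal.ofReal (Real.exp (-(K * ‖v‖ * (‖η‖ + ‖v‖)))) * h (η 1 + v) ∂W ≤
      ∫⁻ η in stays z, h (η 1) ∂W := by
  have hm : Measurable fun η : PlanarPath ↦ h (η 1) :=
    hh.comp (continuous_eval_const _).measurable
  have := hW.lintegral_shift_le hα hK hK0 v (hm.indicator (measurableSet_stays z))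
  rw [lintegral_indicator (measurableSet_stays z)] at this
  refine le_trans ?_ this
  rw [← lintegral_indicator (measurableSet_stays z)]
  refine lintegral_mono fun η ↦ ?_
  by_cases hη : η ∈ stays z
  · rw [Set.indicator_of_mem hη, Set.indicator_of_mem]
    · simp only [ContinuousMap.add_apply, linePath_apply]
      simp [add_comm]
    · intro u
      refine (hη u).trans ?_
      simp only [ContinuousMap.add_apply, linePath_apply, zero_add, sub_zero]
      have : 0 ≤ (u : ℝ) • v := smul_nonneg (unitInterval.nonneg u) hv
      gcongr
      exact le_add_of_nonneg_left this
  · rw [Set.indicator_of_notMem hη]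
    exact zero_le

end IsCorrelatedBrownianLaw

theorem norm_smul_one_one {c : ℝ} (hc : 0 ≤ c) : ‖c • ((1 : ℝ), (1 : ℝ))‖ = c := by
  rw [norm_smul, Real.norm_of_nonneg hc, Prod.norm_def]
  simp

namespace IsCorrelatedBrownianLaw

variable {α : ℝ} {W : Measure PlanarPath}

theorem survExp_neg_le_surv (hW : IsCorrelatedBrownianLaw α W) (hα : α ∈ Set.Ioo (-1 : ℝ) 1)
    {K : ℝ} (hK : ∀ x v, Real.exp (-(K * ‖v‖ * (‖x‖ + ‖v‖))) * gaussDensity α x ≤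
      gaussDensity α (x + v)) (hK0 : 0 ≤ K) {R : ℝ} (hR0 : 0 ≤ R)
    (hR : 2⁻¹ ≤ W {η | ‖η‖ ≤ R}) (z : ℝ × ℝ) :
    ENNReal.ofReal (2⁻¹ * Real.exp (-(4 * K * R ^ 2))) * survExp W (-(2 * K * R)) ((2 : ℝ) • z) ≤
      surv W z := by
  have := hW.isProbabilityMeasure
  let r : unitInterval := ⟨1 / 4, by norm_num, by norm_num⟩
  have h0 : 0 < r := by rw [← Subtype.coe_lt_coe]; norm_num [r]
  have h1 : r < 1 := by rw [← Subtype.coe_lt_coe]; norm_num [r]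
  have hs : √(r : ℝ) = 1 / 2 := by
    rw [show (r : ℝ) = (1 / 2) ^ 2 by norm_num [r]]
    exact Real.sqrt_sq (by norm_num)
  have hz : (√(r : ℝ))⁻¹ • z = (2 : ℝ) • z := by rw [hs]; norm_num
  have hs1 : 1 ≤ (√(1 - r : ℝ))⁻¹ := by
    rw [one_le_inv₀ (Real.sqrt_pos.2 (by norm_num [r]))]
    exact Real.sqrt_le_one.2 (by norm_num [r])
  have hs0 : 0 ≤ (√(1 - r : ℝ))⁻¹ := by positivity
  set v : ℝ × ℝ := (2 * R) • ((1 : ℝ), (1 : ℝ)) with hv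
  have hvn : ‖v‖ = 2 * R := norm_smul_one_one (by positivity)
  have hv0 : 0 ≤ v := by rw [hv]; constructor <;> simp <;> positivity
  have hmS := measurable_surv W
  calc _ = ∫⁻ η in stays ((2 : ℝ) • z), ENNReal.ofReal (2⁻¹ * Real.exp (-(4 * K * R ^ 2))) *
          ENNReal.ofReal (Real.exp (-(2 * K * R) * ‖η‖)) ∂W := by
        rw [survExp, lintegral_const_mul _ (measurable_expNorm _)]
    _ ≤ ∫⁻ η in stays ((2 : ℝ) • z), ENNReal.ofReal (Real.exp (-(K * ‖v‖ * (‖η‖ + ‖v‖)))) *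
          surv W (z + (1 / 2 : ℝ) • (η 1 + v)) ∂W := by
        refine setLIntegral_mono' (measurableSet_stays _) fun η hη ↦ ?_
        have e1 : 2⁻¹ ≤ surv W (z + (1 / 2 : ℝ) • (η 1 + v)) := by
          refine (surv_lower hR).trans (surv_mono W ?_)
          have h3 : (0 : ℝ × ℝ) ≤ (1 / 2 : ℝ) • ((2 : ℝ) • z + η 1) :=
            smul_nonneg (by norm_num) (hη 1)
          calc R • ((1 : ℝ), (1 : ℝ)) = 0 + R • ((1 : ℝ), (1 : ℝ)) := (zero_add _).symm
            _ ≤ (1 / 2 : ℝ) • ((2 : ℝ) • z + η 1) + R • ((1 : ℝ), (1 : ℝ)) := by gcongr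
            _ = _ := by rw [hv]; module
        rw [hvn]
        calc _ = ENNReal.ofReal (Real.exp (-(K * (2 * R) * (‖η‖ + 2 * R)))) *
              ENNReal.ofReal 2⁻¹ := by
              rw [← ENNReal.ofReal_mul (by positivity), ← ENNReal.ofReal_mul (by positivity),
                mul_assoc, ← Real.exp_add, mul_comm]
              congr 3
              ring
          _ ≤ _ := by
              gcongr
              rw [ENNReal.ofReal_inv_of_pos (by norm_num)]
              simpa using e1
    _ ≤ ∫⁻ η in stays ((2 : ℝ) • z), surv W (z + (1 / 2 : ℝ) • η 1) ∂W :=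
        hW.setLIntegral_stays_shift hα hK hK0 _ hv0
          (h := fun x ↦ surv W (z + (1 / 2 : ℝ) • x)) (hmS.comp (by fun_prop))
    _ ≤ ∫⁻ η in stays ((2 : ℝ) • z), 1 * surv W ((√(1 - r : ℝ))⁻¹ • (z + √(r : ℝ) • η 1)) ∂W := by
        refine setLIntegral_mono' (measurableSet_stays _) fun η hη ↦ ?_
        rw [one_mul, hs]
        refine surv_mono W (le_smul_of_one_le hs1 ?_)
        have h3 : (0 : ℝ × ℝ) ≤ (1 / 2 : ℝ) • ((2 : ℝ) • z + η 1) :=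
            smul_nonneg (by norm_num) (hη 1)
        convert h3 using 1
        module
    _ = ∫⁻ η in stays z, 1 ∂W := by
        rw [← hz]
        exact (hW.setLIntegral_stays h0 h1 z (H := fun _ ↦ 1) measurable_const).symm
    _ = surv W z := by rw [setLIntegral_one]; rfl

theorem exists_surv_bounds (hW : IsCorrelatedBrownianLaw α W) (hα : α ∈ Set.Ioo (-1 : ℝ) 1) :
    ∃ l C : ℝ, 0 < l ∧ 0 < C ∧ ∀ z : ℝ × ℝ, 0 < z.1 → 0 < z.2 →
      survExp W l z ≤ ENNReal.ofReal C * surv W z ∧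
      surv W ((2 : ℝ) • z) ≤ ENNReal.ofReal C * surv W z ∧ surv W z ≠ 0 := by
  have := hW.isProbabilityMeasure
  obtain ⟨K, hK0, hK⟩ := exists_gaussDensity_shift hα
  obtain ⟨R, hR1, hR⟩ := hW.exists_norm_le
  set l := 2 * K * R with hl
  have hl0 : 0 < l := by positivity
  set c := 2⁻¹ * Real.exp (-(4 * K * R ^ 2)) with hc
  have hc0 : 0 < c := by positivity
  set B := ∫⁻ η, ENNReal.ofReal (Real.exp (2 * (2 * l) * ‖η‖)) ∂W with hB
  have hBtop : B ≠ ⊤ := by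
    have := (hW.integrable_exp_norm (2 * (2 * l))).lintegral_lt_top
    exact this.ne
  set b := B.toReal with hb
  have hbB : B = ENNReal.ofReal b := (ENNReal.ofReal_toReal hBtop).symm
  have hb0 : 0 ≤ b := ENNReal.toReal_nonneg
  set κ := 1 + 2 * b + b / c with hκ
  have hκ1 : 1 ≤ κ := by
    have : 0 ≤ b / c := by positivity
    linarith
  have hκ0 : 0 < κ := by linarith
  have hκb : b ≤ κ * c := by
    have : b = (b / c) * c := by field_simp
    rw [this]
    gcongr
    linarith
  have step (z : ℝ × ℝ)
      (h : survExp W (2 * (2 * l)) ((2 : ℝ) • z) ≤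
        ENNReal.ofReal (κ ^ 4) * surv W ((2 : ℝ) • z)) :
      survExp W (2 * (2 * l)) z ≤ ENNReal.ofReal (κ ^ 4) * surv W z ∧
        surv W ((2 : ℝ) • z) ≤ ENNReal.ofReal (κ / c) * surv W z := by
    have a1 := survExp_half (κ := κ ^ 2) (by positivity)
      (h.trans_eq (by rw [← pow_mul]))
    have a2 := survExp_half (κ := κ) hκ0 a1
    have a3 := survExp_neg hκ0 a2
    have a4 := hW.survExp_neg_le_surv hα hK hK0.le (zero_le_one.trans hR1) hR z
    have a5 : surv W ((2 : ℝ) • z) ≤ ENNReal.ofReal (κ / c) * surv W z := by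
      calc surv W ((2 : ℝ) • z) = ENNReal.ofReal (κ / c) * (ENNReal.ofReal c *
            (ENNReal.ofReal κ⁻¹ * surv W ((2 : ℝ) • z))) := by
            rw [← mul_assoc, ← mul_assoc, ← ENNReal.ofReal_mul (by positivity),
              ← ENNReal.ofReal_mul (by positivity)]
            have : κ / c * c * κ⁻¹ = 1 := by field_simp
            rw [this, ENNReal.ofReal_one, one_mul]
        _ ≤ ENNReal.ofReal (κ / c) * surv W z := by
            gcongr
            exact le_trans (by gcongr) a4
    refine ⟨?_, a5⟩
    calc survExp W (2 * (2 * l)) z ≤ B * survExp W (2 * l) ((2 : ℝ) • z) :=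
          hW.survExp_le_survExp_two_smul (by positivity) z
      _ ≤ ENNReal.ofReal b * (ENNReal.ofReal (κ ^ 2) *
            (ENNReal.ofReal (κ / c) * surv W z)) := by
          rw [hbB]
          gcongr
          exact a1.trans (by gcongr)
      _ = ENNReal.ofReal (b * κ ^ 2 * (κ / c)) * surv W z := by
          rw [← mul_assoc, ← mul_assoc, ← ENNReal.ofReal_mul (by positivity),
            ← ENNReal.ofReal_mul (by positivity)]
      _ ≤ _ := by
          gcongr
          rw [← mul_div_assoc, div_le_iff₀ hc0]
          calc b * κ ^ 2 * κ ≤ (κ * c) * κ ^ 2 * κ := by gcongr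
            _ = κ ^ 4 * c := by ring
  have base (z : ℝ × ℝ) (hz : R • ((1 : ℝ), (1 : ℝ)) ≤ z) :
      survExp W (2 * (2 * l)) z ≤ ENNReal.ofReal (κ ^ 4) * surv W z ∧ surv W z ≠ 0 := by
    have h1 : 2⁻¹ ≤ surv W z := (surv_lower hR).trans (surv_mono W hz)
    refine ⟨?_, fun h ↦ by simp [h] at h1⟩
    calc survExp W (2 * (2 * l)) z ≤ B := setLIntegral_le_lintegral _ _
      _ = ENNReal.ofReal (2 * b) * 2⁻¹ := by
          rw [hbB, mul_comm 2, ENNReal.ofReal_mul hb0, mul_assoc]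
          simp [ENNReal.mul_inv_cancel]
      _ ≤ _ := by
          gcongr
          calc 2 * b ≤ κ := by
                have : 0 ≤ b / c := by positivity
                linarith
            _ ≤ κ ^ 4 := le_self_pow₀ hκ1 (by norm_num)
  have all (n : ℕ) : ∀ z : ℝ × ℝ, R • ((1 : ℝ), (1 : ℝ)) ≤ (2 : ℝ) ^ n • z →
      survExp W (2 * (2 * l)) z ≤ ENNReal.ofReal (κ ^ 4) * surv W z ∧ surv W z ≠ 0 := by
    induction n with
    | zero => intro z hz; exact base z (by simpa using hz)
    | succ n ih =>
      intro z hz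
      have := ih ((2 : ℝ) • z) (by rwa [smul_smul, ← pow_succ])
      refine ⟨(step z this.1).1, fun h ↦ ?_⟩
      have h2 := (step z this.1).2
      rw [h, mul_zero] at h2
      exact this.2 (le_antisymm h2 zero_le)
  have all' (z : ℝ × ℝ) (h1 : 0 < z.1) (h2 : 0 < z.2) :
      survExp W (2 * (2 * l)) z ≤ ENNReal.ofReal (κ ^ 4) * surv W z ∧ surv W z ≠ 0 := by
    obtain ⟨n, hn⟩ := pow_unbounded_of_one_lt (R / z.1 + R / z.2) (one_lt_two (α := ℝ))
    have p1 : 0 ≤ R / z.1 := by positivity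
    have p2 : 0 ≤ R / z.2 := by positivity
    refine all n z ⟨?_, ?_⟩
    · simp only [Prod.smul_fst, smul_eq_mul, mul_one]
      rw [← div_le_iff₀ h1]
      linarith
    · simp only [Prod.smul_snd, smul_eq_mul, mul_one]
      rw [← div_le_iff₀ h2]
      linarith
  refine ⟨2 * (2 * l), max (κ ^ 4) (κ / c), by positivity, by positivity, fun z h1 h2 ↦ ?_⟩
  have a := all' z h1 h2
  have b := (step z (all' ((2 : ℝ) • z) (by simpa using h1) (by simpa using h2)).1).2
  refine ⟨a.1.trans ?_, b.trans ?_, a.2⟩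
  · gcongr; exact le_max_left _ _
  · gcongr; exact le_max_right _ _

end IsCorrelatedBrownianLaw

theorem neg_smul_one_le {x : ℝ × ℝ} {M : ℝ} (h : ‖x‖ ≤ M) : -(M • ((1 : ℝ), (1 : ℝ))) ≤ x := by
  refine le_trans ?_ (neg_norm_le x)
  rw [neg_le_neg_iff]
  exact ⟨by simpa using h, by simpa using h⟩

theorem le_smul_one {x : ℝ × ℝ} {M : ℝ} (h : ‖x‖ ≤ M) : x ≤ M • ((1 : ℝ), (1 : ℝ)) := by
  refine (le_norm_smul x).trans ?_
  exact ⟨by simpa using h, by simpa using h⟩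

theorem exists_pow_mul_le_exp {l : ℝ} (hl : 0 < l) (m : ℕ) :
    ∃ C : ℝ, 0 < C ∧ ∀ x : ℝ, 0 ≤ x → x * (2 * (1 + x)) ^ m ≤ C * Real.exp (l * x) := by
  refine ⟨2 ^ m * ((m + 1).factorial / l ^ (m + 1)) * Real.exp l, by positivity, fun x hx ↦ ?_⟩
  have h := Real.pow_div_factorial_le_exp (l * (1 + x)) (by positivity) (m + 1)
  rw [div_le_iff₀ (by positivity)] at h
  calc x * (2 * (1 + x)) ^ m ≤ (1 + x) * (2 * (1 + x)) ^ m := by gcongr; linarith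
    _ = 2 ^ m * ((l * (1 + x)) ^ (m + 1)) / l ^ (m + 1) := by
        rw [mul_pow, mul_pow]; field_simp; ring
    _ ≤ 2 ^ m * (Real.exp (l * (1 + x)) * (m + 1).factorial) / l ^ (m + 1) := by gcongr
    _ = _ := by
        rw [mul_add, mul_one, Real.exp_add]; ring

theorem surv_two_pow_smul {W : Measure PlanarPath} {C : ℝ} (hC : 0 < C)
    (h : ∀ z : ℝ × ℝ, 0 < z.1 → 0 < z.2 → surv W ((2 : ℝ) • z) ≤ ENNReal.ofReal C * surv W z)
    (n : ℕ) {z : ℝ × ℝ} (h1 : 0 < z.1) (h2 : 0 < z.2) :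
    surv W ((2 : ℝ) ^ n • z) ≤ ENNReal.ofReal (C ^ n) * surv W z := by
  induction n with
  | zero => simp
  | succ n ih =>
    rw [pow_succ', mul_smul]
    refine (h _ (by simpa using h1) (by simpa using h2)).trans ?_
    rw [pow_succ', ENNReal.ofReal_mul hC.le, mul_assoc]
    gcongr

namespace IsCorrelatedBrownianLaw

variable {α : ℝ} {W : Measure PlanarPath}

theorem exists_surv_le_two_mul (hW : IsCorrelatedBrownianLaw α W)
    (hα : α ∈ Set.Ioo (-1 : ℝ) 1) :
    ∃ M : ℝ, 0 < M ∧ ∀ z : ℝ × ℝ, 0 < z.1 → 0 < z.2 →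
      surv W z ≤ 2 * W (stays z ∩ {η | ‖η‖ ≤ M}) := by
  have := hW.isProbabilityMeasure
  obtain ⟨l, C, hl, hC, h⟩ := hW.exists_surv_bounds hα
  refine ⟨2 * C / l, by positivity, fun z h1 h2 ↦ ?_⟩
  set M := 2 * C / l
  have hms : MeasurableSet {η : PlanarPath | ‖η‖ ≤ M} :=
    (isClosed_le continuous_norm continuous_const).measurableSet
  have hM : 2 * C ≤ Real.exp (l * M) := by
    have : l * M = 2 * C := by simp only [M]; field_simp
    rw [this]
    linarith [Real.add_one_le_exp (2 * C)]
  have far : W (stays z \ {η | ‖η‖ ≤ M}) ≤ 2⁻¹ * surv W z := by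
    have e1 : ENNReal.ofReal (2 * C) * W (stays z \ {η | ‖η‖ ≤ M}) ≤
        ENNReal.ofReal C * surv W z := by
      calc _ = ∫⁻ _ in stays z \ {η | ‖η‖ ≤ M}, ENNReal.ofReal (2 * C) ∂W :=
            (setLIntegral_const _ _).symm
        _ ≤ ∫⁻ η in stays z \ {η | ‖η‖ ≤ M}, ENNReal.ofReal (Real.exp (l * ‖η‖)) ∂W := by
            refine setLIntegral_mono' ((measurableSet_stays z).diff hms) fun η hη ↦ ?_
            refine ENNReal.ofReal_le_ofReal (hM.trans (Real.exp_le_exp.2 ?_))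
            have : M < ‖η‖ := not_le.1 hη.2
            gcongr
        _ ≤ survExp W l z := lintegral_mono_set Set.sdiff_subset
        _ ≤ _ := (h z h1 h2).1
    calc W (stays z \ {η | ‖η‖ ≤ M}) = ENNReal.ofReal (2 * C)⁻¹ *
          (ENNReal.ofReal (2 * C) * W (stays z \ {η | ‖η‖ ≤ M})) := by
          rw [← mul_assoc, ← ENNReal.ofReal_mul (by positivity), inv_mul_cancel₀ (by positivity),
            ENNReal.ofReal_one, one_mul]
      _ ≤ ENNReal.ofReal (2 * C)⁻¹ * (ENNReal.ofReal C * surv W z) := by gcongr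
      _ = 2⁻¹ * surv W z := by
          rw [← mul_assoc, ← ENNReal.ofReal_mul (by positivity)]
          have : (2 * C)⁻¹ * C = 2⁻¹ := by field_simp
          rw [this, ENNReal.ofReal_inv_of_pos (by norm_num)]
          norm_num
  have split : surv W z = W (stays z ∩ {η | ‖η‖ ≤ M}) + W (stays z \ {η | ‖η‖ ≤ M}) :=
    (measure_inter_add_sdiff _ hms).symm
  have e2 : 2⁻¹ * surv W z + 2⁻¹ * surv W z ≤ W (stays z ∩ {η | ‖η‖ ≤ M}) + 2⁻¹ * surv W z := by
    rw [← add_mul, ENNReal.inv_two_add_inv_two, one_mul]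
    conv_lhs => rw [split]
    gcongr
  have e3 : 2⁻¹ * surv W z ≤ W (stays z ∩ {η | ‖η‖ ≤ M}) :=
    (ENNReal.add_le_add_iff_right (ENNReal.mul_ne_top (by simp) (measure_ne_top _ _))).1 e2
  calc surv W z = 2 * (2⁻¹ * surv W z) := by
        rw [← mul_assoc, ENNReal.mul_inv_cancel (by norm_num) (by norm_num), one_mul]
    _ ≤ _ := by gcongr

/-- Weighting by a later survival probability does not change the order of the displacement. -/
theorem exists_lintegral_norm_mul_surv_le (hW : IsCorrelatedBrownianLaw α W)
    (hα : α ∈ Set.Ioo (-1 : ℝ) 1) :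
    ∃ C : ℝ, 0 < C ∧ ∀ z : ℝ × ℝ, 0 < z.1 → 0 < z.2 → ∀ c : ℝ, 0 < c →
      ∫⁻ η in stays z, ENNReal.ofReal ‖η‖ * surv W (c • (z + η 1)) ∂W ≤
        ENNReal.ofReal C * ∫⁻ η in stays z, surv W (c • (z + η 1)) ∂W := by
  have := hW.isProbabilityMeasure
  obtain ⟨K, hK0, hK⟩ := exists_gaussDensity_shift hα
  obtain ⟨l, C, hl, hC, hS⟩ := hW.exists_surv_bounds hα
  obtain ⟨M, hM0, hM⟩ := hW.exists_surv_le_two_mul hα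
  obtain ⟨m, hm⟩ := pow_unbounded_of_one_lt C (one_lt_two (α := ℝ))
  obtain ⟨D, hD0, hD⟩ := exists_pow_mul_le_exp hl m
  set b := Real.exp (-(K * (M + 1) * (M + (M + 1)))) with hb
  have hb0 : 0 < b := Real.exp_pos _
  refine ⟨2 * D * C / b, by positivity, fun z hz1 hz2 c hc ↦ ?_⟩
  set e : ℝ × ℝ := ((1 : ℝ), (1 : ℝ)) with he
  set T := surv W (c • (z + e)) with hT
  have hx1 : 0 < (c • (z + e)).1 := by simp only [he, Prod.smul_fst, Prod.fst_add, smul_eq_mul]; positivity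
  have hx2 : 0 < (c • (z + e)).2 := by simp only [he, Prod.smul_snd, Prod.snd_add, smul_eq_mul]; positivity
  have hms : MeasurableSet {η : PlanarPath | ‖η‖ ≤ M} :=
    (isClosed_le continuous_norm continuous_const).measurableSet
  have upper : ∫⁻ η in stays z, ENNReal.ofReal ‖η‖ * surv W (c • (z + η 1)) ∂W ≤
      ENNReal.ofReal (D * C) * surv W z * T := by
    calc _ ≤ ∫⁻ η in stays z, ENNReal.ofReal D * ENNReal.ofReal (Real.exp (l * ‖η‖)) * T ∂W := by
          refine lintegral_mono fun η ↦ ?_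
          obtain ⟨n, hn1, hn2⟩ := exists_nat_pow_near (x := 1 + ‖η‖) (y := (2 : ℝ))
            (by linarith [norm_nonneg η]) one_lt_two
          have hle : surv W (c • (z + η 1)) ≤ ENNReal.ofReal (C ^ (n + 1)) * T := by
            refine le_trans (surv_mono W ?_)
              (surv_two_pow_smul hC (fun z h1 h2 ↦ (hS z h1 h2).2.1) (n + 1) hx1 hx2)
            rw [smul_comm]
            have h1 : η 1 ≤ ‖η‖ • e := le_smul_one (η.norm_coe_le_norm 1)
            have h2 : z + η 1 ≤ (2 : ℝ) ^ (n + 1) • (z + e) := by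
              have hz : (0 : ℝ × ℝ) ≤ z := ⟨hz1.le, hz2.le⟩
              have he0 : (0 : ℝ × ℝ) ≤ e := ⟨zero_le_one, zero_le_one⟩
              have h3 : z ≤ (2 : ℝ) ^ (n + 1) • z :=
                le_smul_of_one_le (one_le_pow₀ one_le_two) hz
              have h4 : ‖η‖ • e ≤ (2 : ℝ) ^ (n + 1) • e := by
                refine smul_le_smul_of_nonneg_right ?_ he0
                linarith
              rw [smul_add]
              exact add_le_add h3 (h1.trans h4)
            exact smul_le_smul_of_nonneg_left h2 hc.le
          calc ENNReal.ofReal ‖η‖ * surv W (c • (z + η 1))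
              ≤ ENNReal.ofReal ‖η‖ * (ENNReal.ofReal (C ^ (n + 1)) * T) := by gcongr
            _ = ENNReal.ofReal (‖η‖ * C ^ (n + 1)) * T := by
              rw [← mul_assoc, ← ENNReal.ofReal_mul (norm_nonneg _)]
            _ ≤ ENNReal.ofReal (D * Real.exp (l * ‖η‖)) * T := by
              gcongr ENNReal.ofReal ?_ * T
              refine le_trans ?_ (hD ‖η‖ (norm_nonneg _))
              gcongr
              calc C ^ (n + 1) ≤ (2 ^ m) ^ (n + 1) := by gcongr
                _ = (2 ^ (n + 1)) ^ m := by rw [← pow_mul, ← pow_mul, mul_comm]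
                _ ≤ (2 * (1 + ‖η‖)) ^ m := by
                  gcongr
                  rw [pow_succ']
                  gcongr
            _ = _ := by rw [ENNReal.ofReal_mul hD0.le]
      _ = ENNReal.ofReal D * survExp W l z * T := by
          rw [lintegral_mul_const _ ((measurable_expNorm l).const_mul _),
            lintegral_const_mul _ (measurable_expNorm l)]
          rfl
      _ ≤ ENNReal.ofReal D * (ENNReal.ofReal C * surv W z) * T := by
          gcongr
          exact (hS z hz1 hz2).1
      _ = _ := by rw [ENNReal.ofReal_mul hD0.le]; ring
  have lower : ENNReal.ofReal b * surv W z * T ≤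
      2 * ∫⁻ η in stays z, surv W (c • (z + η 1)) ∂W := by
    have hv0 : (0 : ℝ × ℝ) ≤ (M + 1) • e := by
      constructor <;> simp [he] <;> positivity
    have hvn : ‖(M + 1) • e‖ = M + 1 := norm_smul_one_one (by positivity)
    have hsh := hW.setLIntegral_stays_shift hα hK hK0.le z hv0
      (h := fun x ↦ surv W (c • (z + x))) ((measurable_surv W).comp (by fun_prop))
    refine le_trans ?_ (mul_le_mul_right hsh 2)
    rw [hvn]
    calc _ ≤ ENNReal.ofReal b * (2 * W (stays z ∩ {η | ‖η‖ ≤ M})) * T := by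
          gcongr
          exact hM z hz1 hz2
      _ = 2 * (ENNReal.ofReal b * T * W (stays z ∩ {η | ‖η‖ ≤ M})) := by ring
      _ = 2 * ∫⁻ _ in stays z ∩ {η | ‖η‖ ≤ M}, ENNReal.ofReal b * T ∂W := by
          rw [setLIntegral_const]
      _ ≤ 2 * ∫⁻ η in stays z ∩ {η | ‖η‖ ≤ M},
            ENNReal.ofReal (Real.exp (-(K * (M + 1) * (‖η‖ + (M + 1))))) *
              surv W (c • (z + (η 1 + (M + 1) • e))) ∂W := by
          gcongr 2 * ?_
          refine setLIntegral_mono' ((measurableSet_stays z).inter hms) fun η hη ↦ ?_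
          have hη' : ‖η‖ ≤ M := hη.2
          refine mul_le_mul' (ENNReal.ofReal_le_ofReal ?_) (surv_mono W ?_)
          · rw [hb]
            apply Real.exp_le_exp.2
            gcongr
          · refine smul_le_smul_of_nonneg_left ?_ hc.le
            have h1 := neg_smul_one_le ((η.norm_coe_le_norm 1).trans hη')
            gcongr
            calc e = -(M • e) + (M + 1) • e := by module
              _ ≤ η 1 + (M + 1) • e := by gcongr
      _ ≤ _ := by
          gcongr 2 * ?_
          exact lintegral_mono_set Set.inter_subset_left
  calc _ ≤ ENNReal.ofReal (D * C) * surv W z * T := upper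
    _ = ENNReal.ofReal (D * C / b) * (ENNReal.ofReal b * surv W z * T) := by
        rw [← mul_assoc, ← mul_assoc, ← ENNReal.ofReal_mul (by positivity),
          div_mul_cancel₀ _ hb0.ne']
    _ ≤ ENNReal.ofReal (D * C / b) * (2 * ∫⁻ η in stays z, surv W (c • (z + η 1)) ∂W) := by
        gcongr
    _ = _ := by
        rw [← mul_assoc, mul_assoc 2 D C, mul_div_assoc 2, ENNReal.ofReal_mul zero_le_two,
          mul_comm _ (2 : ENNReal), ENNReal.ofReal_ofNat]

/-- Given survival up to time `1`, the displacement up to time `r` is of order `√r`. -/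
theorem exists_lintegral_seg_le (hW : IsCorrelatedBrownianLaw α W)
    (hα : α ∈ Set.Ioo (-1 : ℝ) 1) :
    ∃ C : ℝ, 0 < C ∧ ∀ z : ℝ × ℝ, 0 < z.1 → 0 < z.2 → ∀ r : unitInterval, 0 < r → r < 1 →
      ∫⁻ η in stays z, ENNReal.ofReal ‖seg 0 r η‖ ∂W ≤ ENNReal.ofReal C * surv W z := by
  obtain ⟨C, hC, h⟩ := hW.exists_lintegral_norm_mul_surv_le hα
  refine ⟨C, hC, fun z hz1 hz2 r h0 h1 ↦ ?_⟩
  have hr0 : 0 < √(r : ℝ) := Real.sqrt_pos.2 h0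
  have hr1 : 0 < √(1 - r : ℝ) := Real.sqrt_pos.2 (sub_pos.2 h1)
  have hm : Measurable fun η : PlanarPath ↦ ENNReal.ofReal ‖η‖ :=
    continuous_norm.measurable.ennreal_ofReal
  have e (η : PlanarPath) : (√(1 - r : ℝ))⁻¹ • (z + √(r : ℝ) • η 1) =
      ((√(1 - r : ℝ))⁻¹ * √(r : ℝ)) • ((√(r : ℝ))⁻¹ • z + η 1) := by
    rw [mul_smul]
    congr 1
    rw [smul_add, smul_inv_smul₀ hr0.ne']
  rw [hW.setLIntegral_stays h0 h1 z hm]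
  have e2 : surv W z = ∫⁻ η in stays ((√(r : ℝ))⁻¹ • z),
      surv W ((√(1 - r : ℝ))⁻¹ • (z + √(r : ℝ) • η 1)) ∂W := by
    have := hW.setLIntegral_stays h0 h1 z (H := fun _ ↦ 1) measurable_const
    simp only [one_mul, lintegral_one, Measure.restrict_apply_univ] at this
    exact this
  rw [e2]
  simp only [e]
  refine h _ ?_ ?_ _ (by positivity)
  · simp only [Prod.smul_fst, smul_eq_mul]; positivity
  · simp only [Prod.smul_snd, smul_eq_mul]; positivity

end IsCorrelatedBrownianLaw

/-! ### Brownian bridges killed outside the quadrant -/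

/-- The bridges that stay in the closed quadrant when run from `z` to `w`. -/
def bstays (z w : ℝ × ℝ) : Set PlanarPath := {f | ∀ u, 0 ≤ linePath z w u + f u}

/-- The probability that the Brownian bridge from `z` to `w` of length `1` stays in the quadrant. -/
noncomputable def stayProb (W : Measure PlanarPath) (z w : ℝ × ℝ) : ENNReal :=
  bridgeLaw W (bstays z w)

theorem isClosed_bstays_uncurry :
    IsClosed {p : ((ℝ × ℝ) × (ℝ × ℝ)) × PlanarPath | p.2 ∈ bstays p.1.1 p.1.2} := by
  have : {p : ((ℝ × ℝ) × (ℝ × ℝ)) × PlanarPath | p.2 ∈ bstays p.1.1 p.1.2} =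
      ⋂ u : unitInterval, {p | 0 ≤ p.1.1 + (u : ℝ) • (p.1.2 - p.1.1) + p.2 u} := by
    ext; simp [bstays, linePath_apply]
  rw [this]
  exact isClosed_iInter fun u ↦ isClosed_le continuous_const (by fun_prop)

theorem measurableSet_bstays (z w : ℝ × ℝ) : MeasurableSet (bstays z w) :=
  measurable_prodMk_left isClosed_bstays_uncurry.measurableSet (x := (z, w))

theorem linePath_mono {z w z' w' : ℝ × ℝ} (hz : z ≤ z') (hw : w ≤ w') (u : unitInterval) :
    linePath z w u ≤ linePath z' w' u := by
  have e (z w : ℝ × ℝ) : linePath z w u = (1 - u : ℝ) • z + (u : ℝ) • w := by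
    rw [linePath_apply]; module
  have h0 := unitInterval.nonneg u
  have h1 : (0 : ℝ) ≤ 1 - u := sub_nonneg.2 (unitInterval.le_one u)
  rw [e, e]
  exact add_le_add (smul_le_smul_of_nonneg_left hz h1) (smul_le_smul_of_nonneg_left hw h0)

theorem bstays_mono {z w z' w' : ℝ × ℝ} (hz : z ≤ z') (hw : w ≤ w') :
    bstays z w ⊆ bstays z' w' :=
  fun _ hf u ↦ (hf u).trans (add_le_add_left (linePath_mono hz hw u) _)

theorem stayProb_mono (W : Measure PlanarPath) {z w z' w' : ℝ × ℝ} (hz : z ≤ z') (hw : w ≤ w') :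
    stayProb W z w ≤ stayProb W z' w' := measure_mono (bstays_mono hz hw)

theorem measurable_stayProb (W : Measure PlanarPath) [IsProbabilityMeasure W] :
    Measurable fun p : (ℝ × ℝ) × (ℝ × ℝ) ↦ stayProb W p.1 p.2 :=
  measurable_measure_prodMk_left (ν := bridgeLaw W) isClosed_bstays_uncurry.measurableSet

theorem ae_bridgeLaw (W : Measure PlanarPath) : ∀ᵐ f ∂(bridgeLaw W), f 0 = 0 ∧ f 1 = 0 := by
  have hm : MeasurableSet {f : PlanarPath | f 0 = 0 ∧ f 1 = 0} :=
    ((isClosed_eq (by fun_prop) continuous_const).inter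
      (isClosed_eq (by fun_prop) continuous_const)).measurableSet
  rw [bridgeLaw, ae_map_iff continuous_bridgePart.measurable.aemeasurable hm]
  exact Filter.Eventually.of_forall fun η ↦ by simp [bridgePart_apply]

theorem seg_linePath_add {θ : unitInterval} (h0 : 0 < θ) (z w : ℝ × ℝ) (η : PlanarPath) :
    seg 0 θ (linePath z w + bridgePart η) =
      linePath 0 ((√(θ : ℝ))⁻¹ • (linePath z w θ + bridgePart η θ - z)) +
        bridgePart (seg 0 θ η) := by
  have hr0 : √(θ : ℝ) ≠ 0 := (Real.sqrt_pos.2 h0).ne'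
  ext1 u
  have e0 : |((θ : ℝ) - (0 : unitInterval))| = θ := by simp [abs_of_nonneg (unitInterval.nonneg θ)]
  have h : ((affTime 0 θ u : unitInterval) : ℝ) = u * θ := by simp [coe_affTime]
  rw [seg_apply, e0, ContinuousMap.add_apply, ContinuousMap.add_apply, ContinuousMap.add_apply,
    bridgePart_affTime_zero h0, linePath_apply, linePath_apply, linePath_apply, linePath_apply, h,
    inv_smul_eq_iff₀ hr0]
  have : bridgePart η 0 = 0 := by simp [bridgePart_apply]
  rw [this, smul_add, sub_zero, zero_add, smul_comm, smul_inv_smul₀ hr0]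
  simp only [Set.Icc.coe_zero]
  module

theorem mem_bstays_iff_seg {θ : unitInterval} (h0 : 0 < θ) (h1 : θ < 1) (z w : ℝ × ℝ)
    (η : PlanarPath) : bridgePart η ∈ bstays z w ↔
      bridgePart (seg 0 θ η) ∈ bstays ((√(θ : ℝ))⁻¹ • z)
        ((√(θ : ℝ))⁻¹ • (linePath z w θ + bridgePart η θ)) ∧
      bridgePart (seg 1 θ η) ∈ bstays ((√(1 - θ : ℝ))⁻¹ • w)
        ((√(1 - θ : ℝ))⁻¹ • (linePath z w θ + bridgePart η θ)) := by
  have hr0 : 0 < √(θ : ℝ) := Real.sqrt_pos.2 h0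
  have hr1 : 0 < √(1 - θ : ℝ) := Real.sqrt_pos.2 (sub_pos.2 h1)
  have k1 u : 0 ≤ linePath ((√(θ : ℝ))⁻¹ • z)
        ((√(θ : ℝ))⁻¹ • (linePath z w θ + bridgePart η θ)) u + bridgePart (seg 0 θ η) u ↔
      0 ≤ linePath z w (affTime 0 θ u) + bridgePart η (affTime 0 θ u) := by
    have h : ((affTime 0 θ u : unitInterval) : ℝ) = u * θ := by simp [coe_affTime]
    rw [bridgePart_affTime_zero h0, ← quadrant_smul_iff hr0, smul_add, linePath_apply, smul_add,
      smul_comm (√(θ : ℝ)) (u : ℝ), smul_sub, smul_inv_smul₀ hr0.ne', smul_inv_smul₀ hr0.ne',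
      linePath_apply, linePath_apply, h]
    refine iff_of_eq (congrArg _ ?_)
    module
  have k2 u : 0 ≤ linePath ((√(1 - θ : ℝ))⁻¹ • w)
        ((√(1 - θ : ℝ))⁻¹ • (linePath z w θ + bridgePart η θ)) u + bridgePart (seg 1 θ η) u ↔
      0 ≤ linePath z w (affTime 1 θ u) + bridgePart η (affTime 1 θ u) := by
    have h : ((affTime 1 θ u : unitInterval) : ℝ) = (1 - u) + u * θ := by simp [coe_affTime]
    rw [bridgePart_affTime_one h1, ← quadrant_smul_iff hr1, smul_add, linePath_apply, smul_add,
      smul_comm (√(1 - θ : ℝ)) (u : ℝ), smul_sub, smul_inv_smul₀ hr1.ne', smul_inv_smul₀ hr1.ne',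
      linePath_apply, linePath_apply, h]
    refine iff_of_eq (congrArg _ ?_)
    module
  constructor
  · exact fun h ↦ ⟨fun u ↦ (k1 u).2 (h _), fun u ↦ (k2 u).2 (h _)⟩
  · rintro ⟨a, b⟩ u
    rcases le_total u θ with hu | hu
    · obtain ⟨v, rfl⟩ := exists_affTime_eq unitInterval.nonneg' hu
      exact (k1 v).1 (a v)
    · obtain ⟨v, hv⟩ := exists_affTime_eq hu unitInterval.le_one'
      have : affTime 1 θ (unitInterval.symm v) = u := by
        rw [← hv]; ext; simp only [coe_affTime, unitInterval.coe_symm_eq]; ring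
      rw [← this]
      exact (k2 _).1 (b _)

namespace IsCorrelatedBrownianLaw

variable {α : ℝ} {W : Measure PlanarPath}

/-- Decomposition of killed Brownian motion according to its end value. -/
theorem setLIntegral_stays_eq (hW : IsCorrelatedBrownianLaw α W) (hα : α ∈ Set.Ioo (-1 : ℝ) 1)
    (z : ℝ × ℝ) {H : PlanarPath → ENNReal} (hH : Measurable H) :
    ∫⁻ η in stays z, H η ∂W = ∫⁻ y, ENNReal.ofReal (gaussDensity α (y - z)) *
      ∫⁻ f in bstays z y, H (linePath 0 (y - z) + f) ∂(bridgeLaw W) := by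
  have := hW.isProbabilityMeasure
  have hG := hH.indicator (measurableSet_stays z)
  have hc : Measurable fun p : (ℝ × ℝ) × PlanarPath ↦ linePath 0 p.1 + p.2 :=
    ((continuous_linePath.comp (continuous_const.prodMk continuous_fst)).add
      continuous_snd).measurable
  have hI : Measurable fun x ↦ ∫⁻ f, (stays z).indicator H (linePath 0 x + f) ∂(bridgeLaw W) :=
    (hG.comp hc).lintegral_prod_right'
  rw [← lintegral_indicator (measurableSet_stays z), hW.lintegral_eq_endLaw_bridgeLaw hG,
    hW.lintegral_endLaw hα hI, ← lintegral_sub_right_eq_self _ z]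
  refine lintegral_congr fun y ↦ ?_
  congr 1
  rw [← lintegral_indicator (measurableSet_bstays z y)]
  refine lintegral_congr fun f ↦ ?_
  have : linePath 0 (y - z) + f ∈ stays z ↔ f ∈ bstays z y := by
    refine forall_congr' fun u ↦ iff_of_eq (congrArg _ ?_)
    rw [ContinuousMap.add_apply, linePath_apply, linePath_apply]
    module
  by_cases h : f ∈ bstays z y
  · rw [Set.indicator_of_mem h, Set.indicator_of_mem (this.2 h)]
  · rw [Set.indicator_of_notMem h, Set.indicator_of_notMem (fun h' ↦ h (this.1 h'))]

/-- Decomposition of a killed bridge according to its value at time `θ`. -/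
theorem setLIntegral_bstays (hW : IsCorrelatedBrownianLaw α W) {θ : unitInterval} (h0 : 0 < θ)
    (h1 : θ < 1) (z w : ℝ × ℝ) {H : PlanarPath → ENNReal} (hH : Measurable H) :
    ∫⁻ f in bstays z w, H (seg 0 θ (linePath z w + f)) ∂(bridgeLaw W) =
      ∫⁻ x, (fun y ↦ (∫⁻ f in bstays ((√(θ : ℝ))⁻¹ • z) ((√(θ : ℝ))⁻¹ • y),
          H (linePath 0 ((√(θ : ℝ))⁻¹ • (y - z)) + f) ∂(bridgeLaw W)) *
        stayProb W ((√(1 - θ : ℝ))⁻¹ • w) ((√(1 - θ : ℝ))⁻¹ • y))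
          (linePath z w θ + √(θ * (1 - θ) : ℝ) • x) ∂(endLaw W) := by
  have := hW.isProbabilityMeasure
  set a := (√(θ : ℝ))⁻¹ with ha
  set b := (√(1 - θ : ℝ))⁻¹ with hb
  set m := linePath z w θ with hm
  let A : Set ((ℝ × ℝ) × PlanarPath × PlanarPath) :=
    {p | p.2.1 ∈ bstays (a • z) (a • (m + p.1)) ∧ p.2.2 ∈ bstays (b • w) (b • (m + p.1))}
  have hA : MeasurableSet A := by
    refine MeasurableSet.inter ?_ ?_
    · exact (isClosed_bstays_uncurry.preimage (by fun_prop :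
        Continuous fun p : (ℝ × ℝ) × PlanarPath × PlanarPath ↦
          ((a • z, a • (m + p.1)), p.2.1))).measurableSet
    · exact (isClosed_bstays_uncurry.preimage (by fun_prop :
        Continuous fun p : (ℝ × ℝ) × PlanarPath × PlanarPath ↦
          ((b • w, b • (m + p.1)), p.2.2))).measurableSet
  let Ψ : (ℝ × ℝ) × PlanarPath × PlanarPath → ENNReal :=
    A.indicator fun p ↦ H (linePath 0 (a • (m + p.1 - z)) + p.2.1)
  have hΨ : Measurable Ψ := by
    refine Measurable.indicator (hH.comp ?_) hA
    have hl : Continuous fun p : (ℝ × ℝ) × PlanarPath × PlanarPath ↦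
        linePath 0 (a • (m + p.1 - z)) :=
      continuous_linePath.comp (by fun_prop :
        Continuous fun p : (ℝ × ℝ) × PlanarPath × PlanarPath ↦
          ((0 : ℝ × ℝ), a • (m + p.1 - z)))
    exact (hl.add (by fun_prop)).measurable
  have hpos (x : ℝ × ℝ) (f g : PlanarPath) (hf : f ∈ bstays (a • z) (a • (m + x)))
      (hg : g ∈ bstays (b • w) (b • (m + x))) :
      Ψ (x, f, g) = H (linePath 0 (a • (m + x - z)) + f) :=
    Set.indicator_of_mem (s := A) (a := (x, f, g)) ⟨hf, hg⟩ _
  have hneg (x : ℝ × ℝ) (f g : PlanarPath) (h : ¬ (f ∈ bstays (a • z) (a • (m + x)) ∧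
      g ∈ bstays (b • w) (b • (m + x)))) : Ψ (x, f, g) = 0 :=
    Set.indicator_of_notMem (s := A) (a := (x, f, g)) h _
  clear_value Ψ
  have hs : Measurable fun f : PlanarPath ↦ H (seg 0 θ (linePath z w + f)) :=
    hH.comp ((measurable_seg _ _).comp (measurable_const_add _))
  have key : ∫⁻ f in bstays z w, H (seg 0 θ (linePath z w + f)) ∂(bridgeLaw W) =
      ∫⁻ p, Ψ p ∂(((endLaw W).map (√(θ * (1 - θ) : ℝ) • ·)).prod
        ((bridgeLaw W).prod (bridgeLaw W))) := by
    rw [← hW.map_bridgePart_split h0 h1, lintegral_map hΨ, ← lintegral_indicator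
      (measurableSet_bstays z w), bridgeLaw, lintegral_map _ continuous_bridgePart.measurable]
    · refine lintegral_congr fun η ↦ ?_
      have h := mem_bstays_iff_seg h0 h1 z w η
      by_cases hη : bridgePart η ∈ bstays z w
      · rw [Set.indicator_of_mem hη, seg_linePath_add h0, hpos _ _ _ (h.1 hη).1 (h.1 hη).2]
      · rw [Set.indicator_of_notMem hη, hneg _ _ _ (fun h' ↦ hη (h.2 h'))]
    · exact hs.indicator (measurableSet_bstays z w)
    · exact ((continuous_eval_const θ).measurable.comp continuous_bridgePart.measurable).prodMk
        ((continuous_bridgePart.measurable.comp (measurable_seg _ _)).prodMk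
          (continuous_bridgePart.measurable.comp (measurable_seg _ _)))
  have hprob : IsProbabilityMeasure ((endLaw W).map (√(θ * (1 - θ) : ℝ) • ·)) :=
    Measure.isProbabilityMeasure_map (measurable_const_smul _).aemeasurable
  have e1 := lintegral_prod (μ := (endLaw W).map (√(θ * (1 - θ) : ℝ) • ·))
    (ν := (bridgeLaw W).prod (bridgeLaw W)) _ hΨ.aemeasurable
  rw [key]
  refine e1.trans ?_
  rw [lintegral_map hΨ.lintegral_prod_right' (measurable_const_smul _)]
  refine lintegral_congr fun x ↦ ?_
  have e2 := lintegral_prod (μ := bridgeLaw W) (ν := bridgeLaw W)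
    (fun q ↦ Ψ (√(θ * (1 - θ) : ℝ) • x, q)) (hΨ.comp measurable_prodMk_left).aemeasurable
  refine e2.trans ?_
  set y := m + √(θ * (1 - θ) : ℝ) • x with hy
  have hg : Measurable fun f : PlanarPath ↦ H (linePath 0 (a • (y - z)) + f) :=
    hH.comp (measurable_const_add _)
  beta_reduce
  rw [← lintegral_mul_const _ hg, ← lintegral_indicator (measurableSet_bstays _ _)]
  refine lintegral_congr fun f ↦ ?_
  by_cases hf : f ∈ bstays (a • z) (a • y)
  · rw [Set.indicator_of_mem hf]
    have : (fun g ↦ Ψ (√(θ * (1 - θ) : ℝ) • x, f, g)) =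
        (bstays (b • w) (b • y)).indicator fun _ ↦ H (linePath 0 (a • (y - z)) + f) := by
      ext1 g
      by_cases h' : g ∈ bstays (b • w) (b • y)
      · rw [Set.indicator_of_mem h']
        exact hpos _ _ _ hf h'
      · rw [Set.indicator_of_notMem h']
        exact hneg _ _ _ (fun h'' ↦ h' h''.2)
    rw [this, lintegral_indicator_const (measurableSet_bstays _ _)]
    rfl
  · rw [Set.indicator_of_notMem hf]
    have : (fun g ↦ Ψ (√(θ * (1 - θ) : ℝ) • x, f, g)) = 0 := by
      ext1 g
      exact hneg _ _ _ (fun h' ↦ hf h'.1)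
    rw [this]
    exact lintegral_zero

end IsCorrelatedBrownianLaw

/-- The integral of `H` over the increments of the killed bridge from `z` to `y`. -/
noncomputable def bridgeInt (W : Measure PlanarPath) (H : PlanarPath → ENNReal) (z y : ℝ × ℝ) :
    ENNReal :=
  ∫⁻ f in bstays z y, H (linePath 0 (y - z) + f) ∂(bridgeLaw W)

theorem measurable_bridgeInt (W : Measure PlanarPath) [IsProbabilityMeasure W]
    {H : PlanarPath → ENNReal} (hH : Measurable H) (z : ℝ × ℝ) : Measurable (bridgeInt W H z) := by
  have hm : Measurable fun p : (ℝ × ℝ) × PlanarPath ↦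
      {p : (ℝ × ℝ) × PlanarPath | p.2 ∈ bstays z p.1}.indicator
        (fun p ↦ H (linePath 0 (p.1 - z) + p.2)) p := by
    refine Measurable.indicator (hH.comp ?_) ?_
    · have hl : Continuous fun p : (ℝ × ℝ) × PlanarPath ↦ linePath 0 (p.1 - z) :=
        continuous_linePath.comp (by fun_prop :
          Continuous fun p : (ℝ × ℝ) × PlanarPath ↦ ((0 : ℝ × ℝ), p.1 - z))
      exact (hl.add continuous_snd).measurable
    · exact (isClosed_bstays_uncurry.preimage (by fun_prop :
        Continuous fun p : (ℝ × ℝ) × PlanarPath ↦ ((z, p.1), p.2))).measurableSet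
  have := hm.lintegral_prod_right' (ν := bridgeLaw W)
  convert this using 2 with y
  rw [bridgeInt, ← lintegral_indicator (measurableSet_bstays z y)]
  rfl

theorem measurable_stayProb_right (W : Measure PlanarPath) [IsProbabilityMeasure W] (z : ℝ × ℝ) :
    Measurable (stayProb W z) :=
  (measurable_stayProb W).comp measurable_prodMk_left

theorem bridgeInt_one (W : Measure PlanarPath) (z y : ℝ × ℝ) :
    bridgeInt W (fun _ ↦ 1) z y = stayProb W z y := by
  rw [bridgeInt, setLIntegral_one]
  rfl

/-- The midpoint of the time interval. -/
noncomputable def halfTime : unitInterval := ⟨1 / 2, by norm_num, by norm_num⟩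

theorem halfTime_pos : 0 < halfTime := by
  rw [← Subtype.coe_lt_coe]; simp [halfTime]

theorem halfTime_lt_one : halfTime < 1 := by
  rw [← Subtype.coe_lt_coe]; simp only [halfTime, Set.Icc.coe_one]; norm_num

theorem coe_halfTime : (halfTime : ℝ) = 1 / 2 := rfl

theorem sqrt_halfTime : (√(halfTime : ℝ))⁻¹ = √2 ∧ (√(1 - halfTime : ℝ))⁻¹ = √2 ∧
    √(halfTime * (1 - halfTime) : ℝ) = 1 / 2 := by
  rw [coe_halfTime, show (1 - 1 / 2 : ℝ) = 1 / 2 by norm_num]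
  refine ⟨by simp, by simp, ?_⟩
  rw [Real.sqrt_mul_self (by norm_num)]

theorem linePath_halfTime (z w : ℝ × ℝ) : linePath z w halfTime = (1 / 2 : ℝ) • (z + w) := by
  rw [linePath_apply, coe_halfTime]; module

theorem exists_gaussDensity_ge {α : ℝ} (hα : α ∈ Set.Ioo (-1 : ℝ) 1) (L : ℝ) :
    ∃ c : ℝ, 0 < c ∧ ∀ x, ‖x‖ ≤ L → c ≤ gaussDensity α x := by
  obtain ⟨K, hK0, hK⟩ := exists_gaussDensity_shift hα
  refine ⟨Real.exp (-(K * L * L)) * gaussDensity α 0,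
    mul_pos (Real.exp_pos _) (gaussDensity_pos hα 0), fun x hx ↦ ?_⟩
  have h := hK 0 x
  rw [norm_zero, zero_add, zero_add] at h
  refine le_trans ?_ h
  have := (gaussDensity_pos hα 0).le
  have := norm_nonneg x
  have := this.trans hx
  gcongr

theorem volume_box (a : ℝ × ℝ) {δ : ℝ} (hδ : 0 ≤ δ) :
    volume (Set.Icc a (a + δ • ((1 : ℝ), (1 : ℝ)))) = ENNReal.ofReal (δ ^ 2) := by
  rw [← Prod.mk.eta (p := a), ← Set.Icc_prod_Icc, Measure.volume_eq_prod, Measure.prod_prod,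
    Real.volume_Icc, Real.volume_Icc, sq, ENNReal.ofReal_mul hδ]
  simp

namespace IsCorrelatedBrownianLaw

variable {α : ℝ} {W : Measure PlanarPath}

theorem setLIntegral_bstays_bridgeInt (hW : IsCorrelatedBrownianLaw α W) {θ : unitInterval}
    (h0 : 0 < θ) (h1 : θ < 1) (z w : ℝ × ℝ) {H : PlanarPath → ENNReal} (hH : Measurable H) :
    ∫⁻ f in bstays z w, H (seg 0 θ (linePath z w + f)) ∂(bridgeLaw W) =
      ∫⁻ x, bridgeInt W H ((√(θ : ℝ))⁻¹ • z)
          ((√(θ : ℝ))⁻¹ • (linePath z w θ + √(θ * (1 - θ) : ℝ) • x)) *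
        stayProb W ((√(1 - θ : ℝ))⁻¹ • w)
          ((√(1 - θ : ℝ))⁻¹ • (linePath z w θ + √(θ * (1 - θ) : ℝ) • x)) ∂(endLaw W) := by
  refine (hW.setLIntegral_bstays h0 h1 z w hH).trans (lintegral_congr fun x ↦ ?_)
  simp only [bridgeInt, smul_sub]

theorem gaussDensity_mul_midpoint (hα : α ∈ Set.Ioo (-1 : ℝ) 1) (z w : ℝ × ℝ) :
    ∃ κ : ℝ, 0 < κ ∧ ∀ y, ENNReal.ofReal κ *
      (ENNReal.ofReal (gaussDensity α (√2 • (y - (1 / 2 : ℝ) • (z + w)))) *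
        ENNReal.ofReal (√2 ^ 2)) =
      ENNReal.ofReal (gaussDensity α (y - z)) * ENNReal.ofReal (gaussDensity α (y - w)) := by
  have hα' := one_sub_sq_pos hα
  set k : ℝ := ((√(2 * Real.pi))⁻¹ * (√(2 * Real.pi * (1 - α ^ 2)))⁻¹) *
        Real.exp (-gaussForm α (w - z) / 4) with hk
  have hk0 : 0 < k := by positivity
  refine ⟨k / 2, by positivity, fun y ↦ ?_⟩
  have h2 : √2 ^ 2 = (2 : ℝ) := Real.sq_sqrt (by norm_num)
  rw [← ENNReal.ofReal_mul (gaussDensity_pos hα _).le, ← ENNReal.ofReal_mul (by positivity),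
    ← ENNReal.ofReal_mul (gaussDensity_pos hα _).le, gaussDensity_midpoint, ← hk, h2]
  congr 1
  ring

theorem setLIntegral_bstays_half (hW : IsCorrelatedBrownianLaw α W)
    (hα : α ∈ Set.Ioo (-1 : ℝ) 1) (z w : ℝ × ℝ) :
    ∃ κ : ℝ, 0 < κ ∧ ∀ H : PlanarPath → ENNReal, Measurable H →
      ENNReal.ofReal κ *
        ∫⁻ f in bstays z w, H (seg 0 halfTime (linePath z w + f)) ∂(bridgeLaw W) =
      ∫⁻ y, (ENNReal.ofReal (gaussDensity α (y - √2 • z)) * bridgeInt W H (√2 • z) y) *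
        (ENNReal.ofReal (gaussDensity α (y - √2 • w)) * stayProb W (√2 • w) y) := by
  have := hW.isProbabilityMeasure
  obtain ⟨κ, hκ0, hκ⟩ := gaussDensity_mul_midpoint hα (√2 • z) (√2 • w)
  refine ⟨κ, hκ0, fun H hH ↦ ?_⟩
  have h20 : (0 : ℝ) < √2 := by positivity
  have c1 := sqrt_halfTime.1
  have c2 := sqrt_halfTime.2.1
  have c3 := sqrt_halfTime.2.2
  have F0 : Measurable fun y ↦ bridgeInt W H (√2 • z) y * stayProb W (√2 • w) y :=
    (measurable_bridgeInt W hH _).mul (measurable_stayProb_right W _)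
  have hinv : (√2 / 2)⁻¹ = √2 := by
    rw [inv_div, div_eq_iff h20.ne', Real.mul_self_sqrt (by norm_num)]
  have key := hW.lintegral_endLaw_affine hα F0 (c := √2 / 2) (by positivity)
    ((1 / 2 : ℝ) • (√2 • z + √2 • w))
  rw [hW.setLIntegral_bstays_bridgeInt halfTime_pos halfTime_lt_one z w hH, c1, c2, c3,
    linePath_halfTime]
  have e (x : ℝ × ℝ) : √2 • ((1 / 2 : ℝ) • (z + w) + (1 / 2 : ℝ) • x) =
      (1 / 2 : ℝ) • (√2 • z + √2 • w) + (√2 / 2) • x := by module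
  simp_rw [e]
  rw [key, hinv, ← lintegral_const_mul' _ _ ENNReal.ofReal_ne_top]
  refine lintegral_congr fun y ↦ ?_
  calc _ = (ENNReal.ofReal κ * (ENNReal.ofReal (gaussDensity α (√2 •
            (y - (1 / 2 : ℝ) • (√2 • z + √2 • w)))) * ENNReal.ofReal (√2 ^ 2))) *
            (bridgeInt W H (√2 • z) y * stayProb W (√2 • w) y) := by ring
    _ = _ := by rw [hκ]; ring

/-- The transition density of the killed Brownian motion is bounded by the survival probability. -/
theorem exists_gaussDensity_mul_stayProb_le (hW : IsCorrelatedBrownianLaw α W)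
    (hα : α ∈ Set.Ioo (-1 : ℝ) 1) :
    ∃ C : ℝ, 0 < C ∧ ∀ w : ℝ × ℝ, 0 < w.1 → 0 < w.2 → ∀ y,
      ENNReal.ofReal (gaussDensity α (y - w)) * stayProb W w y ≤ ENNReal.ofReal C * surv W w := by
  have := hW.isProbabilityMeasure
  obtain ⟨l, C, hl, hC, hS⟩ := hW.exists_surv_bounds hα
  obtain ⟨K, hK0, hK⟩ := exists_gaussDensity_shift hα
  set δ : ℝ := l / K with hδ
  have hδ0 : 0 < δ := by positivity
  have hKδ : K * δ = l := by rw [hδ]; field_simp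
  refine ⟨Real.exp (2 * l * δ) * C / δ ^ 2, by positivity, fun w h1 h2 y ↦ ?_⟩
  set e : ℝ × ℝ := (1, 1) with he
  set q := ENNReal.ofReal (gaussDensity α (y - w)) * stayProb W w y with hq
  have main : ENNReal.ofReal (δ ^ 2) * q ≤
      ENNReal.ofReal (Real.exp (2 * l * δ)) * survExp W l w := by
    calc ENNReal.ofReal (δ ^ 2) * q = ∫⁻ _ in Set.Icc y (y + δ • e), q := by
          rw [setLIntegral_const, volume_box _ hδ0.le, mul_comm]
      _ ≤ ∫⁻ y' in Set.Icc y (y + δ • e), ENNReal.ofReal (Real.exp (2 * l * δ)) *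
            (ENNReal.ofReal (gaussDensity α (y' - w)) *
              (ENNReal.ofReal (Real.exp (l * ‖y' - w‖)) * stayProb W w y')) := by
          refine setLIntegral_mono' measurableSet_Icc fun y' hy' ↦ ?_
          rw [hq, ← mul_assoc, ← mul_assoc, ← ENNReal.ofReal_mul (Real.exp_pos _).le,
            ← ENNReal.ofReal_mul (mul_nonneg (Real.exp_pos _).le (gaussDensity_pos hα _).le)]
          refine mul_le_mul' (ENNReal.ofReal_le_ofReal ?_) (stayProb_mono W le_rfl hy'.1)
          have hv : ‖y' - y‖ ≤ δ := by
            have a1 := hy'.1.1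
            have a2 := hy'.1.2
            have a3 := hy'.2.1
            have a4 := hy'.2.2
            simp only [Prod.fst_add, Prod.snd_add, Prod.smul_fst, Prod.smul_snd, he, smul_eq_mul,
              mul_one] at a3 a4
            refine norm_prod_le_iff.2 ⟨?_, ?_⟩ <;> rw [Real.norm_eq_abs, abs_le] <;>
              constructor <;> simp only [Prod.fst_sub, Prod.snd_sub] <;> linarith
          have hs := hK (y - w) (y' - y)
          rw [show y - w + (y' - y) = y' - w by abel] at hs
          have hn : ‖y - w‖ ≤ ‖y' - w‖ + δ := by
            calc ‖y - w‖ = ‖(y' - w) - (y' - y)‖ := by congr 1; abel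
              _ ≤ ‖y' - w‖ + ‖y' - y‖ := norm_sub_le _ _
              _ ≤ _ := by gcongr
          have hexp : K * ‖y' - y‖ * (‖y - w‖ + ‖y' - y‖) ≤ l * ‖y' - w‖ + 2 * l * δ := by
            calc _ ≤ K * δ * (‖y' - w‖ + δ + δ) := by gcongr
              _ = _ := by rw [hKδ]; ring
          calc gaussDensity α (y - w) = Real.exp (K * ‖y' - y‖ * (‖y - w‖ + ‖y' - y‖)) *
                (Real.exp (-(K * ‖y' - y‖ * (‖y - w‖ + ‖y' - y‖))) * gaussDensity α (y - w)) := by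
                rw [← mul_assoc, ← Real.exp_add, add_neg_cancel, Real.exp_zero, one_mul]
            _ ≤ Real.exp (l * ‖y' - w‖ + 2 * l * δ) * gaussDensity α (y' - w) := by
                have := (gaussDensity_pos hα (y - w)).le
                gcongr
            _ = _ := by rw [Real.exp_add]; ring
      _ ≤ ∫⁻ y', ENNReal.ofReal (Real.exp (2 * l * δ)) *
            (ENNReal.ofReal (gaussDensity α (y' - w)) *
              (ENNReal.ofReal (Real.exp (l * ‖y' - w‖)) * stayProb W w y')) :=
          setLIntegral_le_lintegral _ _
      _ = ENNReal.ofReal (Real.exp (2 * l * δ)) * ∫⁻ η in stays w,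
            ENNReal.ofReal (Real.exp (l * ‖η 1‖)) ∂W := by
          have hm : Measurable fun η : PlanarPath ↦ ENNReal.ofReal (Real.exp (l * ‖η 1‖)) :=
            (by fun_prop : Continuous fun η : PlanarPath ↦
              Real.exp (l * ‖η 1‖)).measurable.ennreal_ofReal
          rw [lintegral_const_mul, hW.setLIntegral_stays_eq hα w hm]
          · congr 1
            refine lintegral_congr fun y' ↦ ?_
            congr 1
            rw [stayProb, ← setLIntegral_const]
            refine setLIntegral_congr_fun_ae (measurableSet_bstays _ _) ?_
            filter_upwards [ae_bridgeLaw W] with f hf _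
            rw [ContinuousMap.add_apply, hf.2, linePath_apply]
            simp
          · exact ((continuous_gaussDensity α).measurable.comp (by fun_prop)).ennreal_ofReal.mul
              ((by fun_prop : Continuous fun y' : ℝ × ℝ ↦
                Real.exp (l * ‖y' - w‖)).measurable.ennreal_ofReal.mul
                ((measurable_stayProb W).comp measurable_prodMk_left))
      _ ≤ _ := by
          gcongr
          refine lintegral_mono fun η ↦ ?_
          gcongr
          exact η.norm_coe_le_norm 1
  have hδ2 : ENNReal.ofReal (δ ^ 2) ≠ 0 := by
    rw [Ne, ENNReal.ofReal_eq_zero, not_le]; positivity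
  rw [mul_comm, ← ENNReal.le_div_iff_mul_le (Or.inl hδ2) (Or.inl ENNReal.ofReal_ne_top)] at main
  refine main.trans ?_
  rw [ENNReal.div_le_iff hδ2 ENNReal.ofReal_ne_top]
  calc _ ≤ ENNReal.ofReal (Real.exp (2 * l * δ)) * (ENNReal.ofReal C * surv W w) := by
        gcongr
        exact (hS w h1 h2).1
    _ = _ := by
        rw [mul_right_comm (ENNReal.ofReal _), ← mul_assoc, ← ENNReal.ofReal_mul (by positivity),
          ← ENNReal.ofReal_mul (by positivity), div_mul_cancel₀ _ (by positivity)]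

theorem exists_surv_le_stayProb (hW : IsCorrelatedBrownianLaw α W)
    (hα : α ∈ Set.Ioo (-1 : ℝ) 1) :
    ∃ M : ℝ, 0 < M ∧ ∀ z : ℝ × ℝ, 0 < z.1 → 0 < z.2 → ∀ y, z + M • ((1 : ℝ), (1 : ℝ)) ≤ y →
      surv W z ≤ 2 * stayProb W z y := by
  obtain ⟨M, hM0, hM⟩ := hW.exists_surv_le_two_mul hα
  refine ⟨M, hM0, fun z h1 h2 y hy ↦ (hM z h1 h2).trans ?_⟩
  gcongr 2 * ?_
  rw [stayProb, bridgeLaw, Measure.map_apply continuous_bridgePart.measurable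
    (measurableSet_bstays _ _)]
  refine measure_mono_ae ?_
  filter_upwards [hW.ae_zero] with η h0 hη u
  have hs : 0 ≤ z + η u := hη.1 u
  have hn : ‖η 1‖ ≤ M := (η.norm_coe_le_norm 1).trans hη.2
  have h3 : z + η 1 ≤ y := le_trans (by gcongr; exact le_smul_one hn) hy
  have h4 : 0 ≤ (u : ℝ) • (y - (z + η 1)) := smul_nonneg (unitInterval.nonneg u) (sub_nonneg.2 h3)
  have e : linePath z y u + bridgePart η u = (z + η u) + (u : ℝ) • (y - (z + η 1)) := by
    rw [linePath_apply, bridgePart_apply, h0]; module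
  rw [e]
  exact add_nonneg hs h4

theorem exists_surv_mul_surv_le (hW : IsCorrelatedBrownianLaw α W)
    (hα : α ∈ Set.Ioo (-1 : ℝ) 1) (R : ℝ) :
    ∃ C : ℝ, 0 < C ∧ ∀ z w : ℝ × ℝ, 0 < z.1 → 0 < z.2 → 0 < w.1 → 0 < w.2 → ‖z‖ ≤ R → ‖w‖ ≤ R →
      surv W z * surv W w ≤ ENNReal.ofReal C *
        ∫⁻ y, (ENNReal.ofReal (gaussDensity α (y - z)) * stayProb W z y) *
          (ENNReal.ofReal (gaussDensity α (y - w)) * stayProb W w y) := by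
  obtain ⟨M, hM0, hM⟩ := hW.exists_surv_le_stayProb hα
  obtain ⟨c, hc0, hc⟩ := exists_gaussDensity_ge hα (R + M + 1 + R)
  refine ⟨4 / c ^ 2, by positivity, fun z w hz1 hz2 hw1 hw2 hz hw ↦ ?_⟩
  have hR : 0 ≤ R := (norm_nonneg z).trans hz
  set e : ℝ × ℝ := (1, 1) with he
  set y0 := (R + M) • e with hy0
  have hle {x y : ℝ × ℝ} (hx : ‖x‖ ≤ R) (hy : y ∈ Set.Icc y0 (y0 + (1 : ℝ) • e)) :
      x + M • e ≤ y := by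
    refine le_trans ?_ hy.1
    rw [hy0, add_smul]
    gcongr
    exact le_smul_one hx
  have hn {x y : ℝ × ℝ} (hx : ‖x‖ ≤ R) (hy : y ∈ Set.Icc y0 (y0 + (1 : ℝ) • e)) :
      c ≤ gaussDensity α (y - x) := by
    refine hc _ ((norm_sub_le _ _).trans ?_)
    gcongr
    have a1 := hy.1.1
    have a2 := hy.1.2
    have a3 := hy.2.1
    have a4 := hy.2.2
    simp only [Prod.fst_add, Prod.snd_add, Prod.smul_fst, Prod.smul_snd, he, smul_eq_mul,
      mul_one, hy0] at a1 a2 a3 a4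
    refine norm_prod_le_iff.2 ⟨?_, ?_⟩ <;> rw [Real.norm_eq_abs, abs_le] <;>
      constructor <;> linarith
  have hc2 : ENNReal.ofReal (4 / c ^ 2) * (ENNReal.ofReal c * ENNReal.ofReal c) = 4 := by
    rw [← ENNReal.ofReal_mul hc0.le, ← ENNReal.ofReal_mul (by positivity)]
    have : 4 / c ^ 2 * (c * c) = 4 := by field_simp
    rw [this]; simp
  calc surv W z * surv W w = ∫⁻ _ in Set.Icc y0 (y0 + (1 : ℝ) • e), surv W z * surv W w := by
        rw [setLIntegral_const, volume_box _ zero_le_one]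
        simp
    _ ≤ ∫⁻ y in Set.Icc y0 (y0 + (1 : ℝ) • e), ENNReal.ofReal (4 / c ^ 2) *
          ((ENNReal.ofReal (gaussDensity α (y - z)) * stayProb W z y) *
          (ENNReal.ofReal (gaussDensity α (y - w)) * stayProb W w y)) := by
        refine setLIntegral_mono' measurableSet_Icc fun y hy ↦ ?_
        calc _ ≤ (2 * stayProb W z y) * (2 * stayProb W w y) := by
              gcongr
              · exact hM z hz1 hz2 y (hle hz hy)
              · exact hM w hw1 hw2 y (hle hw hy)
          _ = 4 * (stayProb W z y * stayProb W w y) := by ring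
          _ = ENNReal.ofReal (4 / c ^ 2) * ((ENNReal.ofReal c * stayProb W z y) *
                (ENNReal.ofReal c * stayProb W w y)) := by rw [← hc2]; ring
          _ ≤ _ := by
              gcongr
              · exact hn hz hy
              · exact hn hw hy
    _ ≤ ∫⁻ y, ENNReal.ofReal (4 / c ^ 2) *
          ((ENNReal.ofReal (gaussDensity α (y - z)) * stayProb W z y) *
          (ENNReal.ofReal (gaussDensity α (y - w)) * stayProb W w y)) :=
        setLIntegral_le_lintegral _ _
    _ = _ := lintegral_const_mul' _ _ ENNReal.ofReal_ne_top

end IsCorrelatedBrownianLaw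

/-- The time reversal of a path. -/
def reversePath (f : PlanarPath) : PlanarPath := f.comp ⟨affTime 1 0, continuous_affTime 1 0⟩

theorem continuous_reversePath : Continuous reversePath := ContinuousMap.continuous_precomp _

theorem affTime_one_zero (u : unitInterval) : affTime 1 0 u = unitInterval.symm u := by
  ext; simp [coe_affTime]

theorem reversePath_apply (f : PlanarPath) (u : unitInterval) :
    reversePath f u = f (unitInterval.symm u) := by
  rw [← affTime_one_zero]; rfl

theorem reversePath_linePath_add (z w : ℝ × ℝ) (f : PlanarPath) :
    reversePath (linePath z w + f) = linePath w z + reversePath f := by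
  ext1 u
  rw [reversePath_apply, ContinuousMap.add_apply, ContinuousMap.add_apply, reversePath_apply,
    linePath_apply, linePath_apply, unitInterval.coe_symm_eq]
  module

theorem mem_bstays_reversePath (z w : ℝ × ℝ) (f : PlanarPath) :
    reversePath f ∈ bstays w z ↔ f ∈ bstays z w := by
  have h (z w : ℝ × ℝ) (f : PlanarPath) (hf : f ∈ bstays z w) : reversePath f ∈ bstays w z := by
    intro u
    rw [← ContinuousMap.add_apply, ← reversePath_linePath_add, reversePath_apply]
    exact hf _
  refine ⟨fun hf ↦ ?_, h z w f⟩
  have := h _ _ _ hf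
  have e : reversePath (reversePath f) = f := by
    ext1 u; rw [reversePath_apply, reversePath_apply, unitInterval.symm_symm]
  rwa [e] at this

theorem seg_reversePath (r : unitInterval) (f : PlanarPath) :
    seg 0 r (reversePath f) = seg 1 (unitInterval.symm r) f := by
  ext1 u
  rw [seg_apply, seg_apply, reversePath_apply, reversePath_apply, unitInterval.symm_zero]
  have e : unitInterval.symm (affTime 0 r u) = affTime 1 (unitInterval.symm r) u := by
    ext; simp only [coe_affTime, unitInterval.coe_symm_eq, Set.Icc.coe_zero, Set.Icc.coe_one]; ring
  rw [e, unitInterval.coe_symm_eq]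
  congr 3
  simp only [Set.Icc.coe_zero, Set.Icc.coe_one, sub_zero]
  rw [sub_sub_cancel_left, abs_neg]

theorem seg_seg_halfTime {r r' : unitInterval} (h : (r' : ℝ) = 2 * r) (η : PlanarPath) :
    seg 0 r' (seg 0 halfTime η) = seg 0 r η := by
  ext1 u
  have e0 : |((r : ℝ) - (0 : unitInterval))| = r := by simp [abs_of_nonneg (unitInterval.nonneg r)]
  have e1 : |((r' : ℝ) - (0 : unitInterval))| = 2 * r := by
    rw [← h]; simp [abs_of_nonneg (unitInterval.nonneg r')]
  have e2 : |((halfTime : ℝ) - (0 : unitInterval))| = halfTime := by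
    simp [abs_of_nonneg (unitInterval.nonneg halfTime)]
  have c1 := sqrt_halfTime.1
  have a : affTime 0 halfTime (affTime 0 r' u) = affTime 0 r u := by
    ext; simp only [coe_affTime, coe_halfTime, h, Set.Icc.coe_zero]; ring
  rw [seg_apply, seg_apply, seg_apply, seg_apply, e0, e1, e2, c1, affTime_zero, sub_self, smul_zero,
    sub_zero, smul_smul, a, Real.sqrt_mul zero_le_two, mul_inv, mul_right_comm,
    inv_mul_cancel₀ (by positivity), one_mul]

namespace IsCorrelatedBrownianLaw

variable {α : ℝ} {W : Measure PlanarPath}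

theorem setLIntegral_bstays_reverse (hW : IsCorrelatedBrownianLaw α W) (z w : ℝ × ℝ)
    {H : PlanarPath → ENNReal} (hH : Measurable H) :
    ∫⁻ f in bstays z w, H (linePath z w + f) ∂(bridgeLaw W) =
      ∫⁻ f in bstays w z, H (reversePath (linePath w z + f)) ∂(bridgeLaw W) := by
  have hr : (bridgeLaw W).map reversePath = bridgeLaw W := hW.map_reverse_bridgeLaw
  have hm : Measurable fun f : PlanarPath ↦ H (linePath z w + f) := hH.comp (measurable_const_add _)
  conv_lhs => rw [← hr]
  rw [← lintegral_indicator (measurableSet_bstays _ _),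
    ← lintegral_indicator (measurableSet_bstays _ _),
    lintegral_map (hm.indicator (measurableSet_bstays _ _)) continuous_reversePath.measurable]
  refine lintegral_congr fun f ↦ ?_
  by_cases h : f ∈ bstays w z
  · rw [Set.indicator_of_mem h, Set.indicator_of_mem ((mem_bstays_reversePath _ _ _).2 h),
      reversePath_linePath_add]
  · rw [Set.indicator_of_notMem h,
      Set.indicator_of_notMem (fun h' ↦ h ((mem_bstays_reversePath _ _ _).1 h'))]

theorem stayProb_comm (hW : IsCorrelatedBrownianLaw α W) (z w : ℝ × ℝ) :
    stayProb W z w = stayProb W w z := by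
  have := hW.setLIntegral_bstays_reverse z w (H := fun _ ↦ 1) measurable_const
  rwa [setLIntegral_one, setLIntegral_one] at this

theorem exists_stayProb_bounds (hW : IsCorrelatedBrownianLaw α W)
    (hα : α ∈ Set.Ioo (-1 : ℝ) 1) (R : ℝ) :
    ∃ C : ℝ, 0 < C ∧ ∀ z w : ℝ × ℝ, 0 < z.1 → 0 < z.2 → 0 < w.1 → 0 < w.2 → ‖z‖ ≤ R → ‖w‖ ≤ R →
      stayProb W z w ≠ 0 ∧ ∀ r : unitInterval, 0 < r → (r : ℝ) < 1 / 2 →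
        ∫⁻ f in bstays z w, ENNReal.ofReal ‖seg 0 r (linePath z w + f)‖ ∂(bridgeLaw W) ≤
          ENNReal.ofReal C * stayProb W z w := by
  have := hW.isProbabilityMeasure
  obtain ⟨C1, hC1, h1⟩ := hW.exists_gaussDensity_mul_stayProb_le hα
  obtain ⟨C2, hC2, h2⟩ := hW.exists_lintegral_seg_le hα
  obtain ⟨C3, hC3, h3⟩ := hW.exists_surv_mul_surv_le hα (√2 * R)
  obtain ⟨l, C0, hl, hC0, h0⟩ := hW.exists_surv_bounds hα
  refine ⟨C1 * C2 * C3, by positivity, fun z w hz1 hz2 hw1 hw2 hz hw ↦ ?_⟩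
  have h20 : (0 : ℝ) < √2 := by positivity
  have hz1' : 0 < (√2 • z).1 := by simpa using hz1
  have hz2' : 0 < (√2 • z).2 := by simpa using hz2
  have hw1' : 0 < (√2 • w).1 := by simpa using hw1
  have hw2' : 0 < (√2 • w).2 := by simpa using hw2
  have hn (x : ℝ × ℝ) (hx : ‖x‖ ≤ R) : ‖√2 • x‖ ≤ √2 * R := by
    rw [norm_smul, Real.norm_of_nonneg h20.le]; gcongr
  obtain ⟨κ, hκ, hs⟩ := hW.setLIntegral_bstays_half hα z w
  have hκ0 : ENNReal.ofReal κ ≠ 0 := by simpa using hκ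
  have lower : surv W (√2 • z) * surv W (√2 • w) ≤
      ENNReal.ofReal C3 * (ENNReal.ofReal κ * stayProb W z w) := by
    have e := hs (fun _ ↦ 1) measurable_const
    rw [setLIntegral_one] at e
    simp only [bridgeInt_one] at e
    rw [stayProb, e]
    exact h3 _ _ hz1' hz2' hw1' hw2' (hn z hz) (hn w hw)
  refine ⟨fun hq ↦ ?_, fun r hr0 hr ↦ ?_⟩
  · rw [hq, mul_zero, mul_zero, nonpos_iff_eq_zero, mul_eq_zero] at lower
    exact lower.elim (h0 _ hz1' hz2').2.2 (h0 _ hw1' hw2').2.2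
  · have hr0' : (0 : ℝ) < r := hr0
    let r' : unitInterval := ⟨2 * r, by linarith, by linarith⟩
    have hr'0 : 0 < r' := by
      rw [← Subtype.coe_lt_coe]; simpa [r'] using hr0
    have hr'1 : r' < 1 := by
      rw [← Subtype.coe_lt_coe]; simp only [r', Set.Icc.coe_one]; linarith
    have hm : Measurable fun η : PlanarPath ↦ ENNReal.ofReal ‖seg 0 r' η‖ :=
      (continuous_norm.measurable.comp (measurable_seg 0 r')).ennreal_ofReal
    have e := hs _ hm
    have e' (f : PlanarPath) : seg 0 r' (seg 0 halfTime (linePath z w + f)) =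
      seg 0 r (linePath z w + f) := seg_seg_halfTime rfl _
    simp only [e'] at e
    rw [← ENNReal.mul_le_mul_iff_right hκ0 ENNReal.ofReal_ne_top, e]
    have hm1 : Measurable fun y ↦ ENNReal.ofReal (gaussDensity α (y - √2 • z)) *
        bridgeInt W (fun η ↦ ENNReal.ofReal ‖seg 0 r' η‖) (√2 • z) y :=
      ((continuous_gaussDensity α).measurable.comp (by fun_prop)).ennreal_ofReal.mul
        (measurable_bridgeInt W hm _)
    calc _ ≤ ∫⁻ y, (ENNReal.ofReal (gaussDensity α (y - √2 • z)) *
            bridgeInt W (fun η ↦ ENNReal.ofReal ‖seg 0 r' η‖) (√2 • z) y) *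
            (ENNReal.ofReal C1 * surv W (√2 • w)) := by
          refine lintegral_mono fun y ↦ ?_
          exact mul_le_mul' le_rfl (h1 _ hw1' hw2' y)
      _ = (∫⁻ η in stays (√2 • z), ENNReal.ofReal ‖seg 0 r' η‖ ∂W) *
            (ENNReal.ofReal C1 * surv W (√2 • w)) := by
          rw [lintegral_mul_const _ hm1, hW.setLIntegral_stays_eq hα _ hm]
          rfl
      _ ≤ (ENNReal.ofReal C2 * surv W (√2 • z)) * (ENNReal.ofReal C1 * surv W (√2 • w)) := by
          gcongr
          exact h2 _ hz1' hz2' r' hr'0 hr'1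
      _ = ENNReal.ofReal C1 * ENNReal.ofReal C2 * (surv W (√2 • z) * surv W (√2 • w)) := by ring
      _ ≤ ENNReal.ofReal C1 * ENNReal.ofReal C2 *
            (ENNReal.ofReal C3 * (ENNReal.ofReal κ * stayProb W z w)) := by gcongr
      _ = _ := by
          rw [ENNReal.ofReal_mul (by positivity), ENNReal.ofReal_mul hC1.le]
          ring

theorem setLIntegral_bstays_apply (hW : IsCorrelatedBrownianLaw α W) {θ : unitInterval}
    (h0 : 0 < θ) (h1 : θ < 1) (z w : ℝ × ℝ) {g : ℝ × ℝ → ENNReal} (hg : Measurable g) :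
    ∫⁻ f in bstays z w, g (linePath z w θ + f θ) ∂(bridgeLaw W) =
      ∫⁻ x, (fun y ↦ g y * (stayProb W ((√(θ : ℝ))⁻¹ • z) ((√(θ : ℝ))⁻¹ • y) *
        stayProb W ((√(1 - θ : ℝ))⁻¹ • w) ((√(1 - θ : ℝ))⁻¹ • y)))
          (linePath z w θ + √(θ * (1 - θ) : ℝ) • x) ∂(endLaw W) := by
  have hr0 : 0 < √(θ : ℝ) := Real.sqrt_pos.2 h0
  have hH : Measurable fun η : PlanarPath ↦ g (z + √(θ : ℝ) • η 1) := by
    refine hg.comp (Continuous.measurable ?_)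
    fun_prop
  have key := hW.setLIntegral_bstays_bridgeInt h0 h1 z w hH
  have hb (y : ℝ × ℝ) : bridgeInt W (fun η ↦ g (z + √(θ : ℝ) • η 1)) ((√(θ : ℝ))⁻¹ • z)
      ((√(θ : ℝ))⁻¹ • y) = g y * stayProb W ((√(θ : ℝ))⁻¹ • z) ((√(θ : ℝ))⁻¹ • y) := by
    rw [bridgeInt, stayProb, ← setLIntegral_const]
    refine setLIntegral_congr_fun_ae (measurableSet_bstays _ _) ?_
    filter_upwards [ae_bridgeLaw W] with f hf _
    rw [ContinuousMap.add_apply, hf.2, linePath_apply]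
    simp [smul_sub, smul_inv_smul₀ hr0.ne']
  refine Eq.trans (setLIntegral_congr_fun_ae (measurableSet_bstays _ _) ?_)
    (key.trans (lintegral_congr fun x ↦ ?_))
  · filter_upwards [ae_bridgeLaw W] with f hf _
    have e0 : |((θ : ℝ) - (0 : unitInterval))| = θ := by
      simp [abs_of_nonneg (unitInterval.nonneg θ)]
    rw [seg_apply, e0, smul_inv_smul₀ hr0.ne', affTime_one, ContinuousMap.add_apply,
      ContinuousMap.add_apply, hf.1, linePath_apply z w 0]
    simp
  · rw [hb, mul_assoc]

/-- A killed bridge with an end point close to `z₀` has, at a small time, a positive density at a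
comparable distance from `z₀`. -/
theorem exists_minorization (hW : IsCorrelatedBrownianLaw α W) (hα : α ∈ Set.Ioo (-1 : ℝ) 1)
    {R M : ℝ} (hR : 0 ≤ R) (hM : 0 ≤ M) :
    ∃ c N : ℝ, 0 < c ∧ 0 < N ∧ ∀ (z₀ z w : ℝ × ℝ) (θ : unitInterval), 0 < z.1 → 0 < z.2 → 0 < w.1 →
      0 < w.2 → ‖z‖ ≤ R → ‖w‖ ≤ R → 0 < θ → (θ : ℝ) ≤ 1 / 4 → ‖z - z₀‖ ≤ √(θ : ℝ) * M →
      ∀ A : Set (ℝ × ℝ), MeasurableSet A →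
      A ⊆ Set.Icc (z₀ + (√(θ : ℝ) * N) • ((1 : ℝ), (1 : ℝ)))
        (z₀ + (√(θ : ℝ) * (N + 1)) • ((1 : ℝ), (1 : ℝ))) →
      ENNReal.ofReal (c / θ) * volume A * stayProb W z w ≤
        bridgeLaw W (bstays z w ∩ {f | linePath z w θ + f θ ∈ A}) := by
  have := hW.isProbabilityMeasure
  obtain ⟨C, hC, hE⟩ := hW.exists_stayProb_bounds hα R
  set N := M + 2 * C with hN
  obtain ⟨c, hc0, hc⟩ := exists_gaussDensity_ge hα (2 * (N + 1 + M + 2 * R))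
  refine ⟨c / 2, N, by positivity, by positivity,
    fun z₀ z w θ hz1 hz2 hw1 hw2 hz hw hθ0 hθ hzz A hA hAN ↦ ?_⟩
  set e : ℝ × ℝ := (1, 1) with he
  have hθ0' : (0 : ℝ) < θ := hθ0
  have hθ1 : θ < 1 := by
    rw [← Subtype.coe_lt_coe]; simp only [Set.Icc.coe_one]; linarith
  have hs0 : 0 < √(θ : ℝ) := Real.sqrt_pos.2 hθ0'
  obtain ⟨hq0, hE⟩ := hE z w hz1 hz2 hw1 hw2 hz hw
  replace hE := hE θ hθ0 (by linarith)
  set q := stayProb W z w with hq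
  have hq1 : q ≠ ⊤ := measure_ne_top _ _
  set F : ℝ × ℝ → ENNReal := fun y ↦ stayProb W ((√(θ : ℝ))⁻¹ • z) ((√(θ : ℝ))⁻¹ • y) *
        stayProb W ((√(1 - θ : ℝ))⁻¹ • w) ((√(1 - θ : ℝ))⁻¹ • y) with hF
  have hFm : Monotone F := by
    intro y y' h
    refine mul_le_mul' (stayProb_mono W le_rfl ?_) (stayProb_mono W le_rfl ?_)
    · exact smul_le_smul_of_nonneg_left h (by positivity)
    · exact smul_le_smul_of_nonneg_left h (by positivity)
  set y0 := z₀ + (√(θ : ℝ) * N) • e with hy0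
  have hval (f : PlanarPath) (hf : f 0 = 0) :
      ‖linePath z w θ + f θ - z‖ ≤ √(θ : ℝ) * ‖seg 0 θ (linePath z w + f)‖ := by
    have h := (seg 0 θ (linePath z w + f)).norm_coe_le_norm 1
    have e0 : |((θ : ℝ) - (0 : unitInterval))| = θ := by
      simp [abs_of_nonneg (unitInterval.nonneg θ)]
    rw [seg_apply, e0, norm_smul, affTime_one, ContinuousMap.add_apply, ContinuousMap.add_apply, hf,
      linePath_apply z w 0, norm_inv, Real.norm_of_nonneg hs0.le, inv_mul_le_iff₀ hs0] at h
    simpa using h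
  have hhalf : q ≤ 2 * F y0 := by
    set g : ℝ × ℝ → ENNReal := (Set.Iic y0).indicator 1 with hg
    have hgm : Measurable g := measurable_one.indicator measurableSet_Iic
    have hmg : Measurable fun f : PlanarPath ↦ g (linePath z w θ + f θ) :=
      hgm.comp ((continuous_eval_const θ).measurable.const_add _)
    have hone : q ≤ ∫⁻ f in bstays z w, g (linePath z w θ + f θ) ∂(bridgeLaw W) +
        ENNReal.ofReal (2 * C)⁻¹ *
        ∫⁻ f in bstays z w, ENNReal.ofReal ‖seg 0 θ (linePath z w + f)‖ ∂(bridgeLaw W) := by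
      rw [← lintegral_const_mul' _ _ ENNReal.ofReal_ne_top, ← lintegral_add_left hmg, hq, stayProb,
        ← setLIntegral_one]
      refine setLIntegral_mono_ae' (measurableSet_bstays _ _) ?_
      filter_upwards [ae_bridgeLaw W] with f hf _
      by_cases hy : linePath z w θ + f θ ≤ y0
      · have : g (linePath z w θ + f θ) = 1 :=
          Set.indicator_of_mem (show _ ∈ Set.Iic y0 from hy) _
        rw [this]
        exact le_self_add
      · refine le_add_left ?_
        rw [← ENNReal.ofReal_mul (by positivity), ← ENNReal.ofReal_one]
        refine ENNReal.ofReal_le_ofReal ?_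
        rw [inv_mul_eq_div, le_div_iff₀ (by positivity), one_mul]
        by_contra! hlt
        refine hy ?_
        have h1 : ‖linePath z w θ + f θ - z₀‖ ≤ √(θ : ℝ) * N := by
          calc _ = ‖(linePath z w θ + f θ - z) + (z - z₀)‖ := by congr 1; abel
            _ ≤ ‖linePath z w θ + f θ - z‖ + ‖z - z₀‖ := norm_add_le _ _
            _ ≤ √(θ : ℝ) * (2 * C) + √(θ : ℝ) * M :=
                add_le_add ((hval f hf.1).trans (by gcongr)) hzz
            _ = _ := by rw [hN]; ring
        have h2 := le_smul_one h1
        rw [hy0]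
        rwa [sub_le_iff_le_add'] at h2
    have htwo : ∫⁻ f in bstays z w, g (linePath z w θ + f θ) ∂(bridgeLaw W) ≤ F y0 := by
      rw [hW.setLIntegral_bstays_apply hθ0 hθ1 z w hgm]
      calc _ ≤ ∫⁻ _, F y0 ∂(endLaw W) := by
            refine lintegral_mono fun x ↦ ?_
            beta_reduce
            by_cases hy : linePath z w θ + √(θ * (1 - θ) : ℝ) • x ≤ y0
            · rw [hg, Set.indicator_of_mem (show _ ∈ Set.Iic y0 from hy), Pi.one_apply, one_mul]
              exact hFm hy
            · rw [hg, Set.indicator_of_notMem (show _ ∉ Set.Iic y0 from hy), zero_mul]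
              exact zero_le
        _ = F y0 := by rw [lintegral_const, measure_univ, mul_one]
    have hthree : ENNReal.ofReal (2 * C)⁻¹ * ∫⁻ f in bstays z w,
        ENNReal.ofReal ‖seg 0 θ (linePath z w + f)‖ ∂(bridgeLaw W) ≤ 2⁻¹ * q := by
      calc _ ≤ ENNReal.ofReal (2 * C)⁻¹ * (ENNReal.ofReal C * q) := by gcongr
        _ = _ := by
          rw [← mul_assoc, ← ENNReal.ofReal_mul (by positivity),
            show (2 * C)⁻¹ * C = 2⁻¹ by field_simp, ENNReal.ofReal_inv_of_pos two_pos,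
            ENNReal.ofReal_ofNat]
    have h4 : 2⁻¹ * q + 2⁻¹ * q ≤ F y0 + 2⁻¹ * q := by
      rw [← add_mul, ENNReal.inv_two_add_inv_two, one_mul]
      exact hone.trans (add_le_add htwo hthree)
    have h5 : 2⁻¹ * q ≤ F y0 :=
      (ENNReal.add_le_add_iff_right (ENNReal.mul_ne_top (by simp) hq1)).1 h4
    calc q = 2 * (2⁻¹ * q) := by
          rw [← mul_assoc, ENNReal.mul_inv_cancel two_ne_zero ENNReal.ofNat_ne_top, one_mul]
      _ ≤ _ := by gcongr
  set σ := √(θ * (1 - θ) : ℝ) with hσ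
  have h1θ : (0 : ℝ) < 1 - θ := by linarith
  have hσ0 : 0 < σ := Real.sqrt_pos.2 (by positivity)
  have hσ2 : σ ^ 2 ≤ θ := by
    rw [hσ, Real.sq_sqrt (by positivity)]; nlinarith
  have hσ3 : √(θ : ℝ) / 2 ≤ σ := by
    rw [hσ]
    refine Real.le_sqrt_of_sq_le ?_
    rw [div_pow, Real.sq_sqrt hθ0'.le]
    nlinarith
  have hgA : Measurable (A.indicator (1 : ℝ × ℝ → ENNReal)) := measurable_one.indicator hA
  have hmass : ENNReal.ofReal (c / θ) * volume A ≤
      ∫⁻ x, A.indicator 1 (linePath z w θ + σ • x) ∂(endLaw W) := by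
    rw [hW.lintegral_endLaw_affine hα hgA hσ0]
    calc _ = ∫⁻ _ in A, ENNReal.ofReal (c / θ) := by rw [setLIntegral_const]
      _ ≤ ∫⁻ y in A, ENNReal.ofReal (gaussDensity α (σ⁻¹ • (y - linePath z w θ))) *
            A.indicator 1 y * ENNReal.ofReal (σ⁻¹ ^ 2) := by
          refine setLIntegral_mono' hA fun y hy ↦ ?_
          rw [Set.indicator_of_mem hy, Pi.one_apply, mul_one,
            ← ENNReal.ofReal_mul (gaussDensity_pos hα _).le]
          refine ENNReal.ofReal_le_ofReal ?_
          rw [div_eq_mul_inv]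
          refine mul_le_mul (hc _ ?_) ?_ (by positivity) (gaussDensity_pos hα _).le
          · rw [norm_smul, norm_inv, Real.norm_of_nonneg hσ0.le, inv_mul_le_iff₀ hσ0]
            have a1 : ‖y - z₀‖ ≤ √(θ : ℝ) * (N + 1) := by
              have b := hAN hy
              have b1 := b.1.1
              have b2 := b.1.2
              have b3 := b.2.1
              have b4 := b.2.2
              simp only [Prod.fst_add, Prod.snd_add, Prod.smul_fst, Prod.smul_snd, he, hy0,
                smul_eq_mul, mul_one] at b1 b2 b3 b4
              have : 0 ≤ √(θ : ℝ) * N := by positivity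
              have : 0 ≤ √(θ : ℝ) * (N + 1) := by positivity
              refine norm_prod_le_iff.2 ⟨?_, ?_⟩ <;> rw [Real.norm_eq_abs, abs_le] <;>
                constructor <;> simp only [Prod.fst_sub, Prod.snd_sub] <;> linarith
            have hle : (θ : ℝ) ≤ √(θ : ℝ) := by
              refine Real.le_sqrt_of_sq_le ?_
              nlinarith
            have a2 : ‖(θ : ℝ) • (w - z)‖ ≤ √(θ : ℝ) * (2 * R) := by
              rw [norm_smul, Real.norm_of_nonneg hθ0'.le]
              gcongr
              calc ‖w - z‖ ≤ ‖w‖ + ‖z‖ := norm_sub_le _ _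
                _ ≤ 2 * R := by linarith
            calc ‖y - linePath z w θ‖ = ‖(y - z₀) - (z - z₀) - (θ : ℝ) • (w - z)‖ := by
                  rw [linePath_apply]; congr 1; abel
              _ ≤ ‖y - z₀‖ + ‖z - z₀‖ + ‖(θ : ℝ) • (w - z)‖ :=
                  (norm_sub_le _ _).trans (by gcongr; exact norm_sub_le _ _)
              _ ≤ √(θ : ℝ) * (N + 1) + √(θ : ℝ) * M + √(θ : ℝ) * (2 * R) := by gcongr
              _ = √(θ : ℝ) / 2 * (2 * (N + 1 + M + 2 * R)) := by ring
              _ ≤ _ := by gcongr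
          · rw [inv_pow]
            gcongr
      _ ≤ _ := setLIntegral_le_lintegral _ _
  have hprob : bridgeLaw W (bstays z w ∩ {f | linePath z w θ + f θ ∈ A}) =
      ∫⁻ f in bstays z w, A.indicator 1 (linePath z w θ + f θ) ∂(bridgeLaw W) := by
    have hS : MeasurableSet {f : PlanarPath | linePath z w θ + f θ ∈ A} :=
      ((continuous_eval_const θ).measurable.const_add _) hA
    rw [Set.inter_comm, ← Measure.restrict_apply hS, ← lintegral_indicator_one hS]
    rfl
  rw [hprob, hW.setLIntegral_bstays_apply hθ0 hθ1 z w hgA]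
  calc _ ≤ ENNReal.ofReal (c / 2 / θ) * volume A * (2 * F y0) := by gcongr
    _ = ENNReal.ofReal (c / θ) * volume A * F y0 := by
        rw [show c / θ = 2 * (c / 2 / θ) by field_simp, ENNReal.ofReal_mul zero_le_two,
          ENNReal.ofReal_ofNat]
        ring
    _ ≤ (∫⁻ x, A.indicator 1 (linePath z w θ + σ • x) ∂(endLaw W)) * F y0 := by gcongr
    _ = ∫⁻ x, A.indicator 1 (linePath z w θ + σ • x) * F y0 ∂(endLaw W) := by
        have hm : Measurable fun x : ℝ × ℝ ↦
            A.indicator (1 : ℝ × ℝ → ENNReal) (linePath z w θ + σ • x) :=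
          hgA.comp (by fun_prop)
        rw [lintegral_mul_const _ hm]
    _ ≤ _ := by
        refine lintegral_mono fun x ↦ ?_
        beta_reduce
        by_cases hy : linePath z w θ + σ • x ∈ A
        · gcongr
          exact hFm (hAN hy).1
        · rw [Set.indicator_of_notMem hy, zero_mul]
          exact zero_le

end IsCorrelatedBrownianLaw

/-! ### Conditioned bridges on general time intervals -/

/-- The proportion of the interval from `s` to `t` that has passed at time `r`. -/
noncomputable def relTime (s t : unitInterval) (r : Set.Icc s t) : unitInterval :=
  Set.projIcc (0 : ℝ) 1 zero_le_one (((r : unitInterval) - s : ℝ) / (t - s : ℝ))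

theorem continuous_relTime (s t : unitInterval) : Continuous (relTime s t) := by
  refine continuous_projIcc.comp ?_
  fun_prop

theorem coe_relTime {s t : unitInterval} (h : s < t) (r : Set.Icc s t) :
    (relTime s t r : ℝ) = ((r : unitInterval) - s : ℝ) / (t - s : ℝ) := by
  have h' : (0 : ℝ) < t - s := sub_pos.2 h
  have h1 : (s : ℝ) ≤ (r : unitInterval) := r.2.1
  have h2 : ((r : unitInterval) : ℝ) ≤ t := r.2.2
  rw [relTime, Set.projIcc_of_mem _ ⟨div_nonneg (by linarith) h'.le,
    (div_le_one h').2 (by linarith)⟩]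

theorem affTime_relTime {s t : unitInterval} (h : s < t) (r : Set.Icc s t) :
    affTime s t (relTime s t r) = r := by
  have h' : (0 : ℝ) < t - s := sub_pos.2 h
  ext
  rw [coe_affTime, coe_relTime h]
  field_simp
  ring

theorem affTime_mem {s t : unitInterval} (h : s ≤ t) (u : unitInterval) :
    affTime s t u ∈ Set.Icc s t := by
  have h0 := unitInterval.nonneg u
  have h1 := unitInterval.le_one u
  have h' : (s : ℝ) ≤ t := h
  constructor <;> rw [← Subtype.coe_le_coe, coe_affTime] <;> nlinarith

theorem relTime_affTime {s t : unitInterval} (h : s < t) (u : unitInterval) :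
    relTime s t ⟨affTime s t u, affTime_mem h.le u⟩ = u := by
  have h' : (0 : ℝ) < t - s := sub_pos.2 h
  ext
  rw [coe_relTime h, coe_affTime]
  field_simp
  ring

/-- The path from `z` to `w` on `[s, t]` with the fluctuations given by `f`, in Brownian scaling. -/
noncomputable def bridgeOf (s t : unitInterval) (z w : ℝ × ℝ) (f : PlanarPath) :
    C(Set.Icc s t, ℝ × ℝ) where
  toFun r := linePath z w (relTime s t r) + √(t - s : ℝ) • f (relTime s t r)
  continuous_toFun := by
    have := continuous_relTime s t
    fun_prop

theorem bridgeOf_apply (s t : unitInterval) (z w : ℝ × ℝ) (f : PlanarPath) (r : Set.Icc s t) :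
    bridgeOf s t z w f r = linePath z w (relTime s t r) + √(t - s : ℝ) • f (relTime s t r) := rfl

theorem bridgeOf_eq_smul {s t : unitInterval} (h : s < t) (z w : ℝ × ℝ) (f : PlanarPath)
    (r : Set.Icc s t) : bridgeOf s t z w f r = √(t - s : ℝ) •
      (linePath ((√(t - s : ℝ))⁻¹ • z) ((√(t - s : ℝ))⁻¹ • w) + f) (relTime s t r) := by
  have : √(t - s : ℝ) ≠ 0 := (Real.sqrt_pos.2 (sub_pos.2 h)).ne'
  rw [bridgeOf_apply, ContinuousMap.add_apply, smul_add, linePath_apply, linePath_apply, smul_add,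
    smul_comm (√_) (_ : ℝ) (_ - _), smul_sub (√_), smul_inv_smul₀ this, smul_inv_smul₀ this]

theorem continuous_bridgeOf (s t : unitInterval) :
    Continuous fun p : ((ℝ × ℝ) × (ℝ × ℝ)) × PlanarPath ↦ bridgeOf s t p.1.1 p.1.2 p.2 := by
  apply ContinuousMap.continuous_of_continuous_uncurry
  have := continuous_relTime s t
  have h : Continuous fun q : (((ℝ × ℝ) × (ℝ × ℝ)) × PlanarPath) × Set.Icc s t ↦
      (q.1.1.1 + (relTime s t q.2 : ℝ) • (q.1.1.2 - q.1.1.1)) +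
        √(t - s : ℝ) • q.1.2 (relTime s t q.2) := by fun_prop
  exact h

theorem measurable_bridgeOf (s t : unitInterval) (z w : ℝ × ℝ) : Measurable (bridgeOf s t z w) :=
  ((continuous_bridgeOf s t).comp (Continuous.prodMk_right (z, w))).measurable

theorem bridge_eq_bridgeOf {s t : unitInterval} (h : s < t) (z w : ℝ × ℝ) (η : PlanarPath) :
    bridge s t z w η = bridgeOf s t z w (bridgePart (seg s t η)) := by
  have h' : (0 : ℝ) < t - s := sub_pos.2 h
  ext1 r
  have e := sqrt_smul_bridgePart_seg h.ne (relTime s t r) η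
  rw [abs_of_pos h', affTime_relTime h] at e
  rw [bridgeOf_apply, e, linePath_apply, coe_relTime h]
  change z + (η r - η s) - (((r : unitInterval) - s : ℝ) / (t - s : ℝ)) •
    ((η t - η s) - (w - z)) = _
  module

theorem bridgeOf_mem_stay {s t : unitInterval} (h : s < t) (z w : ℝ × ℝ) (f : PlanarPath) :
    bridgeOf s t z w f ∈ stayInQuadrant s t ↔
      f ∈ bstays ((√(t - s : ℝ))⁻¹ • z) ((√(t - s : ℝ))⁻¹ • w) := by
  have hs : 0 < √(t - s : ℝ) := Real.sqrt_pos.2 (sub_pos.2 h)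
  have e (r : Set.Icc s t) : 0 ≤ bridgeOf s t z w f r ↔
      0 ≤ linePath ((√(t - s : ℝ))⁻¹ • z) ((√(t - s : ℝ))⁻¹ • w) (relTime s t r) +
        f (relTime s t r) := by
    rw [bridgeOf_eq_smul h, quadrant_smul_iff hs, ContinuousMap.add_apply]
  constructor
  · intro hf u
    have := (e ⟨affTime s t u, affTime_mem h.le u⟩).1 (hf _)
    rwa [relTime_affTime h] at this
  · exact fun hf r ↦ (e r).2 (hf _)

namespace IsCorrelatedBrownianLaw

variable {α : ℝ} {W : Measure PlanarPath}

theorem map_bridge (hW : IsCorrelatedBrownianLaw α W) {s t : unitInterval} (h : s < t)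
    (z w : ℝ × ℝ) : W.map (bridge s t z w) = (bridgeLaw W).map (bridgeOf s t z w) := by
  have hm : Measurable fun η ↦ bridgePart (seg s t η) :=
    continuous_bridgePart.measurable.comp (measurable_seg _ _)
  rw [← hW.map_bridgePart_seg h.ne, Measure.map_map (measurable_bridgeOf s t z w) hm]
  congr 1
  ext1 η
  exact bridge_eq_bridgeOf h z w η

theorem quadrantBridge_eq (hW : IsCorrelatedBrownianLaw α W) {s t : unitInterval} (h : s < t)
    (z w : ℝ × ℝ) : quadrantBridge W s t z w =
      (stayProb W ((√(t - s : ℝ))⁻¹ • z) ((√(t - s : ℝ))⁻¹ • w))⁻¹ •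
        ((bridgeLaw W).restrict (bstays ((√(t - s : ℝ))⁻¹ • z) ((√(t - s : ℝ))⁻¹ • w))).map
          (bridgeOf s t z w) := by
  have e : bridgeOf s t z w ⁻¹' stayInQuadrant s t =
      bstays ((√(t - s : ℝ))⁻¹ • z) ((√(t - s : ℝ))⁻¹ • w) :=
    Set.ext fun f ↦ bridgeOf_mem_stay h z w f
  rw [quadrantBridge, ProbabilityTheory.cond, hW.map_bridge h,
    Measure.map_apply (measurable_bridgeOf s t z w) (measurableSet_stayInQuadrant s t),
    Measure.restrict_map (measurable_bridgeOf s t z w) (measurableSet_stayInQuadrant s t), e]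
  rfl

theorem lintegral_quadrantBridge_le (hW : IsCorrelatedBrownianLaw α W) {s t : unitInterval}
    (h : s < t) (z w : ℝ × ℝ) (G : C(Set.Icc s t, ℝ × ℝ) → ENNReal) :
    ∫⁻ f, G f ∂(quadrantBridge W s t z w) ≤
      (stayProb W ((√(t - s : ℝ))⁻¹ • z) ((√(t - s : ℝ))⁻¹ • w))⁻¹ *
        ∫⁻ f in bstays ((√(t - s : ℝ))⁻¹ • z) ((√(t - s : ℝ))⁻¹ • w), G (bridgeOf s t z w f)
          ∂(bridgeLaw W) := by
  rw [hW.quadrantBridge_eq h, lintegral_smul_measure, smul_eq_mul]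
  gcongr
  exact lintegral_map_le _ _

theorem quadrantBridge_apply (hW : IsCorrelatedBrownianLaw α W) {s t : unitInterval}
    (h : s < t) (z w : ℝ × ℝ) {A : Set C(Set.Icc s t, ℝ × ℝ)} (hA : MeasurableSet A) :
    quadrantBridge W s t z w A =
      (stayProb W ((√(t - s : ℝ))⁻¹ • z) ((√(t - s : ℝ))⁻¹ • w))⁻¹ *
        bridgeLaw W (bstays ((√(t - s : ℝ))⁻¹ • z) ((√(t - s : ℝ))⁻¹ • w) ∩
          bridgeOf s t z w ⁻¹' A) := by
  rw [hW.quadrantBridge_eq h, Measure.smul_apply, smul_eq_mul,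
    Measure.map_apply (measurable_bridgeOf s t z w) hA,
    Measure.restrict_apply (measurable_bridgeOf s t z w hA), Set.inter_comm]

theorem norm_bridgeOf_sub_le {s t : unitInterval} (h : s < t) (z w : ℝ × ℝ) (f : PlanarPath)
    {u r : Set.Icc s t} (hu : u ≤ r) :
    ‖bridgeOf s t z w f u - bridgeOf s t z w f ⟨s, le_rfl, h.le⟩‖ ≤
      √((r : unitInterval) - s : ℝ) * ‖seg 0 (relTime s t r)
        (linePath ((√(t - s : ℝ))⁻¹ • z) ((√(t - s : ℝ))⁻¹ • w) + f)‖ := by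
  have h' : (0 : ℝ) < t - s := sub_pos.2 h
  set Z := linePath ((√(t - s : ℝ))⁻¹ • z) ((√(t - s : ℝ))⁻¹ • w) + f with hZ
  have hr := relTime s t r
  have hsr : relTime s t ⟨s, le_rfl, h.le⟩ = 0 := by
    ext; rw [coe_relTime h]; simp
  have hle : relTime s t u ≤ relTime s t r := by
    rw [← Subtype.coe_le_coe, coe_relTime h, coe_relTime h]
    have : ((u : unitInterval) : ℝ) ≤ (r : unitInterval) := hu
    gcongr
  obtain ⟨v, hv⟩ := exists_affTime_eq unitInterval.nonneg' hle
  rcases eq_or_ne (relTime s t r) 0 with h0 | h0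
  · have : relTime s t u = 0 := le_antisymm (hle.trans h0.le) unitInterval.nonneg'
    rw [bridgeOf_eq_smul h, bridgeOf_eq_smul h, this, hsr, sub_self, norm_zero]
    positivity
  · have e := sqrt_smul_seg h0.symm v Z
    have e0 : |((relTime s t r : ℝ) - (0 : unitInterval))| = relTime s t r := by
      simp [abs_of_nonneg (unitInterval.nonneg (relTime s t r))]
    rw [e0, hv] at e
    have hsq : √((r : unitInterval) - s : ℝ) = √(t - s : ℝ) * √(relTime s t r : ℝ) := by
      rw [← Real.sqrt_mul h'.le, coe_relTime h, mul_div_cancel₀ _ h'.ne']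
    rw [bridgeOf_eq_smul h, bridgeOf_eq_smul h, hsr, ← smul_sub, ← hZ, ← e, smul_smul, norm_smul,
      hsq, Real.norm_of_nonneg (by positivity)]
    gcongr
    exact (seg 0 _ Z).norm_coe_le_norm v

theorem norm_bridgeOf_sub_le' {s t : unitInterval} (h : s < t) (z w : ℝ × ℝ) (f : PlanarPath)
    {u r : Set.Icc s t} (hu : r ≤ u) :
    ‖bridgeOf s t z w f u - bridgeOf s t z w f ⟨t, h.le, le_rfl⟩‖ ≤
      √(t - (r : unitInterval) : ℝ) * ‖seg 0 (unitInterval.symm (relTime s t r)) (reversePath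
        (linePath ((√(t - s : ℝ))⁻¹ • z) ((√(t - s : ℝ))⁻¹ • w) + f))‖ := by
  have h' : (0 : ℝ) < t - s := sub_pos.2 h
  set Z := linePath ((√(t - s : ℝ))⁻¹ • z) ((√(t - s : ℝ))⁻¹ • w) + f with hZ
  have hr := relTime s t r
  have hsr : relTime s t ⟨t, h.le, le_rfl⟩ = 1 := by
    ext; rw [coe_relTime h]; simp [h'.ne']
  have hle : relTime s t r ≤ relTime s t u := by
    rw [← Subtype.coe_le_coe, coe_relTime h, coe_relTime h]
    have : ((r : unitInterval) : ℝ) ≤ (u : unitInterval) := hu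
    gcongr
  rw [seg_reversePath, unitInterval.symm_symm]
  obtain ⟨v', hv'⟩ := exists_affTime_eq hle unitInterval.le_one'
  obtain ⟨v, hv⟩ : ∃ v, affTime 1 (relTime s t r) v = relTime s t u := by
    refine ⟨unitInterval.symm v', ?_⟩
    rw [← hv']; ext; simp only [coe_affTime, unitInterval.coe_symm_eq]; ring
  rcases eq_or_ne (relTime s t r) 1 with h0 | h0
  · have : relTime s t u = 1 := le_antisymm unitInterval.le_one' (h0.ge.trans hle)
    rw [bridgeOf_eq_smul h, bridgeOf_eq_smul h, this, hsr, sub_self, norm_zero]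
    positivity
  · have e := sqrt_smul_seg h0.symm v Z
    have e0 : |((relTime s t r : ℝ) - (1 : unitInterval))| = 1 - relTime s t r := by
      rw [abs_sub_comm]
      simp [abs_of_nonneg (sub_nonneg.2 (unitInterval.le_one (relTime s t r)))]
    rw [e0, hv] at e
    have hsq : √(t - (r : unitInterval) : ℝ) = √(t - s : ℝ) * √(1 - relTime s t r : ℝ) := by
      rw [← Real.sqrt_mul h'.le, coe_relTime h]
      congr 1
      field_simp
      ring
    rw [bridgeOf_eq_smul h, bridgeOf_eq_smul h, hsr, ← smul_sub, ← hZ, ← e, smul_smul, norm_smul,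
      hsq, Real.norm_of_nonneg (by positivity)]
    gcongr
    exact (seg 1 _ Z).norm_coe_le_norm v

theorem ae_bridgeLaw_apply_notMem (hW : IsCorrelatedBrownianLaw α W)
    (hα : α ∈ Set.Ioo (-1 : ℝ) 1) {θ : unitInterval} (h0 : 0 < θ) (h1 : θ < 1) (a : ℝ × ℝ) :
    ∀ᵐ f ∂(bridgeLaw W), (f θ).1 ≠ a.1 ∧ (f θ).2 ≠ a.2 := by
  have := hW.isProbabilityMeasure
  have hN : MeasurableSet {x : ℝ × ℝ | x.1 ≠ a.1 ∧ x.2 ≠ a.2} :=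
    ((measurable_fst (measurableSet_singleton a.1)).compl).inter
      ((measurable_snd (measurableSet_singleton a.2)).compl)
  have hσ : √(θ * (1 - θ) : ℝ) ≠ 0 := by
    refine (Real.sqrt_pos.2 (mul_pos ?_ ?_)).ne'
    · exact h0
    · exact sub_pos.2 h1
  have key : ∀ᵐ x ∂((endLaw W).map (√(θ * (1 - θ) : ℝ) • ·)), x.1 ≠ a.1 ∧ x.2 ≠ a.2 := by
    rw [ae_map_iff (measurable_const_smul _).aemeasurable hN, hW.endLaw_eq_withDensity hα]
    refine (withDensity_absolutelyContinuous _ _).ae_le ?_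
    have e1 : ∀ b c : ℝ, c ≠ 0 → ∀ᵐ x : ℝ, c * x ≠ b := by
      intro b c hc
      filter_upwards [Measure.ae_ne volume (b / c)] with x hx hx'
      exact hx (by rw [← hx']; field_simp)
    rw [Measure.volume_eq_prod]
    have m1 : ∀ᵐ x ∂((volume : Measure ℝ).prod (volume : Measure ℝ)),
        √(θ * (1 - θ) : ℝ) * x.1 ≠ a.1 := Measure.quasiMeasurePreserving_fst.ae (e1 a.1 _ hσ)
    have m2 : ∀ᵐ x ∂((volume : Measure ℝ).prod (volume : Measure ℝ)),
        √(θ * (1 - θ) : ℝ) * x.2 ≠ a.2 := Measure.quasiMeasurePreserving_snd.ae (e1 a.2 _ hσ)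
    filter_upwards [m1, m2] with x h1 h2
    exact ⟨h1, h2⟩
  have hm : Measurable fun η ↦ bridgePart η θ :=
    (continuous_eval_const θ).measurable.comp continuous_bridgePart.measurable
  rw [← hW.map_bridgePart_apply, ae_map_iff hm.aemeasurable hN] at key
  rw [bridgeLaw, ae_map_iff continuous_bridgePart.measurable.aemeasurable]
  · exact key
  · exact (continuous_eval_const θ).measurable hN

/-- A conditioned bridge is in the open quadrant at each interior time. -/
theorem ae_quadrantBridge_pos (hW : IsCorrelatedBrownianLaw α W) (hα : α ∈ Set.Ioo (-1 : ℝ) 1)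
    {s t : unitInterval} (h : s < t) (z w : ℝ × ℝ) {r : Set.Icc s t} (h0 : s < r) (h1 : r < t) :
    ∀ᵐ f ∂(quadrantBridge W s t z w), 0 < (f r).1 ∧ 0 < (f r).2 := by
  have h' : (0 : ℝ) < t - s := sub_pos.2 h
  have h0' : (s : ℝ) < (r : unitInterval) := h0
  have h1' : ((r : unitInterval) : ℝ) < t := h1
  have hs : √(t - s : ℝ) ≠ 0 := (Real.sqrt_pos.2 h').ne'
  have hm : MeasurableSet {f : C(Set.Icc s t, ℝ × ℝ) | 0 < (f r).1 ∧ 0 < (f r).2} :=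
    (((isOpen_lt continuous_const continuous_fst).inter
      (isOpen_lt continuous_const continuous_snd)).preimage
        (continuous_eval_const r : Continuous fun f : C(Set.Icc s t, ℝ × ℝ) ↦ f r)).measurableSet
  have hθ0 : 0 < relTime s t r := by
    rw [← Subtype.coe_lt_coe, coe_relTime h]; exact div_pos (by linarith) h'
  have hθ1 : relTime s t r < 1 := by
    rw [← Subtype.coe_lt_coe, coe_relTime h]; exact (div_lt_one h').2 (by linarith)
  rw [hW.quadrantBridge_eq h]
  refine Measure.ae_smul_measure ?_ _
  rw [ae_map_iff (measurable_bridgeOf s t z w).aemeasurable hm]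
  refine (ae_restrict_iff' (measurableSet_bstays _ _)).2 ?_
  filter_upwards [hW.ae_bridgeLaw_apply_notMem hα hθ0 hθ1
    (-((√(t - s : ℝ))⁻¹ • linePath z w (relTime s t r)))] with f hf hst
  have hge := (bridgeOf_mem_stay h z w f).2 hst r
  have aux (a b : ℝ) (hb : b ≠ -((√(t - s : ℝ))⁻¹ * a)) (hab : 0 ≤ a + √(t - s : ℝ) * b) :
      0 < a + √(t - s : ℝ) * b := by
    refine lt_of_le_of_ne hab fun h ↦ hb ?_
    rw [eq_neg_iff_add_eq_zero]
    field_simp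
    linarith
  rw [bridgeOf_apply] at hge ⊢
  exact ⟨aux _ _ hf.1 hge.1, aux _ _ hf.2 hge.2⟩

end IsCorrelatedBrownianLaw

namespace IsCorrelatedBrownianLaw

variable {α : ℝ} {W : Measure PlanarPath}

theorem norm_inv_sqrt_smul_le {s t : unitInterval} (h : (1 / 2 : ℝ) ≤ t - s) {R : ℝ} {z : ℝ × ℝ}
    (hz : ‖z‖ ≤ R) : ‖(√(t - s : ℝ))⁻¹ • z‖ ≤ 2 * R := by
  have hs : (1 / 2 : ℝ) ≤ √(t - s : ℝ) := Real.le_sqrt_of_sq_le (by linarith)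
  have hs0 : (0 : ℝ) < √(t - s : ℝ) := by linarith
  rw [norm_smul, norm_inv, Real.norm_of_nonneg hs0.le, inv_mul_le_iff₀ hs0]
  have := norm_nonneg z
  nlinarith

/-- The fluctuations of conditioned bridges near their end points. -/
theorem exists_step_bounds (hW : IsCorrelatedBrownianLaw α W) (hα : α ∈ Set.Ioo (-1 : ℝ) 1)
    (R : ℝ) :
    ∃ C : ℝ, 0 < C ∧ ∀ (s t : unitInterval) (h : s < t) (z w : ℝ × ℝ), (1 / 2 : ℝ) ≤ t - s →
      0 < z.1 → 0 < z.2 → 0 < w.1 → 0 < w.2 → ‖z‖ ≤ R → ‖w‖ ≤ R →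
      IsProbabilityMeasure (quadrantBridge W s t z w) ∧
      (∀ r : Set.Icc s t, s < r → ((r : unitInterval) - s : ℝ) < (t - s) / 2 →
        ∫⁻ f, ⨆ u, ⨆ (_ : u ≤ r), ‖f u - f ⟨s, le_rfl, h.le⟩‖ₑ ∂(quadrantBridge W s t z w) ≤
          ENNReal.ofReal (C * √((r : unitInterval) - s))) ∧
      (∀ r : Set.Icc s t, r < t → (t - (r : unitInterval) : ℝ) < (t - s) / 2 →
        ∫⁻ f, ⨆ u, ⨆ (_ : r ≤ u), ‖f u - f ⟨t, h.le, le_rfl⟩‖ₑ ∂(quadrantBridge W s t z w) ≤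
          ENNReal.ofReal (C * √(t - (r : unitInterval)))) := by
  have := hW.isProbabilityMeasure
  obtain ⟨C, hC, hE⟩ := hW.exists_stayProb_bounds hα (2 * R)
  refine ⟨C, hC, fun s t h z w hst hz1 hz2 hw1 hw2 hz hw ↦ ?_⟩
  have h' : (0 : ℝ) < t - s := sub_pos.2 h
  have hi : (0 : ℝ) < (√(t - s : ℝ))⁻¹ := inv_pos.2 (Real.sqrt_pos.2 h')
  set l := (√(t - s : ℝ))⁻¹ with hl
  have p1 {x : ℝ × ℝ} (hx : 0 < x.1) : 0 < (l • x).1 := by simpa [hi] using hx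
  have p2 {x : ℝ × ℝ} (hx : 0 < x.2) : 0 < (l • x).2 := by simpa [hi] using hx
  have hnz := norm_inv_sqrt_smul_le hst hz
  have hnw := norm_inv_sqrt_smul_le hst hw
  obtain ⟨hq0, hE1⟩ := hE _ _ (p1 hz1) (p2 hz2) (p1 hw1) (p2 hw2) hnz hnw
  obtain ⟨-, hE2⟩ := hE _ _ (p1 hw1) (p2 hw2) (p1 hz1) (p2 hz2) hnw hnz
  rw [hW.stayProb_comm] at hE2
  set q := stayProb W (l • z) (l • w) with hq
  have hq1 : q ≠ ⊤ := measure_ne_top _ _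
  have fin {X : ENNReal} {a : ℝ} (ha : 0 ≤ a) (hX : X ≤ ENNReal.ofReal C * q) :
      q⁻¹ * (ENNReal.ofReal a * X) ≤ ENNReal.ofReal (C * a) := by
    calc _ ≤ q⁻¹ * (ENNReal.ofReal a * (ENNReal.ofReal C * q)) := by gcongr
      _ = (q⁻¹ * q) * (ENNReal.ofReal C * ENNReal.ofReal a) := by ring
      _ = _ := by rw [ENNReal.inv_mul_cancel hq0 hq1, one_mul, ENNReal.ofReal_mul hC.le]
  refine ⟨?_, fun r hr0 hr ↦ ?_, fun r hr0 hr ↦ ?_⟩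
  · have hne : W.map (bridge s t z w) (stayInQuadrant s t) ≠ 0 := by
      have e : bridgeOf s t z w ⁻¹' stayInQuadrant s t = bstays (l • z) (l • w) :=
        Set.ext fun f ↦ bridgeOf_mem_stay h z w f
      rw [hW.map_bridge h, Measure.map_apply (measurable_bridgeOf s t z w)
        (measurableSet_stayInQuadrant s t), e]
      exact hq0
    exact cond_isProbabilityMeasure hne
  · refine (hW.lintegral_quadrantBridge_le h z w _).trans ?_
    have hθ0 : 0 < relTime s t r := by
      rw [← Subtype.coe_lt_coe, coe_relTime h]
      exact div_pos (sub_pos.2 hr0) h'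
    have hθ : (relTime s t r : ℝ) < 1 / 2 := by
      rw [coe_relTime h, div_lt_iff₀ h']; linarith
    refine le_trans ?_ (fin (Real.sqrt_nonneg _) (hE1 _ hθ0 hθ))
    rw [← lintegral_const_mul' _ _ ENNReal.ofReal_ne_top]
    gcongr q⁻¹ * ?_
    refine lintegral_mono fun f ↦ iSup₂_le fun u hu ↦ ?_
    rw [← ENNReal.ofReal_mul (Real.sqrt_nonneg _), ← ofReal_norm]
    exact ENNReal.ofReal_le_ofReal (norm_bridgeOf_sub_le h z w f hu)
  · refine (hW.lintegral_quadrantBridge_le h z w _).trans ?_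
    have hr0' : ((r : unitInterval) : ℝ) < t := hr0
    have hθ0 : 0 < unitInterval.symm (relTime s t r) := by
      rw [← Subtype.coe_lt_coe, unitInterval.coe_symm_eq, coe_relTime h, Set.Icc.coe_zero, sub_pos,
        div_lt_one h']
      linarith
    have hθ : (unitInterval.symm (relTime s t r) : ℝ) < 1 / 2 := by
      rw [unitInterval.coe_symm_eq, coe_relTime h, sub_lt_comm, lt_div_iff₀ h']; linarith
    refine le_trans ?_ (fin (Real.sqrt_nonneg _) (hE2 _ hθ0 hθ))
    have hm : Measurable fun f : PlanarPath ↦ ENNReal.ofReal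
        ‖seg 0 (unitInterval.symm (relTime s t r)) (reversePath f)‖ :=
      (continuous_norm.measurable.comp
        ((measurable_seg _ _).comp continuous_reversePath.measurable)).ennreal_ofReal
    have e (f : PlanarPath) : reversePath (reversePath f) = f := by
      ext1 u; rw [reversePath_apply, reversePath_apply, unitInterval.symm_symm]
    have hrev := hW.setLIntegral_bstays_reverse (l • z) (l • w) hm
    simp only [e] at hrev
    rw [← hrev, ← lintegral_const_mul' _ _ ENNReal.ofReal_ne_top]
    gcongr q⁻¹ * ?_
    refine lintegral_mono fun f ↦ iSup₂_le fun u hu ↦ ?_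
    rw [← ENNReal.ofReal_mul (Real.sqrt_nonneg _), ← ofReal_norm]
    exact ENNReal.ofReal_le_ofReal (norm_bridgeOf_sub_le' h z w f hu)

open scoped Pointwise in
theorem quadrantBridge_minorization (hW : IsCorrelatedBrownianLaw α W) {s t : unitInterval}
    (h : s < t) (z w z₀ : ℝ × ℝ) {c a N b : ℝ} {X : PlanarPath → ℝ × ℝ}
    (hq : stayProb W ((√(t - s : ℝ))⁻¹ • z) ((√(t - s : ℝ))⁻¹ • w) ≠ 0)
    (key : ∀ A : Set (ℝ × ℝ), MeasurableSet A →
      A ⊆ Set.Icc ((√(t - s : ℝ))⁻¹ • z₀ + (√(a / (t - s)) * N) • ((1 : ℝ), (1 : ℝ)))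
        ((√(t - s : ℝ))⁻¹ • z₀ + (√(a / (t - s)) * b) • ((1 : ℝ), (1 : ℝ))) →
      ENNReal.ofReal (c / (a / (t - s))) * volume A *
        stayProb W ((√(t - s : ℝ))⁻¹ • z) ((√(t - s : ℝ))⁻¹ • w) ≤
        bridgeLaw W (bstays ((√(t - s : ℝ))⁻¹ • z) ((√(t - s : ℝ))⁻¹ • w) ∩ {f | X f ∈ A}))
    (r : Set.Icc s t) (hX : ∀ f, bridgeOf s t z w f r = √(t - s : ℝ) • X f)
    {A : Set (ℝ × ℝ)} (hA : MeasurableSet A) (hsub : A ⊆ Set.Icc (z₀ + (√a * N) • ((1 : ℝ), (1 : ℝ)))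
        (z₀ + (√a * b) • ((1 : ℝ), (1 : ℝ)))) :
    ENNReal.ofReal (c / a) * volume A ≤ quadrantBridge W s t z w {f | f r ∈ A} := by
  have := hW.isProbabilityMeasure
  have h' : (0 : ℝ) < t - s := sub_pos.2 h
  have hs : 0 < √(t - s : ℝ) := Real.sqrt_pos.2 h'
  set l := √(t - s : ℝ) with hl
  have hl2 : l ^ 2 = t - s := Real.sq_sqrt h'.le
  have hm : MeasurableSet {f : C(Set.Icc s t, ℝ × ℝ) | f r ∈ A} :=
    (continuous_eval_const r).measurable hA
  have hsq : √(a / (t - s)) = l⁻¹ * √a := by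
    rw [Real.sqrt_div' _ h'.le, ← hl, div_eq_inv_mul]
  have hA' : MeasurableSet (l⁻¹ • A) := hA.const_smul₀ _
  have key' := key (l⁻¹ • A) hA' (by
    rintro _ ⟨x, hx, rfl⟩
    have hx' := hsub hx
    rw [hsq, mul_assoc, mul_assoc, mul_smul, mul_smul l⁻¹, ← smul_add, ← smul_add]
    exact ⟨smul_le_smul_of_nonneg_left hx'.1 (by positivity),
      smul_le_smul_of_nonneg_left hx'.2 (by positivity)⟩)
  have hvol : volume (l⁻¹ • A) = ENNReal.ofReal (l⁻¹ ^ 2) * volume A := by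
    rw [Measure.addHaar_smul]
    simp [abs_of_pos hs]
  rw [hW.quadrantBridge_apply h z w hm]
  have hset : {f | X f ∈ l⁻¹ • A} = bridgeOf s t z w ⁻¹' {f | f r ∈ A} := by
    ext f
    simp only [Set.mem_ofPred_eq, Set.mem_preimage]
    rw [hX, Set.mem_smul_set_iff_inv_smul_mem₀ (inv_ne_zero hs.ne'), inv_inv]
  rw [← hset]
  refine le_trans (le_of_eq ?_) (mul_le_mul_right key' _)
  rw [hvol, mul_comm _ (stayProb _ _ _), ← mul_assoc,
    ENNReal.inv_mul_cancel hq (measure_ne_top _ _), one_mul, ← mul_assoc, mul_comm (ENNReal.ofReal _)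
      (ENNReal.ofReal _), ← ENNReal.ofReal_mul (by positivity)]
  congr 2
  rw [inv_pow, hl2]
  field_simp

theorem exists_step_minorization (hW : IsCorrelatedBrownianLaw α W)
    (hα : α ∈ Set.Ioo (-1 : ℝ) 1) {R M : ℝ} (hR : 0 ≤ R) (hM : 0 ≤ M) :
    ∃ c N : ℝ, 0 < c ∧ 0 < N ∧ ∀ (s t : unitInterval) (z₀ z w : ℝ × ℝ), s < t → (1 / 2 : ℝ) ≤ t - s →
      0 < z.1 → 0 < z.2 → 0 < w.1 → 0 < w.2 → ‖z‖ ≤ R → ‖w‖ ≤ R →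
      (∀ r : Set.Icc s t, s < r → ((r : unitInterval) - s : ℝ) ≤ (t - s) / 4 →
        ‖z - z₀‖ ≤ √((r : unitInterval) - s : ℝ) * M → ∀ A : Set (ℝ × ℝ), MeasurableSet A →
        A ⊆ Set.Icc (z₀ + (√((r : unitInterval) - s : ℝ) * N) • ((1 : ℝ), (1 : ℝ)))
          (z₀ + (√((r : unitInterval) - s : ℝ) * (N + 1)) • ((1 : ℝ), (1 : ℝ))) →
        ENNReal.ofReal (c / ((r : unitInterval) - s)) * volume A ≤
          quadrantBridge W s t z w {f | f r ∈ A}) ∧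
      (∀ r : Set.Icc s t, r < t → (t - (r : unitInterval) : ℝ) ≤ (t - s) / 4 →
        ‖w - z₀‖ ≤ √(t - (r : unitInterval) : ℝ) * M → ∀ A : Set (ℝ × ℝ), MeasurableSet A →
        A ⊆ Set.Icc (z₀ + (√(t - (r : unitInterval) : ℝ) * N) • ((1 : ℝ), (1 : ℝ)))
          (z₀ + (√(t - (r : unitInterval) : ℝ) * (N + 1)) • ((1 : ℝ), (1 : ℝ))) →
        ENNReal.ofReal (c / (t - (r : unitInterval))) * volume A ≤
          quadrantBridge W s t z w {f | f r ∈ A}) := by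
  have := hW.isProbabilityMeasure
  obtain ⟨c, N, hc, hN, hE⟩ := hW.exists_minorization hα (R := 2 * R) (by positivity) hM
  obtain ⟨_, _, hS⟩ := hW.exists_stayProb_bounds hα (2 * R)
  refine ⟨c, N, hc, hN, fun s t z₀ z w h hst hz1 hz2 hw1 hw2 hz hw ↦ ?_⟩
  have h' : (0 : ℝ) < t - s := sub_pos.2 h
  have hi : (0 : ℝ) < (√(t - s : ℝ))⁻¹ := inv_pos.2 (Real.sqrt_pos.2 h')
  set l := (√(t - s : ℝ))⁻¹ with hl
  have p1 {x : ℝ × ℝ} (hx : 0 < x.1) : 0 < (l • x).1 := by simpa [hi] using hx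
  have p2 {x : ℝ × ℝ} (hx : 0 < x.2) : 0 < (l • x).2 := by simpa [hi] using hx
  have hnz := norm_inv_sqrt_smul_le hst hz
  have hnw := norm_inv_sqrt_smul_le hst hw
  have hq0 := (hS _ _ (p1 hz1) (p2 hz2) (p1 hw1) (p2 hw2) hnz hnw).1
  have scale {x : ℝ × ℝ} {a : ℝ} (hx : ‖x - z₀‖ ≤ √a * M) :
      ‖l • x - l • z₀‖ ≤ √(a / (t - s)) * M := by
    rw [← smul_sub, norm_smul, Real.norm_of_nonneg hi.le, Real.sqrt_div' _ h'.le, div_eq_inv_mul,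
      mul_assoc]
    gcongr
  refine ⟨fun r hr0 hr hzz A hA hsub ↦ ?_, fun r hr0 hr hww A hA hsub ↦ ?_⟩
  · have hθ0 : 0 < relTime s t r := by
      rw [← Subtype.coe_lt_coe, coe_relTime h]
      exact div_pos (sub_pos.2 hr0) h'
    have hθ : (relTime s t r : ℝ) ≤ 1 / 4 := by
      rw [coe_relTime h, div_le_iff₀ h']; linarith
    have key := hE (l • z₀) (l • z) (l • w) (relTime s t r) (p1 hz1) (p2 hz2) (p1 hw1) (p2 hw2)
      hnz hnw hθ0 hθ (by rw [coe_relTime h]; exact scale hzz)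
    rw [coe_relTime h] at key
    exact hW.quadrantBridge_minorization h z w z₀ hq0 key r (fun f ↦ bridgeOf_eq_smul h z w f r)
      hA hsub
  · have hr0' : ((r : unitInterval) : ℝ) < t := hr0
    have hcoe : (unitInterval.symm (relTime s t r) : ℝ) = (t - (r : unitInterval)) / (t - s) := by
      rw [unitInterval.coe_symm_eq, coe_relTime h]; field_simp; ring
    have hθ0 : 0 < unitInterval.symm (relTime s t r) := by
      rw [← Subtype.coe_lt_coe, hcoe]
      exact div_pos (by linarith) h'
    have hθ : (unitInterval.symm (relTime s t r) : ℝ) ≤ 1 / 4 := by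
      rw [hcoe, div_le_iff₀ h']; linarith
    have key := hE (l • z₀) (l • w) (l • z) (unitInterval.symm (relTime s t r)) (p1 hw1) (p2 hw2)
      (p1 hz1) (p2 hz2) hnw hnz hθ0 hθ (by rw [hcoe]; exact scale hww)
    rw [hcoe] at key
    refine hW.quadrantBridge_minorization h z w z₀ hq0 (X := fun f ↦
      (linePath (l • z) (l • w) + f) (relTime s t r)) ?_ r (fun f ↦ bridgeOf_eq_smul h z w f r)
      hA hsub
    intro A hA hsub
    refine (le_of_eq ?_).trans ((key A hA hsub).trans (le_of_eq ?_))
    · rw [hW.stayProb_comm]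
    · have hr : (bridgeLaw W).map reversePath = bridgeLaw W := hW.map_reverse_bridgeLaw
      have hm : MeasurableSet (bstays (l • w) (l • z) ∩ {f | linePath (l • w) (l • z)
          (unitInterval.symm (relTime s t r)) + f (unitInterval.symm (relTime s t r)) ∈ A}) :=
        (measurableSet_bstays _ _).inter
          (((continuous_eval_const (unitInterval.symm (relTime s t r))).measurable.const_add _) hA)
      conv_lhs => rw [← hr]
      rw [Measure.map_apply continuous_reversePath.measurable hm]
      congr 1
      ext f
      refine and_congr (mem_bstays_reversePath _ _ _) ?_
      simp only [Set.mem_ofPred_eq]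
      rw [← ContinuousMap.add_apply, ← reversePath_linePath_add, reversePath_apply,
        unitInterval.symm_symm]

end IsCorrelatedBrownianLaw

/-! ### Contraction of inhomogeneous Markov chains with a Lyapunov function -/

theorem exists_eq_smul_add_smul {E : Type*} [MeasurableSpace E] {m ν : Measure E}
    [IsProbabilityMeasure m] [IsProbabilityMeasure ν] {c : ENNReal} (hc : c < 1)
    (h : c • ν ≤ m) : ∃ m₁ : Measure E, IsProbabilityMeasure m₁ ∧ m = c • ν + (1 - c) • m₁ := by
  have hc0 : 1 - c ≠ 0 := (tsub_pos_of_lt hc).ne'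
  have hc1 : 1 - c ≠ ⊤ := ENNReal.sub_ne_top ENNReal.one_ne_top
  have hct : c ≠ ⊤ := (hc.trans ENNReal.one_lt_top).ne
  have : IsFiniteMeasure (c • ν) := ν.smul_finite hct
  have hadd : m - c • ν + c • ν = m := Measure.sub_add_cancel_of_le h
  refine ⟨(1 - c)⁻¹ • (m - c • ν), ⟨?_⟩, ?_⟩
  · have e : (m - c • ν) Set.univ = 1 - c := by
      have := congrArg (fun μ : Measure E ↦ μ Set.univ) hadd
      simp only [Measure.add_apply, Measure.smul_apply, measure_univ, smul_eq_mul, mul_one] at this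
      exact ENNReal.eq_sub_of_add_eq hct this
    rw [Measure.smul_apply, e, smul_eq_mul, ENNReal.inv_mul_cancel hc0 hc1]
  · rw [smul_smul, ENNReal.mul_inv_cancel hc0 hc1, one_smul, add_comm, hadd]

/-- The function `g` integrated successively against the kernels `κ 0`, ..., `κ (n - 1)`. -/
noncomputable def iterInt {E : Type*} [MeasurableSpace E] (κ : ℕ → Kernel E E) (g : E → ENNReal) :
    ℕ → E → ENNReal
  | 0 => g
  | n + 1 => fun x ↦ ∫⁻ y, iterInt κ g n y ∂(κ n x)

theorem measurable_iterInt {E : Type*} [MeasurableSpace E] (κ : ℕ → Kernel E E)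
    {g : E → ENNReal} (hg : Measurable g) (n : ℕ) : Measurable (iterInt κ g n) := by
  induction n with
  | zero => exact hg
  | succ n ih => exact ih.lintegral_kernel

theorem lintegral_iterInt_le {E : Type*} [MeasurableSpace E] (κ : ℕ → Kernel E E)
    (V : ℕ → E → ENNReal) (hV : ∀ k, Measurable (V k)) (ν : ℕ → Measure E)
    [∀ k, IsProbabilityMeasure (ν k)] {K c : ENNReal} (hK0 : K ≠ 0) (hK : K ≠ ⊤) (hc : c ≤ 2⁻¹)
    (hprob : ∀ k x, V (k + 1) x ≠ ⊤ → κ k x Set.univ = 1)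
    (hdrift : ∀ k x, ∫⁻ y, V k y ∂(κ k x) ≤ 4⁻¹ * V (k + 1) x + 4⁻¹ * K)
    (hmin : ∀ k x, V (k + 1) x ≤ 2 * K → (2 * c) • ν k ≤ κ k x)
    {g : E → ENNReal} (hg : Measurable g) (hg1 : ∀ x, g x ≤ 1) (n : ℕ) (m m' : Measure E)
    [IsProbabilityMeasure m] [IsProbabilityMeasure m'] (hm : ∫⁻ x, V n x ∂m ≤ K)
    (hm' : ∫⁻ x, V n x ∂m' ≤ K) :
    ∫⁻ x, iterInt κ g n x ∂m ≤ ∫⁻ x, iterInt κ g n x ∂m' + (1 - c) ^ n := by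
  have hc1 : c < 1 := hc.trans_lt (by simp)
  have hc2 : 2⁻¹ ≤ 1 - c := by
    refine ENNReal.le_sub_of_add_le_left (hc1.trans ENNReal.one_lt_top).ne ?_
    calc c + 2⁻¹ ≤ 2⁻¹ + 2⁻¹ := by gcongr
      _ = 1 := ENNReal.inv_two_add_inv_two
  induction n generalizing m m' with
  | zero =>
    rw [pow_zero]
    refine le_add_left ?_
    calc _ ≤ ∫⁻ _, 1 ∂m := lintegral_mono fun x ↦ hg1 x
      _ = 1 := by simp
  | succ n ih =>
    have split (m : Measure E) [IsProbabilityMeasure m] (hm : ∫⁻ x, V (n + 1) x ∂m ≤ K) :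
        ∃ m₁ : Measure E, IsProbabilityMeasure m₁ ∧ ∫⁻ x, V n x ∂m₁ ≤ K ∧
          ∫⁻ x, iterInt κ g (n + 1) x ∂m =
            c * ∫⁻ x, iterInt κ g n x ∂(ν n) + (1 - c) * ∫⁻ x, iterInt κ g n x ∂m₁ := by
      have hfin : ∀ᵐ x ∂m, V (n + 1) x ≠ ⊤ :=
        (ae_lt_top (hV _) (hm.trans_lt hK.lt_top).ne).mono fun x hx ↦ hx.ne
      have hmb : IsProbabilityMeasure (m.bind (κ n)) := by
        refine ⟨?_⟩
        rw [Measure.bind_apply MeasurableSet.univ (κ n).aemeasurable]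
        calc _ = ∫⁻ _, 1 ∂m := lintegral_congr_ae (hfin.mono fun x hx ↦ hprob n x hx)
          _ = 1 := by simp
      have hVb : ∫⁻ y, V n y ∂(m.bind (κ n)) ≤ 2⁻¹ * K := by
        rw [Measure.lintegral_bind (κ n).aemeasurable (hV n).aemeasurable]
        calc _ ≤ ∫⁻ x, (4⁻¹ * V (n + 1) x + 4⁻¹ * K) ∂m := lintegral_mono (hdrift n)
          _ = 4⁻¹ * ∫⁻ x, V (n + 1) x ∂m + 4⁻¹ * K := by
            rw [lintegral_add_right _ measurable_const, lintegral_const_mul _ (hV _)]; simp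
          _ ≤ 4⁻¹ * K + 4⁻¹ * K := by gcongr
          _ = _ := by
            rw [← add_mul, ← two_mul]
            congr 1
            rw [show (4 : ENNReal) = 2 * 2 by norm_num, ENNReal.mul_inv (by simp) (by simp),
              ← mul_assoc, ENNReal.mul_inv_cancel (by simp) (by simp), one_mul]
      have hhalf : 2⁻¹ ≤ m {x | V (n + 1) x ≤ 2 * K} := by
        have hmark : 2 * K * m {x | 2 * K ≤ V (n + 1) x} ≤ K :=
          (mul_meas_ge_le_lintegral (hV _) _).trans hm
        have hms : MeasurableSet {x | V (n + 1) x ≤ 2 * K} := hV _ measurableSet_Iic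
        have h1 : m {x | V (n + 1) x ≤ 2 * K}ᶜ ≤ 2⁻¹ := by
          refine (measure_mono fun x hx ↦ ?_).trans
            (?_ : m {x | 2 * K ≤ V (n + 1) x} ≤ 2⁻¹)
          · exact (not_le.1 (show ¬ V (n + 1) x ≤ 2 * K from hx)).le
          · rw [mul_assoc, mul_comm, ← ENNReal.le_div_iff_mul_le (by simp) (by simp)] at hmark
            rw [← ENNReal.mul_le_mul_iff_right hK0 hK, ← div_eq_mul_inv]
            exact hmark
        rw [prob_compl_eq_one_sub hms, tsub_le_iff_right] at h1
        refine (ENNReal.add_le_add_iff_left (show (2⁻¹ : ENNReal) ≠ ⊤ by simp)).1 ?_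
        rw [ENNReal.inv_two_add_inv_two]
        exact h1
      have hle : c • ν n ≤ m.bind (κ n) := by
        refine Measure.le_iff.2 fun B hB ↦ ?_
        rw [Measure.bind_apply hB (κ n).aemeasurable]
        have hms : MeasurableSet {x | V (n + 1) x ≤ 2 * K} := hV _ measurableSet_Iic
        calc (c • ν n) B = (2 * c) * ν n B * 2⁻¹ := by
              rw [Measure.smul_apply, smul_eq_mul, mul_comm _ (2⁻¹ : ENNReal), ← mul_assoc,
                ← mul_assoc, ENNReal.inv_mul_cancel (by simp) (by simp), one_mul]
          _ ≤ (2 * c) * ν n B * m {x | V (n + 1) x ≤ 2 * K} := by gcongr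
          _ = ∫⁻ _ in {x | V (n + 1) x ≤ 2 * K}, (2 * c) * ν n B ∂m := by rw [setLIntegral_const]
          _ ≤ ∫⁻ x in {x | V (n + 1) x ≤ 2 * K}, κ n x B ∂m := by
              refine setLIntegral_mono' hms fun x hx ↦ ?_
              exact hmin n x hx B
          _ ≤ _ := setLIntegral_le_lintegral _ _
      obtain ⟨m₁, hm₁, e⟩ := exists_eq_smul_add_smul hc1 hle
      have hint (F : E → ENNReal) : ∫⁻ x, F x ∂(m.bind (κ n)) =
          c * ∫⁻ x, F x ∂(ν n) + (1 - c) * ∫⁻ x, F x ∂m₁ := by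
        rw [e, lintegral_add_measure, lintegral_smul_measure, lintegral_smul_measure, smul_eq_mul,
          smul_eq_mul]
      refine ⟨m₁, hm₁, ?_, ?_⟩
      · rw [hint] at hVb
        have : 2⁻¹ * ∫⁻ x, V n x ∂m₁ ≤ 2⁻¹ * K :=
          le_trans (by gcongr) (le_add_self.trans hVb)
        exact (ENNReal.mul_le_mul_iff_right (by simp) (by simp)).1 this
      · rw [← hint, Measure.lintegral_bind (κ n).aemeasurable
          (measurable_iterInt κ hg n).aemeasurable]
        rfl
    obtain ⟨m₁, hp, hb, e⟩ := split m hm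
    obtain ⟨m₁', hp', hb', e'⟩ := split m' hm'
    rw [e, e', add_assoc, pow_succ', ← mul_add]
    gcongr
    exact ih m₁ m₁' hb hb'

/-! ### Resampling steps -/

/-- The transition of the pair `(z, w)` of end values to the pair `g ((z, w), f)`, where `f` is a
conditioned bridge from `z` to `w`. -/
noncomputable def stepKernel (W : Measure PlanarPath) [IsProbabilityMeasure W]
    (s t : unitInterval) (g : ((ℝ × ℝ) × (ℝ × ℝ)) × C(Set.Icc s t, ℝ × ℝ) → (ℝ × ℝ) × (ℝ × ℝ)) :
    Kernel ((ℝ × ℝ) × (ℝ × ℝ)) ((ℝ × ℝ) × (ℝ × ℝ)) :=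
  (Kernel.id ×ₖ quadrantBridgeKernel W s t).map g

theorem lintegral_stepKernel (W : Measure PlanarPath) [IsProbabilityMeasure W]
    (s t : unitInterval) {g : ((ℝ × ℝ) × (ℝ × ℝ)) × C(Set.Icc s t, ℝ × ℝ) → (ℝ × ℝ) × (ℝ × ℝ)}
    (hg : Measurable g) (p : (ℝ × ℝ) × (ℝ × ℝ)) {h : (ℝ × ℝ) × (ℝ × ℝ) → ENNReal}
    (hh : Measurable h) :
    ∫⁻ q, h q ∂(stepKernel W s t g p) = ∫⁻ f, h (g (p, f)) ∂(quadrantBridge W s t p.1 p.2) := by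
  have : SFinite (quadrantBridgeKernel W s t p) := inferInstance
  have e := lintegral_prod (μ := Kernel.id p) (ν := quadrantBridgeKernel W s t p)
    (fun q ↦ h (g q)) (hh.comp hg).aemeasurable
  rw [stepKernel, Kernel.map_apply _ hg, lintegral_map hh hg, Kernel.prod_apply]
  refine e.trans ?_
  have hm : Measurable fun x ↦ ∫⁻ y, h (g (x, y)) ∂(quadrantBridgeKernel W s t p) :=
    (hh.comp hg).lintegral_prod_right'
  rw [Kernel.id_apply, lintegral_dirac' _ hm]
  rfl

/-- The open quadrant. -/
def IsInterior (z : ℝ × ℝ) : Prop := 0 < z.1 ∧ 0 < z.2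

theorem measurableSet_isInterior : MeasurableSet {z : ℝ × ℝ | IsInterior z} :=
  ((isOpen_lt continuous_const continuous_fst).inter
    (isOpen_lt continuous_const continuous_snd)).measurableSet

theorem measurableSet_isInterior_prod :
    MeasurableSet {p : (ℝ × ℝ) × (ℝ × ℝ) | IsInterior p.1 ∧ IsInterior p.2} :=
  (measurable_fst measurableSet_isInterior).inter (measurable_snd measurableSet_isInterior)

/-- The truncated distance of `p` from `(0, w₀)`. -/
noncomputable def endDist (w₀ : ℝ × ℝ) (p : (ℝ × ℝ) × (ℝ × ℝ)) : ℝ :=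
  min ‖p.1‖ 1 + min ‖p.2 - w₀‖ 1

theorem continuous_endDist (w₀ : ℝ × ℝ) : Continuous (endDist w₀) := by
  unfold endDist; fun_prop

theorem endDist_nonneg (w₀ : ℝ × ℝ) (p : (ℝ × ℝ) × (ℝ × ℝ)) : 0 ≤ endDist w₀ p := by
  unfold endDist; positivity

theorem endDist_le_two (w₀ : ℝ × ℝ) (p : (ℝ × ℝ) × (ℝ × ℝ)) : endDist w₀ p ≤ 2 := by
  unfold endDist
  linarith [min_le_right ‖p.1‖ 1, min_le_right ‖p.2 - w₀‖ 1]

open Classical in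
/-- The distance of the end values from `0` and from `w₀`, in Brownian scaling. -/
noncomputable def lyap (w₀ : ℝ × ℝ) (σ : ℝ) (p : (ℝ × ℝ) × (ℝ × ℝ)) : ENNReal :=
  if IsInterior p.1 ∧ IsInterior p.2 then ENNReal.ofReal (endDist w₀ p / √σ) else ⊤

theorem measurable_lyap (w₀ : ℝ × ℝ) (σ : ℝ) : Measurable (lyap w₀ σ) :=
  Measurable.ite measurableSet_isInterior_prod
    ((continuous_endDist w₀).measurable.div_const _).ennreal_ofReal measurable_const

theorem lyap_of_isInterior (w₀ : ℝ × ℝ) (σ : ℝ) {p : (ℝ × ℝ) × (ℝ × ℝ)}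
    (h : IsInterior p.1 ∧ IsInterior p.2) : lyap w₀ σ p = ENNReal.ofReal (endDist w₀ p / √σ) :=
  if_pos h

theorem isInterior_of_lyap_ne_top {w₀ : ℝ × ℝ} {σ : ℝ} {p : (ℝ × ℝ) × (ℝ × ℝ)}
    (h : lyap w₀ σ p ≠ ⊤) : IsInterior p.1 ∧ IsInterior p.2 := by
  by_contra h'
  exact h (if_neg h')

/-- The Lyapunov property of the resampling steps, with constant `C`. -/
def HasDrift (W : Measure PlanarPath) (w₀ : ℝ × ℝ) (C : ℝ) : Prop :=
  ∀ (s t : unitInterval) (p : (ℝ × ℝ) × (ℝ × ℝ)) (σ σ' : ℝ), s < t →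
    (1 / 2 : ℝ) ≤ t - s → 0 < σ → 0 < σ' → IsInterior p.1 ∧ IsInterior p.2 →
    (∀ r : Set.Icc s t, s < r → ((r : unitInterval) - s : ℝ) < (t - s) / 2 →
      ((r : unitInterval) - s : ℝ) ≤ σ →
      ∫⁻ f, lyap w₀ σ (f r, p.2) ∂(quadrantBridge W s t p.1 p.2) ≤
        ENNReal.ofReal (2 * (√σ' / √σ)) * lyap w₀ σ' p + ENNReal.ofReal C) ∧
    (∀ r : Set.Icc s t, r < t → (t - (r : unitInterval) : ℝ) < (t - s) / 2 →
      (t - (r : unitInterval) : ℝ) ≤ σ →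
      ∫⁻ f, lyap w₀ σ (p.1, f r) ∂(quadrantBridge W s t p.1 p.2) ≤
        ENNReal.ofReal (2 * (√σ' / √σ)) * lyap w₀ σ' p + ENNReal.ofReal C)

namespace IsCorrelatedBrownianLaw

variable {α : ℝ} {W : Measure PlanarPath}

/-- A conditioned bridge has the prescribed end values. -/
theorem ae_quadrantBridge_ends (hW : IsCorrelatedBrownianLaw α W) {s t : unitInterval} (h : s < t)
    (z w : ℝ × ℝ) : ∀ᵐ f ∂(quadrantBridge W s t z w),
      f ⟨s, le_rfl, h.le⟩ = z ∧ f ⟨t, h.le, le_rfl⟩ = w := by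
  have h' : (0 : ℝ) < t - s := sub_pos.2 h
  have hm : MeasurableSet {f : C(Set.Icc s t, ℝ × ℝ) |
      f ⟨s, le_rfl, h.le⟩ = z ∧ f ⟨t, h.le, le_rfl⟩ = w} :=
    ((continuous_eval_const _).measurable (measurableSet_singleton z)).inter
      ((continuous_eval_const _).measurable (measurableSet_singleton w))
  rw [hW.quadrantBridge_eq h]
  refine Measure.ae_smul_measure ?_ _
  rw [ae_map_iff (measurable_bridgeOf s t z w).aemeasurable hm]
  refine ae_restrict_of_ae ?_
  filter_upwards [ae_bridgeLaw W] with f hf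
  have h0 : relTime s t ⟨s, le_rfl, h.le⟩ = 0 := by
    ext; rw [coe_relTime h]; simp
  have h1 : relTime s t ⟨t, h.le, le_rfl⟩ = 1 := by
    ext; rw [coe_relTime h]; simp [h'.ne']
  rw [bridgeOf_apply, bridgeOf_apply, h0, h1, hf.1, hf.2, linePath_apply, linePath_apply]
  simp

theorem lyap_step (w₀ : ℝ × ℝ) {σ σ' C : ℝ} (hσ : 0 < σ) (hσ' : 0 < σ') (hC : 0 < C)
    {Ω : Type*} [MeasurableSpace Ω] {μ : Measure Ω} [IsProbabilityMeasure μ]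
    {X : Ω → (ℝ × ℝ) × (ℝ × ℝ)} {p : (ℝ × ℝ) × (ℝ × ℝ)} (hp : IsInterior p.1 ∧ IsInterior p.2)
    (hX : ∀ᵐ ω ∂μ, IsInterior (X ω).1 ∧ IsInterior (X ω).2) {D : Ω → ENNReal}
    (hD : ∀ᵐ ω ∂μ, ENNReal.ofReal (endDist w₀ (X ω)) ≤ ENNReal.ofReal (endDist w₀ p) + D ω)
    (hbound : ‖p.1‖ ≤ 1 → ‖p.2 - w₀‖ ≤ 1 → ∫⁻ ω, D ω ∂μ ≤ ENNReal.ofReal (C * √σ)) :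
    ∫⁻ ω, lyap w₀ σ (X ω) ∂μ ≤
      ENNReal.ofReal (2 * (√σ' / √σ)) * lyap w₀ σ' p + ENNReal.ofReal C := by
  have s0 : 0 < √σ := Real.sqrt_pos.2 hσ
  have s0' : 0 < √σ' := Real.sqrt_pos.2 hσ'
  have hl : ∀ᵐ ω ∂μ, lyap w₀ σ (X ω) =
      ENNReal.ofReal (√σ)⁻¹ * ENNReal.ofReal (endDist w₀ (X ω)) := by
    filter_upwards [hX] with ω hω
    rw [lyap_of_isInterior w₀ σ hω, ← ENNReal.ofReal_mul (by positivity), div_eq_inv_mul]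
  have hp0 := endDist_nonneg w₀ p
  have hlp : ENNReal.ofReal (2 * (√σ' / √σ)) * lyap w₀ σ' p =
      ENNReal.ofReal ((√σ)⁻¹ * (2 * endDist w₀ p)) := by
    rw [lyap_of_isInterior w₀ σ' hp, ← ENNReal.ofReal_mul (by positivity)]
    congr 1
    field_simp
  rw [lintegral_congr_ae hl, hlp]
  by_cases hb : ‖p.1‖ ≤ 1 ∧ ‖p.2 - w₀‖ ≤ 1
  · calc _ ≤ ∫⁻ ω, ENNReal.ofReal (√σ)⁻¹ * (ENNReal.ofReal (endDist w₀ p) + D ω) ∂μ := by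
          refine lintegral_mono_ae ?_
          filter_upwards [hD] with ω hω
          gcongr
      _ = ENNReal.ofReal (√σ)⁻¹ * (ENNReal.ofReal (endDist w₀ p) + ∫⁻ ω, D ω ∂μ) := by
          rw [lintegral_const_mul' _ _ ENNReal.ofReal_ne_top, lintegral_add_left measurable_const]
          simp
      _ ≤ ENNReal.ofReal (√σ)⁻¹ * (ENNReal.ofReal (endDist w₀ p) + ENNReal.ofReal (C * √σ)) := by
          gcongr
          exact hbound hb.1 hb.2
      _ = ENNReal.ofReal ((√σ)⁻¹ * endDist w₀ p) + ENNReal.ofReal C := by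
          rw [mul_add, ← ENNReal.ofReal_mul (by positivity), ← ENNReal.ofReal_mul (by positivity)]
          congr 2
          field_simp
      _ ≤ _ := by
          gcongr
          linarith
  · refine le_add_right ?_
    have h1 : 1 ≤ endDist w₀ p := by
      unfold endDist
      have a := le_min (norm_nonneg p.1) zero_le_one
      have b := le_min (norm_nonneg (p.2 - w₀)) zero_le_one
      rcases not_and_or.1 hb with h | h
      · rw [min_eq_right (not_le.1 h).le]; linarith
      · rw [min_eq_right (not_le.1 h).le]; linarith
    calc _ ≤ ∫⁻ _, ENNReal.ofReal (√σ)⁻¹ * ENNReal.ofReal 2 ∂μ := by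
          refine lintegral_mono fun ω ↦ ?_
          gcongr
          exact endDist_le_two w₀ _
      _ = ENNReal.ofReal ((√σ)⁻¹ * 2) := by
          rw [lintegral_const, measure_univ, mul_one, ← ENNReal.ofReal_mul (by positivity)]
      _ ≤ _ := by
          gcongr
          linarith

theorem abs_min_norm_sub_le (x y : ℝ × ℝ) : min ‖y‖ 1 ≤ min ‖x‖ 1 + ‖y - x‖ := by
  have h : ‖y‖ ≤ ‖x‖ + ‖y - x‖ := by
    calc ‖y‖ = ‖x + (y - x)‖ := by congr 1; abel
      _ ≤ _ := norm_add_le _ _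
  rcases le_total ‖x‖ 1 with hx | hx
  · rw [min_eq_left hx]; exact (min_le_left _ _).trans h
  · rw [min_eq_right hx]; linarith [min_le_right ‖y‖ 1, norm_nonneg (y - x)]

theorem isProbabilityMeasure_quadrantBridge (hW : IsCorrelatedBrownianLaw α W)
    (hα : α ∈ Set.Ioo (-1 : ℝ) 1) {s t : unitInterval} (h : s < t) {z w : ℝ × ℝ}
    (hz : IsInterior z) (hw : IsInterior w) : IsProbabilityMeasure (quadrantBridge W s t z w) := by
  have := hW.isProbabilityMeasure
  have hi : (0 : ℝ) < (√(t - s : ℝ))⁻¹ := inv_pos.2 (Real.sqrt_pos.2 (sub_pos.2 h))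
  set l := (√(t - s : ℝ))⁻¹ with hl
  have p1 {x : ℝ × ℝ} (hx : 0 < x.1) : 0 < (l • x).1 := by simpa [hi] using hx
  have p2 {x : ℝ × ℝ} (hx : 0 < x.2) : 0 < (l • x).2 := by simpa [hi] using hx
  obtain ⟨_, _, hE⟩ := hW.exists_stayProb_bounds hα (max ‖l • z‖ ‖l • w‖)
  have hq := (hE (l • z) (l • w) (p1 hz.1) (p2 hz.2) (p1 hw.1) (p2 hw.2) (le_max_left _ _)
    (le_max_right _ _)).1
  have hne : W.map (bridge s t z w) (stayInQuadrant s t) ≠ 0 := by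
    have e : bridgeOf s t z w ⁻¹' stayInQuadrant s t = bstays (l • z) (l • w) :=
      Set.ext fun f ↦ bridgeOf_mem_stay h z w f
    rw [hW.map_bridge h, Measure.map_apply (measurable_bridgeOf s t z w)
      (measurableSet_stayInQuadrant s t), e]
    exact hq
  exact cond_isProbabilityMeasure hne

/-- The Lyapunov property of the resampling steps. -/
theorem exists_hasDrift (hW : IsCorrelatedBrownianLaw α W) (hα : α ∈ Set.Ioo (-1 : ℝ) 1)
    (w₀ : ℝ × ℝ) : ∃ C : ℝ, 0 < C ∧ HasDrift W w₀ C := by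
  obtain ⟨C, hC, hE⟩ := hW.exists_step_bounds hα (1 + ‖w₀‖)
  refine ⟨C, hC, fun s t p σ σ' h hst hσ hσ' hp ↦ ?_⟩
  have hprob := hW.isProbabilityMeasure_quadrantBridge hα h hp.1 hp.2
  have hb (h1 : ‖p.1‖ ≤ 1) (h2 : ‖p.2 - w₀‖ ≤ 1) := hE s t h p.1 p.2 hst hp.1.1 hp.1.2 hp.2.1 hp.2.2
    (h1.trans (by linarith [norm_nonneg w₀])) (by
      calc ‖p.2‖ = ‖(p.2 - w₀) + w₀‖ := by congr 1; abel
        _ ≤ _ := (norm_add_le _ _).trans (by gcongr))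
  refine ⟨fun r hr0 hr hrσ ↦ ?_, fun r hr0 hr hrσ ↦ ?_⟩
  · have hr1 : r < t := by
      have h' : (0 : ℝ) < t - s := sub_pos.2 h
      rw [← Subtype.coe_lt_coe]; linarith
    refine lyap_step w₀ hσ hσ' hC hp ?_
      (D := fun f ↦ ⨆ u, ⨆ (_ : u ≤ r), ‖f u - f ⟨s, le_rfl, h.le⟩‖ₑ) ?_ fun h1 h2 ↦ ?_
    · filter_upwards [hW.ae_quadrantBridge_pos hα h p.1 p.2 hr0 hr1] with f hf
      exact ⟨hf, hp.2⟩
    · filter_upwards [hW.ae_quadrantBridge_ends h p.1 p.2] with f hf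
      calc _ ≤ ENNReal.ofReal (endDist w₀ p + ‖f r - p.1‖) := by
            refine ENNReal.ofReal_le_ofReal ?_
            unfold endDist
            linarith [abs_min_norm_sub_le p.1 (f r)]
        _ = ENNReal.ofReal (endDist w₀ p) + ‖f r - p.1‖ₑ := by
            rw [ENNReal.ofReal_add (endDist_nonneg _ _) (norm_nonneg _), ofReal_norm]
        _ ≤ _ := by
            gcongr
            rw [hf.1]
            exact le_iSup₂_of_le r le_rfl le_rfl
    · refine ((hb h1 h2).2.1 r hr0 hr).trans ?_
      gcongr
  · have hr1 : s < r := by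
      have h' : (0 : ℝ) < t - s := sub_pos.2 h
      rw [← Subtype.coe_lt_coe]; linarith
    refine lyap_step w₀ hσ hσ' hC hp ?_
      (D := fun f ↦ ⨆ u, ⨆ (_ : r ≤ u), ‖f u - f ⟨t, h.le, le_rfl⟩‖ₑ) ?_ fun h1 h2 ↦ ?_
    · filter_upwards [hW.ae_quadrantBridge_pos hα h p.1 p.2 hr1 hr0] with f hf
      exact ⟨hp.1, hf⟩
    · filter_upwards [hW.ae_quadrantBridge_ends h p.1 p.2] with f hf
      calc _ ≤ ENNReal.ofReal (endDist w₀ p + ‖f r - p.2‖) := by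
            refine ENNReal.ofReal_le_ofReal ?_
            unfold endDist
            have := abs_min_norm_sub_le (p.2 - w₀) (f r - w₀)
            rw [sub_sub_sub_cancel_right] at this
            linarith
        _ = ENNReal.ofReal (endDist w₀ p) + ‖f r - p.2‖ₑ := by
            rw [ENNReal.ofReal_add (endDist_nonneg _ _) (norm_nonneg _), ofReal_norm]
        _ ≤ _ := by
            gcongr
            rw [hf.2]
            exact le_iSup₂_of_le r le_rfl le_rfl
    · refine ((hb h1 h2).2.2 r hr0 hr).trans ?_
      gcongr

end IsCorrelatedBrownianLaw

/-! ### The chain of resampling steps towards the end points -/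

/-- The base of a sequence of times tending to `0`. -/
abbrev TimeBase : Type := {b : ℝ // 0 < b ∧ b ≤ 1 / 8}

/-- A sequence of times tending to `0`. -/
noncomputable def lo (b : TimeBase) (k : ℕ) : unitInterval :=
  ⟨b * (1 / 256) ^ k, by have := b.2.1; positivity, by
    have h1 : ((1 : ℝ) / 256) ^ k ≤ 1 := pow_le_one₀ (by norm_num) (by norm_num)
    have h2 := b.2.1
    have h3 := b.2.2
    nlinarith⟩

/-- The reflected sequence of times, tending to `1`. -/
noncomputable def hi (b : TimeBase) (k : ℕ) : unitInterval := unitInterval.symm (lo b k)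

theorem coe_lo (b : TimeBase) (k : ℕ) : (lo b k : ℝ) = b * (1 / 256) ^ k := rfl

theorem coe_hi (b : TimeBase) (k : ℕ) : (hi b k : ℝ) = 1 - lo b k := rfl

theorem coe_lo_succ (b : TimeBase) (k : ℕ) : (lo b (k + 1) : ℝ) = lo b k / 256 := by
  rw [coe_lo, coe_lo, pow_succ]; ring

theorem coe_lo_pos (b : TimeBase) (k : ℕ) : (0 : ℝ) < lo b k := by
  have := b.2.1
  rw [coe_lo]; positivity

theorem coe_lo_le_base (b : TimeBase) (k : ℕ) : (lo b k : ℝ) ≤ b := by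
  have h1 : ((1 : ℝ) / 256) ^ k ≤ 1 := pow_le_one₀ (by norm_num) (by norm_num)
  have := b.2.1
  rw [coe_lo]
  nlinarith

theorem coe_lo_le (b : TimeBase) (k : ℕ) : (lo b k : ℝ) ≤ 1 / 8 := (coe_lo_le_base b k).trans b.2.2

theorem lo_succ_lt (b : TimeBase) (k : ℕ) : lo b (k + 1) < lo b k := by
  rw [← Subtype.coe_lt_coe, coe_lo_succ]
  linarith [coe_lo_pos b k]

theorem hi_lt_succ (b : TimeBase) (k : ℕ) : hi b k < hi b (k + 1) := by
  rw [← Subtype.coe_lt_coe, coe_hi, coe_hi, coe_lo_succ]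
  linarith [coe_lo_pos b k]

theorem lo_lt_hi (b : TimeBase) (j k : ℕ) : lo b j < hi b k := by
  rw [← Subtype.coe_lt_coe, coe_hi]
  linarith [coe_lo_le b j, coe_lo_le b k]

theorem half_le_hi_sub_lo (b : TimeBase) (j k : ℕ) : (1 / 2 : ℝ) ≤ hi b k - lo b j := by
  rw [coe_hi]
  linarith [coe_lo_le b j, coe_lo_le b k]

/-- The time `lo b k` in the interval from `lo b (k + 1)` to `hi b (k + 1)`. -/
noncomputable def loMem (b : TimeBase) (k : ℕ) : Set.Icc (lo b (k + 1)) (hi b (k + 1)) :=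
  ⟨lo b k, (lo_succ_lt b k).le, (lo_lt_hi b k (k + 1)).le⟩

/-- The time `hi b k` in the interval from `lo b k` to `hi b (k + 1)`. -/
noncomputable def hiMem (b : TimeBase) (k : ℕ) : Set.Icc (lo b k) (hi b (k + 1)) :=
  ⟨hi b k, (lo_lt_hi b k k).le, (hi_lt_succ b k).le⟩

/-- The transition from the values at the times `lo b (k + 1)` and `hi b (k + 1)` to those at the
times `lo b k` and `hi b (k + 1)`. -/
noncomputable def loStep (W : Measure PlanarPath) [IsProbabilityMeasure W] (b : TimeBase) (k : ℕ) :
    Kernel ((ℝ × ℝ) × (ℝ × ℝ)) ((ℝ × ℝ) × (ℝ × ℝ)) :=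
  stepKernel W (lo b (k + 1)) (hi b (k + 1)) fun q ↦ (q.2 (loMem b k), q.1.2)

/-- The transition from the values at the times `lo b k` and `hi b (k + 1)` to those at the
times `lo b k` and `hi b k`. -/
noncomputable def hiStep (W : Measure PlanarPath) [IsProbabilityMeasure W] (b : TimeBase) (k : ℕ) :
    Kernel ((ℝ × ℝ) × (ℝ × ℝ)) ((ℝ × ℝ) × (ℝ × ℝ)) :=
  stepKernel W (lo b k) (hi b (k + 1)) fun q ↦ (q.1.1, q.2 (hiMem b k))

/-- The transition from the values at the times `lo b (k + 1)` and `hi b (k + 1)` to those at the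
times `lo b k` and `hi b k`. -/
noncomputable def chainKernel (W : Measure PlanarPath) [IsProbabilityMeasure W] (b : TimeBase)
    (k : ℕ) : Kernel ((ℝ × ℝ) × (ℝ × ℝ)) ((ℝ × ℝ) × (ℝ × ℝ)) :=
  hiStep W b k ∘ₖ loStep W b k

theorem measurable_lo_eval {s t : unitInterval} (r : Set.Icc s t) :
    Measurable fun q : ((ℝ × ℝ) × (ℝ × ℝ)) × C(Set.Icc s t, ℝ × ℝ) ↦ (q.2 r, q.1.2) :=
  (by fun_prop : Continuous fun q : ((ℝ × ℝ) × (ℝ × ℝ)) × C(Set.Icc s t, ℝ × ℝ) ↦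
    (q.2 r, q.1.2)).measurable

theorem measurable_hi_eval {s t : unitInterval} (r : Set.Icc s t) :
    Measurable fun q : ((ℝ × ℝ) × (ℝ × ℝ)) × C(Set.Icc s t, ℝ × ℝ) ↦ (q.1.1, q.2 r) :=
  (by fun_prop : Continuous fun q : ((ℝ × ℝ) × (ℝ × ℝ)) × C(Set.Icc s t, ℝ × ℝ) ↦
    (q.1.1, q.2 r)).measurable

theorem lintegral_chainKernel (W : Measure PlanarPath) [IsProbabilityMeasure W] (b : TimeBase)
    (k : ℕ) (p : (ℝ × ℝ) × (ℝ × ℝ)) {h : (ℝ × ℝ) × (ℝ × ℝ) → ENNReal} (hh : Measurable h) :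
    ∫⁻ q, h q ∂(chainKernel W b k p) =
      ∫⁻ f, ∫⁻ f', h (f (loMem b k), f' (hiMem b k))
        ∂(quadrantBridge W (lo b k) (hi b (k + 1)) (f (loMem b k)) p.2)
        ∂(quadrantBridge W (lo b (k + 1)) (hi b (k + 1)) p.1 p.2) := by
  rw [chainKernel, Kernel.lintegral_comp _ _ _ hh, loStep,
    lintegral_stepKernel W _ _ (measurable_lo_eval _) p hh.lintegral_kernel]
  refine lintegral_congr fun f ↦ ?_
  rw [hiStep, lintegral_stepKernel W _ _ (measurable_hi_eval _) _ hh]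

theorem smul_restrict_le_map {Ω : Type*} [MeasurableSpace Ω] {m : Measure Ω} {X : Ω → ℝ × ℝ}
    (hX : Measurable X) {B : Set (ℝ × ℝ)} (hB : MeasurableSet B) {c δ : ℝ} (hc : 0 ≤ c)
    (h : ∀ A, MeasurableSet A → A ⊆ B → ENNReal.ofReal (c / δ) * volume A ≤ m {f | X f ∈ A}) :
    ENNReal.ofReal c • (ENNReal.ofReal δ⁻¹ • (volume : Measure (ℝ × ℝ)).restrict B) ≤ m.map X := by
  refine Measure.le_iff.2 fun A hA ↦ ?_
  rw [Measure.map_apply hX hA, smul_smul, ← ENNReal.ofReal_mul hc, ← div_eq_mul_inv,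
    Measure.smul_apply, Measure.restrict_apply hA, smul_eq_mul]
  exact (h _ (hA.inter hB) Set.inter_subset_right).trans
    (measure_mono fun f hf ↦ hf.1)

theorem isProbabilityMeasure_smul_restrict_box (a : ℝ × ℝ) {δ : ℝ} (hδ : 0 < δ) (N : ℝ) :
    IsProbabilityMeasure (ENNReal.ofReal δ⁻¹ • (volume : Measure (ℝ × ℝ)).restrict
      (Set.Icc (a + (√δ * N) • ((1 : ℝ), (1 : ℝ))) (a + (√δ * (N + 1)) • ((1 : ℝ), (1 : ℝ))))) := by
  have e : a + (√δ * (N + 1)) • ((1 : ℝ), (1 : ℝ)) =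
      (a + (√δ * N) • ((1 : ℝ), (1 : ℝ))) + √δ • ((1 : ℝ), (1 : ℝ)) := by module
  refine ⟨?_⟩
  rw [Measure.smul_apply, Measure.restrict_apply_univ, e, volume_box _ (Real.sqrt_nonneg _),
    Real.sq_sqrt hδ.le, smul_eq_mul, ← ENNReal.ofReal_mul (by positivity), inv_mul_cancel₀ hδ.ne',
    ENNReal.ofReal_one]

namespace IsCorrelatedBrownianLaw

variable {α : ℝ} {W : Measure PlanarPath}

theorem chainKernel_drift (hα : α ∈ Set.Ioo (-1 : ℝ) 1) [IsProbabilityMeasure W]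
    (hW : IsCorrelatedBrownianLaw α W) {w₀ : ℝ × ℝ} {C : ℝ} (hD : HasDrift W w₀ C)
    (b : TimeBase) (k : ℕ) (p : (ℝ × ℝ) × (ℝ × ℝ)) :
    ∫⁻ q, lyap w₀ (lo b k) q ∂(chainKernel W b k p) ≤
      4⁻¹ * lyap w₀ (lo b (k + 1)) p + 4⁻¹ * ENNReal.ofReal (16 + 12 * C) := by
  by_cases hp : lyap w₀ (lo b (k + 1)) p = ⊤
  · rw [hp, ENNReal.mul_top (by simp), top_add]
    exact le_top
  replace hp := isInterior_of_lyap_ne_top hp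
  have s0 := coe_lo_pos b k
  have s1 := coe_lo_pos b (k + 1)
  have hs := coe_lo_succ b k
  have h8 := coe_lo_le b k
  rw [lintegral_chainKernel W b k p (measurable_lyap _ _)]
  have hsq : √(lo b (k + 1) : ℝ) / √(lo b k : ℝ) = 1 / 16 := by
    rw [← Real.sqrt_div s1.le, hs]
    rw [show ((lo b k : ℝ) / 256 / lo b k) = (1 / 16) ^ 2 by field_simp; norm_num,
      Real.sqrt_sq (by norm_num)]
  have first := (hD (lo b (k + 1)) (hi b (k + 1)) p (lo b k) (lo b (k + 1)) (lo_lt_hi b _ _)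
    (half_le_hi_sub_lo b _ _) s0 s1 hp).1 (loMem b k) (lo_succ_lt b k)
    (by
      have := half_le_hi_sub_lo b (k + 1) (k + 1)
      simp only [loMem]
      linarith) (by simp only [loMem]; linarith)
  rw [hsq] at first
  have second (z : ℝ × ℝ) : ∫⁻ f', lyap w₀ (lo b k) (z, f' (hiMem b k))
        ∂(quadrantBridge W (lo b k) (hi b (k + 1)) z p.2) ≤
      2 * lyap w₀ (lo b k) (z, p.2) + ENNReal.ofReal C := by
    by_cases hz : lyap w₀ (lo b k) (z, p.2) = ⊤
    · rw [hz, ENNReal.mul_top (by simp), top_add]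
      exact le_top
    have h2 := (hD (lo b k) (hi b (k + 1)) (z, p.2) (lo b k) (lo b k) (lo_lt_hi b _ _)
      (half_le_hi_sub_lo b _ _) s0 s0 (isInterior_of_lyap_ne_top hz)).2 (hiMem b k) (hi_lt_succ b k)
      (by
        have := half_le_hi_sub_lo b k (k + 1)
        simp only [hiMem]
        rw [coe_hi, coe_hi] at *
        linarith)
      (by
        simp only [hiMem]
        rw [coe_hi, coe_hi]
        linarith)
    rw [div_self (Real.sqrt_pos.2 s0).ne', mul_one, ENNReal.ofReal_ofNat] at h2
    exact h2
  have hm : Measurable fun f : C(Set.Icc (lo b (k + 1)) (hi b (k + 1)), ℝ × ℝ) ↦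
      lyap w₀ (lo b k) (f (loMem b k), p.2) :=
    (measurable_lyap _ _).comp ((continuous_eval_const _).measurable.prodMk measurable_const)
  have := hW.isProbabilityMeasure_quadrantBridge hα (lo_lt_hi b (k + 1) (k + 1)) hp.1 hp.2
  calc _ ≤ ∫⁻ f, (2 * lyap w₀ (lo b k) (f (loMem b k), p.2) + ENNReal.ofReal C)
        ∂(quadrantBridge W (lo b (k + 1)) (hi b (k + 1)) p.1 p.2) :=
        lintegral_mono fun f ↦ second _
    _ = 2 * ∫⁻ f, lyap w₀ (lo b k) (f (loMem b k), p.2)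
        ∂(quadrantBridge W (lo b (k + 1)) (hi b (k + 1)) p.1 p.2) + ENNReal.ofReal C := by
        rw [lintegral_add_right _ measurable_const, lintegral_const_mul _ hm]
        simp
    _ ≤ 2 * (ENNReal.ofReal (2 * (1 / 16)) * lyap w₀ (lo b (k + 1)) p + ENNReal.ofReal C) +
        ENNReal.ofReal C := by gcongr
    _ = 4⁻¹ * lyap w₀ (lo b (k + 1)) p + ENNReal.ofReal (3 * C) := by
        have e4 : (4⁻¹ : ENNReal) = 2 * ENNReal.ofReal (2 * (1 / 16)) := by
          rw [← ENNReal.ofReal_ofNat, ← ENNReal.ofReal_inv_of_pos (by norm_num),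
            ← ENNReal.ofReal_ofNat, ← ENNReal.ofReal_mul (by norm_num)]
          norm_num
        rw [e4, ENNReal.ofReal_mul (by norm_num : (0 : ℝ) ≤ 3), ENNReal.ofReal_ofNat]
        ring
    _ ≤ _ := by
        gcongr
        rw [← ENNReal.ofReal_ofNat, ← ENNReal.ofReal_inv_of_pos (by norm_num),
          ← ENNReal.ofReal_mul (by positivity)]
        apply ENNReal.ofReal_le_ofReal
        linarith

theorem chainKernel_univ (hα : α ∈ Set.Ioo (-1 : ℝ) 1) [IsProbabilityMeasure W]
    (hW : IsCorrelatedBrownianLaw α W) (b : TimeBase) (k : ℕ) {p : (ℝ × ℝ) × (ℝ × ℝ)}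
    (hp : IsInterior p.1 ∧ IsInterior p.2) : chainKernel W b k p Set.univ = 1 := by
  rw [← lintegral_one, lintegral_chainKernel W b k p measurable_const]
  have := hW.isProbabilityMeasure_quadrantBridge hα (lo_lt_hi b (k + 1) (k + 1)) hp.1 hp.2
  calc _ = ∫⁻ _, 1 ∂(quadrantBridge W (lo b (k + 1)) (hi b (k + 1)) p.1 p.2) := by
        refine lintegral_congr_ae ?_
        filter_upwards [hW.ae_quadrantBridge_pos hα (lo_lt_hi b (k + 1) (k + 1)) p.1 p.2
          (r := loMem b k) (lo_succ_lt b k) (lo_lt_hi b k (k + 1))] with f hf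
        have := hW.isProbabilityMeasure_quadrantBridge hα (lo_lt_hi b k (k + 1))
          (z := f (loMem b k)) hf hp.2
        simp
    _ = 1 := by simp

theorem exists_chainKernel_minorization (hα : α ∈ Set.Ioo (-1 : ℝ) 1) [IsProbabilityMeasure W]
    (hW : IsCorrelatedBrownianLaw α W) (w₀ : ℝ × ℝ) {K : ℝ} (hK : 0 < K) :
    ∃ (b : TimeBase) (c : ENNReal) (ν : ℕ → Measure ((ℝ × ℝ) × (ℝ × ℝ))), c ≠ 0 ∧ c ≤ 2⁻¹ ∧
      (∀ k, IsProbabilityMeasure (ν k)) ∧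
      ∀ k p, lyap w₀ (lo b (k + 1)) p ≤ 2 * ENNReal.ofReal K →
        (2 * c) • ν k ≤ chainKernel W b k p := by
  obtain ⟨c, N, hc, hN, hE⟩ := hW.exists_step_minorization hα (R := 1 + ‖w₀‖) (M := K)
    (by positivity) hK.le
  let b : TimeBase := ⟨min (1 / 8) (min (1 / (N + 1) ^ 2) (1 / 4 / K ^ 2)), by positivity,
    min_le_left _ _⟩
  have hbN : (b : ℝ) * (N + 1) ^ 2 ≤ 1 := by
    rw [← le_div_iff₀ (by positivity)]
    exact (min_le_right _ _).trans (min_le_left _ _)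
  have hbK : (b : ℝ) * K ^ 2 ≤ 1 / 4 := by
    rw [← le_div_iff₀ (by positivity)]
    exact (min_le_right _ _).trans (min_le_right _ _)
  clear_value b
  set e : ℝ × ℝ := (1, 1) with he
  have hδ (k : ℕ) : (0 : ℝ) < lo b k - lo b (k + 1) := sub_pos.2 (lo_succ_lt b k)
  let μ (a : ℝ × ℝ) (k : ℕ) : Measure (ℝ × ℝ) := ENNReal.ofReal (lo b k - lo b (k + 1) : ℝ)⁻¹ •
    (volume : Measure (ℝ × ℝ)).restrict (Set.Icc (a + (√(lo b k - lo b (k + 1) : ℝ) * N) • e)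
      (a + (√(lo b k - lo b (k + 1) : ℝ) * (N + 1)) • e))
  have hμ (a : ℝ × ℝ) (k : ℕ) : IsProbabilityMeasure (μ a k) :=
    isProbabilityMeasure_smul_restrict_box a (hδ k) N
  refine ⟨b, min (2⁻¹ * ENNReal.ofReal (c * c)) 2⁻¹, fun k ↦ (μ 0 k).prod (μ w₀ k), ?_,
    min_le_right _ _, fun k ↦ inferInstance, fun k p hV ↦ ?_⟩
  · rw [Ne, ← nonpos_iff_eq_zero, min_le_iff, not_or]
    constructor
    · simp [hc]
    · simp
  have hp := isInterior_of_lyap_ne_top (hV.trans_lt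
    (ENNReal.mul_lt_top (by simp) ENNReal.ofReal_lt_top)).ne
  have hs := coe_lo_succ b k
  have s0 := coe_lo_pos b k
  have s1 := coe_lo_pos b (k + 1)
  set δ : ℝ := lo b k - lo b (k + 1) with hδd
  have hδ0 : 0 < δ := hδ k
  have hδb : δ ≤ b := by linarith [coe_lo_le_base b k]
  have hδ8 : δ ≤ 1 / 8 := hδb.trans b.2.2
  have hsd : √(lo b (k + 1) : ℝ) ≤ √δ / 2 := by
    rw [Real.sqrt_le_left (by positivity), div_pow, Real.sq_sqrt hδ0.le]
    rw [hδd, hs]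
    linarith
  have hδK : √δ * K ≤ 1 / 2 := by
    rw [← sq_le_sq₀ (by positivity) (by norm_num), mul_pow, Real.sq_sqrt hδ0.le]
    refine (mul_le_mul_of_nonneg_right hδb (by positivity)).trans (hbK.trans (by norm_num))
  have hδN : √δ * (N + 1) ≤ 1 := by
    rw [← sq_le_one_iff₀ (by positivity), mul_pow, Real.sq_sqrt hδ0.le]
    exact (mul_le_mul_of_nonneg_right hδb (by positivity)).trans hbN
  have hdist : endDist w₀ p ≤ √δ * K := by
    rw [lyap_of_isInterior _ _ hp, ← ENNReal.ofReal_ofNat, ← ENNReal.ofReal_mul zero_le_two,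
      ENNReal.ofReal_le_ofReal_iff (by positivity), div_le_iff₀ (Real.sqrt_pos.2 s1)] at hV
    refine hV.trans ?_
    calc _ ≤ 2 * K * (√δ / 2) := by gcongr
      _ = _ := by ring
  have m1 : 0 ≤ min ‖p.1‖ 1 := by positivity
  have m2 : 0 ≤ min ‖p.2 - w₀‖ 1 := by positivity
  have close {x : ℝ} (h : min x 1 ≤ √δ * K) : x ≤ √δ * K := by
    rcases le_total x 1 with hx | hx
    · rwa [min_eq_left hx] at h
    · rw [min_eq_right hx] at h; linarith
  have hz : ‖p.1‖ ≤ √δ * K := close (by unfold endDist at hdist; linarith)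
  have hw : ‖p.2 - w₀‖ ≤ √δ * K := close (by unfold endDist at hdist; linarith)
  have hzR : ‖p.1‖ ≤ 1 + ‖w₀‖ := by linarith [norm_nonneg w₀]
  have hwR : ‖p.2‖ ≤ 1 + ‖w₀‖ := by
    calc ‖p.2‖ = ‖(p.2 - w₀) + w₀‖ := by congr 1; abel
      _ ≤ ‖p.2 - w₀‖ + ‖w₀‖ := norm_add_le _ _
      _ ≤ _ := by linarith
  have first : ENNReal.ofReal c • μ 0 k ≤
      (quadrantBridge W (lo b (k + 1)) (hi b (k + 1)) p.1 p.2).map fun f ↦ f (loMem b k) := by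
    refine smul_restrict_le_map (continuous_eval_const _).measurable measurableSet_Icc hc.le ?_
    have := (hE (lo b (k + 1)) (hi b (k + 1)) 0 p.1 p.2 (lo_lt_hi b _ _) (half_le_hi_sub_lo b _ _)
      hp.1.1 hp.1.2 hp.2.1 hp.2.2 hzR hwR).1 (loMem b k) (lo_succ_lt b k)
    refine this ?_ ?_
    · have := half_le_hi_sub_lo b (k + 1) (k + 1)
      simp only [loMem]
      linarith
    · rwa [sub_zero]
  have second (x : ℝ × ℝ) (hx : x ∈ Set.Icc (0 + (√δ * N) • e) (0 + (√δ * (N + 1)) • e)) :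
      ENNReal.ofReal c • μ w₀ k ≤
      (quadrantBridge W (lo b k) (hi b (k + 1)) x p.2).map fun f ↦ f (hiMem b k) := by
    refine smul_restrict_le_map (continuous_eval_const _).measurable measurableSet_Icc hc.le ?_
    have hδe : (hi b (k + 1) : ℝ) - hi b k = δ := by rw [coe_hi, coe_hi]; ring
    have hpos : 0 < √δ * N := mul_pos (Real.sqrt_pos.2 hδ0) hN
    have x1 : √δ * N ≤ x.1 := by simpa [he] using hx.1.1
    have x2 : √δ * N ≤ x.2 := by simpa [he] using hx.1.2
    have x3 : x.1 ≤ √δ * (N + 1) := by simpa [he] using hx.2.1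
    have x4 : x.2 ≤ √δ * (N + 1) := by simpa [he] using hx.2.2
    have hxn : ‖x‖ ≤ 1 + ‖w₀‖ := by
      have := norm_nonneg w₀
      refine norm_prod_le_iff.2 ⟨?_, ?_⟩ <;> rw [Real.norm_eq_abs, abs_le] <;>
        constructor <;> linarith
    have := (hE (lo b k) (hi b (k + 1)) w₀ x p.2 (lo_lt_hi b _ _) (half_le_hi_sub_lo b _ _)
      (hpos.trans_le x1) (hpos.trans_le x2) hp.2.1 hp.2.2 hxn hwR).2 (hiMem b k) (hi_lt_succ b k)
    simp only [hiMem, hδe] at this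
    refine this ?_ hw
    have := half_le_hi_sub_lo b k (k + 1)
    linarith
  refine Measure.le_iff.2 fun S hS ↦ ?_
  have hmS (x : ℝ × ℝ) : MeasurableSet (Prod.mk x ⁻¹' S) := measurable_prodMk_left hS
  have hset (x : ℝ × ℝ) (m : Measure C(Set.Icc (lo b k) (hi b (k + 1)), ℝ × ℝ)) :
      ∫⁻ f', S.indicator 1 (x, f' (hiMem b k)) ∂m = m {f' | (x, f' (hiMem b k)) ∈ S} := by
    have hm : MeasurableSet {f' : C(Set.Icc (lo b k) (hi b (k + 1)), ℝ × ℝ) |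
        (x, f' (hiMem b k)) ∈ S} :=
      (measurable_const.prodMk (continuous_eval_const (hiMem b k)).measurable) hS
    rw [← lintegral_indicator_one hm]
    rfl
  have hG : Measurable fun x ↦ quadrantBridge W (lo b k) (hi b (k + 1)) x p.2
      {f' | (x, f' (hiMem b k)) ∈ S} := by
    have h1 : Measurable fun x : ℝ × ℝ ↦ hiStep W b k (x, p.2) S :=
      ((hiStep W b k).measurable_coe hS).comp (by fun_prop)
    convert h1 using 2 with x
    have := lintegral_stepKernel W (lo b k) (hi b (k + 1)) (measurable_hi_eval (hiMem b k)) (x, p.2)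
      (measurable_one.indicator hS)
    rw [lintegral_indicator_one hS] at this
    rw [hiStep, this, hset]
  have hchain : chainKernel W b k p S = ∫⁻ x, quadrantBridge W (lo b k) (hi b (k + 1)) x p.2
      {f' | (x, f' (hiMem b k)) ∈ S} ∂((quadrantBridge W (lo b (k + 1)) (hi b (k + 1)) p.1 p.2).map
        fun f ↦ f (loMem b k)) := by
    rw [lintegral_map hG (continuous_eval_const _).measurable, ← lintegral_indicator_one hS,
      lintegral_chainKernel W b k p (measurable_one.indicator hS)]
    exact lintegral_congr fun f ↦ hset _ _
  have hcc : (2 * min (2⁻¹ * ENNReal.ofReal (c * c)) 2⁻¹ : ENNReal) ≤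
      ENNReal.ofReal c * ENNReal.ofReal c := by
    rw [← ENNReal.ofReal_mul hc.le]
    calc _ ≤ 2 * (2⁻¹ * ENNReal.ofReal (c * c)) := by gcongr; exact min_le_left _ _
      _ = _ := by rw [← mul_assoc, ENNReal.mul_inv_cancel (by simp) (by simp), one_mul]
  rw [hchain, Measure.smul_apply, smul_eq_mul, Measure.prod_apply hS]
  calc _ ≤ (ENNReal.ofReal c * ENNReal.ofReal c) * ∫⁻ x, μ w₀ k (Prod.mk x ⁻¹' S) ∂(μ 0 k) := by
        gcongr
    _ = ∫⁻ x, ENNReal.ofReal c * μ w₀ k (Prod.mk x ⁻¹' S) ∂(ENNReal.ofReal c • μ 0 k) := by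
        conv_rhs => rw [lintegral_const_mul' _ _ ENNReal.ofReal_ne_top, lintegral_smul_measure,
          smul_eq_mul, ← mul_assoc]
    _ ≤ ∫⁻ x, quadrantBridge W (lo b k) (hi b (k + 1)) x p.2
          {f' | (x, f' (hiMem b k)) ∈ S} ∂(ENNReal.ofReal c • μ 0 k) := by
        refine lintegral_mono_ae ?_
        refine Measure.ae_smul_measure (Measure.ae_smul_measure ?_ _) _
        refine (ae_restrict_iff' measurableSet_Icc).2 (Filter.Eventually.of_forall fun x hx ↦ ?_)
        have := second x hx (Prod.mk x ⁻¹' S)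
        rw [Measure.map_apply (continuous_eval_const _).measurable (hmS x)] at this
        exact this
    _ ≤ _ := lintegral_mono' first le_rfl

end IsCorrelatedBrownianLaw

/-! ### Approximate solutions and their comparison -/

/-- Between the times `s` and `t`, a path with law `μ` is a conditioned bridge, given its values at
these times. -/
def Resamples (W μ : Measure PlanarPath) (s t : unitInterval) : Prop :=
  ∀ G : ((ℝ × ℝ) × (ℝ × ℝ)) × C(Set.Icc s t, ℝ × ℝ) → ENNReal, Measurable G →
    ∫⁻ ω, G ((ω s, ω t), inside s t ω) ∂μ =
      ∫⁻ ω, ∫⁻ f, G ((ω s, ω t), f) ∂(quadrantBridge W s t (ω s) (ω t)) ∂μ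

/-- The law `μ` is that of a path which, except for times at distance `ε` from `0` and from `1`,
behaves like the conditioned Brownian path from `0` to `w₀`, and which at these times stays close to
`0` and to `w₀`, respectively, with probability close to `1`. -/
def IsApproxSolution (W : Measure PlanarPath) (w₀ : ℝ × ℝ) (ε : ℝ) (μ : Measure PlanarPath) : Prop :=
  ∃ s t : unitInterval, (s : ℝ) ≤ ε ∧ 1 - ε ≤ (t : ℝ) ∧
    (∀ r, s ≤ r → r ≤ t → ∀ᵐ ω ∂μ, IsInterior (ω r)) ∧
    (∀ s' t', s ≤ s' → s' < t' → t' ≤ t → Resamples W μ s' t') ∧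
    μ {ω | ¬ ((∀ u, u ≤ s → ‖ω u‖ ≤ ε) ∧ ∀ u, t ≤ u → ‖ω u - w₀‖ ≤ ε)} ≤ ENNReal.ofReal ε

theorem IsApproxSolution.mono {W : Measure PlanarPath} {w₀ : ℝ × ℝ} {ε ε' : ℝ}
    {μ : Measure PlanarPath} (h : IsApproxSolution W w₀ ε μ) (hε : ε ≤ ε') :
    IsApproxSolution W w₀ ε' μ := by
  obtain ⟨s, t, h1, h2, h3, h4, h5⟩ := h
  refine ⟨s, t, h1.trans hε, by linarith, h3, h4, ?_⟩
  refine (measure_mono fun ω hω ↦ ?_).trans (h5.trans (ENNReal.ofReal_le_ofReal hε))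
  exact fun h' ↦ hω ⟨fun u hu ↦ (h'.1 u hu).trans hε, fun u hu ↦ (h'.2 u hu).trans hε⟩

theorem measurable_eval_pair (s t : unitInterval) :
    Measurable fun ω : PlanarPath ↦ (ω s, ω t) :=
  (by fun_prop : Continuous fun ω : PlanarPath ↦ (ω s, ω t)).measurable

theorem Resamples.lintegral_lo {W μ : Measure PlanarPath} {s t : unitInterval}
    (h : Resamples W μ s t) (r : Set.Icc s t) {H : (ℝ × ℝ) × (ℝ × ℝ) → ENNReal}
    (hH : Measurable H) : ∫⁻ ω, H (ω r, ω t) ∂μ =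
      ∫⁻ ω, ∫⁻ f, H (f r, ω t) ∂(quadrantBridge W s t (ω s) (ω t)) ∂μ :=
  h (fun q ↦ H (q.2 r, q.1.2)) (hH.comp (measurable_lo_eval r))

theorem Resamples.lintegral_hi {W μ : Measure PlanarPath} {s t : unitInterval}
    (h : Resamples W μ s t) (r : Set.Icc s t) {H : (ℝ × ℝ) × (ℝ × ℝ) → ENNReal}
    (hH : Measurable H) : ∫⁻ ω, H (ω s, ω r) ∂μ =
      ∫⁻ ω, ∫⁻ f, H (ω s, f r) ∂(quadrantBridge W s t (ω s) (ω t)) ∂μ :=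
  h (fun q ↦ H (q.1.1, q.2 r)) (hH.comp (measurable_hi_eval r))

theorem lintegral_chain (W : Measure PlanarPath) [IsProbabilityMeasure W] {μ : Measure PlanarPath}
    (b : TimeBase) (k : ℕ) (h1 : Resamples W μ (lo b (k + 1)) (hi b (k + 1)))
    (h2 : Resamples W μ (lo b k) (hi b (k + 1))) {h : (ℝ × ℝ) × (ℝ × ℝ) → ENNReal}
    (hh : Measurable h) :
    ∫⁻ ω, h (ω (lo b k), ω (hi b k)) ∂μ =
      ∫⁻ ω, ∫⁻ q, h q ∂(chainKernel W b k (ω (lo b (k + 1)), ω (hi b (k + 1)))) ∂μ := by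
  refine (h2.lintegral_hi (hiMem b k) hh).trans ?_
  have hm : Measurable fun p ↦ ∫⁻ q, h q ∂(hiStep W b k p) := hh.lintegral_kernel
  have e (p : (ℝ × ℝ) × (ℝ × ℝ)) : ∫⁻ q, h q ∂(hiStep W b k p) = ∫⁻ f', h (p.1, f' (hiMem b k))
      ∂(quadrantBridge W (lo b k) (hi b (k + 1)) p.1 p.2) :=
    lintegral_stepKernel W _ _ (measurable_hi_eval _) _ hh
  calc _ = ∫⁻ ω, ∫⁻ q, h q ∂(hiStep W b k (ω (lo b k), ω (hi b (k + 1)))) ∂μ :=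
        lintegral_congr fun ω ↦ (e _).symm
    _ = _ := h1.lintegral_lo (loMem b k) hm
    _ = _ := by
        refine lintegral_congr fun ω ↦ ?_
        rw [lintegral_chainKernel W b k _ hh]
        exact lintegral_congr fun f ↦ e _

theorem IsApproxSolution.lintegral_lyap_le {W : Measure PlanarPath} {w₀ : ℝ × ℝ} {ε : ℝ}
    {μ : Measure PlanarPath} [IsProbabilityMeasure μ] {C : ℝ} (hC : 0 < C)
    (hD : HasDrift W w₀ C) (b : TimeBase) (n : ℕ)
    (h : IsApproxSolution W w₀ ε μ) (hε : ε ≤ lo b n / 2) :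
    ∫⁻ ω, lyap w₀ (lo b n) (ω (lo b n), ω (hi b n)) ∂μ ≤ ENNReal.ofReal (16 + 12 * C) := by
  obtain ⟨s, t, hs, ht, hint, hres, hends⟩ := h
  have l0 := coe_lo_pos b n
  have l8 := coe_lo_le b n
  have hs0 := unitInterval.nonneg s
  have hsl : s < lo b n := by rw [← Subtype.coe_lt_coe]; linarith
  have hht : hi b n < t := by rw [← Subtype.coe_lt_coe, coe_hi]; linarith
  have hst : s < t := hsl.trans ((lo_lt_hi b n n).trans hht)
  have hε0 : 0 ≤ ε := hs0.trans hs
  set σ : ℝ := (lo b n : ℝ) with hσ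
  have step {s' t' : unitInterval} {X : PlanarPath → (ℝ × ℝ) × (ℝ × ℝ)}
      (hX : ∫⁻ ω, lyap w₀ σ (X ω) ∂μ ≤ ∫⁻ ω, (2 * lyap w₀ σ (ω s', ω t') + ENNReal.ofReal C) ∂μ) :
      ∫⁻ ω, lyap w₀ σ (X ω) ∂μ ≤ 2 * ∫⁻ ω, lyap w₀ σ (ω s', ω t') ∂μ + ENNReal.ofReal C := by
    refine hX.trans (le_of_eq ?_)
    have hm : Measurable fun ω : PlanarPath ↦ lyap w₀ σ (ω s', ω t') :=
      (measurable_lyap w₀ σ).comp (measurable_eval_pair s' t')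
    rw [lintegral_add_right _ measurable_const, lintegral_const_mul _ hm]
    simp
  have hσσ : ENNReal.ofReal (2 * (√σ / √σ)) = 2 := by
    rw [div_self (Real.sqrt_pos.2 l0).ne', mul_one, ENNReal.ofReal_ofNat]
  have start : ∫⁻ ω, lyap w₀ σ (ω s, ω t) ∂μ ≤ ENNReal.ofReal 2 := by
    set A := {ω : PlanarPath | ¬ ((∀ u, u ≤ s → ‖ω u‖ ≤ ε) ∧ ∀ u, t ≤ u → ‖ω u - w₀‖ ≤ ε)}
    have hsq : 0 < √σ := Real.sqrt_pos.2 l0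
    calc _ ≤ ∫⁻ ω, (ENNReal.ofReal (2 * ε / √σ) +
            (toMeasurable μ A).indicator (fun _ ↦ ENNReal.ofReal (2 / √σ)) ω) ∂μ := by
          refine lintegral_mono_ae ?_
          filter_upwards [hint s le_rfl hst.le, hint t hst.le le_rfl] with ω h1 h2
          rw [lyap_of_isInterior w₀ σ (p := (ω s, ω t)) ⟨h1, h2⟩]
          by_cases hω : ω ∈ toMeasurable μ A
          · rw [Set.indicator_of_mem hω]
            refine le_add_left (ENNReal.ofReal_le_ofReal ?_)
            gcongr
            exact endDist_le_two w₀ _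
          · refine le_add_right (ENNReal.ofReal_le_ofReal ?_)
            have hω' := not_not.1 fun h ↦ hω (subset_toMeasurable μ A h)
            gcongr
            have a := hω'.1 s le_rfl
            have b := hω'.2 t le_rfl
            unfold endDist
            linarith [min_le_left ‖ω s‖ 1, min_le_left ‖ω t - w₀‖ 1]
      _ = ENNReal.ofReal (2 * ε / √σ) + ENNReal.ofReal (2 / √σ) * μ A := by
          rw [lintegral_add_left measurable_const,
            lintegral_indicator_const (measurableSet_toMeasurable _ _), measure_toMeasurable]
          simp
      _ ≤ ENNReal.ofReal (2 * ε / √σ) + ENNReal.ofReal (2 / √σ) * ENNReal.ofReal ε := by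
          gcongr
      _ = ENNReal.ofReal (4 * ε / √σ) := by
          rw [← ENNReal.ofReal_mul (by positivity), ← ENNReal.ofReal_add (by positivity)
            (by positivity)]
          congr 1
          ring
      _ ≤ _ := by
          refine ENNReal.ofReal_le_ofReal ?_
          rw [div_le_iff₀ hsq]
          have : σ ≤ √σ := Real.le_sqrt_of_sq_le (by nlinarith)
          linarith
  have one : ∫⁻ ω, lyap w₀ σ (ω (lo b n), ω t) ∂μ ≤
      2 * ∫⁻ ω, lyap w₀ σ (ω s, ω t) ∂μ + ENNReal.ofReal C := by
    refine step (X := fun ω ↦ (ω (lo b n), ω t)) ?_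
    rw [(hres s t le_rfl hst le_rfl).lintegral_lo
      ⟨lo b n, hsl.le, ((lo_lt_hi b n n).trans hht).le⟩ (measurable_lyap w₀ σ)]
    refine lintegral_mono_ae ?_
    filter_upwards [hint s le_rfl hst.le, hint t hst.le le_rfl] with ω h1 h2
    have := (hD s t (ω s, ω t) σ σ hst (by linarith) l0 l0 ⟨h1, h2⟩).1
      ⟨lo b n, hsl.le, ((lo_lt_hi b n n).trans hht).le⟩ hsl (by simp only; linarith)
      (by simp only; linarith)
    rwa [hσσ] at this
  have two : ∫⁻ ω, lyap w₀ σ (ω (lo b n), ω (hi b n)) ∂μ ≤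
      2 * ∫⁻ ω, lyap w₀ σ (ω (lo b n), ω t) ∂μ + ENNReal.ofReal C := by
    have hlt : lo b n < t := (lo_lt_hi b n n).trans hht
    have ht1 := unitInterval.le_one t
    refine step (X := fun ω ↦ (ω (lo b n), ω (hi b n))) ?_
    rw [(hres (lo b n) t hsl.le hlt le_rfl).lintegral_hi
      ⟨hi b n, (lo_lt_hi b n n).le, hht.le⟩ (measurable_lyap w₀ σ)]
    refine lintegral_mono_ae ?_
    filter_upwards [hint (lo b n) hsl.le hlt.le, hint t hst.le le_rfl] with ω h1 h2
    have := (hD (lo b n) t (ω (lo b n), ω t) σ σ hlt (by linarith) l0 l0 ⟨h1, h2⟩).2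
      ⟨hi b n, (lo_lt_hi b n n).le, hht.le⟩ hht (by simp only [coe_hi]; linarith)
      (by simp only [coe_hi]; linarith)
    rwa [hσσ] at this
  calc _ ≤ 2 * (2 * ENNReal.ofReal 2 + ENNReal.ofReal C) + ENNReal.ofReal C := by
        refine two.trans ?_
        gcongr
        exact one.trans (by gcongr)
    _ = ENNReal.ofReal (8 + 3 * C) := by
        rw [ENNReal.ofReal_add (by norm_num) (by positivity),
          ENNReal.ofReal_mul (by norm_num : (0 : ℝ) ≤ 3)]
        simp only [ENNReal.ofReal_ofNat]
        ring
    _ ≤ _ := ENNReal.ofReal_le_ofReal (by linarith)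

namespace IsCorrelatedBrownianLaw

variable {α : ℝ} {W : Measure PlanarPath}

/-- Away from the times `0` and `1`, approximate solutions are close in total variation. -/
theorem exists_inside_close (hα : α ∈ Set.Ioo (-1 : ℝ) 1) [IsProbabilityMeasure W]
    (hW : IsCorrelatedBrownianLaw α W) (w₀ : ℝ × ℝ) :
    ∃ b : TimeBase, ∀ (j : ℕ) (η : ℝ), 0 < η → ∃ ε : ℝ, 0 < ε ∧
      ∀ μ μ' : Measure PlanarPath, IsProbabilityMeasure μ → IsProbabilityMeasure μ' →
        IsApproxSolution W w₀ ε μ → IsApproxSolution W w₀ ε μ' →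
        ∀ g : C(Set.Icc (lo b j) (hi b j), ℝ × ℝ) → ENNReal, Measurable g → (∀ f, g f ≤ 1) →
        ∫⁻ ω, g (inside _ _ ω) ∂μ ≤ ∫⁻ ω, g (inside _ _ ω) ∂μ' + ENNReal.ofReal η := by
  obtain ⟨C, hC, hD⟩ := hW.exists_hasDrift hα w₀
  obtain ⟨b, c, ν, hc0, hc, hν, hmin⟩ :=
    exists_chainKernel_minorization hα hW w₀ (K := 16 + 12 * C) (by positivity)
  refine ⟨b, fun j η hη ↦ ?_⟩
  have hc1 : 1 - c < 1 := ENNReal.sub_lt_self ENNReal.one_ne_top one_ne_zero hc0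
  obtain ⟨n, hn⟩ : ∃ n : ℕ, (1 - c) ^ n ≤ ENNReal.ofReal η :=
    ((ENNReal.tendsto_pow_atTop_nhds_zero_of_lt_one hc1).eventually
      (ge_mem_nhds (ENNReal.ofReal_pos.2 hη))).exists
  have l0 := coe_lo_pos b (j + n)
  refine ⟨lo b (j + n) / 2, by positivity, fun μ μ' hμ hμ' h h' g hg hg1 ↦ ?_⟩
  let κ : ℕ → Kernel ((ℝ × ℝ) × (ℝ × ℝ)) ((ℝ × ℝ) × (ℝ × ℝ)) := fun i ↦ chainKernel W b (j + i)
  let g₀ : (ℝ × ℝ) × (ℝ × ℝ) → ENNReal := fun p ↦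
    ∫⁻ f, g f ∂(quadrantBridgeKernel W (lo b j) (hi b j) p)
  have hg₀ : Measurable g₀ := hg.lintegral_kernel
  have hg₀1 (p : (ℝ × ℝ) × (ℝ × ℝ)) : g₀ p ≤ 1 := by
    have hle : quadrantBridge W (lo b j) (hi b j) p.1 p.2 Set.univ ≤ 1 := by
      rw [quadrantBridge, cond_apply (measurableSet_stayInQuadrant _ _), Set.inter_univ]
      exact ENNReal.inv_mul_le_one _
    calc g₀ p ≤ ∫⁻ _, 1 ∂(quadrantBridgeKernel W (lo b j) (hi b j) p) :=
          lintegral_mono fun f ↦ hg1 f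
      _ = quadrantBridge W (lo b j) (hi b j) p.1 p.2 Set.univ := by rw [lintegral_one]; rfl
      _ ≤ 1 := hle
  have key (μ : Measure PlanarPath) (h : IsApproxSolution W w₀ (lo b (j + n) / 2) μ) :
      ∫⁻ ω, g (inside _ _ ω) ∂μ =
        ∫⁻ p, iterInt κ g₀ n p ∂(μ.map fun ω ↦ (ω (lo b (j + n)), ω (hi b (j + n)))) := by
    obtain ⟨s, t, hs, ht, hint, hres, hends⟩ := h
    have hlo {i : ℕ} (hi : i ≤ j + n) : s ≤ lo b i := by
      have : lo b (j + n) ≤ lo b i := antitone_nat_of_succ_le (fun k ↦ (lo_succ_lt b k).le) hi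
      refine le_trans ?_ this
      rw [← Subtype.coe_le_coe]; linarith
    have hhi {i : ℕ} (hi' : i ≤ j + n) : hi b i ≤ t := by
      have : hi b i ≤ hi b (j + n) := monotone_nat_of_le_succ (fun k ↦ (hi_lt_succ b k).le) hi'
      refine this.trans ?_
      rw [← Subtype.coe_le_coe, coe_hi]; linarith
    have iter (i : ℕ) (hi' : i ≤ n) : ∫⁻ ω, g (inside _ _ ω) ∂μ =
        ∫⁻ ω, iterInt κ g₀ i (ω (lo b (j + i)), ω (hi b (j + i))) ∂μ := by
      induction i with
      | zero =>
        exact hres (lo b j) (hi b j) (hlo (by omega)) (lo_lt_hi b j j) (hhi (by omega))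
          (fun q ↦ g q.2) (hg.comp measurable_snd)
      | succ i ih =>
        rw [ih (by omega)]
        exact lintegral_chain W b (j + i)
          (hres _ _ (hlo (by omega)) (lo_lt_hi b _ _) (hhi (by omega)))
          (hres _ _ (hlo (by omega)) (lo_lt_hi b _ _) (hhi (by omega)))
          (measurable_iterInt κ hg₀ i)
    rw [iter n le_rfl, lintegral_map (measurable_iterInt κ hg₀ n) (measurable_eval_pair _ _)]
  have hV (μ : Measure PlanarPath) [IsProbabilityMeasure μ]
      (h : IsApproxSolution W w₀ (lo b (j + n) / 2) μ) :
      ∫⁻ p, lyap w₀ (lo b (j + n)) p ∂(μ.map fun ω ↦ (ω (lo b (j + n)), ω (hi b (j + n)))) ≤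
        ENNReal.ofReal (16 + 12 * C) := by
    rw [lintegral_map (measurable_lyap _ _) (measurable_eval_pair _ _)]
    exact h.lintegral_lyap_le hC hD b (j + n) le_rfl
  rw [key μ h, key μ' h']
  have p1 := Measure.isProbabilityMeasure_map (μ := μ)
    (measurable_eval_pair (lo b (j + n)) (hi b (j + n))).aemeasurable
  have p2 := Measure.isProbabilityMeasure_map (μ := μ')
    (measurable_eval_pair (lo b (j + n)) (hi b (j + n))).aemeasurable
  have hν' : ∀ k, IsProbabilityMeasure (ν (j + k)) := fun k ↦ hν _
  refine (lintegral_iterInt_le κ (fun k ↦ lyap w₀ (lo b (j + k))) (fun k ↦ measurable_lyap _ _)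
    (fun k ↦ ν (j + k)) (K := ENNReal.ofReal (16 + 12 * C)) ?_ ENNReal.ofReal_ne_top hc
    (fun k x hx ↦ chainKernel_univ hα hW b (j + k) (isInterior_of_lyap_ne_top hx))
    (fun k x ↦ chainKernel_drift hα hW hD b (j + k) x) (fun k x hx ↦ hmin (j + k) x hx)
    hg₀ hg₀1 n _ _ (hV μ h) (hV μ' h')).trans (by gcongr)
  exact (ENNReal.ofReal_pos.2 (by positivity)).ne'

/-- Approximate solutions stay close to their end values near the times `0` and `1`. -/
theorem exists_ends_bound (hα : α ∈ Set.Ioo (-1 : ℝ) 1)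
    (hW : IsCorrelatedBrownianLaw α W) (w₀ : ℝ × ℝ) :
    ∃ C : ℝ, 0 < C ∧ ∀ (ε η : ℝ) (r : unitInterval) (μ : Measure PlanarPath),
      IsProbabilityMeasure μ → IsApproxSolution W w₀ ε μ → 0 < η → ε ≤ η / 2 → ε < r →
      (r : ℝ) ≤ 1 / 8 →
      μ {ω | ¬ ((∀ u, u ≤ r → ‖ω u‖ ≤ η) ∧ ∀ u, unitInterval.symm r ≤ u → ‖ω u - w₀‖ ≤ η)} ≤
        ENNReal.ofReal (ε + C * √(r : ℝ) / η) := by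
  obtain ⟨C, hC, hE⟩ := hW.exists_step_bounds hα (1 + ‖w₀‖)
  refine ⟨4 * C, by positivity, fun ε η r μ hμ h hη hεη hεr hr ↦ ?_⟩
  obtain ⟨s, t, hs, ht, hint, hres, hends⟩ := h
  have hs0 := unitInterval.nonneg s
  have hε0 : 0 ≤ ε := hs0.trans hs
  have hsr : s < r := by rw [← Subtype.coe_lt_coe]; linarith
  have hst : s < t := by rw [← Subtype.coe_lt_coe]; linarith
  have hrt : r < t := by rw [← Subtype.coe_lt_coe]; linarith
  have hrt' : unitInterval.symm r < t := by
    rw [← Subtype.coe_lt_coe, unitInterval.coe_symm_eq]; linarith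
  have hsr' : s < unitInterval.symm r := by
    rw [← Subtype.coe_lt_coe, unitInterval.coe_symm_eq]; linarith
  let rl : Set.Icc s t := ⟨r, hsr.le, hrt.le⟩
  let rh : Set.Icc s t := ⟨unitInterval.symm r, hsr'.le, hrt'.le⟩
  let D₁ : C(Set.Icc s t, ℝ × ℝ) → ENNReal := fun f ↦
    ⨆ u, ⨆ (_ : u ≤ rl), ‖f u - f ⟨s, le_rfl, hst.le⟩‖ₑ
  let D₂ : C(Set.Icc s t, ℝ × ℝ) → ENNReal := fun f ↦
    ⨆ u, ⨆ (_ : rh ≤ u), ‖f u - f ⟨t, hst.le, le_rfl⟩‖ₑ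
  have mD₁ : Measurable D₁ := by
    refine (lowerSemicontinuous_iSup fun u ↦ lowerSemicontinuous_iSup fun _ ↦ ?_).measurable
    exact (by fun_prop : Continuous fun f : C(Set.Icc s t, ℝ × ℝ) ↦
      ‖f u - f ⟨s, le_rfl, hst.le⟩‖ₑ).lowerSemicontinuous
  have mD₂ : Measurable D₂ := by
    refine (lowerSemicontinuous_iSup fun u ↦ lowerSemicontinuous_iSup fun _ ↦ ?_).measurable
    exact (by fun_prop : Continuous fun f : C(Set.Icc s t, ℝ × ℝ) ↦
      ‖f u - f ⟨t, hst.le, le_rfl⟩‖ₑ).lowerSemicontinuous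
  set A := {ω : PlanarPath | ¬ ((∀ u, u ≤ s → ‖ω u‖ ≤ ε) ∧ ∀ u, t ≤ u → ‖ω u - w₀‖ ≤ ε)}
  let S : Set ((ℝ × ℝ) × (ℝ × ℝ)) := {p | ‖p.1‖ ≤ 1 ∧ ‖p.2 - w₀‖ ≤ 1}
  have mS : MeasurableSet S :=
    ((isClosed_le (f := fun p : (ℝ × ℝ) × (ℝ × ℝ) ↦ ‖p.1‖) (by fun_prop) continuous_const).inter
      (isClosed_le (f := fun p : (ℝ × ℝ) × (ℝ × ℝ) ↦ ‖p.2 - w₀‖) (by fun_prop)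
        continuous_const)).measurableSet
  have bound (p : (ℝ × ℝ) × (ℝ × ℝ)) (hp : IsInterior p.1 ∧ IsInterior p.2) (hpS : p ∈ S) :=
    hE s t hst p.1 p.2 (by linarith) hp.1.1 hp.1.2 hp.2.1 hp.2.2
      (hpS.1.trans (by linarith [norm_nonneg w₀])) (by
        calc ‖p.2‖ = ‖(p.2 - w₀) + w₀‖ := by congr 1; abel
          _ ≤ _ := (norm_add_le _ _).trans (by gcongr; exact hpS.2))
  have markov (D : C(Set.Icc s t, ℝ × ℝ) → ENNReal) (mD : Measurable D)
      (hD : ∀ p, IsInterior p.1 ∧ IsInterior p.2 → p ∈ S →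
        ∫⁻ f, D f ∂(quadrantBridge W s t p.1 p.2) ≤ ENNReal.ofReal (C * √(r : ℝ))) :
      μ {ω | (ω s, ω t) ∈ S ∧ ENNReal.ofReal (η / 2) ≤ D (inside s t ω)} ≤
        ENNReal.ofReal (2 * C * √(r : ℝ) / η) := by
    have hη2 : ENNReal.ofReal (η / 2) ≠ 0 := (ENNReal.ofReal_pos.2 (by positivity)).ne'
    have mG : Measurable fun q : ((ℝ × ℝ) × (ℝ × ℝ)) × C(Set.Icc s t, ℝ × ℝ) ↦
        S.indicator 1 q.1 * D q.2 :=
      ((measurable_one.indicator mS).comp measurable_fst).mul (mD.comp measurable_snd)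
    have hle : ∫⁻ ω, S.indicator 1 (ω s, ω t) * D (inside s t ω) ∂μ ≤
        ENNReal.ofReal (C * √(r : ℝ)) := by
      rw [hres s t le_rfl hst le_rfl _ mG]
      calc _ ≤ ∫⁻ _, ENNReal.ofReal (C * √(r : ℝ)) ∂μ := by
            refine lintegral_mono_ae ?_
            filter_upwards [hint s le_rfl hst.le, hint t hst.le le_rfl] with ω h1 h2
            by_cases hω : (ω s, ω t) ∈ S
            · simp only [Set.indicator_of_mem hω, Pi.one_apply, one_mul]
              exact hD (ω s, ω t) ⟨h1, h2⟩ hω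
            · simp [Set.indicator_of_notMem hω]
        _ = _ := by simp
    have mI : Measurable fun ω : PlanarPath ↦ S.indicator 1 (ω s, ω t) * D (inside s t ω) :=
      mG.comp ((measurable_eval_pair s t).prodMk
        (ContinuousMap.continuous_restrict (Set.Icc s t)).measurable)
    have hm := (mul_meas_ge_le_lintegral mI (ENNReal.ofReal (η / 2))).trans hle
    rw [mul_comm, ← ENNReal.le_div_iff_mul_le (Or.inl hη2) (Or.inl ENNReal.ofReal_ne_top),
      ← ENNReal.ofReal_div_of_pos (by positivity)] at hm
    refine (measure_mono fun ω hω ↦ ?_).trans (hm.trans (le_of_eq ?_))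
    · change _ ≤ S.indicator 1 (ω s, ω t) * D (inside s t ω)
      rw [Set.indicator_of_mem hω.1, Pi.one_apply, one_mul]
      exact hω.2
    · congr 1
      field_simp
  have b₁ := markov D₁ mD₁ fun p hp hpS ↦ ((bound p hp hpS).2.1 rl hsr
    (by simp only [rl]; linarith)).trans (by gcongr; simp only [rl]; linarith)
  have b₂ := markov D₂ mD₂ fun p hp hpS ↦ ((bound p hp hpS).2.2 rh hrt'
    (by simp only [rh, unitInterval.coe_symm_eq]; linarith [unitInterval.le_one t])).trans (by
      gcongr
      simp only [rh, unitInterval.coe_symm_eq]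
      linarith [unitInterval.le_one t])
  have hε1 : ε ≤ 1 := by linarith
  have cover : {ω : PlanarPath | ¬ ((∀ u, u ≤ r → ‖ω u‖ ≤ η) ∧
      ∀ u, unitInterval.symm r ≤ u → ‖ω u - w₀‖ ≤ η)} ⊆
      A ∪ ({ω | (ω s, ω t) ∈ S ∧ ENNReal.ofReal (η / 2) ≤ D₁ (inside s t ω)} ∪
        {ω | (ω s, ω t) ∈ S ∧ ENNReal.ofReal (η / 2) ≤ D₂ (inside s t ω)}) := by
    intro ω hω
    by_contra hcon
    simp only [Set.mem_union, not_or] at hcon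
    obtain ⟨hA, h1, h2⟩ := hcon
    have hA' := not_not.1 hA
    have hSω : (ω s, ω t) ∈ S :=
      ⟨(hA'.1 s le_rfl).trans hε1, (hA'.2 t le_rfl).trans hε1⟩
    have h1' : D₁ (inside s t ω) < ENNReal.ofReal (η / 2) := not_le.1 fun h ↦ h1 ⟨hSω, h⟩
    have h2' : D₂ (inside s t ω) < ENNReal.ofReal (η / 2) := not_le.1 fun h ↦ h2 ⟨hSω, h⟩
    refine hω ⟨fun u hu ↦ ?_, fun u hu ↦ ?_⟩
    · rcases le_total u s with hus | hus
      · exact (hA'.1 u hus).trans (by linarith)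
      · have hd : ‖ω u - ω s‖ₑ ≤ ENNReal.ofReal (η / 2) :=
          (le_iSup₂_of_le (f := fun (u : Set.Icc s t) (_ : u ≤ rl) ↦
            ‖inside s t ω u - inside s t ω ⟨s, le_rfl, hst.le⟩‖ₑ)
            ⟨u, hus, hu.trans hrt.le⟩ hu le_rfl).trans h1'.le
        rw [← ofReal_norm, ENNReal.ofReal_le_ofReal_iff (by positivity)] at hd
        calc ‖ω u‖ = ‖(ω u - ω s) + ω s‖ := by congr 1; abel
          _ ≤ ‖ω u - ω s‖ + ‖ω s‖ := norm_add_le _ _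
          _ ≤ η := by linarith [hA'.1 s le_rfl]
    · rcases le_total t u with hus | hus
      · exact (hA'.2 u hus).trans (by linarith)
      · have hd : ‖ω u - ω t‖ₑ ≤ ENNReal.ofReal (η / 2) :=
          (le_iSup₂_of_le (f := fun (u : Set.Icc s t) (_ : rh ≤ u) ↦
            ‖inside s t ω u - inside s t ω ⟨t, hst.le, le_rfl⟩‖ₑ)
            ⟨u, hsr'.le.trans hu, hus⟩ hu le_rfl).trans h2'.le
        rw [← ofReal_norm, ENNReal.ofReal_le_ofReal_iff (by positivity)] at hd
        calc ‖ω u - w₀‖ = ‖(ω u - ω t) + (ω t - w₀)‖ := by congr 1; abel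
          _ ≤ ‖ω u - ω t‖ + ‖ω t - w₀‖ := norm_add_le _ _
          _ ≤ η := by linarith [hA'.2 t le_rfl]
  refine (measure_mono cover).trans ((measure_union_le _ _).trans ?_)
  calc _ ≤ ENNReal.ofReal ε + (ENNReal.ofReal (2 * C * √(r : ℝ) / η) +
        ENNReal.ofReal (2 * C * √(r : ℝ) / η)) :=
        add_le_add hends ((measure_union_le _ _).trans (add_le_add b₁ b₂))
    _ = _ := by
        rw [← ENNReal.ofReal_add (by positivity) (by positivity),
          ← ENNReal.ofReal_add hε0 (by positivity)]
        congr 1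
        ring

end IsCorrelatedBrownianLaw

/-! ### Weak convergence of approximate solutions -/

/-- The path on `[0, 1]` that agrees with `f` on `[s, t]` and is constant before and after. -/
noncomputable def extendConst {s t : unitInterval} (h : s ≤ t) (f : C(Set.Icc s t, ℝ × ℝ)) : PlanarPath :=
  f.comp ⟨Set.projIcc s t h, continuous_projIcc⟩

theorem extendConst_apply {s t : unitInterval} (h : s ≤ t) (f : C(Set.Icc s t, ℝ × ℝ))
    (u : unitInterval) : extendConst h f u = f (Set.projIcc s t h u) := rfl

theorem extendConst_of_mem {s t : unitInterval} (h : s ≤ t) (f : C(Set.Icc s t, ℝ × ℝ))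
    {u : unitInterval} (hu : u ∈ Set.Icc s t) : extendConst h f u = f ⟨u, hu⟩ := by
  rw [extendConst_apply, Set.projIcc_of_mem]

theorem extendConst_of_le {s t : unitInterval} (h : s ≤ t) (f : C(Set.Icc s t, ℝ × ℝ))
    {u : unitInterval} (hu : u ≤ s) : extendConst h f u = f ⟨s, le_rfl, h⟩ := by
  rw [extendConst_apply, Set.projIcc_of_le_left h hu]

theorem extendConst_of_ge {s t : unitInterval} (h : s ≤ t) (f : C(Set.Icc s t, ℝ × ℝ))
    {u : unitInterval} (hu : t ≤ u) : extendConst h f u = f ⟨t, h, le_rfl⟩ := by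
  rw [extendConst_apply, Set.projIcc_of_right_le h hu]

theorem continuous_extendConst {s t : unitInterval} (h : s ≤ t) :
    Continuous (extendConst h) := ContinuousMap.continuous_precomp _

theorem continuous_inside (s t : unitInterval) : Continuous (inside s t) :=
  ContinuousMap.continuous_restrict _

theorem dist_extendConst_inside_le {s t : unitInterval} (h : s ≤ t) {ω : PlanarPath} {x y : ℝ × ℝ}
    {η : ℝ} (h1 : ∀ u, u ≤ s → ‖ω u - x‖ ≤ η) (h2 : ∀ u, t ≤ u → ‖ω u - y‖ ≤ η) :
    dist ω (extendConst h (inside s t ω)) ≤ 2 * η := by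
  have h0 : 0 ≤ η := (norm_nonneg _).trans (h1 s le_rfl)
  refine (ContinuousMap.dist_le (by positivity)).2 fun u ↦ ?_
  have key {u v : unitInterval} {a : ℝ × ℝ} (hu : ‖ω u - a‖ ≤ η) (hv : ‖ω v - a‖ ≤ η) :
      dist (ω u) (ω v) ≤ 2 * η := by
    rw [← dist_eq_norm] at hu hv
    linarith [dist_triangle_right (ω u) (ω v) a]
  rcases le_total u s with hu | hu
  · rw [extendConst_of_le h _ hu]
    exact key (h1 u hu) (h1 s le_rfl)
  · rcases le_total t u with hu' | hu'
    · rw [extendConst_of_ge h _ hu']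
      exact key (h2 u hu') (h2 t le_rfl)
    · rw [extendConst_of_mem h _ ⟨hu, hu'⟩]
      change dist (ω u) (ω u) ≤ _
      rw [dist_self]
      positivity

theorem measure_inside_le_of_lintegral_le {s t : unitInterval} {μ μ' : Measure PlanarPath}
    {η : ENNReal} (h : ∀ g : C(Set.Icc s t, ℝ × ℝ) → ENNReal, Measurable g → (∀ f, g f ≤ 1) →
      ∫⁻ ω, g (inside s t ω) ∂μ ≤ ∫⁻ ω, g (inside s t ω) ∂μ' + η)
    {E : Set C(Set.Icc s t, ℝ × ℝ)} (hE : MeasurableSet E) :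
    μ (inside s t ⁻¹' E) ≤ μ' (inside s t ⁻¹' E) + η := by
  have e (m : Measure PlanarPath) :
      ∫⁻ ω, E.indicator 1 (inside s t ω) ∂m = m (inside s t ⁻¹' E) := by
    have hm := (continuous_inside s t).measurable hE
    rw [← lintegral_indicator_one hm]
    rfl
  have := h (E.indicator 1) (measurable_one.indicator hE) (Set.indicator_le_self' fun _ _ ↦ zero_le)
  rwa [e, e] at this

theorem tendsto_coe_lo (b : TimeBase) : Filter.Tendsto (fun k ↦ (lo b k : ℝ)) Filter.atTop (𝓝 0) := by
  have := (tendsto_pow_atTop_nhds_zero_of_lt_one (r := (1 / 256 : ℝ)) (by norm_num)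
    (by norm_num)).const_mul (b : ℝ)
  rwa [mul_zero] at this

namespace IsCorrelatedBrownianLaw

variable {α : ℝ} {W : Measure PlanarPath}

/-- Approximate solutions are close in the Lévy–Prokhorov sense. -/
theorem exists_measure_le_thickening (hα : α ∈ Set.Ioo (-1 : ℝ) 1) [IsProbabilityMeasure W]
    (hW : IsCorrelatedBrownianLaw α W) (w₀ : ℝ × ℝ) {η : ℝ} (hη : 0 < η) :
    ∃ ε : ℝ, 0 < ε ∧ ∀ μ μ' : Measure PlanarPath, IsProbabilityMeasure μ →
      IsProbabilityMeasure μ' → IsApproxSolution W w₀ ε μ → IsApproxSolution W w₀ ε μ' →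
      ∀ B : Set PlanarPath, μ B ≤ μ' (Metric.thickening η B) + ENNReal.ofReal η := by
  obtain ⟨C, hC, hends⟩ := hW.exists_ends_bound hα w₀
  obtain ⟨b, hclose⟩ := hW.exists_inside_close hα w₀
  set δ := η / 8 with hδ
  have hδ0 : 0 < δ := by positivity
  obtain ⟨j, hj⟩ : ∃ j : ℕ, C * √(lo b j : ℝ) / δ ≤ δ := by
    have := ((Real.continuous_sqrt.tendsto 0).comp (tendsto_coe_lo b)).const_mul C |>.div_const δ
    rw [Real.sqrt_zero, mul_zero, zero_div] at this
    exact (this.eventually (ge_mem_nhds hδ0)).exists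
  obtain ⟨ε, hε, hj'⟩ := hclose j δ hδ0
  have hl := coe_lo_pos b j
  refine ⟨min ε (min (δ / 2) (lo b j / 2)), by positivity, fun μ μ' hμ hμ' h h' B ↦ ?_⟩
  set ε' := min ε (min (δ / 2) (lo b j / 2))
  have hε'ε : ε' ≤ ε := min_le_left _ _
  have hε'δ : ε' ≤ δ / 2 := (min_le_right _ _).trans (min_le_left _ _)
  have hε'l : ε' < lo b j := ((min_le_right _ _).trans (min_le_right _ _)).trans_lt (by linarith)
  clear_value ε' δ
  set D := {ω : PlanarPath | ¬ ((∀ u, u ≤ lo b j → ‖ω u‖ ≤ δ) ∧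
    ∀ u, unitInterval.symm (lo b j) ≤ u → ‖ω u - w₀‖ ≤ δ)}
  have hD (m : Measure PlanarPath) (hm : IsProbabilityMeasure m) (hm' : IsApproxSolution W w₀ ε' m) :
      m D ≤ ENNReal.ofReal (2 * δ) :=
    (hends ε' δ (lo b j) m hm hm' hδ0 hε'δ hε'l (coe_lo_le b j)).trans
      (ENNReal.ofReal_le_ofReal (by linarith))
  have hst : lo b j ≤ hi b j := (lo_lt_hi b j j).le
  have hdist {ω : PlanarPath} (hω : ω ∉ D) : dist ω (extendConst hst (inside _ _ ω)) ≤ 2 * δ := by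
    obtain ⟨h1, h2⟩ := not_not.1 hω
    exact dist_extendConst_inside_le hst (x := 0) (y := w₀) (fun u hu ↦ by simpa using h1 u hu) h2
  set E : Set C(Set.Icc (lo b j) (hi b j), ℝ × ℝ) :=
    extendConst hst ⁻¹' Metric.thickening (3 * δ) B
  have hE : MeasurableSet E :=
    (Metric.isOpen_thickening.preimage (continuous_extendConst hst)).measurableSet
  have hin := measure_inside_le_of_lintegral_le (hj' μ μ' hμ hμ' (h.mono hε'ε) (h'.mono hε'ε)) hE
  have memE (ω : PlanarPath) (h : ω ∈ inside (lo b j) (hi b j) ⁻¹' E) :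
      extendConst hst (inside _ _ ω) ∈ Metric.thickening (3 * δ) B := h
  have memE' (ω : PlanarPath) (h : extendConst hst (inside _ _ ω) ∈ Metric.thickening (3 * δ) B) :
      ω ∈ inside (lo b j) (hi b j) ⁻¹' E := h
  have c1 : B ⊆ D ∪ inside _ _ ⁻¹' E := fun ω hω ↦ by
    by_cases hωD : ω ∈ D
    · exact Or.inl hωD
    · refine Or.inr (memE' ω (Metric.mem_thickening_iff.2 ⟨ω, hω, ?_⟩))
      rw [dist_comm]
      exact (hdist hωD).trans_lt (by linarith)
  have c2 : inside _ _ ⁻¹' E ⊆ D ∪ Metric.thickening η B := fun ω hω ↦ by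
    by_cases hωD : ω ∈ D
    · exact Or.inl hωD
    · obtain ⟨x, hx, hdx⟩ := Metric.mem_thickening_iff.1 (memE ω hω)
      refine Or.inr (Metric.mem_thickening_iff.2 ⟨x, hx, ?_⟩)
      linarith [dist_triangle ω (extendConst hst (inside _ _ ω)) x, hdist hωD]
  calc μ B ≤ μ D + μ (inside _ _ ⁻¹' E) := (measure_mono c1).trans (measure_union_le _ _)
    _ ≤ ENNReal.ofReal (2 * δ) + ((ENNReal.ofReal (2 * δ) + μ' (Metric.thickening η B)) +
        ENNReal.ofReal δ) :=
      add_le_add (hD μ hμ h) (hin.trans (add_le_add_left ((measure_mono c2).trans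
        ((measure_union_le _ _).trans (add_le_add_left (hD μ' hμ' h') _))) _))
    _ = μ' (Metric.thickening η B) + ENNReal.ofReal (5 * δ) := by
      rw [show 5 * δ = 2 * δ + 2 * δ + δ by ring, ENNReal.ofReal_add (by positivity) hδ0.le,
        ENNReal.ofReal_add (by positivity) (by positivity)]
      ring
    _ ≤ _ := by gcongr; linarith

theorem tendsto_of_isApproxSolution (hα : α ∈ Set.Ioo (-1 : ℝ) 1) [IsProbabilityMeasure W]
    (hW : IsCorrelatedBrownianLaw α W) {w₀ : ℝ × ℝ} {ι : Type*} {l : Filter ι}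
    [l.IsCountablyGenerated] {μ : ι → ProbabilityMeasure PlanarPath}
    {ν : ProbabilityMeasure PlanarPath}
    (hμ : ∀ ε : ℝ, 0 < ε → ∀ᶠ i in l, IsApproxSolution W w₀ ε (μ i))
    (hν : ∀ ε : ℝ, 0 < ε → IsApproxSolution W w₀ ε ν) : Filter.Tendsto μ l (𝓝 ν) := by
  refine tendsto_of_forall_isClosed_limsup_le' fun F hF ↦ ?_
  have key (η : ℝ) (hη : 0 < η) : Filter.limsup (fun i ↦ (μ i : Measure PlanarPath) F) l ≤
      (ν : Measure PlanarPath) (Metric.thickening η F) + ENNReal.ofReal η := by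
    obtain ⟨ε, hε, h⟩ := hW.exists_measure_le_thickening hα w₀ hη
    refine Filter.limsup_le_of_le (by isBoundedDefault) ?_
    filter_upwards [hμ ε hε] with i hi
    exact h _ _ inferInstance inferInstance hi (hν ε hε) F
  have t1 := tendsto_measure_thickening_of_isClosed (μ := (ν : Measure PlanarPath))
    ⟨1, one_pos, measure_ne_top _ _⟩ hF
  have t2 : Filter.Tendsto (fun η : ℝ ↦ ENNReal.ofReal η) (𝓝[>] 0) (𝓝 0) := by
    have := (ENNReal.continuous_ofReal.tendsto 0).mono_left (nhdsWithin_le_nhds (s := Set.Ioi 0))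
    rwa [ENNReal.ofReal_zero] at this
  have t3 := t1.add t2
  rw [add_zero] at t3
  exact ge_of_tendsto t3 (Filter.eventually_of_mem self_mem_nhdsWithin fun η hη ↦ key η hη)

end IsCorrelatedBrownianLaw

/-- A sequence of probability measures that is Cauchy in the Lévy–Prokhorov sense is tight. -/
theorem isTightMeasureSet_range_of_le_thickening {E : Type*} [PseudoMetricSpace E] [CompleteSpace E]
    [SecondCountableTopology E] [MeasurableSpace E] [BorelSpace E] {μ : ℕ → Measure E}
    [∀ n, IsProbabilityMeasure (μ n)]
    (h : ∀ η : ℝ, 0 < η → ∃ N, ∀ n, N ≤ n → ∀ B : Set E,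
      μ n B ≤ μ N (Metric.thickening η B) + ENNReal.ofReal η) :
    IsTightMeasureSet (Set.range μ) := by
  rw [isTightMeasureSet_iff_exists_isCompact_measure_compl_le]
  intro ε hε
  have single (η : ℝ) (hη : 0 < η) : ∃ K : Set E, IsCompact K ∧
      ∀ n, μ n (Metric.cthickening η K)ᶜ ≤ 2 * ENNReal.ofReal η := by
    obtain ⟨N, hN⟩ := h η hη
    have hK (n : ℕ) : ∃ K : Set E, IsCompact K ∧ μ n Kᶜ ≤ ENNReal.ofReal η := by
      obtain ⟨K, hK, hK'⟩ := isTightMeasureSet_iff_exists_isCompact_measure_compl_le.1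
        (isTightMeasureSet_singleton (μ := μ n)) _ (ENNReal.ofReal_pos.2 hη)
      exact ⟨K, hK, hK' _ rfl⟩
    choose K hKc hK using hK
    have hsub (n : ℕ) (hn : n ≤ N) : K n ⊆ ⋃ i ∈ Set.Iic N, K i :=
      Set.subset_biUnion_of_mem (u := K) (show n ∈ Set.Iic N from hn)
    refine ⟨⋃ i ∈ Set.Iic N, K i, (Set.finite_Iic N).isCompact_biUnion fun i _ ↦ hKc i,
      fun n ↦ ?_⟩
    have two : ENNReal.ofReal η ≤ 2 * ENNReal.ofReal η := by
      rw [two_mul]; exact le_add_right le_rfl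
    rcases le_total n N with hn | hn
    · exact (measure_mono (Set.compl_subset_compl.2 ((hsub n hn).trans
        (Metric.self_subset_cthickening _)))).trans ((hK n).trans two)
    · refine (hN n hn _).trans ?_
      rw [two_mul]
      gcongr
      refine (measure_mono fun x hx hxK ↦ ?_).trans (hK N)
      obtain ⟨y, hy, hxy⟩ := Metric.mem_thickening_iff.1 hx
      refine hy (Metric.mem_cthickening_of_dist_le y x η _ (hsub N le_rfl hxK) ?_)
      rw [dist_comm]
      exact hxy.le
  obtain ⟨e, he, hsum⟩ := ENNReal.exists_pos_sum_of_countable hε.ne' ℕ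
  let η : ℕ → ℝ := fun k ↦ min (e k / 2) (1 / (k + 1))
  have hη (k : ℕ) : 0 < η k := lt_min (by have := he k; positivity) (by positivity)
  choose K hKc hK using fun k ↦ single (η k) (hη k)
  refine ⟨⋂ k, Metric.cthickening (η k) (K k), ?_, ?_⟩
  · refine TotallyBounded.isCompact_of_isClosed (Metric.totallyBounded_iff.2 fun r hr ↦ ?_)
      (isClosed_iInter fun k ↦ Metric.isClosed_cthickening)
    obtain ⟨k, hk⟩ := exists_nat_one_div_lt (half_pos hr)
    obtain ⟨t, ht, hcov⟩ := Metric.totallyBounded_iff.1 (hKc k).totallyBounded (r / 2) (half_pos hr)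
    refine ⟨t, ht, fun x hx ↦ ?_⟩
    have hx' := Set.mem_iInter.1 hx k
    have hlt : η k < r / 2 := (min_le_right _ _).trans_lt hk
    obtain ⟨y, hy, hxy⟩ := Metric.mem_thickening_iff.1
      (Metric.cthickening_subset_thickening' (half_pos hr) hlt _ hx')
    obtain ⟨z, hz, hyz⟩ := Set.mem_iUnion₂.1 (hcov hy)
    refine Set.mem_iUnion₂.2 ⟨z, hz, ?_⟩
    rw [Metric.mem_ball] at hyz ⊢
    linarith [dist_triangle x y z]
  · rintro _ ⟨n, rfl⟩
    rw [Set.compl_iInter]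
    refine (measure_iUnion_le _).trans (le_trans (ENNReal.tsum_le_tsum fun k ↦ ?_) hsum.le)
    refine (hK k n).trans ?_
    calc 2 * ENNReal.ofReal (η k) ≤ 2 * ENNReal.ofReal (e k / 2) := by
          gcongr; exact min_le_left _ _
      _ = ENNReal.ofReal (2 * (e k / 2)) := by
          rw [ENNReal.ofReal_mul (by norm_num), ENNReal.ofReal_ofNat]
      _ = e k := by rw [mul_div_cancel₀ _ (by norm_num), ENNReal.ofReal_coe_nnreal]

/-! ### Resampling given the path outside an interval -/

theorem setLIntegral_eq_lintegral_cond_mul {E : Type*} [MeasurableSpace E] (m : Measure E)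
    [IsFiniteMeasure m] (B : Set E) (g : E → ENNReal) :
    ∫⁻ x in B, g x ∂m = (∫⁻ x, g x ∂(ProbabilityTheory.cond m B)) * m B := by
  rw [ProbabilityTheory.cond, lintegral_smul_measure, smul_eq_mul, mul_right_comm]
  rcases eq_or_ne (m B) 0 with h | h
  · rw [h, mul_zero, zero_mul, Measure.restrict_eq_zero.2 h, lintegral_zero_measure]
  · rw [ENNReal.inv_mul_cancel h (measure_ne_top _ _), one_mul]

/-- If `β` is independent of `O`, then the conditional law of `F O β` given `O` and an event
`O ∈ A`, `F O β ∈ B` is that of `F o β`, conditioned to be in `B`, for `o = O`. -/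
theorem setLIntegral_eq_setLIntegral_cond {Ω S T E : Type*} [MeasurableSpace Ω] [MeasurableSpace S]
    [MeasurableSpace T] [MeasurableSpace E] {P : Measure Ω} [IsProbabilityMeasure P] {O : Ω → S}
    {β : Ω → T} (hO : Measurable O) (hβ : Measurable β) (hind : IndepFun O β P) {F : S × T → E}
    (hF : Measurable F) {A : Set S} {B : Set E} (hA : MeasurableSet A) (hB : MeasurableSet B)
    {G : S × E → ENNReal} (hG : Measurable G) {κ : S → Measure E}
    (hκ : ∀ o, κ o = ProbabilityTheory.cond ((P.map β).map fun b ↦ F (o, b)) B)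
    (hκG : Measurable fun o ↦ ∫⁻ f, G (o, f) ∂(κ o)) :
    ∫⁻ ω in {ω | O ω ∈ A ∧ F (O ω, β ω) ∈ B}, G (O ω, F (O ω, β ω)) ∂P =
      ∫⁻ ω in {ω | O ω ∈ A ∧ F (O ω, β ω) ∈ B}, ∫⁻ f, G (O ω, f) ∂(κ (O ω)) ∂P := by
  have := Measure.isProbabilityMeasure_map (μ := P) hβ.aemeasurable
  have := Measure.isProbabilityMeasure_map (μ := P) hO.aemeasurable
  have hOβ : Measurable fun ω ↦ (O ω, β ω) := hO.prodMk hβ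
  set D : Set (S × T) := {p | p.1 ∈ A ∧ F p ∈ B} with hD
  have mD : MeasurableSet D := (measurable_fst hA).inter (hF hB)
  have disint (H : S × T → ENNReal) (hH : Measurable H) :
      ∫⁻ ω in (fun ω ↦ (O ω, β ω)) ⁻¹' D, H (O ω, β ω) ∂P =
        ∫⁻ o, A.indicator (fun o ↦ ∫⁻ b in (fun b ↦ F (o, b)) ⁻¹' B, H (o, b) ∂(P.map β)) o
          ∂(P.map O) := by
    have e := lintegral_prod (μ := P.map O) (ν := P.map β) (D.indicator H)
      (hH.indicator mD).aemeasurable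
    rw [← (indepFun_iff_map_prod_eq_prod_map_map hO.aemeasurable hβ.aemeasurable).1 hind,
      lintegral_map (hH.indicator mD) hOβ] at e
    rw [← lintegral_indicator (hOβ mD)]
    refine Eq.trans ?_ (e.trans (lintegral_congr fun o ↦ ?_))
    · rfl
    · by_cases ho : o ∈ A
      · have mB : MeasurableSet ((fun b ↦ F (o, b)) ⁻¹' B) := (hF.comp measurable_prodMk_left) hB
        rw [Set.indicator_of_mem ho, ← lintegral_indicator mB]
        refine lintegral_congr fun b ↦ ?_
        by_cases hb : F (o, b) ∈ B
        · rw [Set.indicator_of_mem (show (o, b) ∈ D from ⟨ho, hb⟩),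
            Set.indicator_of_mem (show b ∈ (fun b ↦ F (o, b)) ⁻¹' B from hb)]
        · rw [Set.indicator_of_notMem (fun h : (o, b) ∈ D ↦ hb h.2),
            Set.indicator_of_notMem (fun h : b ∈ (fun b ↦ F (o, b)) ⁻¹' B ↦ hb h)]
      · rw [Set.indicator_of_notMem ho]
        refine (lintegral_congr fun b ↦ ?_).trans lintegral_zero
        exact Set.indicator_of_notMem (fun h : (o, b) ∈ D ↦ ho h.1) _
  have m1 : Measurable fun p : S × T ↦ G (p.1, F p) := hG.comp (measurable_fst.prodMk hF)
  refine (disint (fun p ↦ G (p.1, F p)) m1).trans (Eq.trans ?_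
    (disint (fun p ↦ ∫⁻ f, G (p.1, f) ∂(κ p.1)) (hκG.comp measurable_fst)).symm)
  congr 1
  ext1 o
  congr 1
  ext1 o
  have mF : Measurable fun b ↦ F (o, b) := hF.comp measurable_prodMk_left
  have := Measure.isProbabilityMeasure_map (μ := P.map β) mF.aemeasurable
  have mGo : Measurable fun f ↦ G (o, f) := hG.comp measurable_prodMk_left
  have e := setLIntegral_eq_lintegral_cond_mul ((P.map β).map fun b ↦ F (o, b)) B fun f ↦ G (o, f)
  rw [setLIntegral_map hB mGo mF, Measure.map_apply mF hB, ← hκ] at e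
  change ∫⁻ b in (fun b ↦ F (o, b)) ⁻¹' B, G (o, F (o, b)) ∂(P.map β) =
    ∫⁻ _ in (fun b ↦ F (o, b)) ⁻¹' B, (∫⁻ f, G (o, f) ∂(κ o)) ∂(P.map β)
  rw [setLIntegral_const]
  exact e

/-- Between the times `s` and `t`, a path with law `μ` is a conditioned bridge, given the path
outside this interval. -/
def ResamplesGivenOutside (W μ : Measure PlanarPath) (s t : unitInterval) : Prop :=
  ∀ G : (C(Set.Icc (0 : unitInterval) s, ℝ × ℝ) × C(Set.Icc t (1 : unitInterval), ℝ × ℝ)) ×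
    C(Set.Icc s t, ℝ × ℝ) → ENNReal, Measurable G →
    ∫⁻ ω, G (outside s t ω, inside s t ω) ∂μ =
      ∫⁻ ω, ∫⁻ f, G (outside s t ω, f) ∂(quadrantBridge W s t (ω s) (ω t)) ∂μ

theorem ResamplesGivenOutside.resamples {W μ : Measure PlanarPath} {s t : unitInterval}
    (h : ResamplesGivenOutside W μ s t) : Resamples W μ s t := fun G hG ↦
  h (fun q ↦ G (gapEnds s t q.1, q.2))
    (hG.comp (((measurable_gapEnds s t).comp measurable_fst).prodMk measurable_snd))

theorem continuous_outside (s t : unitInterval) : Continuous (outside s t) :=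
  (ContinuousMap.continuous_restrict _).prodMk (ContinuousMap.continuous_restrict _)

theorem measurable_lintegral_resamplingKernel (W : Measure PlanarPath) [IsProbabilityMeasure W]
    (s t : unitInterval)
    {G : (C(Set.Icc (0 : unitInterval) s, ℝ × ℝ) × C(Set.Icc t (1 : unitInterval), ℝ × ℝ)) ×
      C(Set.Icc s t, ℝ × ℝ) → ENNReal} (hG : Measurable G) :
    Measurable fun o ↦ ∫⁻ f, G (o, f) ∂(resamplingKernel W s t o) :=
  hG.lintegral_kernel_prod_right'

theorem lintegral_compProd_resamplingKernel (W μ : Measure PlanarPath) [IsProbabilityMeasure W]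
    [IsProbabilityMeasure μ] (s t : unitInterval)
    {G : (C(Set.Icc (0 : unitInterval) s, ℝ × ℝ) × C(Set.Icc t (1 : unitInterval), ℝ × ℝ)) ×
      C(Set.Icc s t, ℝ × ℝ) → ENNReal} (hG : Measurable G) :
    ∫⁻ q, G q ∂((μ.map (outside s t)) ⊗ₘ resamplingKernel W s t) =
      ∫⁻ ω, ∫⁻ f, G (outside s t ω, f) ∂(quadrantBridge W s t (ω s) (ω t)) ∂μ := by
  rw [Measure.lintegral_compProd hG, lintegral_map (measurable_lintegral_resamplingKernel W s t hG)
    (continuous_outside s t).measurable]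
  rfl

theorem measurable_outside_inside (s t : unitInterval) :
    Measurable fun ω ↦ (outside s t ω, inside s t ω) :=
  (continuous_outside s t).measurable.prodMk (continuous_inside s t).measurable

theorem resamplesGivenOutside_of_hasCondDistrib {W μ : Measure PlanarPath} [IsProbabilityMeasure W]
    [IsProbabilityMeasure μ] {s t : unitInterval}
    (h : HasCondDistrib (inside s t) (outside s t) (resamplingKernel W s t) μ) :
    ResamplesGivenOutside W μ s t := fun G hG ↦ by
  rw [← lintegral_compProd_resamplingKernel W μ s t hG, ← HasLaw.map_eq h,
    lintegral_map hG (measurable_outside_inside s t)]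

/-! ### Conditioned bridges, extended to the whole time interval -/

/-- The law of the conditioned bridge, extended to be constant before `s` and after `t`. -/
noncomputable def extendedBridge (W : Measure PlanarPath) {s t : unitInterval} (h : s ≤ t)
    (z w : ℝ × ℝ) : Measure PlanarPath :=
  (quadrantBridge W s t z w).map (extendConst h)

theorem measurable_bridge_right (s t : unitInterval) (z w : ℝ × ℝ) :
    Measurable (bridge s t z w) :=
  (measurable_bridge s t).comp (measurable_prodMk_left (x := (z, w)))

theorem lintegral_extendedBridge (W : Measure PlanarPath) {a c : unitInterval} (h : a ≤ c)
    (z w : ℝ × ℝ) {G : PlanarPath → ENNReal} (hG : Measurable G) :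
    ∫⁻ ω, G ω ∂(extendedBridge W h z w) =
      (W (bridge a c z w ⁻¹' stayInQuadrant a c))⁻¹ *
        ∫⁻ η in bridge a c z w ⁻¹' stayInQuadrant a c, G (extendConst h (bridge a c z w η)) ∂W := by
  have hm := measurable_bridge_right a c z w
  have hS := measurableSet_stayInQuadrant a c
  have hE := (continuous_extendConst h).measurable
  have hGE : Measurable fun f ↦ G (extendConst h f) := hG.comp hE
  rw [extendedBridge, lintegral_map hG hE, quadrantBridge, ProbabilityTheory.cond,
    lintegral_smul_measure, setLIntegral_map hS hGE hm, Measure.map_apply hm hS, smul_eq_mul]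

theorem measurableSet_nonneg (K : Type*) [TopologicalSpace K] :
    MeasurableSet {f : C(K, ℝ × ℝ) | ∀ r, 0 ≤ f r} := by
  refine IsClosed.measurableSet ?_
  rw [Set.ofPred_forall]
  exact isClosed_iInter fun r ↦ isClosed_le continuous_const (by fun_prop)

theorem bridge_mem_stay_iff {a c s t : unitInterval} (h : a ≤ c)
    (g : C(Set.Icc a c, ℝ × ℝ)) : g ∈ stayInQuadrant a c ↔
      outside s t (extendConst h g) ∈ {o | (∀ r, 0 ≤ o.1 r) ∧ ∀ r, 0 ≤ o.2 r} ∧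
        inside s t (extendConst h g) ∈ stayInQuadrant s t := by
  constructor
  · exact fun hg ↦ ⟨⟨fun r ↦ hg _, fun r ↦ hg _⟩, fun r ↦ hg _⟩
  · rintro ⟨⟨h1, h2⟩, h3⟩ r
    rw [← extendConst_of_mem h g r.2]
    rcases le_total (r : unitInterval) s with hr | hr
    · exact h1 ⟨r, unitInterval.nonneg', hr⟩
    · rcases le_total t r with hr' | hr'
      · exact h2 ⟨r, hr', unitInterval.le_one'⟩
      · exact h3 ⟨r, hr, hr'⟩

theorem inside_extendConst_bridge {a c s t : unitInterval} (has : a ≤ s) (hst : s < t) (htc : t ≤ c)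
    (h : a ≤ c) (z w : ℝ × ℝ) (η : PlanarPath) :
    inside s t (extendConst h (bridge a c z w η)) =
      bridgeOf s t (extendConst h (bridge a c z w η) s) (extendConst h (bridge a c z w η) t)
        (bridgePart (seg s t η)) := by
  have h' : (0 : ℝ) < t - s := sub_pos.2 hst
  rw [← bridge_eq_bridgeOf hst]
  have e {u : unitInterval} (hu : u ∈ Set.Icc a c) : extendConst h (bridge a c z w η) u =
      z + (η u - η a) - ((u - a : ℝ) / (c - a : ℝ)) • ((η c - η a) - (w - z)) :=
    extendConst_of_mem h _ hu
  ext1 r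
  change extendConst h (bridge a c z w η) r =
    extendConst h (bridge a c z w η) s + (η r - η s) -
      (((r : unitInterval) - s : ℝ) / (t - s : ℝ)) • ((η t - η s) -
        (extendConst h (bridge a c z w η) t - extendConst h (bridge a c z w η) s))
  rw [e ⟨has, hst.le.trans htc⟩, e ⟨has.trans hst.le, htc⟩, e ⟨has.trans r.2.1, r.2.2.trans htc⟩]
  generalize (η c - η a) - (w - z) = x
  have k : ((r : unitInterval) - a : ℝ) / (c - a : ℝ) = (s - a : ℝ) / (c - a : ℝ) +
      (((r : unitInterval) - s : ℝ) / (t - s : ℝ)) * ((t - a : ℝ) / (c - a : ℝ) -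
        (s - a : ℝ) / (c - a : ℝ)) := by
    field_simp
    ring
  rw [k]
  module

namespace IsCorrelatedBrownianLaw

variable {α : ℝ} {W : Measure PlanarPath}

theorem indepFun_outside_extendConst (hW : IsCorrelatedBrownianLaw α W) {a c s t : unitInterval}
    (has : a ≤ s) (hst : s < t) (htc : t ≤ c) (h : a ≤ c) (z w : ℝ × ℝ) :
    IndepFun (fun η ↦ outside s t (extendConst h (bridge a c z w η)))
      (fun η ↦ bridgePart (seg s t η)) W := by
  have hi := hW.indepFun_outside hst
  rw [IndepFun_iff_Indep] at hi ⊢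
  refine indep_of_indep_of_le_left hi ?_
  set m := MeasurableSpace.comap (outside s t) inferInstance
  have ho : Measurable[m] (outside s t) := comap_measurable _
  have ev {u : unitInterval} (hu : u ≤ s ∨ t ≤ u) : Measurable[m] fun η : PlanarPath ↦ η u := by
    rcases hu with hu | hu
    · exact (continuous_eval_const (⟨u, unitInterval.nonneg', hu⟩ :
        Set.Icc (0 : unitInterval) s)).measurable.comp (measurable_fst.comp ho)
    · exact (continuous_eval_const (⟨u, hu, unitInterval.le_one'⟩ :
        Set.Icc t (1 : unitInterval))).measurable.comp (measurable_snd.comp ho)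
  have ex {u : unitInterval} (hu : u ≤ s ∨ t ≤ u) :
      Measurable[m] fun η : PlanarPath ↦ extendConst h (bridge a c z w η) u := by
    set v := Set.projIcc a c h u with hv
    have hv' : (v : unitInterval) ≤ s ∨ t ≤ v := by
      rw [hv, Set.coe_projIcc]
      rcases hu with hu | hu
      · exact Or.inl (max_le has ((min_le_right _ _).trans hu))
      · exact Or.inr (le_max_of_le_right (le_min htc hu))
    change Measurable[m] fun η : PlanarPath ↦ z + (η v - η a) -
      (((v : unitInterval) - a : ℝ) / (c - a : ℝ)) • ((η c - η a) - (w - z))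
    have m1 := ev hv'
    have m2 := ev (u := a) (Or.inl has)
    have m3 := ev (u := c) (Or.inr htc)
    have m4 : Measurable[m] fun η : PlanarPath ↦ (η c - η a) - (w - z) := (m3.sub m2).sub_const _
    exact ((m1.sub m2).const_add z).sub (m4.const_smul (((v : unitInterval) - a : ℝ) / (c - a : ℝ)))
  refine comap_prodMk_le (Measurable.comap_le ?_) (Measurable.comap_le ?_)
  · exact measurable_continuousMap_iff.2 fun r ↦ ex (Or.inl r.2.2)
  · exact measurable_continuousMap_iff.2 fun r ↦ ex (Or.inr r.2.1)

theorem resamplingKernel_eq (hW : IsCorrelatedBrownianLaw α W) [IsProbabilityMeasure W]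
    {s t : unitInterval} (hst : s < t)
    (o : C(Set.Icc (0 : unitInterval) s, ℝ × ℝ) × C(Set.Icc t (1 : unitInterval), ℝ × ℝ)) :
    resamplingKernel W s t o = ProbabilityTheory.cond ((W.map fun η ↦ bridgePart (seg s t η)).map
      fun b ↦ bridgeOf s t (gapEnds s t o).1 (gapEnds s t o).2 b) (stayInQuadrant s t) := by
  have e := hW.map_bridge hst (gapEnds s t o).1 (gapEnds s t o).2
  rw [hW.map_bridgePart_seg hst.ne]
  exact congrArg (ProbabilityTheory.cond · (stayInQuadrant s t)) e

theorem resamplesGivenOutside_extendedBridge (hW : IsCorrelatedBrownianLaw α W)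
    [IsProbabilityMeasure W] {a c s t : unitInterval}
    (has : a ≤ s) (hst : s < t) (htc : t ≤ c) (h : a ≤ c) (z w : ℝ × ℝ) :
    ResamplesGivenOutside W (extendedBridge W h z w) s t := by
  intro G hG
  have hmX : Measurable fun η ↦ extendConst h (bridge a c z w η) :=
    (continuous_extendConst h).measurable.comp (measurable_bridge_right a c z w)
  have hβ : Measurable fun η ↦ bridgePart (seg s t η) :=
    continuous_bridgePart.measurable.comp (measurable_seg _ _)
  have hF : Measurable fun p : (C(Set.Icc (0 : unitInterval) s, ℝ × ℝ) ×
      C(Set.Icc t (1 : unitInterval), ℝ × ℝ)) × PlanarPath ↦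
      bridgeOf s t (gapEnds s t p.1).1 (gapEnds s t p.1).2 p.2 :=
    (continuous_bridgeOf s t).measurable.comp
      (((measurable_gapEnds s t).comp measurable_fst).prodMk measurable_snd)
  have hA : MeasurableSet {o : C(Set.Icc (0 : unitInterval) s, ℝ × ℝ) ×
      C(Set.Icc t (1 : unitInterval), ℝ × ℝ) | (∀ r, 0 ≤ o.1 r) ∧ ∀ r, 0 ≤ o.2 r} :=
    (measurable_fst (measurableSet_nonneg _)).inter (measurable_snd (measurableSet_nonneg _))
  have mG := measurable_lintegral_resamplingKernel W s t hG
  have key := setLIntegral_eq_setLIntegral_cond (P := W)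
    ((continuous_outside s t).measurable.comp hmX) hβ
    (hW.indepFun_outside_extendConst has hst htc h z w) hF hA (measurableSet_stayInQuadrant s t) hG
    (κ := fun o ↦ resamplingKernel W s t o) (hW.resamplingKernel_eq hst) mG
  have e : bridge a c z w ⁻¹' stayInQuadrant a c =
      {η | outside s t (extendConst h (bridge a c z w η)) ∈
        {o | (∀ r, 0 ≤ o.1 r) ∧ ∀ r, 0 ≤ o.2 r} ∧
        bridgeOf s t (extendConst h (bridge a c z w η) s) (extendConst h (bridge a c z w η) t)
          (bridgePart (seg s t η)) ∈ stayInQuadrant s t} := by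
    ext η
    rw [Set.mem_preimage, bridge_mem_stay_iff (s := s) (t := t) h,
      inside_extendConst_bridge has hst htc h]
    rfl
  refine (lintegral_extendedBridge W h z w (hG.comp (measurable_outside_inside s t))).trans
    (Eq.trans ?_ (lintegral_extendedBridge W h z w
      (mG.comp (continuous_outside s t).measurable)).symm)
  rw [e]
  congr 1
  refine Eq.trans (lintegral_congr fun η ↦ ?_) key
  rw [Function.comp_apply, inside_extendConst_bridge has hst htc h]
  rfl

end IsCorrelatedBrownianLaw

/-! ### Limits of approximate solutions -/

theorem lintegral_le_of_measure_le {E : Type*} [MeasurableSpace E] {μ ν : Measure E}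
    {η : ENNReal} (h : ∀ A, MeasurableSet A → μ A ≤ ν A + η) {g : E → ENNReal} (hg : Measurable g)
    (hg1 : ∀ x, g x ≤ 1) : ∫⁻ x, g x ∂μ ≤ ∫⁻ x, g x ∂ν + η := by
  have e (m : Measure E) :
      ∫⁻ x, g x ∂m = ∫⁻ t in Set.Ioi (0 : ℝ), m {x | t ≤ (g x).toReal} := by
    rw [← lintegral_eq_lintegral_meas_le m (Filter.Eventually.of_forall fun x ↦
      ENNReal.toReal_nonneg) hg.ennreal_toReal.aemeasurable]
    exact lintegral_congr fun x ↦
      (ENNReal.ofReal_toReal (ne_top_of_le_ne_top ENNReal.one_ne_top (hg1 x))).symm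
  have hmeas : Measurable ((Set.Ioc (0 : ℝ) 1).indicator fun _ ↦ η) :=
    measurable_const.indicator measurableSet_Ioc
  calc ∫⁻ x, g x ∂μ = ∫⁻ t in Set.Ioi (0 : ℝ), μ {x | t ≤ (g x).toReal} := e μ
    _ ≤ ∫⁻ t in Set.Ioi (0 : ℝ), (ν {x | t ≤ (g x).toReal} + (Set.Ioc (0 : ℝ) 1).indicator
        (fun _ ↦ η) t) := by
      refine setLIntegral_mono' measurableSet_Ioi fun t ht ↦ ?_
      by_cases ht1 : t ≤ 1
      · rw [Set.indicator_of_mem (show t ∈ Set.Ioc (0 : ℝ) 1 from ⟨ht, ht1⟩)]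
        exact h _ (measurableSet_le measurable_const hg.ennreal_toReal)
      · have : {x | t ≤ (g x).toReal} = ∅ := by
          refine Set.eq_empty_of_forall_notMem fun x hx ↦ ht1 (le_trans hx ?_)
          exact ENNReal.toReal_le_of_le_ofReal zero_le_one (by simpa using hg1 x)
        rw [this, measure_empty]
        exact zero_le
    _ = _ := by
      rw [lintegral_add_right _ hmeas, ← e ν, setLIntegral_indicator measurableSet_Ioc,
        Set.inter_eq_left.2 Set.Ioc_subset_Ioi_self, setLIntegral_const, Real.volume_Ioc]
      simp

theorem eventually_forall_le_norm_sub_le {ω : PlanarPath} {a : ℕ → unitInterval}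
    (ha : Filter.Tendsto (fun k ↦ (a k : ℝ)) Filter.atTop (𝓝 0)) {η : ℝ} (hη : 0 < η) :
    ∀ᶠ k in Filter.atTop, ∀ u, u ≤ a k → ‖ω u - ω 0‖ ≤ η := by
  obtain ⟨δ, hδ, h⟩ := Metric.continuous_iff.1 ω.continuous 0 η hη
  filter_upwards [ha.eventually (gt_mem_nhds hδ)] with k hk u hu
  rw [← dist_eq_norm]
  refine (h u ?_).le
  have hu' : (u : ℝ) ≤ a k := hu
  rw [Subtype.dist_eq, Real.dist_eq, Set.Icc.coe_zero, sub_zero,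
    abs_of_nonneg (unitInterval.nonneg u)]
  exact hu'.trans_lt hk

theorem eventually_forall_ge_norm_sub_le {ω : PlanarPath} {a : ℕ → unitInterval}
    (ha : Filter.Tendsto (fun k ↦ (a k : ℝ)) Filter.atTop (𝓝 0)) {η : ℝ} (hη : 0 < η) :
    ∀ᶠ k in Filter.atTop, ∀ u, unitInterval.symm (a k) ≤ u → ‖ω u - ω 1‖ ≤ η := by
  filter_upwards [eventually_forall_le_norm_sub_le
    (ω := ω.comp ⟨unitInterval.symm, unitInterval.continuous_symm⟩) ha hη] with k hk u hu
  have := hk (unitInterval.symm u) (by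
    rw [← Subtype.coe_le_coe, unitInterval.coe_symm_eq] at hu ⊢
    linarith)
  simpa using this

theorem tendsto_extendConst_inside (b : TimeBase) (ω : PlanarPath) :
    Filter.Tendsto (fun j ↦ extendConst (lo_lt_hi b j j).le (inside (lo b j) (hi b j) ω))
      Filter.atTop (𝓝 ω) := by
  refine Metric.tendsto_nhds.2 fun δ hδ ↦ ?_
  filter_upwards [eventually_forall_le_norm_sub_le (ω := ω) (tendsto_coe_lo b)
    (show 0 < δ / 3 by positivity), eventually_forall_ge_norm_sub_le (ω := ω) (tendsto_coe_lo b)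
    (show 0 < δ / 3 by positivity)] with j h1 h2
  rw [dist_comm]
  exact (dist_extendConst_inside_le _ h1 h2).trans_lt (by linarith)

/-- The path outside `(s, t)`, made constant before `a` and after `c`. -/
noncomputable def clampOutside {a c s t : unitInterval} (has : a ≤ s) (htc : t ≤ c)
    (o : C(Set.Icc (0 : unitInterval) s, ℝ × ℝ) × C(Set.Icc t (1 : unitInterval), ℝ × ℝ)) :
    C(Set.Icc (0 : unitInterval) s, ℝ × ℝ) × C(Set.Icc t (1 : unitInterval), ℝ × ℝ) :=
  (o.1.comp ⟨fun r ↦ ⟨max a r, unitInterval.nonneg', max_le has r.2.2⟩, by fun_prop⟩,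
    o.2.comp ⟨fun r ↦ ⟨min c r, le_min htc r.2.1, unitInterval.le_one'⟩, by fun_prop⟩)

theorem continuous_clampOutside {a c s t : unitInterval} (has : a ≤ s) (htc : t ≤ c) :
    Continuous (clampOutside has htc) :=
  ((ContinuousMap.continuous_precomp _).comp continuous_fst).prodMk
    ((ContinuousMap.continuous_precomp _).comp continuous_snd)

theorem outside_extendConst_inside {a c s t : unitInterval} (has : a ≤ s) (hst : s ≤ t)
    (htc : t ≤ c) (h : a ≤ c) (ω : PlanarPath) :
    outside s t (extendConst h (inside a c ω)) = clampOutside has htc (outside s t ω) := by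
  have e (u : unitInterval) : extendConst h (inside a c ω) u = ω (max a (min c u)) := by
    rw [extendConst_apply]
    change ω (Set.projIcc a c h u) = _
    rw [Set.coe_projIcc]
  refine Prod.ext (ContinuousMap.ext fun r ↦ ?_) (ContinuousMap.ext fun r ↦ ?_)
  · refine (e r).trans ?_
    rw [min_eq_right (r.2.2.trans (hst.trans htc))]
    rfl
  · refine (e r).trans ?_
    rw [max_eq_right (has.trans (hst.trans (le_min htc r.2.1)))]
    rfl

theorem inside_extendConst_inside {a c s t : unitInterval} (has : a ≤ s) (htc : t ≤ c) (h : a ≤ c)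
    (ω : PlanarPath) : inside s t (extendConst h (inside a c ω)) = inside s t ω :=
  ContinuousMap.ext fun r ↦
    extendConst_of_mem h (inside a c ω) (u := r) ⟨has.trans r.2.1, r.2.2.trans htc⟩

theorem ResamplesGivenOutside.lintegral_extendConst {W μ : Measure PlanarPath}
    [IsProbabilityMeasure W] {a c s t : unitInterval} (hμ : ResamplesGivenOutside W μ s t)
    (has : a ≤ s) (hst : s ≤ t) (htc : t ≤ c) (h : a ≤ c)
    {G : (C(Set.Icc (0 : unitInterval) s, ℝ × ℝ) × C(Set.Icc t (1 : unitInterval), ℝ × ℝ)) ×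
      C(Set.Icc s t, ℝ × ℝ) → ENNReal} (hG : Measurable G) :
    ∫⁻ ω, G (outside s t (extendConst h (inside a c ω)),
        inside s t (extendConst h (inside a c ω))) ∂μ =
      ∫⁻ ω, ∫⁻ f, G (outside s t (extendConst h (inside a c ω)), f)
        ∂(resamplingKernel W s t (outside s t (extendConst h (inside a c ω)))) ∂μ := by
  have hk (ω : PlanarPath) :
      resamplingKernel W s t (outside s t (extendConst h (inside a c ω))) =
        quadrantBridge W s t (ω s) (ω t) := by
    change quadrantBridge W s t (extendConst h (inside a c ω) s)
      (extendConst h (inside a c ω) t) = _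
    rw [extendConst_of_mem h _ ⟨has, hst.trans htc⟩, extendConst_of_mem h _ ⟨has.trans hst, htc⟩]
    rfl
  simp_rw [hk, inside_extendConst_inside has htc h, outside_extendConst_inside has hst htc h]
  exact hμ (fun q ↦ G (clampOutside has htc q.1, q.2)) (hG.comp
    (((continuous_clampOutside has htc).measurable.comp measurable_fst).prodMk measurable_snd))

theorem isClosed_ends (s t : unitInterval) (ε : ℝ) (w₀ : ℝ × ℝ) :
    IsClosed {ω : PlanarPath | (∀ u, u ≤ s → ‖ω u‖ ≤ ε) ∧ ∀ u, t ≤ u → ‖ω u - w₀‖ ≤ ε} := by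
  simp only [Set.ofPred_and, Set.ofPred_forall]
  exact (isClosed_iInter fun u ↦ isClosed_iInter fun _ ↦ isClosed_le (by fun_prop)
    continuous_const).inter (isClosed_iInter fun u ↦ isClosed_iInter fun _ ↦
      isClosed_le (by fun_prop) continuous_const)

namespace IsCorrelatedBrownianLaw

variable {α : ℝ} {W : Measure PlanarPath}

theorem isApproxSolution_extendedBridge (hα : α ∈ Set.Ioo (-1 : ℝ) 1)
    (hW : IsCorrelatedBrownianLaw α W) [IsProbabilityMeasure W] {a c : unitInterval} (h : a < c)
    {z w w₀ : ℝ × ℝ} (hz : IsInterior z) (hw : IsInterior w) {ε : ℝ} (ha : (a : ℝ) ≤ ε)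
    (hc : 1 - ε ≤ (c : ℝ)) (hzε : ‖z‖ ≤ ε) (hwε : ‖w - w₀‖ ≤ ε) :
    IsApproxSolution W w₀ ε (extendedBridge W h.le z w) := by
  have hE := (continuous_extendConst h.le).measurable
  have hends := hW.ae_quadrantBridge_ends h z w
  refine ⟨a, c, ha, hc, fun r har hrc ↦ ?_, fun s t has hst htc ↦
    (hW.resamplesGivenOutside_extendedBridge has hst htc h.le z w).resamples, ?_⟩
  · have mI : MeasurableSet {ω : PlanarPath | IsInterior (ω r)} :=
      (continuous_eval_const r).measurable measurableSet_isInterior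
    rw [extendedBridge, ae_map_iff hE.aemeasurable mI]
    rcases har.eq_or_lt with rfl | har
    · filter_upwards [hends] with f hf
      rw [extendConst_of_le h.le f le_rfl, hf.1]
      exact hz
    · rcases hrc.eq_or_lt with rfl | hrc
      · filter_upwards [hends] with f hf
        rw [extendConst_of_ge h.le f le_rfl, hf.2]
        exact hw
      · filter_upwards [hW.ae_quadrantBridge_pos hα h z w (r := ⟨r, har.le, hrc.le⟩) har hrc]
          with f hf
        rw [extendConst_of_mem h.le f ⟨har.le, hrc.le⟩]
        exact hf
  · refine le_trans (le_of_eq ?_) zero_le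
    refine (ae_iff (p := fun ω : PlanarPath ↦
      (∀ u, u ≤ a → ‖ω u‖ ≤ ε) ∧ ∀ u, c ≤ u → ‖ω u - w₀‖ ≤ ε)).1 ?_
    rw [extendedBridge, ae_map_iff hE.aemeasurable (isClosed_ends a c ε w₀).measurableSet]
    filter_upwards [hends] with f hf
    refine ⟨fun u hu ↦ ?_, fun u hu ↦ ?_⟩
    · rwa [extendConst_of_le h.le f hu, hf.1]
    · rwa [extendConst_of_ge h.le f hu, hf.2]

end IsCorrelatedBrownianLaw

theorem measure_le_add_of_compl {E : Type*} [MeasurableSpace E] {μ ν : Measure E}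
    [IsProbabilityMeasure μ] [IsProbabilityMeasure ν] {A : Set E} (hA : MeasurableSet A)
    {η : ENNReal} (h : μ Aᶜ ≤ ν Aᶜ + η) : ν A ≤ μ A + η := by
  refine (ENNReal.add_le_add_iff_right (measure_ne_top ν Aᶜ)).1 ?_
  calc ν A + ν Aᶜ = μ A + μ Aᶜ := by
        rw [measure_add_measure_compl hA, measure_add_measure_compl hA, measure_univ, measure_univ]
    _ ≤ μ A + (ν Aᶜ + η) := by gcongr
    _ = μ A + η + ν Aᶜ := by ring

namespace IsCorrelatedBrownianLaw

variable {α : ℝ} {W : Measure PlanarPath}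

/-- Away from the times `0` and `1`, a weak limit of approximate solutions is a limit in total
variation. -/
theorem exists_inside_close_limit (hα : α ∈ Set.Ioo (-1 : ℝ) 1) [IsProbabilityMeasure W]
    (hW : IsCorrelatedBrownianLaw α W) {w₀ : ℝ × ℝ} {μ : ℕ → ProbabilityMeasure PlanarPath}
    {ν : ProbabilityMeasure PlanarPath} {l : Filter ℕ} [l.NeBot] (hl : l ≤ Filter.atTop)
    (hlim : Filter.Tendsto μ l (𝓝 ν))
    (hμ : ∀ ε : ℝ, 0 < ε → ∀ᶠ n in Filter.atTop, IsApproxSolution W w₀ ε (μ n)) :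
    ∃ b : TimeBase, ∀ (j : ℕ) (η : ℝ), 0 < η → ∀ᶠ m in Filter.atTop,
      ∀ E : Set C(Set.Icc (lo b j) (hi b j), ℝ × ℝ), MeasurableSet E →
        (ν : Measure PlanarPath) (inside _ _ ⁻¹' E) ≤
          (μ m : Measure PlanarPath) (inside _ _ ⁻¹' E) + ENNReal.ofReal η := by
  obtain ⟨b, hb⟩ := hW.exists_inside_close hα w₀
  refine ⟨b, fun j η hη ↦ ?_⟩
  obtain ⟨ε, hε, h⟩ := hb j (η / 2) (half_pos hη)
  filter_upwards [hμ ε hε] with m hm E hE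
  have hin := continuous_inside (lo b j) (hi b j)
  have hopen (U : Set C(Set.Icc (lo b j) (hi b j), ℝ × ℝ)) (hU : IsOpen U) :
      (ν : Measure PlanarPath) (inside _ _ ⁻¹' U) ≤
        (μ m : Measure PlanarPath) (inside _ _ ⁻¹' U) + ENNReal.ofReal (η / 2) := by
    refine (ProbabilityMeasure.le_liminf_measure_open_of_tendsto hlim (hU.preimage hin)).trans
      (Filter.liminf_le_of_frequently_le' (Filter.Eventually.frequently ?_))
    filter_upwards [hl (hμ ε hε)] with n hn
    exact measure_inside_le_of_lintegral_le (h (μ n) (μ m) inferInstance inferInstance hn hm)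
      hU.measurableSet
  have hη2 : ENNReal.ofReal (η / 2) ≠ 0 := (ENNReal.ofReal_pos.2 (half_pos hη)).ne'
  obtain ⟨U, hEU, hU, hUE⟩ := E.exists_isOpen_le_add
    ((μ m : Measure PlanarPath).map (inside (lo b j) (hi b j))) hη2
  rw [Measure.map_apply hin.measurable hU.measurableSet, Measure.map_apply hin.measurable hE] at hUE
  calc (ν : Measure PlanarPath) (inside _ _ ⁻¹' E) ≤ _ :=
        (measure_mono (Set.preimage_mono hEU)).trans (hopen U hU)
    _ ≤ (μ m : Measure PlanarPath) (inside _ _ ⁻¹' E) + ENNReal.ofReal (η / 2) +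
        ENNReal.ofReal (η / 2) := by gcongr
    _ = _ := by
        rw [add_assoc, ← ENNReal.ofReal_add (by positivity) (by positivity), add_halves]

end IsCorrelatedBrownianLaw

theorem lintegral_inside_le_of_close {s t : unitInterval} {μ : ℕ → ProbabilityMeasure PlanarPath}
    {ν : ProbabilityMeasure PlanarPath}
    (h : ∀ η : ℝ, 0 < η → ∀ᶠ m in Filter.atTop, ∀ E : Set C(Set.Icc s t, ℝ × ℝ), MeasurableSet E →
        (ν : Measure PlanarPath) (inside _ _ ⁻¹' E) ≤
          (μ m : Measure PlanarPath) (inside _ _ ⁻¹' E) + ENNReal.ofReal η)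
    {g₁ g₂ : C(Set.Icc s t, ℝ × ℝ) → ENNReal} (hg₁ : Measurable g₁) (hg₂ : Measurable g₂)
    (h₁ : ∀ f, g₁ f ≤ 1) (h₂ : ∀ f, g₂ f ≤ 1)
    (he : ∀ᶠ m in Filter.atTop, ∫⁻ ω, g₁ (inside s t ω) ∂(μ m : Measure PlanarPath) =
      ∫⁻ ω, g₂ (inside s t ω) ∂(μ m : Measure PlanarPath)) :
    ∫⁻ ω, g₁ (inside s t ω) ∂(ν : Measure PlanarPath) ≤
      ∫⁻ ω, g₂ (inside s t ω) ∂(ν : Measure PlanarPath) := by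
  have hin := (continuous_inside s t).measurable
  refine ENNReal.le_of_forall_pos_le_add fun η hη _ ↦ ?_
  have hη' : (0 : ℝ) < η / 2 := by positivity
  obtain ⟨m, hm, hme⟩ := ((h _ hη').and he).exists
  have c1 := lintegral_le_of_measure_le (μ := (ν : Measure PlanarPath).map (inside s t))
    (ν := (μ m : Measure PlanarPath).map (inside s t)) (η := ENNReal.ofReal (η / 2)) (fun A hA ↦ by
      rw [Measure.map_apply hin hA, Measure.map_apply hin hA]; exact hm A hA) hg₁ h₁
  have c2 := lintegral_le_of_measure_le (ν := (ν : Measure PlanarPath).map (inside s t))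
    (μ := (μ m : Measure PlanarPath).map (inside s t)) (η := ENNReal.ofReal (η / 2)) (fun A hA ↦ by
      rw [Measure.map_apply hin hA, Measure.map_apply hin hA]
      exact measure_le_add_of_compl (hin hA) (hm Aᶜ hA.compl)) hg₂ h₂
  rw [lintegral_map hg₁ hin, lintegral_map hg₁ hin] at c1
  rw [lintegral_map hg₂ hin, lintegral_map hg₂ hin] at c2
  rw [hme] at c1
  refine (c1.trans (add_le_add_left c2 _)).trans (le_of_eq ?_)
  rw [add_assoc, ← ENNReal.ofReal_add hη'.le hη'.le, add_halves, ENNReal.ofReal_coe_nnreal]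

theorem lintegral_inside_eq_of_close {s t : unitInterval} {μ : ℕ → ProbabilityMeasure PlanarPath}
    {ν : ProbabilityMeasure PlanarPath}
    (h : ∀ η : ℝ, 0 < η → ∀ᶠ m in Filter.atTop, ∀ E : Set C(Set.Icc s t, ℝ × ℝ), MeasurableSet E →
        (ν : Measure PlanarPath) (inside _ _ ⁻¹' E) ≤
          (μ m : Measure PlanarPath) (inside _ _ ⁻¹' E) + ENNReal.ofReal η)
    {g₁ g₂ : C(Set.Icc s t, ℝ × ℝ) → ENNReal} (hg₁ : Measurable g₁) (hg₂ : Measurable g₂)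
    {M : ENNReal} (hM : M ≠ 0) (hM' : M ≠ ⊤) (h₁ : ∀ f, g₁ f ≤ M) (h₂ : ∀ f, g₂ f ≤ M)
    (he : ∀ᶠ m in Filter.atTop, ∫⁻ ω, g₁ (inside s t ω) ∂(μ m : Measure PlanarPath) =
      ∫⁻ ω, g₂ (inside s t ω) ∂(μ m : Measure PlanarPath)) :
    ∫⁻ ω, g₁ (inside s t ω) ∂(ν : Measure PlanarPath) =
      ∫⁻ ω, g₂ (inside s t ω) ∂(ν : Measure PlanarPath) := by
  have hin := (continuous_inside s t).measurable
  have sc {g : C(Set.Icc s t, ℝ × ℝ) → ENNReal} (hg : Measurable g) (m : Measure PlanarPath) :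
      ∫⁻ ω, M⁻¹ * g (inside s t ω) ∂m = M⁻¹ * ∫⁻ ω, g (inside s t ω) ∂m :=
    lintegral_const_mul _ (hg.comp hin)
  have s1 {g : C(Set.Icc s t, ℝ × ℝ) → ENNReal} (hg : ∀ f, g f ≤ M) (f) : M⁻¹ * g f ≤ 1 := by
    rw [← ENNReal.inv_mul_cancel hM hM']
    gcongr
    exact hg f
  have he' : ∀ᶠ m in Filter.atTop,
      ∫⁻ ω, M⁻¹ * g₁ (inside s t ω) ∂(μ m : Measure PlanarPath) =
        ∫⁻ ω, M⁻¹ * g₂ (inside s t ω) ∂(μ m : Measure PlanarPath) := by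
    filter_upwards [he] with m hm
    rw [sc hg₁, sc hg₂, hm]
  have e : M⁻¹ * ∫⁻ ω, g₁ (inside s t ω) ∂(ν : Measure PlanarPath) =
      M⁻¹ * ∫⁻ ω, g₂ (inside s t ω) ∂(ν : Measure PlanarPath) := by
    rw [← sc hg₁, ← sc hg₂]
    exact le_antisymm
      (lintegral_inside_le_of_close h (hg₁.const_mul M⁻¹) (hg₂.const_mul M⁻¹) (s1 h₁) (s1 h₂) he')
      (lintegral_inside_le_of_close h (hg₂.const_mul M⁻¹) (hg₁.const_mul M⁻¹) (s1 h₂) (s1 h₁)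
        (he'.mono fun _ ↦ Eq.symm))
  exact (ENNReal.mul_right_inj (ENNReal.inv_ne_zero.2 hM') (ENNReal.inv_ne_top.2 hM)).1 e

namespace IsCorrelatedBrownianLaw

variable {α : ℝ} {W : Measure PlanarPath}

theorem hasCondDistrib_of_tendsto (hα : α ∈ Set.Ioo (-1 : ℝ) 1) [IsProbabilityMeasure W]
    (hW : IsCorrelatedBrownianLaw α W) {w₀ : ℝ × ℝ} {μ : ℕ → ProbabilityMeasure PlanarPath}
    {ν : ProbabilityMeasure PlanarPath} {l : Filter ℕ} [l.NeBot] (hl : l ≤ Filter.atTop)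
    (hlim : Filter.Tendsto μ l (𝓝 ν))
    (hμ : ∀ ε : ℝ, 0 < ε → ∀ᶠ n in Filter.atTop, IsApproxSolution W w₀ ε (μ n))
    {s t : unitInterval} (hs : 0 < s) (hst : s < t) (ht : t < 1)
    (hres : ∀ᶠ n in Filter.atTop, ResamplesGivenOutside W (μ n) s t) :
    HasCondDistrib (inside s t) (outside s t) (resamplingKernel W s t)
      (ν : Measure PlanarPath) := by
  obtain ⟨b, hb⟩ := hW.exists_inside_close_limit hα hl hlim hμ
  refine ⟨(measurable_outside_inside s t).aemeasurable, ?_⟩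
  have := Measure.isProbabilityMeasure_map (μ := (ν : Measure PlanarPath))
    (measurable_outside_inside s t).aemeasurable
  refine ext_of_forall_lintegral_eq_of_IsFiniteMeasure fun G ↦ ?_
  have hGc : Continuous fun q ↦ (G q : ENNReal) := ENNReal.continuous_coe.comp G.continuous
  have hG := hGc.measurable
  rw [lintegral_map hG (measurable_outside_inside s t), lintegral_compProd_resamplingKernel W _ s t hG]
  set M : ENNReal := nndist G 0 + 1 with hM
  have hM0 : M ≠ 0 := by simp [hM]
  have hMt : M ≠ ⊤ := by simp [hM]
  have hGM (q) : (G q : ENNReal) ≤ M :=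
    (ENNReal.coe_le_coe.2 (BoundedContinuousFunction.NNReal.upper_bound G q)).trans
      le_self_add
  let T (j : ℕ) (ω : PlanarPath) : PlanarPath :=
    extendConst (lo_lt_hi b j j).le (inside (lo b j) (hi b j) ω)
  have hTc (j : ℕ) : Continuous (T j) :=
    (continuous_extendConst _).comp (continuous_inside _ _)
  have hT (ω : PlanarPath) : Filter.Tendsto (fun j ↦ T j ω) Filter.atTop (𝓝 ω) :=
    tendsto_extendConst_inside b ω
  have hker (o) : ∫⁻ f, (M : ENNReal) ∂(resamplingKernel W s t o) ≤ M := by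
    rw [lintegral_const]
    refine mul_le_of_le_one_right zero_le ?_
    change ProbabilityTheory.cond _ _ Set.univ ≤ 1
    rw [cond_apply (measurableSet_stayInQuadrant s t), Set.inter_univ]
    exact ENNReal.inv_mul_le_one _
  have mK := measurable_lintegral_resamplingKernel W s t hG
  have hGO : Continuous fun ω : PlanarPath ↦ (G (outside s t ω, inside s t ω) : ENNReal) :=
    hGc.comp ((continuous_outside s t).prodMk (continuous_inside s t))
  have l1 : Filter.Tendsto (fun j ↦ ∫⁻ ω, (G (outside s t (T j ω), inside s t (T j ω)) : ENNReal)
      ∂(ν : Measure PlanarPath)) Filter.atTop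
      (𝓝 (∫⁻ ω, (G (outside s t ω, inside s t ω) : ENNReal) ∂(ν : Measure PlanarPath))) :=
    tendsto_lintegral_of_dominated_convergence (fun _ ↦ M)
      (fun j ↦ (hGO.comp (hTc j)).measurable) (fun j ↦ Filter.Eventually.of_forall fun ω ↦ hGM _)
      (by simpa using hMt) (Filter.Eventually.of_forall fun ω ↦ (hGO.tendsto ω).comp (hT ω))
  have hk {j : ℕ} (h1 : lo b j ≤ s) (h2 : t ≤ hi b j) (ω : PlanarPath) :
      resamplingKernel W s t (outside s t (T j ω)) = quadrantBridge W s t (ω s) (ω t) := by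
    change quadrantBridge W s t (T j ω s) (T j ω t) = _
    rw [show T j ω s = ω s from extendConst_of_mem _ _ ⟨h1, hst.le.trans h2⟩,
      show T j ω t = ω t from extendConst_of_mem _ _ ⟨h1.trans hst.le, h2⟩]
  have hev : ∀ᶠ j in Filter.atTop, lo b j ≤ s ∧ t ≤ hi b j := by
    have h0 : (0 : ℝ) < min (s : ℝ) (1 - t) := lt_min hs (sub_pos.2 ht)
    filter_upwards [(tendsto_coe_lo b).eventually (gt_mem_nhds h0)] with j hj
    rw [← Subtype.coe_le_coe, ← Subtype.coe_le_coe, coe_hi]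
    exact ⟨(hj.le.trans (min_le_left _ _)), by linarith [min_le_right (s : ℝ) (1 - t)]⟩
  have l2 : Filter.Tendsto (fun j ↦ ∫⁻ ω, ∫⁻ f, (G (outside s t (T j ω), f) : ENNReal)
      ∂(resamplingKernel W s t (outside s t (T j ω))) ∂(ν : Measure PlanarPath)) Filter.atTop
      (𝓝 (∫⁻ ω, ∫⁻ f, (G (outside s t ω, f) : ENNReal) ∂(quadrantBridge W s t (ω s) (ω t))
        ∂(ν : Measure PlanarPath))) := by
    refine tendsto_lintegral_of_dominated_convergence (fun _ ↦ M)
      (fun j ↦ mK.comp ((continuous_outside s t).comp (hTc j)).measurable)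
      (fun j ↦ Filter.Eventually.of_forall fun ω ↦
        (lintegral_mono fun f ↦ hGM _).trans (hker _))
      (by simpa using hMt) (Filter.Eventually.of_forall fun ω ↦ ?_)
    have hω : Filter.Tendsto (fun j ↦ ∫⁻ f, (G (outside s t (T j ω), f) : ENNReal)
        ∂(quadrantBridge W s t (ω s) (ω t))) Filter.atTop
        (𝓝 (∫⁻ f, (G (outside s t ω, f) : ENNReal) ∂(quadrantBridge W s t (ω s) (ω t)))) := by
      refine tendsto_lintegral_of_dominated_convergence (fun _ ↦ M)
        (fun j ↦ (hGc.comp (Continuous.prodMk_right _)).measurable)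
        (fun j ↦ Filter.Eventually.of_forall fun f ↦ hGM _)
        (ne_top_of_le_ne_top hMt (hker (outside s t ω))) (Filter.Eventually.of_forall fun f ↦ ?_)
      have hc : Continuous fun ω' : PlanarPath ↦ (G (outside s t ω', f) : ENNReal) :=
        hGc.comp ((continuous_outside s t).prodMk continuous_const)
      exact (hc.tendsto ω).comp (hT ω)
    refine hω.congr' ?_
    filter_upwards [hev] with j hj
    rw [hk hj.1 hj.2]
  refine tendsto_nhds_unique_of_eventuallyEq l1 l2 ?_
  filter_upwards [hev] with j hj
  have hE := continuous_extendConst (lo_lt_hi b j j).le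
  refine lintegral_inside_eq_of_close (μ := μ)
    (g₁ := fun f ↦ (G (outside s t (extendConst (lo_lt_hi b j j).le f),
      inside s t (extendConst (lo_lt_hi b j j).le f)) : ENNReal))
    (g₂ := fun f ↦ ∫⁻ f', (G (outside s t (extendConst (lo_lt_hi b j j).le f), f') : ENNReal)
      ∂(resamplingKernel W s t (outside s t (extendConst (lo_lt_hi b j j).le f))))
    (hb j) (hGO.comp hE).measurable (mK.comp ((continuous_outside s t).comp hE).measurable)
    hM0 hMt (fun f ↦ hGM _) (fun f ↦ (lintegral_mono fun f' ↦ hGM _).trans (hker _)) ?_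
  filter_upwards [hres] with n hn
  exact hn.lintegral_extendConst hj.1 hst.le hj.2 (lo_lt_hi b j j).le hG

/-- A weak limit of approximate solutions that resample given the path outside of intervals is the
law of a conditioned Brownian path. -/
theorem isQuadrantBridgeLaw_of_tendsto (hα : α ∈ Set.Ioo (-1 : ℝ) 1) [IsProbabilityMeasure W]
    (hW : IsCorrelatedBrownianLaw α W) {w₀ : ℝ × ℝ} {μ : ℕ → ProbabilityMeasure PlanarPath}
    {ν : ProbabilityMeasure PlanarPath} {l : Filter ℕ} [l.NeBot] (hl : l ≤ Filter.atTop)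
    (hlim : Filter.Tendsto μ l (𝓝 ν))
    (hμ : ∀ ε : ℝ, 0 < ε → ∀ᶠ n in Filter.atTop, IsApproxSolution W w₀ ε (μ n))
    (hres : ∀ s t : unitInterval, 0 < s → s < t → t < 1 →
      ∀ᶠ n in Filter.atTop, ResamplesGivenOutside W (μ n) s t) :
    IsQuadrantBridgeLaw W w₀ ν := by
  have point {u : unitInterval} {x : ℝ × ℝ} (h : ∀ ε : ℝ, 0 < ε → ∀ᶠ n in Filter.atTop,
      (μ n : Measure PlanarPath) {ω | ¬ ‖ω u - x‖ ≤ ε} ≤ ENNReal.ofReal ε) :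
      ∀ᵐ ω ∂(ν : Measure PlanarPath), ω u = x := by
    have hz (k : ℕ) : ∀ᵐ ω ∂(ν : Measure PlanarPath), ‖ω u - x‖ ≤ 1 / (k + 1) := by
      refine ae_iff.2 (le_antisymm (ENNReal.le_of_forall_pos_le_add fun η hη _ ↦ ?_) zero_le)
      rw [zero_add]
      have hopen : IsOpen {ω : PlanarPath | ¬ ‖ω u - x‖ ≤ 1 / (k + 1)} := by
        simp only [not_le]
        exact isOpen_lt continuous_const (by fun_prop)
      refine (ProbabilityMeasure.le_liminf_measure_open_of_tendsto hlim hopen).trans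
        (Filter.liminf_le_of_frequently_le' (Filter.Eventually.frequently ?_))
      have hε : (0 : ℝ) < min η (1 / (k + 1)) := by positivity
      filter_upwards [hl (h _ hε)] with n hn
      refine le_trans (measure_mono ?_) (hn.trans ?_)
      · exact fun ω hω hω' ↦ hω (hω'.trans (min_le_right _ _))
      · exact ENNReal.ofReal_le_of_le_toReal (min_le_left _ _)
    filter_upwards [ae_all_iff.2 hz] with ω hω
    have : ‖ω u - x‖ ≤ 0 := ge_of_tendsto' tendsto_one_div_add_atTop_nhds_zero_nat hω
    exact sub_eq_zero.1 (norm_le_zero_iff.1 this)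
  refine ⟨⟨point fun ε hε ↦ ?_, fun r h0 h1 ↦ ?_, fun s t hs hst ht ↦
    hW.hasCondDistrib_of_tendsto hα hl hlim hμ hs hst ht (hres s t hs hst ht)⟩, point fun ε hε ↦ ?_⟩
  · filter_upwards [hμ ε hε] with n hn
    obtain ⟨s, t, -, -, -, -, h⟩ := hn
    refine le_trans (measure_mono ?_) h
    exact fun ω hω hω' ↦ hω (by simpa using hω'.1 0 unitInterval.nonneg')
  · obtain ⟨b, hb⟩ := hW.exists_inside_close_limit hα hl hlim hμ
    have h0' : (0 : ℝ) < min (r : ℝ) (1 - r) := lt_min h0 (sub_pos.2 h1)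
    obtain ⟨j, hj⟩ := ((tendsto_coe_lo b).eventually (gt_mem_nhds h0')).exists
    have hr : r ∈ Set.Icc (lo b j) (hi b j) := by
      constructor <;> rw [← Subtype.coe_le_coe]
      · exact hj.le.trans (min_le_left _ _)
      · rw [coe_hi]; linarith [min_le_right (r : ℝ) (1 - r)]
    set E : Set C(Set.Icc (lo b j) (hi b j), ℝ × ℝ) := {f | ¬ IsInterior (f ⟨r, hr⟩)} with hE
    have mE : MeasurableSet E :=
      ((continuous_eval_const (⟨r, hr⟩ : Set.Icc (lo b j) (hi b j))).measurable
        measurableSet_isInterior).compl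
    refine ae_iff.2 (le_antisymm (ENNReal.le_of_forall_pos_le_add fun η hη _ ↦ ?_) zero_le)
    have hε : (0 : ℝ) < min (r : ℝ) (1 - r) := h0'
    obtain ⟨m, hm, hm'⟩ := ((hb j η hη).and (hμ _ hε)).exists
    obtain ⟨s, t, hs, ht, hint, -, -⟩ := hm'
    refine (hm E mE).trans ?_
    rw [ENNReal.ofReal_coe_nnreal]
    gcongr
    refine le_of_eq (ae_iff.1 (hint r ?_ ?_)) <;> rw [← Subtype.coe_le_coe]
    · exact hs.trans (min_le_left _ _)
    · exact le_trans (by linarith [min_le_right (r : ℝ) (1 - r)]) ht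
  · filter_upwards [hμ ε hε] with n hn
    obtain ⟨s, t, -, -, -, -, h⟩ := hn
    refine le_trans (measure_mono ?_) h
    exact fun ω hω hω' ↦ hω (hω'.2 1 unitInterval.le_one')

end IsCorrelatedBrownianLaw

/-! ### Existence, uniqueness and convergence -/

theorem IsConditionedInQuadrant.isApproxSolution {W : Measure PlanarPath} [IsProbabilityMeasure W]
    {μ : Measure PlanarPath} [IsProbabilityMeasure μ] (h : IsConditionedInQuadrant W μ)
    {w₀ : ℝ × ℝ} {ε : ℝ} (hε : 0 < ε) (hend : ∀ᵐ ω ∂μ, ‖ω 1 - w₀‖ ≤ ε / 2) :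
    IsApproxSolution W w₀ ε μ := by
  let b : TimeBase := ⟨1 / 8, by norm_num, le_rfl⟩
  let bad (k : ℕ) : Set PlanarPath :=
    {ω | (∀ u, u ≤ lo b k → ‖ω u‖ ≤ ε) ∧ ∀ u, hi b k ≤ u → ‖ω u - w₀‖ ≤ ε}ᶜ
  have mono : Antitone bad := antitone_nat_of_succ_le fun k ↦ Set.compl_subset_compl.2
    fun ω hω ↦ ⟨fun u hu ↦ hω.1 u (hu.trans (lo_succ_lt b k).le),
      fun u hu ↦ hω.2 u ((hi_lt_succ b k).le.trans hu)⟩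
  have hnull : μ (⋂ k, bad k) = 0 := by
    refine measure_mono_null (t := {ω | ¬ (ω 0 = 0 ∧ ‖ω 1 - w₀‖ ≤ ε / 2)}) ?_
      (ae_iff.1 (h.start.and hend))
    rintro ω hω ⟨h0, h1⟩
    obtain ⟨k, hk, hk'⟩ := ((eventually_forall_le_norm_sub_le (ω := ω) (tendsto_coe_lo b) hε).and
      (eventually_forall_ge_norm_sub_le (ω := ω) (tendsto_coe_lo b) (half_pos hε))).exists
    refine Set.mem_iInter.1 hω k ⟨fun u hu ↦ by simpa [h0] using hk u hu, fun u hu ↦ ?_⟩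
    calc ‖ω u - w₀‖ = ‖(ω u - ω 1) + (ω 1 - w₀)‖ := by congr 1; abel
      _ ≤ ε / 2 + ε / 2 := (norm_add_le _ _).trans (add_le_add (hk' u hu) h1)
      _ = ε := add_halves ε
  have lim := tendsto_measure_iInter_atTop (μ := μ)
    (fun k ↦ (isClosed_ends (lo b k) (hi b k) ε w₀).measurableSet.compl.nullMeasurableSet) mono
    ⟨0, measure_ne_top _ _⟩
  rw [hnull] at lim
  obtain ⟨k, hk, hk'⟩ := ((lim.eventually (ge_mem_nhds (ENNReal.ofReal_pos.2 hε))).and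
    ((tendsto_coe_lo b).eventually (ge_mem_nhds hε))).exists
  have l0 : (0 : unitInterval) < lo b k := coe_lo_pos b k
  have l1 : hi b k < 1 := by
    rw [← Subtype.coe_lt_coe, coe_hi, Set.Icc.coe_one]
    linarith [coe_lo_pos b k]
  exact ⟨lo b k, hi b k, hk', by rw [coe_hi]; linarith,
    fun r h0 h1 ↦ h.pos r (l0.trans_le h0) (h1.trans_lt l1), fun s t hs hst ht ↦
      (resamplesGivenOutside_of_hasCondDistrib
        (h.resampling s t (l0.trans_le hs) hst (ht.trans_lt l1))).resamples, hk⟩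

theorem IsQuadrantBridgeLaw.isApproxSolution {W : Measure PlanarPath} [IsProbabilityMeasure W]
    {μ : Measure PlanarPath} [IsProbabilityMeasure μ] {w₀ : ℝ × ℝ} (h : IsQuadrantBridgeLaw W w₀ μ)
    {ε : ℝ} (hε : 0 < ε) : IsApproxSolution W w₀ ε μ := by
  refine h.toIsConditionedInQuadrant.isApproxSolution hε ?_
  filter_upwards [h.terminal] with ω hω
  rw [hω, sub_self, norm_zero]
  positivity

theorem IsConeExcursionLaw.isApproxSolution {W : Measure PlanarPath} [IsProbabilityMeasure W]
    {μ : Measure PlanarPath} [IsProbabilityMeasure μ] {δ : ℝ} (h : IsConeExcursionLaw W δ μ)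
    {ε : ℝ} (hε : 0 < ε) (hδ : δ ≤ ε / 2) : IsApproxSolution W 0 ε μ := by
  refine h.toIsConditionedInQuadrant.isApproxSolution hε ?_
  filter_upwards [h.start, h.excursion, h.displacement] with ω h0 h1 h2
  have h3 : 0 ≤ ω 1 := h0 ▸ h1.1 1
  rw [terminalDisplacement, h0, Prod.fst_zero, Prod.snd_zero, sub_zero, sub_zero] at h2
  rw [sub_zero, Prod.norm_def, Real.norm_of_nonneg h3.1, Real.norm_of_nonneg h3.2, h2]
  exact hδ

/-- A path that is almost surely in the open quadrant at each time in `(0, 1)` is almost surely in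
the closed quadrant at all times. -/
theorem IsConditionedInQuadrant.ae_nonneg {W : Measure PlanarPath} [IsProbabilityMeasure W]
    {μ : Measure PlanarPath} (h : IsConditionedInQuadrant W μ) : ∀ᵐ ω ∂μ, ∀ r, 0 ≤ ω r := by
  have hd : Dense (Set.Ioo (0 : unitInterval) 1) := by
    rw [dense_iff_closure_eq, closure_Ioo zero_ne_one]
    exact Set.eq_univ_of_forall fun r ↦ ⟨unitInterval.nonneg', unitInterval.le_one'⟩
  obtain ⟨D, hDs, hDc, hDd⟩ := hd.exists_countable_dense_subset
  have := hDc.to_subtype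
  have ae : ∀ᵐ ω ∂μ, ∀ r : D, 0 ≤ ω r := ae_all_iff.2 fun r ↦ by
    filter_upwards [h.pos r (hDs r.2).1 (hDs r.2).2] with ω hω
    exact ⟨hω.1.le, hω.2.le⟩
  filter_upwards [ae] with ω hω r
  have hc : IsClosed {r | 0 ≤ ω r} := isClosed_le continuous_const ω.continuous
  exact closure_minimal (fun r hr ↦ hω ⟨r, hr⟩) hc (hDd r)

theorem IsQuadrantBridgeLaw.isConeExcursionLaw {W : Measure PlanarPath} [IsProbabilityMeasure W]
    {μ : Measure PlanarPath} {ε : ℝ} (hε : 0 ≤ ε) (h : IsQuadrantBridgeLaw W (ε, 0) μ) :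
    IsConeExcursionLaw W ε μ := by
  refine ⟨h.toIsConditionedInQuadrant, ?_, ?_⟩
  · filter_upwards [h.start, h.terminal, h.ae_nonneg] with ω h0 h1 h2
    exact ⟨fun r ↦ by rw [h0]; exact h2 r, Or.inr (by rw [h0, h1]; rfl)⟩
  · filter_upwards [h.start, h.terminal] with ω h0 h1
    simp [terminalDisplacement, h0, h1, hε]

namespace IsCorrelatedBrownianLaw

variable {α : ℝ} {W : Measure PlanarPath}

theorem exists_isQuadrantBridgeLaw (hα : α ∈ Set.Ioo (-1 : ℝ) 1) [IsProbabilityMeasure W]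
    (hW : IsCorrelatedBrownianLaw α W) {w₀ : ℝ × ℝ} (hw₀ : 0 ≤ w₀) :
    ∃ μ : ProbabilityMeasure PlanarPath, IsQuadrantBridgeLaw W w₀ μ := by
  let b : TimeBase := ⟨1 / 8, by norm_num, le_rfl⟩
  let x (n : ℕ) : ℝ := lo b n
  have hx (n : ℕ) : 0 < x n := coe_lo_pos b n
  have hx0 : Filter.Tendsto x Filter.atTop (𝓝 0) := tendsto_coe_lo b
  have hz (n : ℕ) : IsInterior (x n, x n) := ⟨hx n, hx n⟩
  have hw (n : ℕ) : IsInterior (w₀ + (x n, x n)) :=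
    ⟨add_pos_of_nonneg_of_pos hw₀.1 (hx n), add_pos_of_nonneg_of_pos hw₀.2 (hx n)⟩
  have hP (n : ℕ) : IsProbabilityMeasure
      (extendedBridge W (lo_lt_hi b n n).le (x n, x n) (w₀ + (x n, x n))) := by
    have := hW.isProbabilityMeasure_quadrantBridge hα (lo_lt_hi b n n) (hz n) (hw n)
    exact Measure.isProbabilityMeasure_map (continuous_extendConst _).measurable.aemeasurable
  let μ (n : ℕ) : ProbabilityMeasure PlanarPath := ⟨_, hP n⟩
  have hnorm (n : ℕ) : ‖((x n, x n) : ℝ × ℝ)‖ ≤ x n := by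
    rw [Prod.norm_def, Real.norm_of_nonneg (hx n).le, max_self]
  have happ (n : ℕ) : IsApproxSolution W w₀ (x n) (μ n) :=
    hW.isApproxSolution_extendedBridge hα (lo_lt_hi b n n) (hz n) (hw n) le_rfl
      (by rw [coe_hi]) (hnorm n) (by rw [add_sub_cancel_left]; exact hnorm n)
  have hμ (ε : ℝ) (hε : 0 < ε) : ∀ᶠ n in Filter.atTop, IsApproxSolution W w₀ ε (μ n) := by
    filter_upwards [hx0.eventually (ge_mem_nhds hε)] with n hn
    exact (happ n).mono hn
  have hres (s t : unitInterval) (hs : 0 < s) (hst : s < t) (ht : t < 1) :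
      ∀ᶠ n in Filter.atTop, ResamplesGivenOutside W (μ n) s t := by
    have h0 : (0 : ℝ) < min (s : ℝ) (1 - t) := lt_min hs (sub_pos.2 ht)
    filter_upwards [hx0.eventually (gt_mem_nhds h0)] with n hn
    refine hW.resamplesGivenOutside_extendedBridge ?_ hst ?_ _ _ _
    · rw [← Subtype.coe_le_coe]; exact hn.le.trans (min_le_left _ _)
    · rw [← Subtype.coe_le_coe, coe_hi]
      have : x n < 1 - t := hn.trans_le (min_le_right _ _)
      linarith
  have tight : IsTightMeasureSet (Set.range fun n ↦ (μ n : Measure PlanarPath)) := by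
    refine isTightMeasureSet_range_of_le_thickening fun η hη ↦ ?_
    obtain ⟨ε, hε, h⟩ := hW.exists_measure_le_thickening hα w₀ hη
    obtain ⟨N, hN⟩ := Filter.eventually_atTop.1 (hμ ε hε)
    exact ⟨N, fun n hn ↦ h _ _ inferInstance inferInstance (hN n hn) (hN N le_rfl)⟩
  have comp : IsCompact (closure (Set.range μ)) := by
    refine isCompact_closure_of_isTightMeasureSet (tight.subset ?_)
    rintro _ ⟨_, ⟨n, rfl⟩, rfl⟩
    exact ⟨n, rfl⟩
  obtain ⟨ν, -, hν⟩ := comp.ultrafilter_le_nhds ((Filter.hyperfilter ℕ).map μ) (by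
    rw [Filter.le_principal_iff]
    exact Filter.mem_map.2 (Filter.univ_mem' fun n ↦ subset_closure (Set.mem_range_self n)))
  exact ⟨ν, hW.isQuadrantBridgeLaw_of_tendsto hα Nat.hyperfilter_le_atTop hν hμ hres⟩

end IsCorrelatedBrownianLaw

theorem proposition3p5 (α : ℝ) (hα : α ∈ Set.Ioo (-1 : ℝ) 1)
    (W : Measure PlanarPath) [IsProbabilityMeasure W] (hW : IsCorrelatedBrownianLaw α W) :
    (∀ w : ℝ × ℝ, 0 ≤ w → (w.1 = 0 ∨ w.2 = 0) →
      ∃! μ : ProbabilityMeasure PlanarPath, IsQuadrantBridgeLaw W w μ) ∧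
    (∀ ε : ℝ, 0 < ε →
      ∃ μ : ProbabilityMeasure PlanarPath, IsConeExcursionLaw W ε μ) ∧
    ∀ (ν : ProbabilityMeasure PlanarPath) (μ : ℝ → ProbabilityMeasure PlanarPath),
      IsQuadrantBridgeLaw W 0 ν → (∀ ε : ℝ, 0 < ε → IsConeExcursionLaw W ε (μ ε)) →
      Filter.Tendsto μ (𝓝[>] 0) (𝓝 ν) := by
  refine ⟨fun w hw _ ↦ ?_, fun ε hε ↦ ?_, fun ν μ hν hμ ↦ ?_⟩
  · obtain ⟨μ, hμ⟩ := hW.exists_isQuadrantBridgeLaw hα hw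
    refine ⟨μ, hμ, fun ν hν ↦ ?_⟩
    have h : Filter.Tendsto (fun _ : ℕ ↦ ν) Filter.atTop (𝓝 μ) :=
      hW.tendsto_of_isApproxSolution hα
        (fun ε hε ↦ Filter.Eventually.of_forall fun _ ↦ hν.isApproxSolution hε)
        fun ε hε ↦ hμ.isApproxSolution hε
    exact tendsto_nhds_unique tendsto_const_nhds h
  · obtain ⟨μ, hμ⟩ := hW.exists_isQuadrantBridgeLaw hα (w₀ := (ε, 0)) ⟨hε.le, le_rfl⟩
    exact ⟨μ, hμ.isConeExcursionLaw hε.le⟩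
  · refine hW.tendsto_of_isApproxSolution hα (fun ε hε ↦ ?_) fun ε hε ↦ hν.isApproxSolution hε
    filter_upwards [Ioc_mem_nhdsGT (half_pos hε)] with δ hδ
    exact (hμ δ hδ.1).isApproxSolution hε hδ.2
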